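/- Let $n\ge 1$, let $q,t\in\mathbb{C}^*$ with $|q|<1$, and suppose that $t^k\notin q^{\mathbb{Z}}$ for $k=1,\dots,n-1$. Let $\lambda=(\lambda_1\ge\cdots\ge\lambda_n)\in\mathbb{Z}^n$ be a dominant vector. Write $\theta(z;p)=\prod_{i\ge0}(1-p^iz)(1-p^{i+1}/z)$ and, for $r=1,\dots,n$, consider the elliptic Ruijsenaars operators $$\mathcal{D}^{(r)}_x(p)=t^{\binom r2}\sum_{I\subseteq\{1,\dots,n\},\,|I|=r}\ \prod_{i\in I,\,j\notin I}\frac{\theta(tx_i/x_j;p)}{\theta(x_i/x_j;p)}\ \prod_{i\in I}T_{q,x_i},$$ where $T_{q,x_i}$ replaces $x_i$ by $qx_i$; expanded as power series in $p$, they act on formal power series in $p$ with coefficients in the ring $\mathbb{C}[x^{\pm1}]^{\mathfrak{S}_n}$ of symmetric Laurent polynomials in $x=(x_1,\dots,x_n)$. Let $P_\lambda(x)$ denote the Macdonald (Laurent) polynomial: the symmetric Laurent polynomial of the form $m_\lambda+\sum_{\mu<\lambda}c_\mu m_\mu$ ($m_\mu$ the monomial symmetric functions, $\mu$ dominant, $<$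 the dominance order) with $\mathcal{D}^{(r)}_x(0)P_\lambda=e_r(t^{n-1}q^{\lambda_1},t^{n-2}q^{\lambda_2},\dots,q^{\lambda_n})P_\lambda$ for $r=1,\dots,n$, where $e_r$ is the $r$th elementary symmetric function. There is a unique normalized formal joint eigenfunction $\mathcal{P}_\lambda(x;p)=\sum_{k\ge0}p^k\mathcal{P}_{\lambda,k}(x)\in\mathbb{C}[x^{\pm1}]^{\mathfrak{S}_n}[[p]]$, with unique formal eigenvalues $\varepsilon^{(r)}_\lambda(p)\in\mathbb{C}[[p]]$, that is, $$\mathcal{D}^{(r)}_x(p)\mathcal{P}_\lambda(x;p)=\varepsilon^{(r)}_\lambda(p)\mathcal{P}_\lambda(x;p)\quad(r=1,\dots,n),\qquad \mathcal{P}_{\lambda,0}=P_\lambda,$$ and the coefficient of $m_\lambda$ in $\mathcal{P}_{\lambda,k}$ is $0$ for all $k>0$. Moreover, there is a constant $\tau\in(0,1]$, not depending on $p$, such that for $|p|<\tau$ the series $\mathcal{P}_\lambda(x;p)$, written as $\sum_{k\ge0}\sum_{\mu\in\mathbb{Z}^n}c_{k,\mu}\,p^kx^\mu$, converges absolutely at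 every $x\in(\mathbb{C}^*)^n$ with $$|p|/\tau<|x_j/x_i|<\tau/|p|\qquad(1\le i<j\le n)$$ (for $p=0$ the upper bound is void), and the power series $\varepsilon^{(r)}_\lambda(p)$ $(r=1,\dots,n)$ converge absolutely for $|p|<\tau$. -/

import Mathlib

noncomputable section

/-- Laurent polynomials `ℂ[x₁^{±1}, …, xₙ^{±1}]`; the exponent `μ : Fin n → ℤ` stands for `x^μ`. -/
abbrev LaurentPoly (n : ℕ) : Type := AddMonoidAlgebra ℂ (Fin n → ℤ)

/-- The coefficient of `x^μ` in `f`. For symmetric `f` and dominant `μ` this is also the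
coefficient of the monomial symmetric function `m_μ` in `f`. -/
def LaurentPoly.coef {n : ℕ} (f : LaurentPoly n) (μ : Fin n → ℤ) : ℂ := f.coeff μ

/-- The monomial `x^μ` at a point `x`. -/
def monomialAt {n : ℕ} (μ : Fin n → ℤ) (x : Fin n → ℂ) : ℂ := ∏ i, x i ^ μ i

/-- The value of a Laurent polynomial at a point `x`. -/
def LaurentPoly.evalAt {n : ℕ} (f : LaurentPoly n) (x : Fin n → ℂ) : ℂ :=
  f.coeff.sum fun μ c => c * monomialAt μ x

/-- Invariance under permutations of the variables. -/
def LaurentPoly.IsSymm {n : ℕ} (f : LaurentPoly n) : Prop :=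
  ∀ (σ : Equiv.Perm (Fin n)) (μ : Fin n → ℤ), f.coef (μ ∘ σ) = f.coef μ

/-- A formal power series in `p` with Laurent polynomial coefficients, evaluated
coefficientwise at a point `x`. -/
def evalSeriesAt {n : ℕ} (ψ : PowerSeries (LaurentPoly n)) (x : Fin n → ℂ) : PowerSeries ℂ :=
  PowerSeries.mk fun k => (PowerSeries.coeff k ψ).evalAt x

/-- The dominance order on `ℤⁿ`. -/
def DominanceLE {n : ℕ} (μ ν : Fin n → ℤ) : Prop :=
  ∑ j, μ j = ∑ j, ν j ∧
    ∀ i : Fin n, ∑ j ∈ Finset.Iic i, μ j ≤ ∑ j ∈ Finset.Iic i, ν j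

/-- The point `∏_{i ∈ I} T_{q,x_i} x`: multiply by `q` the coordinates in `I`. -/
def qShift {n : ℕ} (q : ℂ) (I : Finset (Fin n)) (x : Fin n → ℂ) : Fin n → ℂ :=
  fun i => if i ∈ I then q * x i else x i

/-- The Macdonald-Ruijsenaars operator
`D_x^{(r)} = t^{r(r-1)/2} ∑_{|I| = r} ∏_{i ∈ I, j ∉ I} (1 - t x_i/x_j)/(1 - x_i/x_j) ∏_{i ∈ I} T_{q,x_i}`,
acting on functions on the set of points with distinct nonzero coordinates. -/
def macdonaldOp {n : ℕ} (q t : ℂ) (r : ℕ) (f : (Fin n → ℂ) → ℂ) (x : Fin n → ℂ) : ℂ :=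
  t ^ r.choose 2 * ∑ I ∈ Finset.powersetCard r (Finset.univ : Finset (Fin n)),
    (∏ i ∈ I, ∏ j ∈ Iᶜ, (1 - t * x i / x j) / (1 - x i / x j)) * f (qShift q I x)

/-- The theta function `θ(z;p) = ∏_{i ≥ 0} (1 - p^i z)(1 - p^{i+1}/z)` as a formal power series
in `p` (the variable `X`). Factors with `i > k` do not contribute to the coefficient of `p^k`,
so that coefficient is read off from the finite product over `i ≤ k`. -/
def formalTheta (z : ℂ) : PowerSeries ℂ :=
  PowerSeries.mk fun k => PowerSeries.coeff k
    (∏ i ∈ Finset.range (k + 1),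
      ((1 - PowerSeries.C z * PowerSeries.X ^ i) *
        (1 - PowerSeries.C z⁻¹ * PowerSeries.X ^ (i + 1))) : PowerSeries ℂ)

/-- The elliptic Ruijsenaars operator
`𝒟_x^{(r)}(p) = t^{r(r-1)/2} ∑_{|I| = r} ∏_{i ∈ I, j ∉ I} θ(t x_i/x_j;p)/θ(x_i/x_j;p) ∏_{i ∈ I} T_{q,x_i}`,
expanded as a power series in `p`, acting on functions with values in `ℂ⟦p⟧`. At points with
distinct nonzero coordinates the denominators have constant term `1 - x_i/x_j ≠ 0` and are
therefore invertible in `ℂ⟦p⟧`. -/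
def ellipticRuijsenaarsOp {n : ℕ} (q t : ℂ) (r : ℕ) (f : (Fin n → ℂ) → PowerSeries ℂ)
    (x : Fin n → ℂ) : PowerSeries ℂ :=
  PowerSeries.C (t ^ r.choose 2) *
    ∑ I ∈ Finset.powersetCard r (Finset.univ : Finset (Fin n)),
      (∏ i ∈ I, ∏ j ∈ Iᶜ, formalTheta (t * x i / x j) * (formalTheta (x i / x j))⁻¹) *
        f (qShift q I x)

/-- `e_r(t^ρ q^λ)`, the `r`-th elementary symmetric function of the numbers
`t^{n-i} q^{λ_i}`, `1 ≤ i ≤ n` (here the indices run from `0` to `n-1`). -/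
def macdonaldEigenvalue {n : ℕ} (q t : ℂ) (lam : Fin n → ℤ) (r : ℕ) : ℂ :=
  ∑ I ∈ Finset.powersetCard r (Finset.univ : Finset (Fin n)),
    ∏ i ∈ I, t ^ (n - 1 - (i : ℕ)) * q ^ lam i

/-- `P` is the Macdonald (Laurent) polynomial `P_λ(x|q,t)`: it is symmetric, of the form
`m_λ + ∑_{μ < λ} c_μ m_μ` (sum over dominant `μ`), and satisfies
`D_x^{(r)} P = e_r(t^ρ q^λ) P` for `r = 1, …, n`. -/
structure IsMacdonaldPoly {n : ℕ} (q t : ℂ) (lam : Fin n → ℤ) (P : LaurentPoly n) : Prop where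
  symm : P.IsSymm
  leading : P.coef lam = 1
  triangular : ∀ μ : Fin n → ℤ, Antitone μ → P.coef μ ≠ 0 → DominanceLE μ lam
  eigen : ∀ (r : Fin n) (x : Fin n → ℂ), (∀ i, x i ≠ 0) → Function.Injective x →
    macdonaldOp q t (r + 1) P.evalAt x = macdonaldEigenvalue q t lam (r + 1) * P.evalAt x

/-- `ψ ∈ ℂ[x^{±1}]^{𝔖ₙ}⟦p⟧` is the normalized formal joint eigenfunction `𝒫_λ(x;p)` and
`ε r ∈ ℂ⟦p⟧` its formal eigenvalue `ε_λ^{(r+1)}(p)`, `r = 0, …, n-1`. -/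
structure IsNormalizedFormalEigenfunction {n : ℕ} (q t : ℂ) (lam : Fin n → ℤ)
    (ψ : PowerSeries (LaurentPoly n)) (ε : Fin n → PowerSeries ℂ) : Prop where
  symm : ∀ k, (PowerSeries.coeff k ψ).IsSymm
  initial : IsMacdonaldPoly q t lam (PowerSeries.coeff 0 ψ)
  eigen : ∀ (r : Fin n) (x : Fin n → ℂ), (∀ i, x i ≠ 0) → Function.Injective x →
    ellipticRuijsenaarsOp q t (r + 1) (evalSeriesAt ψ) x = ε r * evalSeriesAt ψ x
  normalized : ∀ k, (PowerSeries.coeff k ψ).coef lam = if k = 0 then 1 else 0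

end

/-! Everything happens order by order in p, on series whose coefficients are Laurent polynomials. By
Jacobi's triple product (`formalTheta_eq`) each theta function is, up to a factor that cancels in
every ratio, the explicit series with terms p^{m(m-1)/2} (-z)^m. After clearing the denominators,
the operators applied to a symmetric series give the Vandermonde product times a unit and a
symmetric function, so they act on symmetric series of Laurent polynomials
(`thetaDenom_dvd_clearedOp`, `ellipticOp`).

Triangularity. Compare exponents (k, μ) of p^k x^μ through the cone of all (l, β) with ∑ β = 0 and
every partial sum of β at most l, an affine version of dominance. Written in the ratios x_b/x_a with
a < b, all theta factors are supported in this cone, and their leading coefficients add up to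
e_r(t^ρ q^μ). Hence the operators are triangular with these diagonal entries (`biCoeff_ellipticOp`).
The assumption on t says that the joint diagonal entry of λ differs from that of every other μ
(`exists_macdonaldEigenvalue_ne`).

Existence. Suppose the eigenvalue equations hold modulo p^K. The lexicographically largest exponent
μ in the defects of order K is dominant. For μ = λ it is absorbed into the eigenvalues, otherwise a
multiple of p^K m_μ is added (`ApproxEigen.eliminate`). One multiple has to serve all r at once, and
it does because the operators commute: commutativity makes the top defects proportional to the
eigenvalue differences. Starting from m_λ at K = 0, this produces P_λ itself along the way.
Uniqueness is the same comparison of top coefficients, applied to the difference of two solutions.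

Commutativity (`ellipticRuijsenaarsOp_comm`) reduces to a theta identity: a sum over the s-element
subsets of a finite set L equals the same sum over the subsets of complementary size
(`subsetSum_symm`). As a function of one coordinate, the difference of the two sums with
denominators cleared is a formal quasi-periodic series having as many known zeros as its degree. It
is thus a constant multiple of the common denominator (`QuasiPeriodic.proportional`), so the
difference does not depend on that coordinate, nor on any other. Inverting all coordinates changes
its sign, so it is zero.

Convergence. The coefficients of the eigenfunction and of the eigenvalues obey a recursion along the
cone. A combination of its left sides over r is bounded below by a constant times ∏_j max(1,
|q|^{μ_j}), and the powers of q on the right grow no faster (`exists_eigenProd_lower_bound`,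
`coeffNorm_lowerTerms_le`). What is left is a quadratic convolution inequality with a uniform
constant (`exists_solutionMajorant_le`). With weights y^height and y small it closes up by induction
on the height (`truncSum_le_of_conv_le`). At order p^k heights are at most linear in k
(`ApproxEigen.exists_height_le`), which yields geometric bounds; the size of the monomials x^μ is
controlled by summation by parts (`ApproxEigen.norm_monomialAt_le`). -/

section

open PowerSeries
open scoped NNReal ENNReal

/-! ### Theta series and their inversion formula -/

/-- The series `∑_m p^{m(m-1)/2} v_m`, `m ∈ ℤ`, with coefficients in an arbitrary ring. -/
noncomputable def thetaSeries {A : Type*} [CommRing A] (v : ℤ → A) : PowerSeries A :=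
  PowerSeries.mk fun l =>
    ∑ m ∈ Finset.Icc (-(l : ℤ)) (l + 1) with m * (m - 1) = 2 * (l : ℤ), v m

/-- The theta function normalized by Jacobi's triple product, `∑_m p^{m(m-1)/2} (-z)^m`. -/
noncomputable def thetaHat (z : ℂ) : PowerSeries ℂ := thetaSeries fun m => (-z) ^ m

/-- The window in `thetaSeries` only serves to make the sum finite; no solution m falls outside it.
-/
theorem mem_Icc_of_triangular {m : ℤ} {l : ℕ} (h : m * (m - 1) = 2 * l) :
    m ∈ Finset.Icc (-(l : ℤ)) (l + 1) := by
  rw [Finset.mem_Icc]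
  constructor
  · by_contra! hm
    nlinarith
  · by_contra! hm
    nlinarith

theorem coeff_thetaSeries {A : Type*} [CommRing A] (v : ℤ → A) (l : ℕ) (s : Finset ℤ)
    (hs : ∀ m : ℤ, m * (m - 1) = 2 * l → m ∈ s) :
    PowerSeries.coeff l (thetaSeries v) = ∑ m ∈ s with m * (m - 1) = 2 * (l : ℤ), v m := by
  rw [thetaSeries, PowerSeries.coeff_mk]
  refine Finset.sum_congr ?_ fun _ _ => rfl
  ext m
  simp only [Finset.mem_filter]
  exact ⟨fun h => ⟨hs m h.2, h.2⟩, fun h => ⟨mem_Icc_of_triangular h.2, h.2⟩⟩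

theorem map_thetaSeries {A B : Type*} [CommRing A] [CommRing B] (f : A →+* B) (v : ℤ → A) :
    PowerSeries.map f (thetaSeries v) = thetaSeries fun m => f (v m) := by
  ext l
  simp [thetaSeries]

theorem coeff_zero_thetaSeries {A : Type*} [CommRing A] (v : ℤ → A) :
    PowerSeries.coeff 0 (thetaSeries v) = v 0 + v 1 := by
  rw [thetaSeries, PowerSeries.coeff_mk]
  have : (Finset.Icc (-((0 : ℕ) : ℤ)) ((0 : ℕ) + 1)).filter
      (fun m : ℤ => m * (m - 1) = 2 * ((0 : ℕ) : ℤ)) = {0, 1} := by decide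
  rw [this, Finset.sum_pair (by decide)]

/-- The index substitution `m ↦ 1 - m`. -/
theorem thetaSeries_reflect {A : Type*} [CommRing A] (v : ℤ → A) :
    thetaSeries (fun m => v (1 - m)) = thetaSeries v := by
  ext l
  simp only [thetaSeries, PowerSeries.coeff_mk]
  refine Finset.sum_nbij' (fun m => 1 - m) (fun m => 1 - m) ?_ ?_ ?_ ?_ ?_
  · intro m hm
    simp only [Finset.mem_filter, Finset.mem_Icc] at hm ⊢
    refine ⟨⟨by omega, by omega⟩, by linarith [hm.2]⟩
  · intro m hm
    simp only [Finset.mem_filter, Finset.mem_Icc] at hm ⊢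
    refine ⟨⟨by omega, by omega⟩, by linarith [hm.2]⟩
  · intro m _; ring
  · intro m _; ring
  · intro m _; rfl

/-- The substitution m ↦ 1 - m preserves m(m-1), and it turns (-z⁻¹)^m into -z⁻¹ times the m-th
power of -z. -/
theorem thetaHat_inv {z : ℂ} (hz : z ≠ 0) :
    thetaHat z⁻¹ = PowerSeries.C (-z⁻¹) * thetaHat z := by
  rw [thetaHat, ← thetaSeries_reflect, thetaHat]
  ext l
  simp only [thetaSeries, PowerSeries.coeff_mk, PowerSeries.coeff_C_mul, Finset.mul_sum]
  refine Finset.sum_congr rfl fun m _ => ?_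
  have : (-z) ≠ 0 := neg_ne_zero.2 hz
  rw [← inv_neg, zpow_sub₀ (inv_ne_zero this), zpow_one, inv_zpow, div_inv_eq_mul, mul_comm]

theorem constantCoeff_thetaHat (z : ℂ) : PowerSeries.constantCoeff (thetaHat z) = 1 - z := by
  rw [← PowerSeries.coeff_zero_eq_constantCoeff_apply, thetaHat, coeff_zero_thetaSeries]
  simp [sub_eq_add_neg]

-- At z = 1 the inversion formula says that the series is its own negative.
open PowerSeries in
theorem thetaHat_one : thetaHat 1 = 0 := by
  have h := thetaHat_inv (z := 1) one_ne_zero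
  simp only [inv_one, map_neg, map_one, neg_mul, one_mul] at h
  have h2 : C (2 : ℂ) * thetaHat 1 = 0 := by
    rw [map_ofNat]
    linear_combination h
  refine (mul_eq_zero.1 h2).resolve_left ?_
  simp

theorem thetaHat_ne_zero {z : ℂ} (hz : z ≠ 1) : thetaHat z ≠ 0 := by
  intro h
  have := constantCoeff_thetaHat z
  rw [h, map_zero] at this
  exact hz (sub_eq_zero.1 this.symm).symm

/-! ### Jacobi's triple product -/

/-- `(p;p)_N`. -/
noncomputable def eulerPoch (N : ℕ) : PowerSeries ℂ := ∏ i ∈ Finset.range N, (1 - X ^ (i + 1))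

/-- `1/(p;p)_k`, extended by `0` to negative `k`. -/
noncomputable def invEulerPoch (k : ℤ) : PowerSeries ℂ :=
  if 0 ≤ k then (eulerPoch k.toNat)⁻¹ else 0

/-- `m(m-1)/2` as a natural number. -/
def triExp (m : ℤ) : ℕ := (m * (m - 1) / 2).toNat

theorem two_mul_triExp (m : ℤ) : 2 * (triExp m : ℤ) = m * (m - 1) := by
  have h1 : 0 ≤ m * (m - 1) := by
    rcases le_or_gt m 0 with h | h <;> nlinarith
  have h2 : Even (m * (m - 1)) := Int.even_mul_pred_self m
  rw [triExp, Int.toNat_of_nonneg (by omega)]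
  obtain ⟨k, hk⟩ := h2
  omega

theorem constantCoeff_eulerPoch (N : ℕ) : constantCoeff (eulerPoch N) = 1 := by
  simp [eulerPoch, map_prod]

theorem eulerPoch_mul_inv (N : ℕ) : eulerPoch N * (eulerPoch N)⁻¹ = 1 :=
  PowerSeries.mul_inv_cancel _ (by simp [constantCoeff_eulerPoch])

/-- The case k = -1 reads 0 = 1 · (1 - p^0). It is the reason for extending 1/(p;p)_k by zero: the
Pascal recursion below then holds at the border as well. -/
theorem invEulerPoch_mul_one_sub {k : ℤ} (hk : -1 ≤ k) :
    invEulerPoch k = invEulerPoch (k + 1) * (1 - X ^ (k + 1).toNat) := by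
  rcases eq_or_lt_of_le hk with rfl | hk
  · simp [invEulerPoch]
  · obtain ⟨k, rfl⟩ := Int.eq_ofNat_of_zero_le (show 0 ≤ k by omega)
    have e1 : ((k : ℤ) + 1).toNat = k + 1 := by omega
    have hp : eulerPoch (k + 1) = eulerPoch k * (1 - X ^ (k + 1)) := by
      rw [eulerPoch, Finset.prod_range_succ, eulerPoch]
    simp only [invEulerPoch, show (0 : ℤ) ≤ k + 1 by omega, if_true, e1,
      show (0 : ℤ) ≤ k by omega, Int.toNat_natCast]
    have h1 := eulerPoch_mul_inv k
    have h2 := eulerPoch_mul_inv (k + 1)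
    rw [hp] at h2 ⊢
    calc (eulerPoch k)⁻¹ = (eulerPoch k)⁻¹ * 1 := by ring
      _ = (eulerPoch k * (eulerPoch k)⁻¹) * ((eulerPoch k * (1 - X ^ (k + 1)))⁻¹ * (1 - X ^ (k + 1))) := by
          linear_combination (-(eulerPoch k)⁻¹) * h2
      _ = _ := by rw [h1, one_mul]

/-- The coefficients in the finite form of the triple product. -/
noncomputable def tripleCoeff (N : ℕ) (m : ℤ) : PowerSeries ℂ :=
  eulerPoch (2 * N) * invEulerPoch (N - m) * invEulerPoch (N + m)

theorem tripleCoeff_eq_zero {N : ℕ} {m : ℤ} (h : m ∉ Finset.Icc (-(N : ℤ)) N) :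
    tripleCoeff N m = 0 := by
  rw [Finset.mem_Icc, not_and_or] at h
  rcases h with h | h
  · simp [tripleCoeff, invEulerPoch, show ¬ (0 : ℤ) ≤ N + m by omega]
  · simp [tripleCoeff, invEulerPoch, show ¬ m ≤ (N : ℤ) by omega]

/-- Pascal's rule for p-binomial coefficients, with a = N - m and b = N + m. It encodes
multiplication by the next factor (1 - z p^N)(1 - p^{N+1}/z) = 1 + p^{2N+1} - z p^N - p^{N+1}/z. For
a = -1 or b = -1 only one of the three neighbours is present. -/
theorem tripleCoeff_rec_of_add_eq (N : ℕ) (a b : ℤ) (ha : -1 ≤ a) (hb : -1 ≤ b) (hab : a + b = 2 * N) :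
    eulerPoch (2 * (N + 1)) * invEulerPoch (a + 1) * invEulerPoch (b + 1) =
      eulerPoch (2 * N) * ((1 + X ^ (2 * N + 1)) * (invEulerPoch a * invEulerPoch b) +
        X ^ (a + 1).toNat * (invEulerPoch (a + 1) * invEulerPoch (b - 1)) +
        X ^ (b + 1).toNat * (invEulerPoch (a - 1) * invEulerPoch (b + 1))) := by
  have hP : eulerPoch (2 * (N + 1)) =
      eulerPoch (2 * N) * (1 - X ^ (2 * N + 1)) * (1 - X ^ (2 * N + 2)) := by
    rw [show 2 * (N + 1) = 2 * N + 1 + 1 by ring, eulerPoch, Finset.prod_range_succ,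
      Finset.prod_range_succ, eulerPoch]
  have neg : ∀ k : ℤ, k < 0 → invEulerPoch k = 0 := fun k hk => by
    simp [invEulerPoch, not_le.2 hk]
  have nat : ∀ k : ℕ, eulerPoch k * invEulerPoch k = 1 := fun k => by
    simp [invEulerPoch, eulerPoch_mul_inv]
  have zero : invEulerPoch 0 = 1 := by
    have := nat 0
    simpa [eulerPoch] using this
  rcases eq_or_lt_of_le ha with rfl | ha'
  · obtain rfl : b = 2 * N + 1 := by omega
    rw [neg (-1) (by omega), neg (-1 - 1) (by omega)]
    have h1 := nat (2 * (N + 1))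
    have h2 := nat (2 * N)
    push_cast at h1 h2
    rw [show (-1 : ℤ) + 1 = 0 by ring, zero, show (2 * N + 1 + 1 : ℤ) = 2 * (N + 1) by ring,
      show (2 * N + 1 - 1 : ℤ) = 2 * N by ring]
    simp only [Int.toNat_zero, pow_zero]
    linear_combination h1 - h2
  rcases eq_or_lt_of_le hb with rfl | hb'
  · obtain rfl : a = 2 * N + 1 := by omega
    rw [neg (-1) (by omega), neg (-1 - 1) (by omega)]
    have h1 := nat (2 * (N + 1))
    have h2 := nat (2 * N)
    push_cast at h1 h2
    rw [show (-1 : ℤ) + 1 = 0 by ring, zero, show (2 * N + 1 + 1 : ℤ) = 2 * (N + 1) by ring,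
      show (2 * N + 1 - 1 : ℤ) = 2 * N by ring]
    simp only [Int.toNat_zero, pow_zero]
    linear_combination h1 - h2
  · have a0 := invEulerPoch_mul_one_sub ha
    have b0 := invEulerPoch_mul_one_sub hb
    have a1 := invEulerPoch_mul_one_sub (k := a - 1) (by omega)
    have b1 := invEulerPoch_mul_one_sub (k := b - 1) (by omega)
    rw [sub_add_cancel] at a1 b1
    obtain ⟨a, rfl⟩ := Int.eq_ofNat_of_zero_le (show 0 ≤ a by omega)
    obtain ⟨b, rfl⟩ := Int.eq_ofNat_of_zero_le (show 0 ≤ b by omega)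
    rw [a1, b1, a0, b0, hP]
    have e1 : ((a : ℤ) + 1).toNat = a + 1 := by omega
    have e2 : ((b : ℤ) + 1).toNat = b + 1 := by omega
    have e3 : 2 * N = a + b := by omega
    simp only [e1, e2, e3, Int.toNat_natCast]
    ring

theorem tripleCoeff_succ (N : ℕ) (m : ℤ) :
    tripleCoeff (N + 1) m * X ^ triExp m =
      (1 + X ^ (2 * N + 1)) * (tripleCoeff N m * X ^ triExp m) +
        X ^ N * (tripleCoeff N (m - 1) * X ^ triExp (m - 1)) +
        X ^ (N + 1) * (tripleCoeff N (m + 1) * X ^ triExp (m + 1)) := by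
  by_cases hm : m ∈ Finset.Icc (-((N + 1 : ℕ) : ℤ)) (N + 1 : ℕ)
  · rw [Finset.mem_Icc] at hm
    push_cast at hm
    have h := tripleCoeff_rec_of_add_eq N (N - m) (N + m) (by omega) (by omega) (by ring)
    have t0 := two_mul_triExp m
    have t1 := two_mul_triExp (m - 1)
    have t2 := two_mul_triExp (m + 1)
    have e1 : N + triExp (m - 1) = ((N : ℤ) - m + 1).toNat + triExp m := by
      have : (triExp m : ℤ) = triExp (m - 1) + (m - 1) := by linarith
      omega
    have e2 : N + 1 + triExp (m + 1) = ((N : ℤ) + m + 1).toNat + triExp m := by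
      have : (triExp (m + 1) : ℤ) = triExp m + m := by linarith
      omega
    have p1 : (X : PowerSeries ℂ) ^ N * X ^ triExp (m - 1) =
        X ^ ((N : ℤ) - m + 1).toNat * X ^ triExp m := by rw [← pow_add, ← pow_add, e1]
    have p2 : (X : PowerSeries ℂ) ^ (N + 1) * X ^ triExp (m + 1) =
        X ^ ((N : ℤ) + m + 1).toNat * X ^ triExp m := by rw [← pow_add, ← pow_add, e2]
    simp only [tripleCoeff, Nat.cast_add, Nat.cast_one]
    rw [show (N : ℤ) + 1 - m = N - m + 1 by ring, show (N : ℤ) + 1 + m = N + m + 1 by ring,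
      show (N : ℤ) - (m - 1) = N - m + 1 by ring, show (N : ℤ) + (m - 1) = N + m - 1 by ring,
      show (N : ℤ) - (m + 1) = N - m - 1 by ring, show (N : ℤ) + (m + 1) = N + m + 1 by ring]
    linear_combination X ^ triExp m * h -
      eulerPoch (2 * N) * invEulerPoch (N - m + 1) * invEulerPoch (N + m - 1) * p1 -
      eulerPoch (2 * N) * invEulerPoch (N - m - 1) * invEulerPoch (N + m + 1) * p2
  · rw [tripleCoeff_eq_zero hm]
    have : ∀ d : ℤ, -1 ≤ d → d ≤ 1 → tripleCoeff N (m + d) = 0 := by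
      intro d h1 h2
      apply tripleCoeff_eq_zero
      rw [Finset.mem_Icc] at hm ⊢
      push_cast at hm
      omega
    have h0 := this 0 (by omega) (by omega)
    have h1 := this (-1) (by omega) (by omega)
    have h2 := this 1 (by omega) (by omega)
    rw [add_zero] at h0
    rw [sub_eq_add_neg, h0, h1, h2]
    ring

/-- The finite form of Jacobi's triple product. -/
theorem finite_triple_product {z : ℂ} (hz : z ≠ 0) (N : ℕ) :
    (∏ i ∈ Finset.range N, ((1 - C z * X ^ i) * (1 - C z⁻¹ * X ^ (i + 1))) : PowerSeries ℂ) =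
      ∑ᶠ m : ℤ, C ((-z) ^ m) * (tripleCoeff N m * X ^ triExp m) := by
  have hz' : -z ≠ 0 := neg_ne_zero.2 hz
  have fin : ∀ (N : ℕ) (d : ℤ) (c : ℤ → PowerSeries ℂ), (Function.support fun m : ℤ =>
      c m * (tripleCoeff N (m + d) * X ^ triExp (m + d))).Finite := by
    intro N d c
    refine (Finset.finite_toSet (Finset.Icc (-(N : ℤ) - d) (N - d))).subset fun m hm => ?_
    rw [Function.mem_support] at hm
    by_contra h
    apply hm
    rw [tripleCoeff_eq_zero]
    · ring
    · rw [Finset.mem_coe, Finset.mem_Icc] at h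
      rw [Finset.mem_Icc]
      omega
  induction N with
  | zero =>
    rw [finsum_eq_single _ 0]
    · simp [tripleCoeff, invEulerPoch, eulerPoch, triExp]
    · intro m hm
      rw [tripleCoeff_eq_zero (by simpa using fun h => by omega)]
      ring
  | succ N ih =>
    rw [Finset.prod_range_succ, ih]
    have f0 := fin N 0
    simp only [add_zero] at f0
    have e1 : ∑ᶠ m : ℤ, C ((-z) ^ m) * (X ^ N * (tripleCoeff N (m - 1) * X ^ triExp (m - 1))) =
        (-C z * X ^ N) * ∑ᶠ m : ℤ, C ((-z) ^ m) * (tripleCoeff N m * X ^ triExp m) := by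
      rw [mul_finsum' _ _ (f0 _), ← finsum_comp_equiv (Equiv.subRight (1 : ℤ))
        (f := fun m : ℤ => (-C z * X ^ N) * (C ((-z) ^ m) * (tripleCoeff N m * X ^ triExp m)))]
      refine finsum_congr fun m => ?_
      rw [Equiv.subRight_apply, show (-z) ^ m = (-z) * (-z) ^ (m - 1) by
        rw [mul_comm, ← zpow_add_one₀ hz', sub_add_cancel]]
      simp only [map_mul, map_neg]
      ring
    have e2 : ∑ᶠ m : ℤ, C ((-z) ^ m) * (X ^ (N + 1) * (tripleCoeff N (m + 1) * X ^ triExp (m + 1))) =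
        (-C z⁻¹ * X ^ (N + 1)) * ∑ᶠ m : ℤ, C ((-z) ^ m) * (tripleCoeff N m * X ^ triExp m) := by
      rw [mul_finsum' _ _ (f0 _), ← finsum_comp_equiv (Equiv.addRight (1 : ℤ))
        (f := fun m : ℤ => (-C z⁻¹ * X ^ (N + 1)) *
          (C ((-z) ^ m) * (tripleCoeff N m * X ^ triExp m)))]
      refine finsum_congr fun m => ?_
      have : -C z⁻¹ * C ((-z) ^ (m + 1)) = C ((-z) ^ m) := by
        rw [← map_neg, ← map_mul, zpow_add_one₀ hz']
        congr 1
        field_simp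
      rw [Equiv.coe_addRight, ← this]
      ring
    have e0 : ∑ᶠ m : ℤ, C ((-z) ^ m) * ((1 + X ^ (2 * N + 1)) * (tripleCoeff N m * X ^ triExp m)) =
        (1 + X ^ (2 * N + 1)) * ∑ᶠ m : ℤ, C ((-z) ^ m) * (tripleCoeff N m * X ^ triExp m) := by
      rw [mul_finsum' _ _ (f0 _)]
      refine finsum_congr fun m => ?_
      ring
    have hzz : (C z * C z⁻¹ : PowerSeries ℂ) = 1 := by rw [← map_mul, mul_inv_cancel₀ hz, map_one]
    symm
    calc _ = ∑ᶠ m : ℤ, (C ((-z) ^ m) * ((1 + X ^ (2 * N + 1)) * (tripleCoeff N m * X ^ triExp m)) +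
          C ((-z) ^ m) * (X ^ N * (tripleCoeff N (m - 1) * X ^ triExp (m - 1))) +
          C ((-z) ^ m) * (X ^ (N + 1) * (tripleCoeff N (m + 1) * X ^ triExp (m + 1)))) := by
          refine finsum_congr fun m => ?_
          rw [tripleCoeff_succ]
          ring
      _ = _ := by
        have g0 : (Function.support fun m : ℤ => C ((-z) ^ m) *
            ((1 + X ^ (2 * N + 1)) * (tripleCoeff N m * X ^ triExp m))).Finite := by
          have := f0 (fun m => C ((-z) ^ m) * (1 + X ^ (2 * N + 1)))
          simp only [mul_assoc] at this
          exact this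
        have g1 : (Function.support fun m : ℤ => C ((-z) ^ m) *
            (X ^ N * (tripleCoeff N (m - 1) * X ^ triExp (m - 1)))).Finite := by
          have := fin N (-1) (fun m => C ((-z) ^ m) * X ^ N)
          simp only [mul_assoc, ← sub_eq_add_neg] at this
          exact this
        have g2 : (Function.support fun m : ℤ => C ((-z) ^ m) *
            (X ^ (N + 1) * (tripleCoeff N (m + 1) * X ^ triExp (m + 1)))).Finite := by
          have := fin N 1 (fun m => C ((-z) ^ m) * X ^ (N + 1))
          simp only [mul_assoc] at this
          exact this
        rw [finsum_add_distrib _ g2, finsum_add_distrib g0 g1, e0, e1, e2]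
        · linear_combination (-X ^ (2 * N + 1) * ∑ᶠ m : ℤ, C ((-z) ^ m) *
            (tripleCoeff N m * X ^ triExp m)) * hzz
        · exact (g0.union g1).subset (Function.support_add _ _)

/-- `(p;p)_∞`. -/
noncomputable def eulerSeries : PowerSeries ℂ := PowerSeries.mk fun l => coeff l (eulerPoch l)

theorem eulerPoch_sub_dvd (a b : ℕ) : X ^ (a + 1) ∣ eulerPoch (a + b) - eulerPoch a := by
  induction b with
  | zero => simp
  | succ b ih =>
    have : eulerPoch (a + (b + 1)) - eulerPoch a =
        (eulerPoch (a + b) - eulerPoch a) - eulerPoch (a + b) * X ^ (a + b + 1) := by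
      rw [← add_assoc, eulerPoch, Finset.prod_range_succ, ← eulerPoch]
      ring
    rw [this]
    exact dvd_sub ih (Dvd.dvd.mul_left (pow_dvd_pow _ (by omega)) _)

theorem eulerSeries_sub_dvd (a : ℕ) : X ^ (a + 1) ∣ eulerSeries - eulerPoch a := by
  rw [X_pow_dvd_iff]
  intro l hl
  obtain ⟨b, rfl⟩ := Nat.exists_eq_add_of_le (show l ≤ a by omega)
  have := X_pow_dvd_iff.1 (eulerPoch_sub_dvd l b) l (by omega)
  rw [map_sub, sub_eq_zero] at this
  rw [map_sub, eulerSeries, coeff_mk, this, sub_self]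

theorem constantCoeff_eulerSeries : constantCoeff eulerSeries = 1 := by
  rw [← coeff_zero_eq_constantCoeff_apply, eulerSeries, coeff_mk,
    coeff_zero_eq_constantCoeff_apply, constantCoeff_eulerPoch]

/-- The limit N → ∞. The p-binomial coefficient agrees with 1/(p;p)_∞ through order N - |m|, which
is poor for large |m|; the factor p^{m(m-1)/2} makes up for it, since |m| ≤ 1 + m(m-1)/2. -/
theorem tripleCoeff_sub_dvd {N : ℕ} {m : ℤ} (hm : m ∈ Finset.Icc (-(N : ℤ)) N) :
    X ^ N ∣ (tripleCoeff N m - eulerSeries⁻¹) * X ^ triExp m := by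
  rw [Finset.mem_Icc] at hm
  have hE : eulerSeries * eulerSeries⁻¹ = 1 :=
    PowerSeries.mul_inv_cancel _ (by simp [constantCoeff_eulerSeries])
  set k : ℕ := (N - |m|).toNat with hk
  have inv : ∀ a : ℕ, k ≤ a → X ^ (k + 1) ∣ (eulerPoch a)⁻¹ - eulerSeries⁻¹ := by
    intro a ha
    have h := (pow_dvd_pow (X : PowerSeries ℂ) (show k + 1 ≤ a + 1 by omega)).trans
      (eulerSeries_sub_dvd a)
    have : (eulerPoch a)⁻¹ - eulerSeries⁻¹ =
        (eulerSeries - eulerPoch a) * ((eulerPoch a)⁻¹ * eulerSeries⁻¹) := by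
      linear_combination (-(eulerPoch a)⁻¹) * hE + eulerSeries⁻¹ * eulerPoch_mul_inv a
    rw [this]
    exact h.mul_right _
  have habs : |m| ≤ N := abs_le.2 hm
  have hb1 := le_abs_self m
  have hb2 := neg_abs_le m
  have h1 := inv ((N : ℤ) - m).toNat (by omega)
  have h2 := inv ((N : ℤ) + m).toNat (by omega)
  have h3 := (pow_dvd_pow (X : PowerSeries ℂ) (show k + 1 ≤ 2 * N + 1 by omega)).trans
      (eulerSeries_sub_dvd (2 * N))
  have key : X ^ (k + 1) ∣ tripleCoeff N m - eulerSeries⁻¹ := by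
    simp only [tripleCoeff, invEulerPoch, show (0 : ℤ) ≤ N - m by omega,
      show (0 : ℤ) ≤ N + m by omega, if_true]
    have : eulerPoch (2 * N) * (eulerPoch ((N : ℤ) - m).toNat)⁻¹ *
        (eulerPoch ((N : ℤ) + m).toNat)⁻¹ - eulerSeries⁻¹ =
        -(eulerSeries - eulerPoch (2 * N)) * ((eulerPoch ((N : ℤ) - m).toNat)⁻¹ *
          (eulerPoch ((N : ℤ) + m).toNat)⁻¹) +
        eulerSeries * ((eulerPoch ((N : ℤ) - m).toNat)⁻¹ - eulerSeries⁻¹) *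
          (eulerPoch ((N : ℤ) + m).toNat)⁻¹ +
        ((eulerPoch ((N : ℤ) + m).toNat)⁻¹ - eulerSeries⁻¹) := by
      linear_combination (eulerPoch ((N : ℤ) + m).toNat)⁻¹ * hE
    rw [this]
    exact dvd_add (dvd_add ((dvd_neg.2 h3).mul_right _) ((h1.mul_left _).mul_right _)) h2
  have ht : N ≤ k + 1 + triExp m := by
    have h := two_mul_triExp m
    have : |m| ≤ 1 + triExp m := by
      rcases le_or_gt 0 m with h0 | h0
      · rw [abs_of_nonneg h0]; nlinarith
      · rw [abs_of_neg h0]; nlinarith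
    omega
  exact (pow_dvd_pow _ ht).trans (by rw [pow_add]; exact mul_dvd_mul key dvd_rfl)

/-- Jacobi's triple product identity: the normalized and unnormalized theta functions differ by
a factor independent of `z`. -/
theorem formalTheta_eq {z : ℂ} (hz : z ≠ 0) : formalTheta z = eulerSeries⁻¹ * thetaHat z := by
  ext l
  -- The coefficient of p^l in `formalTheta` comes from the product of l + 1 factors. The finite
  -- identity with N = l + 1 has its support in this interval and an error divisible by p^{l+1}.
  set s := Finset.Icc (-((l + 1 : ℕ) : ℤ)) (l + 1 : ℕ) with hs
  have h1 : coeff l (formalTheta z) = coeff l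
      (∑ m ∈ s, C ((-z) ^ m) * (tripleCoeff (l + 1) m * X ^ triExp m)) := by
    rw [formalTheta, coeff_mk, finite_triple_product hz]
    congr 1
    refine finsum_eq_sum_of_support_subset _ fun m hm => ?_
    by_contra h
    rw [Function.mem_support] at hm
    apply hm
    rw [tripleCoeff_eq_zero (by simpa [hs] using h)]
    ring
  have h2 : coeff l (∑ m ∈ s, C ((-z) ^ m) * (tripleCoeff (l + 1) m * X ^ triExp m)) =
      coeff l (eulerSeries⁻¹ * ∑ m ∈ s, C ((-z) ^ m) * X ^ triExp m) := by
    rw [← sub_eq_zero, ← map_sub]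
    refine (X_pow_dvd_iff (n := l + 1)).1 ?_ l (by omega)
    rw [Finset.mul_sum, ← Finset.sum_sub_distrib]
    refine Finset.dvd_sum fun m hm => ?_
    have := (tripleCoeff_sub_dvd hm).mul_left (C ((-z) ^ m))
    convert this using 1
    ring
  have h3 : X ^ (l + 1) ∣ (∑ m ∈ s, C ((-z) ^ m) * X ^ triExp m) - thetaHat z := by
    rw [X_pow_dvd_iff]
    intro k hk
    rw [map_sub, sub_eq_zero, thetaHat, coeff_thetaSeries _ _ s, map_sum, Finset.sum_filter]
    · refine Finset.sum_congr rfl fun m _ => ?_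
      rw [coeff_C_mul, coeff_X_pow]
      have := two_mul_triExp m
      by_cases h : m * (m - 1) = 2 * (k : ℤ)
      · rw [if_pos h, if_pos (by omega), mul_one]
      · rw [if_neg h, if_neg (by omega), mul_zero]
    · intro m hm
      have := mem_Icc_of_triangular hm
      rw [Finset.mem_Icc] at this
      rw [hs, Finset.mem_Icc]
      push_cast
      omega
  rw [h1, h2, ← sub_eq_zero, ← map_sub, ← mul_sub]
  exact X_pow_dvd_iff.1 (h3.mul_left _) l (by omega)

/-! ### Formal quasi-periodicity -/

/-- The coefficient of `p^k x^μ`, as a function of `(k, μ) ∈ ℤ × M`. -/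
noncomputable def biCoeff {M : Type*} (F : PowerSeries (AddMonoidAlgebra ℂ M))
    [AddCommGroup M] (a : ℤ × M) : ℂ :=
  if 0 ≤ a.1 then (PowerSeries.coeff a.1.toNat F).coeff a.2 else 0

theorem biCoeff_natCast {M : Type*} [AddCommGroup M] (F : PowerSeries (AddMonoidAlgebra ℂ M))
    (k : ℕ) (μ : M) : biCoeff F ((k : ℤ), μ) = (PowerSeries.coeff k F).coeff μ := by
  simp [biCoeff]

theorem biCoeff_of_neg {M : Type*} [AddCommGroup M] (F : PowerSeries (AddMonoidAlgebra ℂ M))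
    {a : ℤ × M} (h : a.1 < 0) : biCoeff F a = 0 := by
  simp [biCoeff, not_le.2 h]

theorem biCoeff_add {M : Type*} [AddCommGroup M] (F G : PowerSeries (AddMonoidAlgebra ℂ M))
    (a : ℤ × M) : biCoeff (F + G) a = biCoeff F a + biCoeff G a := by
  rw [biCoeff, biCoeff, biCoeff]
  split_ifs <;> simp

theorem biCoeff_sub {M : Type*} [AddCommGroup M] (F G : PowerSeries (AddMonoidAlgebra ℂ M))
    (a : ℤ × M) : biCoeff (F - G) a = biCoeff F a - biCoeff G a := by
  rw [biCoeff, biCoeff, biCoeff]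
  split_ifs <;> simp

theorem biCoeff_sum {M ι : Type*} [AddCommGroup M] (s : Finset ι)
    (F : ι → PowerSeries (AddMonoidAlgebra ℂ M)) (a : ℤ × M) :
    biCoeff (∑ i ∈ s, F i) a = ∑ i ∈ s, biCoeff (F i) a := by
  simp only [biCoeff]
  split_ifs <;> simp

theorem support_biCoeff_mul_finite {M : Type*} [AddCommGroup M]
    (F G : PowerSeries (AddMonoidAlgebra ℂ M)) (c : ℤ × M) :
    (Function.support fun a => biCoeff F a * biCoeff G (c - a)).Finite := by
  have : (⋃ i ∈ (Finset.range (c.1.toNat + 1) : Set ℕ),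
      (Prod.mk (i : ℤ)) '' ((coeff i F).coeff.support : Set M)).Finite :=
    Set.Finite.biUnion (Finset.finite_toSet _) fun i _ => (Finset.finite_toSet _).image _
  refine this.subset fun a ha => ?_
  rw [Function.mem_support] at ha
  have h1 : 0 ≤ a.1 := by
    by_contra! h
    exact ha (by rw [biCoeff_of_neg F h, zero_mul])
  have h2 : 0 ≤ (c - a).1 := by
    by_contra! h
    exact ha (by rw [biCoeff_of_neg G h, mul_zero])
  simp only [Set.mem_iUnion, Set.mem_image]
  refine ⟨a.1.toNat, ?_, a.2, ?_, ?_⟩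
  · rw [Finset.mem_coe, Finset.mem_range]
    rw [Prod.fst_sub] at h2
    omega
  · rw [Finset.mem_coe, Finsupp.mem_support_iff]
    have := left_ne_zero_of_mul ha
    rwa [biCoeff, if_pos h1] at this
  · ext
    · simp [h1]
    · rfl

/-- Because `biCoeff` is extended by zero to negative powers of p, multiplication becomes
convolution over the whole group ℤ × M. Changes of summation index are then free of side conditions.
-/
theorem biCoeff_mul {M : Type*} [AddCommGroup M] (F G : PowerSeries (AddMonoidAlgebra ℂ M))
    (c : ℤ × M) : biCoeff (F * G) c = ∑ᶠ a, biCoeff F a * biCoeff G (c - a) := by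
  classical
  rcases lt_or_ge c.1 0 with hc | hc
  · rw [biCoeff_of_neg _ hc, finsum_eq_zero_of_forall_eq_zero]
    intro a
    rcases lt_or_ge a.1 0 with ha | ha
    · rw [biCoeff_of_neg F ha, zero_mul]
    · rw [biCoeff_of_neg G (by rw [Prod.fst_sub]; omega), mul_zero]
  obtain ⟨l, m⟩ := c
  obtain ⟨l, rfl⟩ := Int.eq_ofNat_of_zero_le hc
  set U : Finset M := (Finset.range (l + 1)).biUnion fun i => (coeff i F).coeff.support with hU
  set s : Finset (ℤ × M) := (Finset.range (l + 1) ×ˢ U).image fun a => ((a.1 : ℤ), a.2) with hs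
  rw [finsum_eq_sum_of_support_subset (s := s), hs, Finset.sum_image, Finset.sum_product]
  · rw [biCoeff_natCast, coeff_mul,
      Finset.Nat.sum_antidiagonal_eq_sum_range_succ_mk, AddMonoidAlgebra.coeff_sum,
      Finsupp.finsetSum_apply]
    refine Finset.sum_congr rfl fun i hi => ?_
    rw [AddMonoidAlgebra.coeff_mul_apply_left, Finsupp.sum_of_support_subset (s := U)]
    · refine Finset.sum_congr rfl fun μ _ => ?_
      rw [Finset.mem_range] at hi
      rw [biCoeff_natCast, Prod.mk_sub_mk, show (l : ℤ) - i = ((l - i : ℕ) : ℤ) by omega,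
        biCoeff_natCast, neg_add_eq_sub]
    · intro μ hμ
      exact Finset.mem_biUnion.2 ⟨i, hi, hμ⟩
    · simp
  · rintro ⟨a, b⟩ _ ⟨a', b'⟩ _ h
    simpa using h
  · intro a ha
    rw [Function.mem_support] at ha
    have h1 : 0 ≤ a.1 := by
      by_contra! h
      exact ha (by rw [biCoeff_of_neg F h, zero_mul])
    have h2 : 0 ≤ (((l : ℤ), m) - a).1 := by
      by_contra! h
      exact ha (by rw [biCoeff_of_neg G h, mul_zero])
    rw [Prod.fst_sub] at h2
    simp only at h2
    rw [hs, Finset.mem_coe, Finset.mem_image]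
    have hr : a.1.toNat ∈ Finset.range (l + 1) := by rw [Finset.mem_range]; omega
    refine ⟨(a.1.toNat, a.2), Finset.mem_product.2 ⟨hr, Finset.mem_biUnion.2 ⟨_, hr, ?_⟩⟩, ?_⟩
    · rw [Finsupp.mem_support_iff]
      have := left_ne_zero_of_mul ha
      rwa [biCoeff, if_pos h1] at this
    · ext
      · simp [h1]
      · rfl

/-- `F(p x) = μ⁻¹ x^{-d} F(x)` up to the constant `μ`, expressed through coefficients. -/
def QuasiPeriodic (d : ℤ) (μ : ℂ) (F : PowerSeries (LaurentPolynomial ℂ)) : Prop :=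
  ∀ l m : ℤ, μ * biCoeff F (l + m, m + d) = biCoeff F (l, m)

/-- Functional equations multiply. On coefficients, this is the reindexing of the convolution by the
bijection (l, m) ↦ (l + m, m + d) of ℤ × ℤ. -/
theorem QuasiPeriodic.mul {d e : ℤ} {μ ν : ℂ} {F G : PowerSeries (LaurentPolynomial ℂ)}
    (hF : QuasiPeriodic d μ F) (hG : QuasiPeriodic e ν G) : QuasiPeriodic (d + e) (μ * ν) (F * G) := by
  intro l m
  let E : ℤ × ℤ ≃ ℤ × ℤ :=
    { toFun := fun a => (a.1 + a.2, a.2 + d)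
      invFun := fun a => (a.1 - (a.2 - d), a.2 - d)
      left_inv := fun a => by ext <;> simp
      right_inv := fun a => by ext <;> simp }
  rw [biCoeff_mul, biCoeff_mul, ← finsum_comp_equiv E, mul_finsum]
  refine finsum_congr fun a => ?_
  have h1 := hF a.1 a.2
  have h2 := hG (l - a.1) (m - a.2)
  have e1 : (l + m, m + (d + e)) - E a = (l - a.1 + (m - a.2), m - a.2 + e) := by
    ext <;> simp [E] <;> ring
  have e2 : (l, m) - a = (l - a.1, m - a.2) := rfl
  have e3 : E a = (a.1 + a.2, a.2 + d) := rfl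
  rw [Prod.mk.eta] at h1
  rw [e1, e2, e3, ← h1, ← h2]
  ring

theorem QuasiPeriodic.sub {d : ℤ} {μ : ℂ} {F G : PowerSeries (LaurentPolynomial ℂ)}
    (hF : QuasiPeriodic d μ F) (hG : QuasiPeriodic d μ G) : QuasiPeriodic d μ (F - G) := by
  intro l m
  rw [biCoeff_sub, biCoeff_sub, mul_sub, hF, hG]

theorem QuasiPeriodic.sum {ι : Type*} {d : ℤ} {μ : ℂ} {F : ι → PowerSeries (LaurentPolynomial ℂ)}
    {s : Finset ι} (hF : ∀ i ∈ s, QuasiPeriodic d μ (F i)) : QuasiPeriodic d μ (∑ i ∈ s, F i) := by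
  intro l m
  rw [biCoeff_sum, biCoeff_sum, Finset.mul_sum]
  exact Finset.sum_congr rfl fun i hi => hF i hi l m

theorem quasiPeriodic_const (c : PowerSeries ℂ) :
    QuasiPeriodic 0 1 (PowerSeries.map LaurentPolynomial.C c) := by
  intro l m
  rcases eq_or_ne m 0 with rfl | hm
  · simp
  · simp [biCoeff, hm]

theorem QuasiPeriodic.const_mul {d : ℤ} {μ : ℂ} {F : PowerSeries (LaurentPolynomial ℂ)}
    (hF : QuasiPeriodic d μ F) (c : PowerSeries ℂ) :
    QuasiPeriodic d μ (PowerSeries.map LaurentPolynomial.C c * F) := by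
  have := (quasiPeriodic_const c).mul hF
  rwa [zero_add, one_mul] at this

theorem QuasiPeriodic.prod {ι : Type*} {d : ι → ℤ} {μ : ι → ℂ}
    {F : ι → PowerSeries (LaurentPolynomial ℂ)} {s : Finset ι}
    (hF : ∀ i ∈ s, QuasiPeriodic (d i) (μ i) (F i)) :
    QuasiPeriodic (∑ i ∈ s, d i) (∏ i ∈ s, μ i) (∏ i ∈ s, F i) := by
  classical
  induction s using Finset.induction_on with
  | empty => simpa using quasiPeriodic_const 1
  | insert i s hi ih =>
    rw [Finset.sum_insert hi, Finset.prod_insert hi, Finset.prod_insert hi]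
    exact (hF i (Finset.mem_insert_self _ _)).mul
      (ih fun j hj => hF j (Finset.mem_insert_of_mem hj))

/-- Evaluation of a Laurent polynomial in one variable. -/
noncomputable def evalLaurent (z : ℂˣ) : LaurentPolynomial ℂ →+* ℂ :=
  LaurentPolynomial.eval₂ (RingHom.id ℂ) z

theorem evalLaurent_C_mul_T (z : ℂˣ) (c : ℂ) (m : ℤ) :
    evalLaurent z (AddMonoidAlgebra.single m c) = c * (z : ℂ) ^ m := by
  rw [LaurentPolynomial.single_eq_C_mul_T, evalLaurent, LaurentPolynomial.eval₂_C_mul_T]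
  simp

theorem evalLaurent_C (z : ℂˣ) (c : ℂ) : evalLaurent z (LaurentPolynomial.C c) = c := by
  rw [evalLaurent, LaurentPolynomial.eval₂_C]
  rfl

/-- A quasi-periodic series of degree `d` with `d` zeros and no terms of degree zero in `x`
vanishes. -/
theorem QuasiPeriodic.eq_zero {d : ℕ} {μ : ℂ} (hμ : μ ≠ 0) {F : PowerSeries (LaurentPolynomial ℂ)}
    (hF : QuasiPeriodic d μ F) (Z : Finset ℂˣ) (hZ : Z.card = d)
    (hvan : ∀ z ∈ Z, PowerSeries.map (evalLaurent z) F = 0)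
    (h0 : ∀ l, (coeff l F).coeff 0 = 0) : F = 0 := by
  ext1 l
  induction l using Nat.strong_induction_on with
  | _ l ih =>
  rw [map_zero]
  have small : ∀ k m : ℤ, k < l → biCoeff F (k, m) = 0 := by
    intro k m hk
    rcases lt_or_ge k 0 with h | h
    · exact biCoeff_of_neg F h
    · obtain ⟨k, rfl⟩ := Int.eq_ofNat_of_zero_le h
      rw [biCoeff_natCast, ih k (by simpa using hk)]
      simp
  set f := coeff l F with hf
  have hbi : ∀ m, biCoeff F ((l : ℤ), m) = f.coeff m := fun m => biCoeff_natCast F l m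
  -- Quasi-periodicity links the coefficients of p^l outside 0 ≤ m < d to lower orders in p, already
  -- known to vanish, except at m = d. That one is linked to the term of degree zero, excluded by
  -- `h0`. So f is a polynomial of degree below d with d roots.
  have hneg : ∀ m : ℤ, m < 0 → f.coeff m = 0 := by
    intro m hm
    rw [← hbi, ← hF, small _ _ (by omega), mul_zero]
  have hbig : ∀ m : ℤ, (d : ℤ) ≤ m → f.coeff m = 0 := by
    intro m hm
    have h := hF (l - (m - d)) (m - d)
    rw [sub_add_cancel, sub_add_cancel, hbi] at h
    rcases eq_or_lt_of_le hm with rfl | hm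
    · rw [sub_self, sub_zero, hbi, h0] at h
      exact (mul_eq_zero.1 h).resolve_left hμ
    · rw [small _ _ (by omega)] at h
      exact (mul_eq_zero.1 h).resolve_left hμ
  set P : Polynomial ℂ := ∑ i ∈ Finset.range d, Polynomial.monomial i (f.coeff i) with hP
  have hfP : f = Polynomial.toLaurent P := by
    refine LaurentPolynomial.ext fun m => ?_
    rw [hP, map_sum, AddMonoidAlgebra.coeff_sum, Finsupp.finsetSum_apply]
    simp only [← Polynomial.C_mul_X_pow_eq_monomial, Polynomial.toLaurent_C_mul_X_pow,
      ← LaurentPolynomial.single_eq_C_mul_T, AddMonoidAlgebra.coeff_single, Finsupp.single_apply]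
    rcases lt_or_ge m 0 with h | h
    · rw [hneg m h, Finset.sum_eq_zero]
      intro i _
      rw [if_neg (by omega)]
    · obtain ⟨m, rfl⟩ := Int.eq_ofNat_of_zero_le h
      simp only [Nat.cast_inj, Finset.sum_ite_eq', Finset.mem_range]
      split_ifs with h'
      · rfl
      · exact hbig _ (by omega)
  have hP0 : P = 0 := by
    rcases Nat.eq_zero_or_pos d with rfl | hd
    · simp [hP]
    refine Polynomial.eq_zero_of_natDegree_lt_card_of_eval_eq_zero P (ι := Z)
      (f := fun z => ((z : ℂˣ) : ℂ)) (fun a b h => Subtype.ext (Units.ext h)) ?_ ?_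
    · rintro ⟨z, hz⟩
      have h := congrArg (coeff l) (hvan z hz)
      rw [coeff_map, ← hf, map_zero, hfP, evalLaurent, LaurentPolynomial.eval₂_toLaurent] at h
      simpa using h
    · rw [Fintype.card_coe, hZ, Nat.lt_iff_le_pred hd]
      refine Polynomial.natDegree_sum_le_of_forall_le _ _ fun i hi => ?_
      refine (Polynomial.natDegree_monomial_le _).trans ?_
      rw [Finset.mem_range] at hi
      omega
  rw [hfP, hP0, map_zero]

/-- The series of terms of degree zero in `x`. -/
noncomputable def degreeZeroPart (F : PowerSeries (LaurentPolynomial ℂ)) : PowerSeries ℂ :=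
  PowerSeries.mk fun l => (coeff l F).coeff 0

theorem degreeZeroPart_const_mul (c : PowerSeries ℂ) (F : PowerSeries (LaurentPolynomial ℂ)) :
    degreeZeroPart (PowerSeries.map LaurentPolynomial.C c * F) = c * degreeZeroPart F := by
  ext l
  simp only [degreeZeroPart, coeff_mk, coeff_mul, coeff_map, AddMonoidAlgebra.coeff_sum,
    Finsupp.finsetSum_apply, ← LaurentPolynomial.smul_eq_C_mul, AddMonoidAlgebra.coeff_smul,
    Finsupp.smul_apply, smul_eq_mul]

/-- Quasi-periodic series of the same type with a full set of common zeros are proportional. -/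
theorem QuasiPeriodic.proportional {d : ℕ} {μ : ℂ} (hμ : μ ≠ 0)
    {F G : PowerSeries (LaurentPolynomial ℂ)} (hF : QuasiPeriodic d μ F) (hG : QuasiPeriodic d μ G)
    (Z : Finset ℂˣ) (hZ : Z.card = d)
    (hFvan : ∀ z ∈ Z, PowerSeries.map (evalLaurent z) F = 0)
    (hGvan : ∀ z ∈ Z, PowerSeries.map (evalLaurent z) G = 0)
    (hG0 : (coeff 0 G).coeff 0 = 1) : ∃ c : PowerSeries ℂ, F = PowerSeries.map LaurentPolynomial.C c * G := by
  have hunit : degreeZeroPart G * (degreeZeroPart G)⁻¹ = 1 := by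
    refine PowerSeries.mul_inv_cancel _ ?_
    rw [← coeff_zero_eq_constantCoeff_apply, degreeZeroPart, coeff_mk, hG0]
    exact one_ne_zero
  -- With the quotient of the degree-zero parts, F - cG has no terms of degree zero, as
  -- `QuasiPeriodic.eq_zero` demands.
  refine ⟨degreeZeroPart F * (degreeZeroPart G)⁻¹, ?_⟩
  rw [← sub_eq_zero]
  refine (hF.sub (hG.const_mul _)).eq_zero hμ Z hZ ?_ ?_
  · intro z hz
    rw [map_sub, map_mul, hFvan z hz, hGvan z hz, mul_zero, sub_zero]
  · intro l
    have h := degreeZeroPart_const_mul (degreeZeroPart F * (degreeZeroPart G)⁻¹) G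
    rw [mul_assoc, mul_comm _ (degreeZeroPart G), hunit, mul_one] at h
    have := congrArg (coeff l) h
    have e : ∀ F : PowerSeries (LaurentPolynomial ℂ), coeff l (degreeZeroPart F) =
        (coeff l F).coeff 0 := fun F => by rw [degreeZeroPart, coeff_mk]
    rw [e, e] at this
    rw [map_sub, AddMonoidAlgebra.coeff_sub, Finsupp.sub_apply, this, sub_self]

/-! ### Theta functions as quasi-periodic series -/

/-- `thetaHat (α x)` as a series in `p` with coefficients in Laurent polynomials in `x`. -/
noncomputable def thetaT (α : ℂ) : PowerSeries (LaurentPolynomial ℂ) :=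
  thetaSeries fun m => AddMonoidAlgebra.single m ((-α) ^ m)

theorem map_evalLaurent_thetaT (z : ℂˣ) (α : ℂ) :
    PowerSeries.map (evalLaurent z) (thetaT α) = thetaHat (α * z) := by
  rw [thetaT, map_thetaSeries, thetaHat]
  congr 1
  ext m
  rw [evalLaurent_C_mul_T, ← mul_zpow, neg_mul]

theorem biCoeff_thetaT (α : ℂ) (l m : ℤ) :
    biCoeff (thetaT α) (l, m) = if m * (m - 1) = 2 * l then (-α) ^ m else 0 := by
  rcases lt_or_ge l 0 with h | h
  · rw [biCoeff_of_neg _ h, if_neg]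
    intro h'
    have := two_mul_triExp m
    omega
  · obtain ⟨l, rfl⟩ := Int.eq_ofNat_of_zero_le h
    rw [biCoeff_natCast, thetaT, thetaSeries, coeff_mk,
      AddMonoidAlgebra.coeff_sum, Finsupp.finsetSum_apply]
    simp only [AddMonoidAlgebra.coeff_single, Finsupp.single_apply, Finset.sum_ite_eq',
      Finset.mem_filter]
    by_cases hm : m * (m - 1) = 2 * (l : ℤ)
    · rw [if_pos ⟨mem_Icc_of_triangular hm, hm⟩, if_pos hm]
    · rw [if_neg fun h => hm h.2, if_neg hm]

/-- Since (m+1)m/2 = m(m-1)/2 + m, raising the exponent of x by one costs exactly p^m. -/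
theorem quasiPeriodic_thetaT {α : ℂ} (hα : α ≠ 0) : QuasiPeriodic 1 (-α⁻¹) (thetaT α) := by
  intro l m
  rw [biCoeff_thetaT, biCoeff_thetaT]
  have : (m + 1) * (m + 1 - 1) = 2 * (l + m) ↔ m * (m - 1) = 2 * l := by
    constructor <;> intro h <;> linarith
  simp only [this]
  split_ifs
  · rw [zpow_add_one₀ (neg_ne_zero.2 hα)]
    field_simp
  · ring

theorem coeff_zero_thetaT (α : ℂ) :
    coeff 0 (thetaT α) = Polynomial.toLaurent (1 - Polynomial.C α * Polynomial.X) := by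
  rw [thetaT, coeff_zero_thetaSeries, map_sub, Polynomial.toLaurent_one,
    Polynomial.toLaurent_C_mul_eq, Polynomial.toLaurent_X, ← LaurentPolynomial.single_eq_C_mul_T,
    zpow_zero, zpow_one, AddMonoidAlgebra.single_neg, ← sub_eq_add_neg]
  rfl

/-! ### The theta function identity behind commutativity -/

/-- `θ(tz)/θ(z)`. -/
noncomputable def thetaRatio (t z : ℂ) : PowerSeries ℂ := thetaHat (t * z) * (thetaHat z)⁻¹

/-- `θ(tz)θ(t/(qz)) / (θ(z)θ(1/(qz)))`. -/
noncomputable def pairFactor (q t z : ℂ) : PowerSeries ℂ :=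
  thetaRatio t z * thetaRatio t (q * z)⁻¹

/-- The common denominator of `pairFactor q t z` and `pairFactor q t z⁻¹`. -/
noncomputable def pairDenom (q z : ℂ) : PowerSeries ℂ :=
  thetaHat z * thetaHat (q * z) * thetaHat (z / q)

/-- The numerator of `pairFactor q t z` over `pairDenom q z`. -/
noncomputable def pairNum (q t z : ℂ) : PowerSeries ℂ :=
  C t * (thetaHat (t * z) * thetaHat (q * z / t) * thetaHat (z / q))

/-- The numerator of `pairFactor q t z⁻¹` over `pairDenom q z`. -/
noncomputable def pairNumInv (q t z : ℂ) : PowerSeries ℂ :=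
  C t * (thetaHat (z / t) * thetaHat (t * z / q) * thetaHat (q * z))

theorem thetaHat_mul_inv {z : ℂ} (hz : z ≠ 1) : thetaHat z * (thetaHat z)⁻¹ = 1 :=
  PowerSeries.mul_inv_cancel _ (by rw [constantCoeff_thetaHat]; exact sub_ne_zero.2 hz.symm)

theorem C_mul_C_eq {a b c : ℂ} (h : a * b = c) : (C a * C b : PowerSeries ℂ) = C c := by
  rw [← map_mul, h]

section

variable {q t : ℂ} (hq : q ≠ 0) (ht : t ≠ 0)

-- The ratio at (qz)⁻¹ is inverted so that only arguments proportional to z remain; the two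
-- inversion prefactors multiply to t. Together with the companion for z⁻¹ this puts both pair
-- factors over a single denominator.
include hq ht in
theorem pairFactor_mul_pairDenom {z : ℂ} (hz : z ≠ 0) (h1 : z ≠ 1) (h2 : q * z ≠ 1) :
    pairFactor q t z * pairDenom q z = pairNum q t z := by
  have hqz : q * z ≠ 0 := mul_ne_zero hq hz
  have e1 := thetaHat_mul_inv h1
  have e2 := thetaHat_mul_inv (z := (q * z)⁻¹) (by rwa [ne_eq, inv_eq_one])
  have e3 : thetaHat (q * z) = C (-(q * z)) * thetaHat (q * z)⁻¹ := by
    have := thetaHat_inv (inv_ne_zero hqz)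
    rwa [inv_inv] at this
  have e4 : thetaHat (t * (q * z)⁻¹) = C (-(t / (q * z))) * thetaHat (q * z / t) := by
    have := thetaHat_inv (z := q * z / t) (div_ne_zero hqz ht)
    rwa [inv_div, div_eq_mul_inv t] at this
  have e5 : (C (-(q * z)) * C (-(t / (q * z))) : PowerSeries ℂ) = C t :=
    C_mul_C_eq (by field_simp)
  rw [pairFactor, thetaRatio, thetaRatio, pairDenom, pairNum, e3, e4, ← e5]
  linear_combination (C (-(q * z)) * C (-(t / (q * z))) * thetaHat (t * z) *
    thetaHat (q * z / t) * thetaHat (z / q)) * (thetaHat (q * z)⁻¹ * (thetaHat (q * z)⁻¹)⁻¹ * e1 + e2)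

include hq ht in
theorem pairFactor_inv_mul_pairDenom {z : ℂ} (hz : z ≠ 0) (h1 : z ≠ 1) (h2 : z ≠ q) :
    pairFactor q t z⁻¹ * pairDenom q z = pairNumInv q t z := by
  have e1 := thetaHat_mul_inv (z := z⁻¹) (by rwa [ne_eq, inv_eq_one])
  have e2 := thetaHat_mul_inv (z := z / q) (by rwa [ne_eq, div_eq_one_iff_eq hq])
  have e3 : thetaHat z = C (-z) * thetaHat z⁻¹ := by
    have := thetaHat_inv (inv_ne_zero hz)
    rwa [inv_inv] at this
  have e4 : thetaHat (t * z⁻¹) = C (-(t / z)) * thetaHat (z / t) := by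
    have := thetaHat_inv (z := z / t) (div_ne_zero hz ht)
    rwa [inv_div, div_eq_mul_inv t] at this
  have e5 : (C (-z) * C (-(t / z)) : PowerSeries ℂ) = C t := C_mul_C_eq (by field_simp)
  have e6 : (q * z⁻¹)⁻¹ = z / q := by field_simp
  rw [pairFactor, thetaRatio, thetaRatio, pairDenom, pairNumInv, e3, e4, e6, ← e5,
    ← mul_div_assoc]
  linear_combination (C (-z) * C (-(t / z)) * thetaHat (z / t) *
    thetaHat (t * z / q) * thetaHat (q * z)) * (thetaHat (z / q) * (thetaHat (z / q))⁻¹ * e1 + e2)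

-- The two ratios in `pairFactor` trade places under z ↦ (qz)⁻¹. At the zeros z = q^{±1} this
-- symmetry matches the surviving terms of the subset sums.
include hq in
theorem pairFactor_reflect {z : ℂ} (hz : z ≠ 0) : pairFactor q t (q * z)⁻¹ = pairFactor q t z := by
  have : (q * (q * z)⁻¹)⁻¹ = z := by field_simp
  rw [pairFactor, this, pairFactor, mul_comm]

theorem pairDenom_one : pairDenom q 1 = 0 := by simp [pairDenom, thetaHat_one]

include hq in
theorem pairDenom_self : pairDenom q q = 0 := by
  simp [pairDenom, div_self hq, thetaHat_one]

include hq in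
theorem pairDenom_inv : pairDenom q q⁻¹ = 0 := by
  simp [pairDenom, mul_inv_cancel₀ hq, thetaHat_one]

include hq in
theorem pairNum_self : pairNum q t q = 0 := by
  simp [pairNum, div_self hq, thetaHat_one]

include hq in
theorem pairNumInv_inv : pairNumInv q t q⁻¹ = 0 := by
  simp [pairNumInv, mul_inv_cancel₀ hq, thetaHat_one]

-- The residues at z = 1 cancel: a term with i₀ chosen and k not chosen compensates the one with the
-- roles of i₀ and k exchanged.
include hq ht in
theorem pairNum_one_add : pairNum q t 1 + pairNumInv q t 1 = 0 := by
  have e1 : thetaHat (1 / t) = C (-t⁻¹) * thetaHat t := by rw [one_div, thetaHat_inv ht]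
  have e2 : thetaHat (t * 1 / q) = C (-(t / q)) * thetaHat (q * 1 / t) := by
    have := thetaHat_inv (z := q / t) (div_ne_zero hq ht)
    rwa [mul_one, mul_one, ← inv_div]
  have e3 : thetaHat (1 / q) = C (-q⁻¹) * thetaHat q := by rw [one_div, thetaHat_inv hq]
  have e4 : (C (-t⁻¹) * C (-(t / q)) : PowerSeries ℂ) = C q⁻¹ := C_mul_C_eq (by field_simp)
  have e5 : (C (-q⁻¹) : PowerSeries ℂ) = - C q⁻¹ := map_neg _ _
  rw [pairNum, pairNumInv, e1, e2, e3, mul_one, mul_one, e5]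
  linear_combination (C t * thetaHat t * thetaHat (q / t) * thetaHat q) * e4

end

/-! ### Subset sums at generic points -/

/-- A point whose coordinates are nonzero and in distinct `q`-orbits. -/
def GenericPt {ι : Type*} (q : ℂ) (x : ι → ℂ) : Prop :=
  (∀ i, x i ≠ 0) ∧ ∀ i j, i ≠ j → ∀ m : ℤ, x i ≠ q ^ m * x j

theorem GenericPt.div_ne {ι : Type*} {q : ℂ} {x : ι → ℂ} (hx : GenericPt q x) {i j : ι} (hij : i ≠ j) (m : ℤ) :
    x i / x j ≠ q ^ m := by
  intro h
  rw [div_eq_iff (hx.1 j)] at h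
  exact hx.2 i j hij m h

/-- `∑_{S ⊆ L, |S| = s} ∏_{i ∈ S, j ∈ L \ S} g(x_i/x_j)`. -/
noncomputable def subsetSum {ι : Type*} [DecidableEq ι] (g : ℂ → PowerSeries ℂ) (L : Finset ι)
    (s : ℕ) (x : ι → ℂ) : PowerSeries ℂ :=
  ∑ S ∈ Finset.powersetCard s L, ∏ i ∈ S, ∏ j ∈ L \ S, g (x i / x j)

/-- Only sets containing exactly one of i, k contribute, and each is P with i or with k adjoined.
The sum thus descends to M with one element fewer per subset, the form to which the induction
hypothesis on subset sums applies. -/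
theorem sum_powersetCard_insert_insert {ι A : Type*} [DecidableEq ι] [AddCommMonoid A] {i k : ι}
    {M : Finset ι} (hik : i ≠ k) (hi : i ∉ M) (hk : k ∉ M) (s : ℕ) (f : Finset ι → A)
    (hf : ∀ S, (i ∈ S ↔ k ∈ S) → f S = 0) :
    ∑ S ∈ Finset.powersetCard (s + 1) (insert i (insert k M)), f S =
      ∑ P ∈ Finset.powersetCard s M, (f (insert i P) + f (insert k P)) := by
  have step : ∀ (j : ι) (N : Finset ι), j ∉ N → ∀ (s : ℕ) (f : Finset ι → A),
      ∑ S ∈ Finset.powersetCard (s + 1) (insert j N), f S =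
        ∑ S ∈ Finset.powersetCard (s + 1) N, f S + ∑ S ∈ Finset.powersetCard s N, f (insert j S) := by
    intro j N hj s f
    rw [Finset.powersetCard_succ_insert hj, Finset.sum_union, Finset.sum_image]
    · intro S hS T hT h
      rw [Finset.mem_coe, Finset.mem_powersetCard] at hS hT
      have := congrArg (fun S => S.erase j) h
      simpa [Finset.erase_insert (fun h => hj (hS.1 h)), Finset.erase_insert (fun h => hj (hT.1 h))]
        using this
    · rw [Finset.disjoint_left]
      intro S hS hS'
      obtain ⟨T, _, rfl⟩ := Finset.mem_image.1 hS'
      exact hj ((Finset.mem_powersetCard.1 hS).1 (Finset.mem_insert_self _ _))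
  have hi' : i ∉ insert k M := by simp [hik, hi]
  have none : ∀ s, ∑ S ∈ Finset.powersetCard s M, f S = 0 := by
    intro s
    refine Finset.sum_eq_zero fun S hS => hf S ?_
    have := (Finset.mem_powersetCard.1 hS).1
    exact ⟨fun h => absurd (this h) hi, fun h => absurd (this h) hk⟩
  rw [step i _ hi', step k _ hk, none, zero_add, Finset.sum_add_distrib, add_comm]
  congr 1
  rcases s with _ | s
  · simp
  · rw [step k _ hk]
    rw [Finset.sum_eq_zero (s := Finset.powersetCard s M), add_zero]
    intro S _
    exact hf _ (by simp)

section

variable {ι : Type*} [DecidableEq ι] (q t : ℂ)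

/-- The part of a summand of `subsetSum` not involving the index `i₀`. -/
noncomputable def restProd (i₀ : ι) (L' : Finset ι) (x : ι → ℂ) (S : Finset ι) : PowerSeries ℂ :=
  ∏ i ∈ S.erase i₀, ∏ j ∈ L' \ S, pairFactor q t (x i / x j)

/-- The summand of `subsetSum` with denominators cleared, as a function of `z = x_{i₀}`. -/
noncomputable def clearedTerm (i₀ : ι) (L' : Finset ι) (x : ι → ℂ) (S : Finset ι) (z : ℂ) :
    PowerSeries ℂ :=
  restProd q t i₀ L' x S * ∏ j ∈ L', (if (i₀ ∈ S ↔ j ∈ S) then pairDenom q (z / x j) else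
    if i₀ ∈ S then pairNum q t (z / x j) else pairNumInv q t (z / x j))

variable {q t} (hq : q ≠ 0) (ht : t ≠ 0)

-- An index j involves i₀ in a summand only if exactly one of the two lies in S. In that case a
-- single pair factor meets the denominator and leaves a numerator; otherwise the denominator
-- remains.
include hq ht in
theorem summand_mul_denom {i₀ : ι} {L' : Finset ι} (hi : i₀ ∉ L') {x : ι → ℂ} (hx : GenericPt q x)
    {S : Finset ι} (hS : S ⊆ insert i₀ L') :
    (∏ i ∈ S, ∏ j ∈ insert i₀ L' \ S, pairFactor q t (x i / x j)) *
      ∏ j ∈ L', pairDenom q (x i₀ / x j) = clearedTerm q t i₀ L' x S (x i₀) := by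
  have ne : ∀ j ∈ L', i₀ ≠ j := fun j hj h => hi (h ▸ hj)
  have nz : ∀ j, x i₀ / x j ≠ 0 := fun j => div_ne_zero (hx.1 _) (hx.1 _)
  have d1 : ∀ j ∈ L', pairFactor q t (x i₀ / x j) * pairDenom q (x i₀ / x j) =
      pairNum q t (x i₀ / x j) := by
    intro j hj
    refine pairFactor_mul_pairDenom hq ht (nz j) ?_ ?_
    · simpa using hx.div_ne (ne j hj) 0
    · have := hx.div_ne (ne j hj) (-1)
      intro h
      apply this
      rw [zpow_neg_one]
      exact eq_inv_of_mul_eq_one_right h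
  have d2 : ∀ j ∈ L', pairFactor q t (x j / x i₀) * pairDenom q (x i₀ / x j) =
      pairNumInv q t (x i₀ / x j) := by
    intro j hj
    rw [← inv_div (x i₀)]
    refine pairFactor_inv_mul_pairDenom hq ht (nz j) ?_ ?_
    · simpa using hx.div_ne (ne j hj) 0
    · simpa using hx.div_ne (ne j hj) 1
  rw [clearedTerm, restProd]
  by_cases h0 : i₀ ∈ S
  · have e1 : insert i₀ L' \ S = L' \ S := Finset.insert_sdiff_of_mem _ h0
    rw [e1, ← Finset.mul_prod_erase S _ h0, mul_comm (∏ j ∈ L' \ S, _), mul_assoc]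
    congr 1
    rw [← Finset.prod_sdiff (Finset.inter_subset_left (s₁ := L') (s₂ := S)),
      ← Finset.prod_sdiff (Finset.inter_subset_left (s₁ := L') (s₂ := S)),
      Finset.sdiff_inter_self_left, ← mul_assoc, ← Finset.prod_mul_distrib]
    congr 1
    · refine Finset.prod_congr rfl fun j hj => ?_
      rw [Finset.mem_sdiff] at hj
      rw [d1 j hj.1, if_neg (by tauto), if_pos h0]
    · refine Finset.prod_congr rfl fun j hj => ?_
      rw [Finset.mem_inter] at hj
      rw [if_pos (by tauto)]
  · have e1 : insert i₀ L' \ S = insert i₀ (L' \ S) := Finset.insert_sdiff_of_notMem _ h0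
    have hS' : S ⊆ L' := fun i h => (Finset.mem_insert.1 (hS h)).resolve_left fun h' => h0 (h' ▸ h)
    have e2 : ∀ i, ∏ j ∈ insert i₀ (L' \ S), pairFactor q t (x i / x j) =
        pairFactor q t (x i / x i₀) * ∏ j ∈ L' \ S, pairFactor q t (x i / x j) := fun i =>
      Finset.prod_insert (by simp [hi])
    simp only [e1, e2]
    rw [Finset.erase_eq_of_notMem h0, Finset.prod_mul_distrib, mul_comm (∏ i ∈ S, _), mul_assoc]
    congr 1
    rw [← Finset.prod_sdiff hS', ← Finset.prod_sdiff hS', mul_comm, mul_assoc,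
      ← Finset.prod_mul_distrib]
    congr 1
    · refine Finset.prod_congr rfl fun j hj => ?_
      rw [Finset.mem_sdiff] at hj
      rw [if_pos (by tauto)]
    · refine Finset.prod_congr rfl fun j hj => ?_
      rw [mul_comm, d2 j (hS' hj), if_neg (by tauto), if_neg h0]

theorem clearedTerm_insert_left {i₀ k : ι} {M P : Finset ι} (hik : i₀ ≠ k) (hi : i₀ ∉ M)
    (hk : k ∉ M) (hP : P ⊆ M) (x : ι → ℂ) (z : ℂ) :
    clearedTerm q t i₀ (insert k M) x (insert i₀ P) z =
      ((∏ i ∈ P, pairFactor q t (x i / x k)) * ∏ i ∈ P, ∏ j ∈ M \ P, pairFactor q t (x i / x j)) *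
      (pairNum q t (z / x k) * ∏ j ∈ M, (if j ∈ P then pairDenom q (z / x j) else
        pairNum q t (z / x j))) := by
  have hiP : i₀ ∉ P := fun h => hi (hP h)
  have hkP : k ∉ P := fun h => hk (hP h)
  rw [clearedTerm, restProd, Finset.erase_insert hiP, Finset.prod_insert hk]
  have e1 : insert k M \ insert i₀ P = insert k (M \ P) := by
    ext j
    simp only [Finset.mem_sdiff, Finset.mem_insert]
    constructor
    · tauto
    · rintro (rfl | ⟨h1, h2⟩)
      · exact ⟨Or.inl rfl, by rintro (h | h); exacts [hik h.symm, hkP h]⟩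
      · exact ⟨Or.inr h1, by rintro (rfl | h); exacts [hi h1, h2 h]⟩
  rw [e1]
  congr 1
  · rw [← Finset.prod_mul_distrib]
    exact Finset.prod_congr rfl fun i _ => Finset.prod_insert (by simp [hk])
  · congr 1
    · rw [if_neg (by simp [hkP, hik.symm]), if_pos (Finset.mem_insert_self _ _)]
    · refine Finset.prod_congr rfl fun j hj => ?_
      have : j ≠ i₀ := fun h => hi (h ▸ hj)
      by_cases hjP : j ∈ P <;> simp [hjP, this]

theorem clearedTerm_insert_right {i₀ k : ι} {M P : Finset ι} (hik : i₀ ≠ k) (hi : i₀ ∉ M)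
    (hk : k ∉ M) (hP : P ⊆ M) (x : ι → ℂ) (z : ℂ) :
    clearedTerm q t i₀ (insert k M) x (insert k P) z =
      ((∏ j ∈ M \ P, pairFactor q t (x k / x j)) *
        ∏ i ∈ P, ∏ j ∈ M \ P, pairFactor q t (x i / x j)) *
      (pairNumInv q t (z / x k) * ∏ j ∈ M, (if j ∈ P then pairNumInv q t (z / x j) else
        pairDenom q (z / x j))) := by
  have hiP : i₀ ∉ P := fun h => hi (hP h)
  have hkP : k ∉ P := fun h => hk (hP h)
  have hi' : i₀ ∉ insert k P := by simp [hik, hiP]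
  rw [clearedTerm, restProd, Finset.erase_eq_of_notMem hi', Finset.prod_insert hk,
    Finset.prod_insert hkP]
  have e1 : insert k M \ insert k P = M \ P := by
    ext j
    simp only [Finset.mem_sdiff, Finset.mem_insert]
    constructor
    · tauto
    · rintro ⟨h1, h2⟩
      exact ⟨Or.inr h1, by rintro (rfl | h); exacts [hk h1, h2 h]⟩
  rw [e1]
  congr 1
  congr 1
  · rw [if_neg (by simp [hiP, hik]), if_neg hi']
  · refine Finset.prod_congr rfl fun j hj => ?_
    have : j ≠ k := fun h => hk (h ▸ hj)
    by_cases hjP : j ∈ P <;> simp [hjP, this, hiP, hik]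

include hq ht in
/-- The difference of the cleared sums vanishes at `z = q^e x_k`, `e ∈ {0, 1, -1}`. -/
theorem sum_clearedTerm_vanish {i₀ k : ι} {M : Finset ι} (hik : i₀ ≠ k) (hi : i₀ ∉ M)
    (hk : k ∉ M) {x : ι → ℂ} (hx : GenericPt q x) {a b : ℕ}
    (ih : subsetSum (pairFactor q t) M a x = subsetSum (pairFactor q t) M b x) {e : ℤ}
    (he : e = 0 ∨ e = 1 ∨ e = -1) :
    ∑ S ∈ Finset.powersetCard (a + 1) (insert i₀ (insert k M)),
      clearedTerm q t i₀ (insert k M) x S (q ^ e * x k) =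
    ∑ S ∈ Finset.powersetCard (b + 1) (insert i₀ (insert k M)),
      clearedTerm q t i₀ (insert k M) x S (q ^ e * x k) := by
  have hdiv : q ^ e * x k / x k = q ^ e := mul_div_cancel_right₀ _ (hx.1 k)
  have hzero : ∀ S : Finset ι, (i₀ ∈ S ↔ k ∈ S) →
      clearedTerm q t i₀ (insert k M) x S (q ^ e * x k) = 0 := by
    intro S hS
    rw [clearedTerm, Finset.prod_insert hk, if_pos hS, hdiv]
    have : pairDenom q (q ^ e) = 0 := by
      rcases he with rfl | rfl | rfl
      · simpa using pairDenom_one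
      · simpa using pairDenom_self hq
      · simpa using pairDenom_inv hq
    rw [this, zero_mul, mul_zero]
  rw [sum_powersetCard_insert_insert hik hi hk a _ hzero,
    sum_powersetCard_insert_insert hik hi hk b _ hzero]
  set D : PowerSeries ℂ := ∏ j ∈ M, pairDenom q (q ^ e * x k / x j) with hD
  have hne : ∀ j ∈ M, ∀ m : ℤ, q ^ e * x k / x j ≠ q ^ m := by
    intro j hj m h
    have := hx.div_ne (i := k) (j := j) (fun h => hk (h ▸ hj)) (m - e)
    apply this
    rw [zpow_sub₀ hq, eq_div_iff (zpow_ne_zero _ hq), ← h]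
    ring
  have hnz : ∀ j, q ^ e * x k / x j ≠ 0 := fun j =>
    div_ne_zero (mul_ne_zero (zpow_ne_zero _ hq) (hx.1 k)) (hx.1 j)
  have p1 : ∀ P ⊆ M, ∏ j ∈ M, (if j ∈ P then pairDenom q (q ^ e * x k / x j) else
      pairNum q t (q ^ e * x k / x j)) =
        D * ∏ j ∈ M \ P, pairFactor q t (q ^ e * x k / x j) := by
    intro P hP
    rw [hD, ← Finset.prod_sdiff hP, ← Finset.prod_sdiff hP, mul_right_comm,
      ← Finset.prod_mul_distrib]
    congr 1
    · refine Finset.prod_congr rfl fun j hj => ?_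
      rw [Finset.mem_sdiff] at hj
      rw [if_neg hj.2, mul_comm (pairDenom q _), pairFactor_mul_pairDenom hq ht (hnz j)]
      · simpa using hne j hj.1 0
      · intro h
        apply hne j hj.1 (-1)
        rw [zpow_neg_one]
        exact eq_inv_of_mul_eq_one_right h
    · exact Finset.prod_congr rfl fun j hj => by rw [if_pos hj]
  have p2 : ∀ P ⊆ M, ∏ j ∈ M, (if j ∈ P then pairNumInv q t (q ^ e * x k / x j) else
      pairDenom q (q ^ e * x k / x j)) =
        D * ∏ j ∈ P, pairFactor q t (q ^ e * x k / x j)⁻¹ := by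
    intro P hP
    rw [hD, ← Finset.prod_sdiff hP, ← Finset.prod_sdiff hP, mul_assoc,
      ← Finset.prod_mul_distrib]
    congr 1
    · refine Finset.prod_congr rfl fun j hj => ?_
      rw [Finset.mem_sdiff] at hj
      rw [if_neg hj.2]
    · refine Finset.prod_congr rfl fun j hj => ?_
      rw [if_pos hj, mul_comm (pairDenom q _), pairFactor_inv_mul_pairDenom hq ht (hnz j)]
      · simpa using hne j (hP hj) 0
      · simpa using hne j (hP hj) 1
  have term : ∀ P ⊆ M, clearedTerm q t i₀ (insert k M) x (insert i₀ P) (q ^ e * x k) +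
      clearedTerm q t i₀ (insert k M) x (insert k P) (q ^ e * x k) =
      ((∏ i ∈ P, ∏ j ∈ M \ P, pairFactor q t (x i / x j)) * D) *
      (pairNum q t (q ^ e) * ((∏ i ∈ P, pairFactor q t (x i / x k)) *
          ∏ j ∈ M \ P, pairFactor q t (q ^ e * x k / x j)) +
        pairNumInv q t (q ^ e) * ((∏ j ∈ M \ P, pairFactor q t (x k / x j)) *
          ∏ j ∈ P, pairFactor q t (q ^ e * x k / x j)⁻¹)) := by
    intro P hP
    rw [clearedTerm_insert_left hik hi hk hP, clearedTerm_insert_right hik hi hk hP, p1 P hP,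
      p2 P hP, hdiv]
    ring
  have const : ∃ K : PowerSeries ℂ, ∀ P ⊆ M,
      clearedTerm q t i₀ (insert k M) x (insert i₀ P) (q ^ e * x k) +
      clearedTerm q t i₀ (insert k M) x (insert k P) (q ^ e * x k) =
      K * ∏ i ∈ P, ∏ j ∈ M \ P, pairFactor q t (x i / x j) := by
    -- For e = 0 both terms carry the same products and the numerators add to zero. For e = 1 and e
    -- = -1 one numerator vanishes, and by `pairFactor_reflect` the products over P and M \ P in the
    -- other term merge into one over M, which does not depend on P.
    rcases he with rfl | rfl | rfl
    · refine ⟨0, fun P hP => ?_⟩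
      rw [term P hP]
      have := pairNum_one_add hq ht
      simp only [zpow_zero, one_mul, inv_div, zero_mul]
      rw [mul_comm (∏ j ∈ M \ P, pairFactor q t (x k / x j)), ← add_mul, this, zero_mul, mul_zero]
    · refine ⟨D * pairNumInv q t q * ∏ j ∈ M, pairFactor q t (x k / x j), fun P hP => ?_⟩
      rw [term P hP]
      have e1 : ∀ j, pairFactor q t (q ^ (1 : ℤ) * x k / x j)⁻¹ = pairFactor q t (x k / x j) := by
        intro j
        rw [zpow_one, mul_div_assoc, pairFactor_reflect hq (div_ne_zero (hx.1 k) (hx.1 j))]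
      simp only [e1]
      rw [Finset.prod_sdiff hP, zpow_one, pairNum_self hq]
      ring
    · refine ⟨D * pairNum q t q⁻¹ * ∏ j ∈ M, pairFactor q t (x j / x k), fun P hP => ?_⟩
      rw [term P hP]
      have e1 : ∀ j, pairFactor q t (q ^ (-1 : ℤ) * x k / x j) = pairFactor q t (x j / x k) := by
        intro j
        rw [← pairFactor_reflect hq (div_ne_zero (hx.1 j) (hx.1 k))]
        congr 1
        rw [zpow_neg_one, mul_inv, inv_div, mul_div_assoc]
      simp only [e1]
      rw [mul_comm (∏ i ∈ P, pairFactor q t (x i / x k)), Finset.prod_sdiff hP, zpow_neg_one,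
        pairNumInv_inv hq]
      ring
  obtain ⟨K, hK⟩ := const
  have sum : ∀ s, ∑ P ∈ Finset.powersetCard s M,
      (clearedTerm q t i₀ (insert k M) x (insert i₀ P) (q ^ e * x k) +
      clearedTerm q t i₀ (insert k M) x (insert k P) (q ^ e * x k)) =
        K * subsetSum (pairFactor q t) M s x := by
    intro s
    rw [subsetSum, Finset.mul_sum]
    exact Finset.sum_congr rfl fun P hP => hK P (Finset.mem_powersetCard.1 hP).1
  rw [sum, sum, ih]

end

theorem GenericPt.inv {ι : Type*} {q : ℂ} {x : ι → ℂ} (hx : GenericPt q x) :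
    GenericPt q fun i => (x i)⁻¹ := by
  refine ⟨fun i => inv_ne_zero (hx.1 i), fun i j hij m h => hx.2 j i hij.symm m ?_⟩
  have h1 := hx.1 i
  have h2 := hx.1 j
  field_simp at h
  rw [h]
  ring

/-! ### Independence of one coordinate, and symmetry of the subset sums -/

section

variable (q t : ℂ)

/-- `pairDenom q (x/a)` as a series with Laurent polynomial coefficients in `x`. -/
noncomputable def pairDenomT (a : ℂ) : PowerSeries (LaurentPolynomial ℂ) :=
  thetaT (1 / a) * thetaT (q / a) * thetaT (1 / (q * a))

/-- `pairNum q t (x/a)` as a series with Laurent polynomial coefficients in `x`. -/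
noncomputable def pairNumT (a : ℂ) : PowerSeries (LaurentPolynomial ℂ) :=
  PowerSeries.map LaurentPolynomial.C (C t) *
    (thetaT (t / a) * thetaT (q / (t * a)) * thetaT (1 / (q * a)))

/-- `pairNumInv q t (x/a)` as a series with Laurent polynomial coefficients in `x`. -/
noncomputable def pairNumInvT (a : ℂ) : PowerSeries (LaurentPolynomial ℂ) :=
  PowerSeries.map LaurentPolynomial.C (C t) *
    (thetaT (1 / (t * a)) * thetaT (t / (q * a)) * thetaT (q / a))

theorem map_evalLaurent_const (z : ℂˣ) (c : PowerSeries ℂ) :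
    PowerSeries.map (evalLaurent z) (PowerSeries.map LaurentPolynomial.C c) = c := by
  ext l
  rw [coeff_map, coeff_map, evalLaurent_C]

theorem map_evalLaurent_pairDenomT (z : ℂˣ) (a : ℂ) :
    PowerSeries.map (evalLaurent z) (pairDenomT q a) = pairDenom q (z / a) := by
  rw [pairDenomT, pairDenom, map_mul, map_mul, map_evalLaurent_thetaT, map_evalLaurent_thetaT,
    map_evalLaurent_thetaT]
  rw [one_div_mul_eq_div, one_div_mul_eq_div, mul_comm q a, ← div_div, div_mul_eq_mul_div,
    mul_div_assoc]

theorem map_evalLaurent_pairNumT (z : ℂˣ) (a : ℂ) :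
    PowerSeries.map (evalLaurent z) (pairNumT q t a) = pairNum q t (z / a) := by
  rw [pairNumT, pairNum, map_mul, map_mul, map_mul, map_evalLaurent_thetaT, map_evalLaurent_thetaT,
    map_evalLaurent_thetaT, map_evalLaurent_const]
  congr 2
  · congr 2
    · ring
    · rw [mul_comm t a, ← div_div]; ring
  · rw [div_div, one_div_mul_eq_div, mul_comm]

theorem map_evalLaurent_pairNumInvT (z : ℂˣ) (a : ℂ) :
    PowerSeries.map (evalLaurent z) (pairNumInvT q t a) = pairNumInv q t (z / a) := by
  rw [pairNumInvT, pairNumInv, map_mul, map_mul, map_mul, map_evalLaurent_thetaT,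
    map_evalLaurent_thetaT, map_evalLaurent_thetaT, map_evalLaurent_const]
  congr 2
  · congr 2
    · rw [div_div, one_div_mul_eq_div, mul_comm]
    · rw [mul_comm q a, ← div_div]; ring
  · congr 1; ring

variable {q t} (hq : q ≠ 0) (ht : t ≠ 0)

/-- The multiplier depends only on the product of the three arguments. In the denominator and in
both numerators this product is a⁻³, with q and t cancelling, so all summands have the same
quasi-periodicity and may be added. -/
theorem quasiPeriodic_thetaT_mul {α β γ c : ℂ} (hα : α ≠ 0) (hβ : β ≠ 0) (hγ : γ ≠ 0)
    (h : α * β * γ = c⁻¹ ^ 3) :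
    QuasiPeriodic 3 (-(c ^ 3)) (thetaT α * thetaT β * thetaT γ) := by
  have := ((quasiPeriodic_thetaT hα).mul (quasiPeriodic_thetaT hβ)).mul (quasiPeriodic_thetaT hγ)
  have e : -α⁻¹ * -β⁻¹ * -γ⁻¹ = -(c ^ 3) := by
    rw [← inv_inv (c ^ 3), ← inv_pow, ← h, mul_inv, mul_inv]
    ring
  rwa [e] at this

include hq in
theorem quasiPeriodic_pairDenomT {a : ℂ} (ha : a ≠ 0) :
    QuasiPeriodic 3 (-(a ^ 3)) (pairDenomT q a) :=
  quasiPeriodic_thetaT_mul (by simp [*]) (by simp [*]) (by simp [*]) (by field_simp)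

include hq ht in
theorem quasiPeriodic_pairNumT {a : ℂ} (ha : a ≠ 0) :
    QuasiPeriodic 3 (-(a ^ 3)) (pairNumT q t a) :=
  (quasiPeriodic_thetaT_mul (by simp [*]) (by simp [*]) (by simp [*])
    (by field_simp)).const_mul _

include hq ht in
theorem quasiPeriodic_pairNumInvT {a : ℂ} (ha : a ≠ 0) :
    QuasiPeriodic 3 (-(a ^ 3)) (pairNumInvT q t a) :=
  (quasiPeriodic_thetaT_mul (by simp [*]) (by simp [*]) (by simp [*])
    (by field_simp)).const_mul _

theorem exists_coeff_zero_pairDenomT (a : ℂ) : ∃ P : Polynomial ℂ, P.coeff 0 = 1 ∧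
    constantCoeff (pairDenomT q a) = Polynomial.toLaurent P := by
  refine ⟨(1 - Polynomial.C (1 / a) * Polynomial.X) * (1 - Polynomial.C (q / a) * Polynomial.X) *
    (1 - Polynomial.C (1 / (q * a)) * Polynomial.X), ?_, ?_⟩
  · simp [Polynomial.mul_coeff_zero]
  · rw [pairDenomT, map_mul, map_mul, map_mul, map_mul, ← coeff_zero_eq_constantCoeff_apply,
      ← coeff_zero_eq_constantCoeff_apply, ← coeff_zero_eq_constantCoeff_apply, coeff_zero_thetaT,
      coeff_zero_thetaT, coeff_zero_thetaT]

/-- The normalization which makes the degree-zero part of the denominator invertible in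
`QuasiPeriodic.proportional`. -/
theorem coeff_zero_prod_pairDenomT {ι : Type*} (s : Finset ι) (x : ι → ℂ) :
    (coeff 0 (∏ j ∈ s, pairDenomT q (x j))).coeff 0 = 1 := by
  choose P hP hP' using fun j => exists_coeff_zero_pairDenomT (q := q) (x j)
  rw [coeff_zero_eq_constantCoeff_apply, map_prod, Finset.prod_congr rfl fun j _ => hP' j,
    ← map_prod, LaurentPolynomial.coeff_toLaurent]
  have : ((0 : ℤ)) = ((0 : ℕ) : ℤ) := rfl
  rw [this, ← Nat.castEmbedding_apply, Finsupp.mapDomain_apply Nat.castEmbedding.injective]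
  change (∏ j ∈ s, P j).coeff 0 = 1
  rw [Polynomial.coeff_zero_prod]
  exact Finset.prod_eq_one fun j _ => hP j

variable {ι : Type*} [DecidableEq ι]

variable (q t) in
/-- `clearedTerm` as a series with Laurent polynomial coefficients in the variable `x_{i₀}`. -/
noncomputable def clearedTermT (i₀ : ι) (L' : Finset ι) (x : ι → ℂ) (S : Finset ι) :
    PowerSeries (LaurentPolynomial ℂ) :=
  PowerSeries.map LaurentPolynomial.C (restProd q t i₀ L' x S) *
    ∏ j ∈ L', (if (i₀ ∈ S ↔ j ∈ S) then pairDenomT q (x j) else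
      if i₀ ∈ S then pairNumT q t (x j) else pairNumInvT q t (x j))

theorem map_evalLaurent_clearedTermT (i₀ : ι) (L' : Finset ι) (x : ι → ℂ) (S : Finset ι) (z : ℂˣ) :
    PowerSeries.map (evalLaurent z) (clearedTermT q t i₀ L' x S) = clearedTerm q t i₀ L' x S z := by
  rw [clearedTermT, clearedTerm, map_mul, map_evalLaurent_const, map_prod]
  congr 1
  refine Finset.prod_congr rfl fun j _ => ?_
  split_ifs
  · rw [map_evalLaurent_pairDenomT]
  · rw [map_evalLaurent_pairNumT]
  · rw [map_evalLaurent_pairNumInvT]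

include hq ht in
theorem quasiPeriodic_clearedTermT (i₀ : ι) (L' : Finset ι) {x : ι → ℂ} (hx : ∀ i, x i ≠ 0)
    (S : Finset ι) :
    QuasiPeriodic ((∑ _j ∈ L', 3 : ℕ) : ℤ) (∏ j ∈ L', -(x j ^ 3)) (clearedTermT q t i₀ L' x S) := by
  rw [Nat.cast_sum]
  refine QuasiPeriodic.const_mul (QuasiPeriodic.prod fun j _ => ?_) _
  push_cast
  split_ifs
  · exact quasiPeriodic_pairDenomT hq (hx j)
  · exact quasiPeriodic_pairNumT hq ht (hx j)
  · exact quasiPeriodic_pairNumInvT hq ht (hx j)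

theorem restProd_congr {i₀ : ι} {L' : Finset ι} (hi : i₀ ∉ L') {x y : ι → ℂ}
    (hxy : ∀ i, i ≠ i₀ → x i = y i) (S : Finset ι) :
    restProd q t i₀ L' x S = restProd q t i₀ L' y S := by
  have h : ∀ j ∈ L', x j = y j := fun j hj => hxy j fun h => hi (h ▸ hj)
  refine Finset.prod_congr rfl fun i hi' => Finset.prod_congr rfl fun j hj => ?_
  rw [hxy i (Finset.mem_erase.1 hi').1, h j (Finset.mem_sdiff.1 hj).1]

theorem clearedTermT_congr {i₀ : ι} {L' : Finset ι} (hi : i₀ ∉ L') {x y : ι → ℂ}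
    (hxy : ∀ i, i ≠ i₀ → x i = y i) (S : Finset ι) :
    clearedTermT q t i₀ L' x S = clearedTermT q t i₀ L' y S := by
  have h : ∀ j ∈ L', x j = y j := fun j hj => hxy j fun h => hi (h ▸ hj)
  rw [clearedTermT, clearedTermT, restProd_congr hi hxy]
  refine congrArg _ (Finset.prod_congr rfl fun j hj => ?_)
  rw [h j hj]

variable (hq1 : ∀ m : ℤ, m ≠ 0 → q ^ m ≠ 1)

include hq ht hq1 in
/-- The difference of two complementary subset sums does not depend on the coordinate `i₀`. -/
theorem subsetSum_sub_congr {i₀ : ι} {L' : Finset ι} (hi : i₀ ∉ L') {a b : ℕ}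
    (ih : ∀ k ∈ L', ∀ x : ι → ℂ, GenericPt q x →
      subsetSum (pairFactor q t) (L'.erase k) a x = subsetSum (pairFactor q t) (L'.erase k) b x)
    {x y : ι → ℂ} (hx : GenericPt q x) (hy : GenericPt q y) (hxy : ∀ i, i ≠ i₀ → x i = y i) :
    subsetSum (pairFactor q t) (insert i₀ L') (a + 1) x -
        subsetSum (pairFactor q t) (insert i₀ L') (b + 1) x =
      subsetSum (pairFactor q t) (insert i₀ L') (a + 1) y -
        subsetSum (pairFactor q t) (insert i₀ L') (b + 1) y := by
  set F : PowerSeries (LaurentPolynomial ℂ) :=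
    (∑ S ∈ Finset.powersetCard (a + 1) (insert i₀ L'), clearedTermT q t i₀ L' x S) -
      ∑ S ∈ Finset.powersetCard (b + 1) (insert i₀ L'), clearedTermT q t i₀ L' x S with hF
  set G : PowerSeries (LaurentPolynomial ℂ) := ∏ j ∈ L', pairDenomT q (x j) with hG
  -- As many common zeros as the degree, three for each index. They are distinct because x is
  -- generic and q is not a root of unity.
  set Z : Finset ℂˣ := (L' ×ˢ ({0, 1, -1} : Finset ℤ)).image fun a =>
    Units.mk0 (q ^ a.2 * x a.1) (mul_ne_zero (zpow_ne_zero _ hq) (hx.1 _)) with hZ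
  have hcard : Z.card = ∑ _j ∈ L', 3 := by
    rw [hZ, Finset.card_image_of_injOn, Finset.card_product, Finset.sum_const, smul_eq_mul]
    · rfl
    · rintro ⟨j, e⟩ _ ⟨k, f⟩ _ h
      have h' : q ^ e * x j = q ^ f * x k := by simpa using congrArg Units.val h
      have hjk : j = k := by
        by_contra hjk
        apply hx.2 j k hjk (f - e)
        rw [zpow_sub₀ hq, div_mul_eq_mul_div, eq_div_iff (zpow_ne_zero _ hq), ← h', mul_comm]
      subst hjk
      have hef : e = f := by
        by_contra hef
        apply hq1 (e - f) (sub_ne_zero.2 hef)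
        rw [zpow_sub₀ hq, mul_right_cancel₀ (hx.1 j) h', div_self (zpow_ne_zero _ hq)]
      rw [hef]
  have hFq : QuasiPeriodic ((∑ _j ∈ L', 3 : ℕ) : ℤ) (∏ j ∈ L', -(x j ^ 3)) F :=
    (QuasiPeriodic.sum fun S _ => quasiPeriodic_clearedTermT hq ht i₀ L' hx.1 S).sub
      (QuasiPeriodic.sum fun S _ => quasiPeriodic_clearedTermT hq ht i₀ L' hx.1 S)
  have hGq : QuasiPeriodic ((∑ _j ∈ L', 3 : ℕ) : ℤ) (∏ j ∈ L', -(x j ^ 3)) G := by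
    rw [Nat.cast_sum]
    refine QuasiPeriodic.prod fun j _ => ?_
    push_cast
    exact quasiPeriodic_pairDenomT hq (hx.1 j)
  have evF : ∀ z : ℂˣ, PowerSeries.map (evalLaurent z) F =
      (∑ S ∈ Finset.powersetCard (a + 1) (insert i₀ L'), clearedTerm q t i₀ L' x S z) -
      ∑ S ∈ Finset.powersetCard (b + 1) (insert i₀ L'), clearedTerm q t i₀ L' x S z := by
    intro z
    simp only [hF, map_sub, map_sum, map_evalLaurent_clearedTermT]
  have evG : ∀ z : ℂˣ, PowerSeries.map (evalLaurent z) G = ∏ j ∈ L', pairDenom q (z / x j) := by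
    intro z
    rw [hG, map_prod]
    exact Finset.prod_congr rfl fun j _ => map_evalLaurent_pairDenomT q z _
  have memZ : ∀ z ∈ Z, ∃ k ∈ L', ∃ e : ℤ, (e = 0 ∨ e = 1 ∨ e = -1) ∧ (z : ℂ) = q ^ e * x k := by
    intro z hz
    obtain ⟨⟨k, e⟩, h, rfl⟩ := Finset.mem_image.1 hz
    rw [Finset.mem_product] at h
    exact ⟨k, h.1, e, by simpa using h.2, rfl⟩
  -- Both F and G are built from the coordinates other than i₀. The same c therefore gives the
  -- difference at every generic point sharing those coordinates, and it is the value of the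
  -- difference after division by the denominator.
  obtain ⟨c, hc⟩ := hFq.proportional (Finset.prod_ne_zero_iff.2 fun j _ =>
    neg_ne_zero.2 (pow_ne_zero _ (hx.1 j))) hGq Z hcard (by
      intro z hz
      obtain ⟨k, hk, e, he, hze⟩ := memZ z hz
      rw [evF, hze, sub_eq_zero]
      have := sum_clearedTerm_vanish hq ht (i₀ := i₀) (k := k) (M := L'.erase k)
        (fun h => hi (h ▸ hk)) (fun h => hi (Finset.mem_of_mem_erase h))
        (Finset.notMem_erase _ _) hx (ih k hk x hx) he
      rwa [Finset.insert_erase hk] at this) (by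
      intro z hz
      obtain ⟨k, hk, e, he, hze⟩ := memZ z hz
      rw [evG, Finset.prod_eq_zero hk]
      rw [hze, mul_div_cancel_right₀ _ (hx.1 k)]
      rcases he with rfl | rfl | rfl
      · simpa using pairDenom_one
      · simpa using pairDenom_self hq
      · simpa using pairDenom_inv hq) (coeff_zero_prod_pairDenomT L' x)
  have key : ∀ w : ι → ℂ, GenericPt q w → (∀ i, i ≠ i₀ → x i = w i) →
      subsetSum (pairFactor q t) (insert i₀ L') (a + 1) w -
        subsetSum (pairFactor q t) (insert i₀ L') (b + 1) w = c := by
    intro w hw hxw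
    set z : ℂˣ := Units.mk0 (w i₀) (hw.1 i₀) with hz
    have hden : ∏ j ∈ L', pairDenom q (w i₀ / w j) ≠ 0 := by
      refine Finset.prod_ne_zero_iff.2 fun j hj => ?_
      have hne : i₀ ≠ j := fun h => hi (h ▸ hj)
      refine mul_ne_zero (mul_ne_zero ?_ ?_) ?_ <;> apply thetaHat_ne_zero
      · simpa using hw.div_ne hne 0
      · intro h
        apply hw.div_ne hne (-1)
        rw [zpow_neg_one]
        exact eq_inv_of_mul_eq_one_right h
      · intro h
        apply hw.div_ne hne 1
        rwa [div_eq_one_iff_eq hq, ← zpow_one q] at h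
    have h1 := congrArg (PowerSeries.map (evalLaurent z)) hc
    rw [map_mul, map_evalLaurent_const, evG, hF] at h1
    simp only [clearedTermT_congr hi hxw, map_sub, map_sum, map_evalLaurent_clearedTermT] at h1
    have hprod : ∏ j ∈ L', pairDenom q (z / x j) = ∏ j ∈ L', pairDenom q (w i₀ / w j) :=
      Finset.prod_congr rfl fun j hj => by rw [hxw j fun h => hi (h ▸ hj)]; rfl
    have hs : ∀ s, ∑ S ∈ Finset.powersetCard s (insert i₀ L'), clearedTerm q t i₀ L' w S z =
        subsetSum (pairFactor q t) (insert i₀ L') s w * ∏ j ∈ L', pairDenom q (w i₀ / w j) := by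
      intro s
      rw [subsetSum, Finset.sum_mul]
      refine Finset.sum_congr rfl fun S hS => ?_
      rw [summand_mul_denom hq ht hi hw (Finset.mem_powersetCard.1 hS).1]
      rfl
    rw [hs, hs, hprod, ← sub_mul] at h1
    exact mul_right_cancel₀ hden h1
  rw [key x hx fun _ _ => rfl, key y hy hxy]

/-- Passing to complements exchanges the roles of i and j, which inverts every ratio x_i/x_j. -/
theorem subsetSum_compl (g : ℂ → PowerSeries ℂ) (L : Finset ι) {a b : ℕ} (hab : a + b = L.card)
    (x : ι → ℂ) : subsetSum g L b x = subsetSum g L a (fun i => (x i)⁻¹) := by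
  rw [subsetSum, subsetSum]
  refine Finset.sum_nbij' (fun S => L \ S) (fun S => L \ S) ?_ ?_ ?_ ?_ ?_
  · intro S hS
    rw [Finset.mem_powersetCard] at hS ⊢
    exact ⟨Finset.sdiff_subset, by rw [Finset.card_sdiff_of_subset hS.1, hS.2]; omega⟩
  · intro S hS
    rw [Finset.mem_powersetCard] at hS ⊢
    exact ⟨Finset.sdiff_subset, by rw [Finset.card_sdiff_of_subset hS.1, hS.2]; omega⟩
  · intro S hS
    exact Finset.sdiff_sdiff_eq_self (Finset.mem_powersetCard.1 hS).1
  · intro S hS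
    exact Finset.sdiff_sdiff_eq_self (Finset.mem_powersetCard.1 hS).1
  · intro S hS
    rw [Finset.sdiff_sdiff_eq_self (Finset.mem_powersetCard.1 hS).1, Finset.prod_comm]
    refine Finset.prod_congr rfl fun i _ => Finset.prod_congr rfl fun j _ => ?_
    congr 1
    rw [inv_div_inv]

include hq ht hq1 in
/-- Moving all coordinates of a generic point does not change the difference of complementary
subset sums. -/
theorem subsetSum_sub_eq [Finite ι] {L : Finset ι} {a b : ℕ} (hab : a + 1 + (b + 1) = L.card)
    (ih : ∀ (M : Finset ι), a + b = M.card → ∀ x : ι → ℂ, GenericPt q x →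
      subsetSum (pairFactor q t) M a x = subsetSum (pairFactor q t) M b x)
    {x y : ι → ℂ} (hx : GenericPt q x) (hy : GenericPt q y)
    (hxy : ∀ i j, ∀ m : ℤ, x i ≠ q ^ m * y j) :
    subsetSum (pairFactor q t) L (a + 1) x - subsetSum (pairFactor q t) L (b + 1) x =
      subsetSum (pairFactor q t) L (a + 1) y - subsetSum (pairFactor q t) L (b + 1) y := by
  have hyx : ∀ i j, ∀ m : ℤ, y i ≠ q ^ m * x j := by
    intro i j m h
    apply hxy j i (-m)
    rw [h, ← mul_assoc, ← zpow_add₀ hq, neg_add_cancel, zpow_zero, one_mul]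
  -- Hybrid points, moved from x to y one coordinate at a time. They stay generic because no
  -- coordinate of x shares a q-orbit with one of y.
  let z : Finset ι → ι → ℂ := fun S i => if i ∈ S then y i else x i
  have hz : ∀ S, GenericPt q (z S) := by
    intro S
    refine ⟨fun i => ?_, fun i j hij m => ?_⟩
    · simp only [z]
      split_ifs
      exacts [hy.1 i, hx.1 i]
    · simp only [z]
      split_ifs
      exacts [hy.2 i j hij m, hyx i j m, hxy i j m, hx.2 i j hij m]
  have step : ∀ S ⊆ L, subsetSum (pairFactor q t) L (a + 1) (z S) -
      subsetSum (pairFactor q t) L (b + 1) (z S) =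
      subsetSum (pairFactor q t) L (a + 1) x - subsetSum (pairFactor q t) L (b + 1) x := by
    intro S
    induction S using Finset.induction_on with
    | empty => intro _; simp [z]
    | insert i S hi ihS =>
      intro hS
      rw [← ihS ((Finset.subset_insert _ _).trans hS)]
      have hiL : i ∈ L := hS (Finset.mem_insert_self _ _)
      have hcard := Finset.card_erase_of_mem hiL
      have := subsetSum_sub_congr hq ht hq1 (i₀ := i) (L' := L.erase i) (a := a) (b := b)
        (Finset.notMem_erase _ _) (fun k hk w hw => ih _ (by
          rw [Finset.card_erase_of_mem hk]; omega) w hw) (hz (insert i S)) (hz S) (by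
          intro j hj
          simp [z, hj])
      rwa [Finset.insert_erase hiL] at this
  rw [← step L le_rfl]
  have : ∀ s, subsetSum (pairFactor q t) L s (z L) = subsetSum (pairFactor q t) L s y := by
    intro s
    rw [subsetSum, subsetSum]
    refine Finset.sum_congr rfl fun S hS => Finset.prod_congr rfl fun i hi =>
      Finset.prod_congr rfl fun j hj => ?_
    simp [z, (Finset.mem_powersetCard.1 hS).1 hi, (Finset.mem_sdiff.1 hj).1]
  rw [this, this]

-- The identity behind commutativity, by strong induction on the size of L. The difference of the
-- two sums takes the same value at x and at x⁻¹, while inversion interchanges the sums; so the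
-- difference equals its own negative.
include hq ht hq1 in
theorem subsetSum_symm [Finite ι] (n : ℕ) : ∀ (L : Finset ι), L.card = n → ∀ a b : ℕ,
    a + b = L.card → ∀ x : ι → ℂ, GenericPt q x →
      subsetSum (pairFactor q t) L a x = subsetSum (pairFactor q t) L b x := by
  induction n using Nat.strong_induction_on with
  | _ n IH =>
  intro L hL a b hab x hx
  have edge : ∀ b, b = L.card →
      subsetSum (pairFactor q t) L 0 x = subsetSum (pairFactor q t) L b x := by
    rintro b rfl
    simp [subsetSum]
  rcases a with _ | a
  · exact edge b (by omega)
  rcases b with _ | b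
  · exact (edge _ (by omega)).symm
  have ih : ∀ (M : Finset ι), a + b = M.card → ∀ x : ι → ℂ, GenericPt q x →
      subsetSum (pairFactor q t) M a x = subsetSum (pairFactor q t) M b x := fun M hM x hx =>
    IH M.card (by omega) M rfl a b hM x hx
  -- The points x and x⁻¹ may share q-orbits, so they are compared through a third point w x. Only
  -- countably many values of w are forbidden.
  obtain ⟨w, hw⟩ : ∃ w : ℂ, w ∉ (⋃ (i : ι) (j : ι) (m : ℤ), ({q ^ m * x j / x i} : Set ℂ) ∪
      {q ^ m * (x j)⁻¹ / x i}) ∪ {0} := by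
    by_contra! h
    refine not_countable_complex (Set.Countable.mono (fun w _ => h w) ?_)
    refine Set.Countable.union ?_ (Set.countable_singleton _)
    refine Set.countable_iUnion fun i => Set.countable_iUnion fun j => Set.countable_iUnion fun m =>
      (Set.countable_singleton _).union (Set.countable_singleton _)
  simp only [Set.mem_union, Set.mem_iUnion, Set.mem_singleton_iff, not_or, not_exists] at hw
  have hy : GenericPt q fun i => w * x i := by
    refine ⟨fun i => mul_ne_zero hw.2 (hx.1 i), fun i j hij m h => hx.2 i j hij m ?_⟩
    refine mul_left_cancel₀ hw.2 ?_
    linear_combination h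
  have h1 := subsetSum_sub_eq hq ht hq1 hab ih hy hx (by
    intro i j m h
    apply (hw.1 i j m).1
    rw [eq_div_iff (hx.1 i), h])
  have h2 := subsetSum_sub_eq hq ht hq1 hab ih hy (hx.inv) (by
    intro i j m h
    apply (hw.1 i j m).2
    rw [eq_div_iff (hx.1 i), h])
  rw [← subsetSum_compl _ _ hab, ← subsetSum_compl (a := b + 1) (b := a + 1) _ _ (by omega),
    h1] at h2
  have h3 : C (2 : ℂ) * (subsetSum (pairFactor q t) L (a + 1) x -
      subsetSum (pairFactor q t) L (b + 1) x) = 0 := by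
    rw [map_ofNat]
    linear_combination h2
  rw [← sub_eq_zero]
  refine (mul_eq_zero.1 h3).resolve_left ?_
  simp

end

/-! ### Commutativity of the elliptic Ruijsenaars operators at generic points -/

theorem GenericPt.injective {ι : Type*} {q : ℂ} {x : ι → ℂ} (hx : GenericPt q x) :
    Function.Injective x := by
  intro i j h
  by_contra hij
  exact hx.2 i j hij 0 (by simpa using h)

theorem GenericPt.qShift {n : ℕ} {q : ℂ} (hq : q ≠ 0) {x : Fin n → ℂ} (hx : GenericPt q x)
    (I : Finset (Fin n)) : GenericPt q (qShift q I x) := by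
  have key : ∀ i, ∃ e : ℤ, _root_.qShift q I x i = q ^ e * x i := by
    intro i
    by_cases h : i ∈ I
    · exact ⟨1, by simp [_root_.qShift, h]⟩
    · exact ⟨0, by simp [_root_.qShift, h]⟩
  refine ⟨fun i => ?_, fun i j hij m h => ?_⟩
  · obtain ⟨e, he⟩ := key i
    rw [he]
    exact mul_ne_zero (zpow_ne_zero _ hq) (hx.1 i)
  · obtain ⟨e, he⟩ := key i
    obtain ⟨f, hf⟩ := key j
    rw [he, hf] at h
    apply hx.2 i j hij (m + f - e)
    rw [zpow_sub₀ hq, zpow_add₀ hq, div_mul_eq_mul_div, eq_div_iff (zpow_ne_zero _ hq), mul_comm, h]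
    ring

/-- The coefficient `∏_{i ∈ I, j ∉ I} θ(t x_i/x_j)/θ(x_i/x_j)`. -/
noncomputable def shiftCoeff {n : ℕ} (t : ℂ) (I : Finset (Fin n)) (x : Fin n → ℂ) : PowerSeries ℂ :=
  ∏ i ∈ I, ∏ j ∈ Iᶜ, thetaRatio t (x i / x j)

theorem formalTheta_mul_inv {t z : ℂ} (ht : t ≠ 0) (hz : z ≠ 0) :
    formalTheta (t * z) * (formalTheta z)⁻¹ = thetaRatio t z := by
  have h : (eulerSeries⁻¹ : PowerSeries ℂ) * (eulerSeries⁻¹)⁻¹ = 1 :=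
    PowerSeries.mul_inv_cancel _ (by simp [constantCoeff_inv, constantCoeff_eulerSeries])
  rw [formalTheta_eq (mul_ne_zero ht hz), formalTheta_eq hz, PowerSeries.mul_inv_rev, thetaRatio]
  linear_combination (thetaHat (t * z) * (thetaHat z)⁻¹) * h

theorem ellipticRuijsenaarsOp_eq {n : ℕ} {t : ℂ} (q : ℂ) (ht : t ≠ 0) (r : ℕ)
    (f : (Fin n → ℂ) → PowerSeries ℂ) {x : Fin n → ℂ} (hx : ∀ i, x i ≠ 0) :
    ellipticRuijsenaarsOp q t r f x = C (t ^ r.choose 2) *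
      ∑ I ∈ Finset.powersetCard r Finset.univ, shiftCoeff t I x * f (qShift q I x) := by
  rw [ellipticRuijsenaarsOp]
  refine congrArg _ (Finset.sum_congr rfl fun I _ => ?_)
  refine congrArg (· * _) ?_
  refine Finset.prod_congr rfl fun i _ => Finset.prod_congr rfl fun j _ => ?_
  rw [mul_div_assoc, formalTheta_mul_inv ht (div_ne_zero (hx i) (hx j))]

/-- For a pair I = K ∪ P, J = K ∪ (L \ P), all interactions regroup into a factor independent of P,
except those between P and L \ P. There the ratio at x_i/x_j meets the ratio at (q x_i/x_j)⁻¹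
produced by the shift, and these two form `pairFactor`. -/
theorem shiftCoeff_mul_shiftCoeff {n : ℕ} {q t : ℂ} (hq : q ≠ 0)
    {K L P : Finset (Fin n)} (hKL : Disjoint K L) (hP : P ⊆ L) (x : Fin n → ℂ) :
    shiftCoeff t (K ∪ P) x * shiftCoeff t (K ∪ L \ P) (qShift q (K ∪ P) x) =
      ((∏ i ∈ K, ∏ j ∈ L, thetaRatio t (x i / x j)) *
        (∏ i ∈ K, ∏ j ∈ (K ∪ L)ᶜ, thetaRatio t (x i / x j)) *
        (∏ i ∈ K, ∏ j ∈ (K ∪ L)ᶜ, thetaRatio t (q * x i / x j)) *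
        (∏ i ∈ L, ∏ j ∈ (K ∪ L)ᶜ, thetaRatio t (x i / x j))) *
      ∏ i ∈ P, ∏ j ∈ L \ P, pairFactor q t (x i / x j) := by
  set M := (K ∪ L)ᶜ with hM
  set Q := L \ P with hQ
  have hKP : Disjoint K P := Finset.disjoint_of_subset_right hP hKL
  have hKQ : Disjoint K Q := Finset.disjoint_of_subset_right Finset.sdiff_subset hKL
  have hPQ : Disjoint P Q := Finset.disjoint_sdiff
  have hLe : P ∪ Q = L := Finset.union_sdiff_of_subset hP
  have c1 : (K ∪ P)ᶜ = Q ∪ M := by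
    ext j
    have h2 := fun h : j ∈ K => Finset.disjoint_left.1 hKL h
    have h3 := @hP j
    simp only [Finset.mem_compl, Finset.mem_union, hQ, hM, Finset.mem_sdiff]
    tauto
  have c2 : (K ∪ Q)ᶜ = P ∪ M := by
    ext j
    have h2 := fun h : j ∈ K => Finset.disjoint_left.1 hKL h
    have h3 := @hP j
    simp only [Finset.mem_compl, Finset.mem_union, hQ, hM, Finset.mem_sdiff]
    tauto
  have dQM : Disjoint Q M := by
    rw [Finset.disjoint_left]
    intro j hj hj'
    rw [hM, Finset.mem_compl, Finset.mem_union] at hj'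
    exact hj' (Or.inr (Finset.mem_sdiff.1 hj).1)
  have dPM : Disjoint P M := by
    rw [Finset.disjoint_left]
    intro j hj hj'
    rw [hM, Finset.mem_compl, Finset.mem_union] at hj'
    exact hj' (Or.inr (hP hj))
  set y := qShift q (K ∪ P) x with hy
  have yK : ∀ i ∈ K, y i = q * x i := fun i hi => by simp [hy, qShift, hi]
  have yP : ∀ i ∈ P, y i = q * x i := fun i hi => by simp [hy, qShift, hi]
  have yQ : ∀ i ∈ Q, y i = x i := fun i hi => by
    have h1 := Finset.disjoint_right.1 hKQ hi
    have h2 := Finset.disjoint_right.1 hPQ hi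
    simp [hy, qShift, h1, h2]
  have yM : ∀ i ∈ M, y i = x i := fun i hi => by
    have h1 := Finset.disjoint_right.1 dPM hi
    have h2 : i ∉ K := fun h => by
      rw [hM, Finset.mem_compl, Finset.mem_union] at hi
      exact hi (Or.inl h)
    simp [hy, qShift, h1, h2]
  have split : ∀ (A B C D : Finset (Fin n)) (w : Fin n → ℂ), Disjoint A B → Disjoint C D →
      ∏ i ∈ A ∪ B, ∏ j ∈ C ∪ D, thetaRatio t (w i / w j) =
      ((∏ i ∈ A, ∏ j ∈ C, thetaRatio t (w i / w j)) * ∏ i ∈ A, ∏ j ∈ D, thetaRatio t (w i / w j)) *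
      ((∏ i ∈ B, ∏ j ∈ C, thetaRatio t (w i / w j)) *
        ∏ i ∈ B, ∏ j ∈ D, thetaRatio t (w i / w j)) := by
    intro A B C D w hAB hCD
    rw [Finset.prod_union hAB, ← Finset.prod_mul_distrib, ← Finset.prod_mul_distrib]
    simp only [Finset.prod_union hCD]
  have e1 : ∏ i ∈ K, ∏ j ∈ P, thetaRatio t (y i / y j) =
      ∏ i ∈ K, ∏ j ∈ P, thetaRatio t (x i / x j) :=
    Finset.prod_congr rfl fun i hi => Finset.prod_congr rfl fun j hj => by
      rw [yK i hi, yP j hj, mul_div_mul_left _ _ hq]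
  have e2 : ∏ i ∈ K, ∏ j ∈ M, thetaRatio t (y i / y j) =
      ∏ i ∈ K, ∏ j ∈ M, thetaRatio t (q * x i / x j) :=
    Finset.prod_congr rfl fun i hi => Finset.prod_congr rfl fun j hj => by
      rw [yK i hi, yM j hj]
  have e3 : ∏ i ∈ Q, ∏ j ∈ P, thetaRatio t (y i / y j) =
      ∏ i ∈ P, ∏ j ∈ Q, thetaRatio t (q * (x i / x j))⁻¹ := by
    rw [Finset.prod_comm]
    refine Finset.prod_congr rfl fun i hi => Finset.prod_congr rfl fun j hj => ?_
    rw [yP i hi, yQ j hj, ← mul_div_assoc, inv_div]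
  have e4 : ∏ i ∈ Q, ∏ j ∈ M, thetaRatio t (y i / y j) =
      ∏ i ∈ Q, ∏ j ∈ M, thetaRatio t (x i / x j) :=
    Finset.prod_congr rfl fun i hi => Finset.prod_congr rfl fun j hj => by
      rw [yQ i hi, yM j hj]
  have e5 : ∏ i ∈ K, ∏ j ∈ L, thetaRatio t (x i / x j) =
      (∏ i ∈ K, ∏ j ∈ P, thetaRatio t (x i / x j)) * ∏ i ∈ K, ∏ j ∈ Q, thetaRatio t (x i / x j) := by
    rw [← Finset.prod_mul_distrib]
    refine Finset.prod_congr rfl fun i _ => ?_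
    rw [← hLe, Finset.prod_union hPQ]
  have e6 : ∏ i ∈ L, ∏ j ∈ M, thetaRatio t (x i / x j) =
      (∏ i ∈ P, ∏ j ∈ M, thetaRatio t (x i / x j)) * ∏ i ∈ Q, ∏ j ∈ M, thetaRatio t (x i / x j) := by
    rw [← Finset.prod_union hPQ, hLe]
  have e7 : ∏ i ∈ P, ∏ j ∈ Q, pairFactor q t (x i / x j) =
      (∏ i ∈ P, ∏ j ∈ Q, thetaRatio t (x i / x j)) *
        ∏ i ∈ P, ∏ j ∈ Q, thetaRatio t (q * (x i / x j))⁻¹ := by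
    simp only [pairFactor, Finset.prod_mul_distrib]
  rw [shiftCoeff, shiftCoeff, c1, c2, split _ _ _ _ _ hKP dQM, split _ _ _ _ _ hKQ dPM, e1, e2, e3,
    e4, e5, e6, e7]
  ring

section

variable {n : ℕ} {q t : ℂ} (hq : q ≠ 0) (ht : t ≠ 0) (hq1 : ∀ m : ℤ, m ≠ 0 → q ^ m ≠ 1)

include hq in
theorem sum_fiber_shiftCoeff (r s a b : ℕ) {K L : Finset (Fin n)} (hKL : Disjoint K L)
    (hr : r = K.card + a) (hs : s = K.card + b) (hab : a + b = L.card) (x : Fin n → ℂ) :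
    ∑ z ∈ (Finset.powersetCard r Finset.univ ×ˢ Finset.powersetCard s Finset.univ :
        Finset (Finset (Fin n) × Finset (Fin n))) with (z.1 ∩ z.2, z.1 ∪ z.2) = (K, K ∪ L),
      shiftCoeff t z.1 x * shiftCoeff t z.2 (qShift q z.1 x) =
      ((∏ i ∈ K, ∏ j ∈ L, thetaRatio t (x i / x j)) *
        (∏ i ∈ K, ∏ j ∈ (K ∪ L)ᶜ, thetaRatio t (x i / x j)) *
        (∏ i ∈ K, ∏ j ∈ (K ∪ L)ᶜ, thetaRatio t (q * x i / x j)) *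
        (∏ i ∈ L, ∏ j ∈ (K ∪ L)ᶜ, thetaRatio t (x i / x j))) *
      subsetSum (pairFactor q t) L a x := by
  rw [subsetSum, Finset.mul_sum]
  symm
  have hdis : ∀ P ⊆ L, Disjoint K P := fun P hP => Finset.disjoint_of_subset_right hP hKL
  refine Finset.sum_nbij' (fun P => (K ∪ P, K ∪ L \ P)) (fun z => z.1 \ K) ?_ ?_ ?_ ?_ ?_
  · intro P hP
    obtain ⟨hPL, hPc⟩ := Finset.mem_powersetCard.1 hP
    have h1 : (K ∪ P).card = K.card + P.card := Finset.card_union_of_disjoint (hdis P hPL)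
    have h2 : (K ∪ L \ P).card = K.card + (L \ P).card :=
      Finset.card_union_of_disjoint (hdis _ Finset.sdiff_subset)
    rw [Finset.card_sdiff_of_subset hPL] at h2
    simp only [Finset.mem_filter, Finset.mem_product, Finset.mem_powersetCard, Finset.subset_univ,
      true_and, Prod.mk.injEq]
    refine ⟨⟨by omega, by omega⟩, ?_, ?_⟩
    · rw [← Finset.union_inter_distrib_left, Finset.inter_sdiff_self, Finset.union_empty]
    · rw [← Finset.union_union_distrib_left, Finset.union_sdiff_of_subset hPL]
  · rintro ⟨I, J⟩ hz
    simp only [Finset.mem_filter, Finset.mem_product, Finset.mem_powersetCard, Finset.subset_univ,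
      true_and, Prod.mk.injEq] at hz
    obtain ⟨⟨hI, hJ⟩, hK, hU⟩ := hz
    rw [Finset.mem_powersetCard]
    constructor
    · intro i hi
      rw [Finset.mem_sdiff] at hi
      have : i ∈ K ∪ L := hU ▸ Finset.mem_union_left _ hi.1
      exact (Finset.mem_union.1 this).resolve_left hi.2
    · simp only
      rw [Finset.card_sdiff_of_subset (hK ▸ Finset.inter_subset_left)]
      omega
  · intro P hP
    obtain ⟨hPL, hPc⟩ := Finset.mem_powersetCard.1 hP
    simp only
    rw [Finset.union_sdiff_left, Finset.sdiff_eq_self_of_disjoint (hdis P hPL).symm]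
  · rintro ⟨I, J⟩ hz
    simp only [Finset.mem_filter, Finset.mem_product, Finset.mem_powersetCard, Finset.subset_univ,
      true_and, Prod.mk.injEq] at hz
    obtain ⟨⟨hI, hJ⟩, hK, hU⟩ := hz
    have m1 : ∀ i, i ∈ K ↔ i ∈ I ∧ i ∈ J := fun i => by rw [← hK, Finset.mem_inter]
    have m2 : ∀ i, i ∈ K ∨ i ∈ L ↔ i ∈ I ∨ i ∈ J := fun i => by
      rw [← Finset.mem_union, ← hU, Finset.mem_union]
    have m3 : ∀ i, i ∈ K → i ∉ L := fun i h => Finset.disjoint_left.1 hKL h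
    ext i
    · have := m1 i
      simp only [Finset.mem_union, Finset.mem_sdiff]
      tauto
    · have h1 := m1 i
      have h2 := m2 i
      have h3 := m3 i
      simp only [Finset.mem_union, Finset.mem_sdiff]
      tauto
  · intro P hP
    rw [shiftCoeff_mul_shiftCoeff hq hKL (Finset.mem_powersetCard.1 hP).1]

theorem qShift_qShift (q : ℂ) (I J : Finset (Fin n)) (x : Fin n → ℂ) :
    qShift q J (qShift q I x) = qShift q (I ∩ J) (qShift q (I ∪ J) x) := by
  ext i
  by_cases h1 : i ∈ I <;> by_cases h2 : i ∈ J <;> simp [qShift, h1, h2]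

include hq ht hq1 in
theorem sum_fiber_shiftCoeff_comm (r s : ℕ) (K U : Finset (Fin n)) {x : Fin n → ℂ}
    (hx : GenericPt q x) :
    ∑ z ∈ (Finset.powersetCard r Finset.univ ×ˢ Finset.powersetCard s Finset.univ :
        Finset (Finset (Fin n) × Finset (Fin n))) with (z.1 ∩ z.2, z.1 ∪ z.2) = (K, U),
      shiftCoeff t z.1 x * shiftCoeff t z.2 (qShift q z.1 x) =
    ∑ z ∈ (Finset.powersetCard s Finset.univ ×ˢ Finset.powersetCard r Finset.univ :
        Finset (Finset (Fin n) × Finset (Fin n))) with (z.1 ∩ z.2, z.1 ∪ z.2) = (K, U),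
      shiftCoeff t z.1 x * shiftCoeff t z.2 (qShift q z.1 x) := by
  by_cases hgood : K ⊆ U ∧ K.card ≤ r ∧ K.card ≤ s ∧ K.card + U.card = r + s
  · obtain ⟨hKU, hr, hs, hc⟩ := hgood
    obtain ⟨a, rfl⟩ := Nat.exists_eq_add_of_le hr
    obtain ⟨b, rfl⟩ := Nat.exists_eq_add_of_le hs
    have hU : U = K ∪ (U \ K) := (Finset.union_sdiff_of_subset hKU).symm
    have hd : Disjoint K (U \ K) := Finset.disjoint_sdiff
    have hcard : a + b = (U \ K).card := by
      rw [Finset.card_sdiff_of_subset hKU]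
      omega
    rw [hU, sum_fiber_shiftCoeff hq _ _ a b hd rfl rfl hcard,
      sum_fiber_shiftCoeff hq _ _ b a hd rfl rfl (by omega),
      subsetSum_symm hq ht hq1 _ _ rfl a b hcard x hx]
  · have empty : ∀ r s : ℕ, (¬ (K ⊆ U ∧ K.card ≤ r ∧ K.card ≤ s ∧ K.card + U.card = r + s)) →
        ∑ z ∈ (Finset.powersetCard r Finset.univ ×ˢ Finset.powersetCard s Finset.univ :
        Finset (Finset (Fin n) × Finset (Fin n))) with (z.1 ∩ z.2, z.1 ∪ z.2) = (K, U),
        shiftCoeff t z.1 x * shiftCoeff t z.2 (qShift q z.1 x) = 0 := by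
      intro r s h
      refine Finset.sum_eq_zero fun z hz => (h ?_).elim
      simp only [Finset.mem_filter, Finset.mem_product, Finset.mem_powersetCard,
        Finset.subset_univ, true_and, Prod.mk.injEq] at hz
      obtain ⟨⟨rfl, rfl⟩, rfl, rfl⟩ := hz
      exact ⟨Finset.inter_subset_left.trans Finset.subset_union_left,
        Finset.card_le_card Finset.inter_subset_left, Finset.card_le_card Finset.inter_subset_right,
        by rw [add_comm, Finset.card_union_add_card_inter]⟩
    rw [empty r s hgood, empty s r fun h => hgood ⟨h.1, h.2.2.1, h.2.1, by omega⟩]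

include hq ht hq1 in
/-- The elliptic Ruijsenaars operators commute. -/
theorem ellipticRuijsenaarsOp_comm (r s : ℕ) (f : (Fin n → ℂ) → PowerSeries ℂ) {x : Fin n → ℂ}
    (hx : GenericPt q x) :
    ellipticRuijsenaarsOp q t r (ellipticRuijsenaarsOp q t s f) x =
      ellipticRuijsenaarsOp q t s (ellipticRuijsenaarsOp q t r f) x := by
  have expand : ∀ r s, ellipticRuijsenaarsOp q t r (ellipticRuijsenaarsOp q t s f) x =
      C (t ^ r.choose 2) * C (t ^ s.choose 2) * ∑ KU : Finset (Fin n) × Finset (Fin n),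
        (∑ z ∈ (Finset.powersetCard r Finset.univ ×ˢ Finset.powersetCard s Finset.univ :
        Finset (Finset (Fin n) × Finset (Fin n))) with (z.1 ∩ z.2, z.1 ∪ z.2) = KU,
        shiftCoeff t z.1 x * shiftCoeff t z.2 (qShift q z.1 x)) *
          f (qShift q KU.1 (qShift q KU.2 x)) := by
    intro r s
    rw [ellipticRuijsenaarsOp_eq q ht r _ hx.1, mul_assoc]
    refine congrArg _ ?_
    have h1 : ∀ I : Finset (Fin n), shiftCoeff t I x * ellipticRuijsenaarsOp q t s f (qShift q I x) =
        C (t ^ s.choose 2) * ∑ J ∈ Finset.powersetCard s Finset.univ, shiftCoeff t I x *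
          shiftCoeff t J (qShift q I x) * f (qShift q (I ∩ J) (qShift q (I ∪ J) x)) := by
      intro I
      rw [ellipticRuijsenaarsOp_eq q ht s _ (hx.qShift hq I).1, mul_left_comm, Finset.mul_sum]
      refine congrArg _ (Finset.sum_congr rfl fun J _ => ?_)
      rw [qShift_qShift]
      ring
    simp only [h1]
    rw [← Finset.mul_sum, ← Finset.sum_product']
    refine congrArg _ ?_
    -- The doubly shifted point depends only on I ∩ J and I ∪ J. On each fibre the value of f
    -- factors out, so commutativity becomes an identity of coefficients, valid for arbitrary f.
    rw [← Finset.sum_fiberwise _ (fun z : Finset (Fin n) × Finset (Fin n) => (z.1 ∩ z.2, z.1 ∪ z.2))]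
    refine Finset.sum_congr rfl fun KU _ => ?_
    rw [Finset.sum_mul]
    refine Finset.sum_congr rfl fun z hz => ?_
    rw [← (Finset.mem_filter.1 hz).2]
  rw [expand r s, expand s r, mul_comm (C (t ^ r.choose 2))]
  refine congrArg _ (Finset.sum_congr rfl fun KU _ => ?_)
  rw [sum_fiber_shiftCoeff_comm hq ht hq1 r s KU.1 KU.2 hx]

end

/-! ### Laurent polynomials as functions -/

theorem monomialAt_add {n : ℕ} {x : Fin n → ℂ} (hx : ∀ i, x i ≠ 0) (μ ν : Fin n → ℤ) :
    monomialAt (μ + ν) x = monomialAt μ x * monomialAt ν x := by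
  rw [monomialAt, monomialAt, monomialAt, ← Finset.prod_mul_distrib]
  exact Finset.prod_congr rfl fun i _ => zpow_add₀ (hx i) _ _

/-- Evaluation at a point with nonzero coordinates as an algebra homomorphism. -/
noncomputable def evalHom {n : ℕ} (x : Fin n → ℂ) (hx : ∀ i, x i ≠ 0) : LaurentPoly n →ₐ[ℂ] ℂ :=
  AddMonoidAlgebra.lift ℂ ℂ (Fin n → ℤ)
    { toFun := fun μ => monomialAt μ.toAdd x
      map_one' := by simp [monomialAt]
      map_mul' := fun μ ν => monomialAt_add hx _ _ }

theorem evalHom_apply {n : ℕ} {x : Fin n → ℂ} (hx : ∀ i, x i ≠ 0) (f : LaurentPoly n) :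
    evalHom x hx f = f.evalAt x := by
  rw [evalHom, AddMonoidAlgebra.lift_apply, LaurentPoly.evalAt]
  rfl

theorem evalHom_single {n : ℕ} {x : Fin n → ℂ} (hx : ∀ i, x i ≠ 0) (μ : Fin n → ℤ) (c : ℂ) :
    evalHom x hx (AddMonoidAlgebra.single μ c) = c * monomialAt μ x := by
  rw [evalHom, AddMonoidAlgebra.lift_single]
  rfl

/-- Coefficientwise evaluation as a ring homomorphism. -/
noncomputable def evalSeriesHom {n : ℕ} (x : Fin n → ℂ) (hx : ∀ i, x i ≠ 0) :
    PowerSeries (LaurentPoly n) →+* PowerSeries ℂ :=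
  PowerSeries.map (evalHom x hx : LaurentPoly n →+* ℂ)

theorem evalSeriesHom_apply {n : ℕ} {x : Fin n → ℂ} (hx : ∀ i, x i ≠ 0)
    (ψ : PowerSeries (LaurentPoly n)) : evalSeriesHom x hx ψ = evalSeriesAt ψ x := by
  ext k
  rw [evalSeriesHom, evalSeriesAt, coeff_map, coeff_mk]
  exact evalHom_apply hx _

theorem coeff_evalSeriesHom {n : ℕ} {x : Fin n → ℂ} (hx : ∀ i, x i ≠ 0)
    (ψ : PowerSeries (LaurentPoly n)) (k : ℕ) :
    coeff k (evalSeriesHom x hx ψ) = evalHom x hx (coeff k ψ) := by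
  rw [evalSeriesHom, coeff_map]
  rfl

/-- Take positive reals from disjoint subintervals of (|q|, 1): ratios of distinct coordinates then
lie strictly between |q| and 1/|q| and differ from 1, so they are not powers of q. A product of
infinite sets is what `MvPolynomial.funext_set` asks for. -/
theorem exists_infinite_generic {n : ℕ} {q : ℂ} (hq0 : q ≠ 0) (hq1 : ‖q‖ < 1) :
    ∃ s : Fin n → Set ℂ, (∀ i, (s i).Infinite) ∧ ∀ x ∈ Set.pi Set.univ s, GenericPt q x := by
  have hq0' : 0 < ‖q‖ := norm_pos_iff.2 hq0
  set ρ : ℝ → ℝ := fun k => ‖q‖ + (1 - ‖q‖) * (k / n) with hρ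
  rcases Nat.eq_zero_or_pos n with rfl | hn
  · exact ⟨fun i => i.elim0, fun i => i.elim0, fun x _ => ⟨fun i => i.elim0, fun i => i.elim0⟩⟩
  have hn' : (0 : ℝ) < n := Nat.cast_pos.2 hn
  have hmono : ∀ a b : ℝ, a ≤ b → ρ a ≤ ρ b := by
    intro a b hab
    simp only [hρ]
    have : a / n ≤ b / n := by gcongr
    nlinarith
  have hlt : ∀ a : ℝ, ρ a < ρ (a + 1) := by
    intro a
    simp only [hρ]
    have : a / n < (a + 1) / n := by gcongr; linarith
    nlinarith
  refine ⟨fun i => (fun r : ℝ => (r : ℂ)) '' Set.Ioo (ρ i) (ρ (i + 1)), fun i => ?_, fun x hx => ?_⟩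
  · exact (Set.Ioo_infinite (hlt _)).image Complex.ofReal_injective.injOn
  · choose r hr hrx using fun i => hx i (Set.mem_univ i)
    have hr0 : ∀ i, ‖q‖ < r i := fun i => by
      have h1 := hmono 0 i (Nat.cast_nonneg _)
      simp only [hρ, zero_div, mul_zero, add_zero] at h1
      exact h1.trans_lt (hr i).1
    have hr1 : ∀ i, r i < 1 := fun i => by
      have h1 := hmono (i + 1) n (by exact_mod_cast i.2)
      refine (hr i).2.trans_le (h1.trans ?_)
      simp only [hρ]
      rw [div_self hn'.ne']
      linarith
    have hnorm : ∀ i, ‖x i‖ = r i := fun i => by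
      rw [← hrx i, Complex.norm_real, Real.norm_of_nonneg (hq0'.trans (hr0 i)).le]
    have hinj : ∀ i j : Fin n, i < j → r i < r j := fun i j hij => by
      have h1 := hmono (i + 1) j (by exact_mod_cast hij)
      exact (hr i).2.trans_le (h1.trans (hr j).1.le)
    have key : ∀ i j : Fin n, ∀ m : ℕ, r i ≠ ‖q‖ ^ (m + 1) * r j := by
      intro i j m h
      have h2 : ‖q‖ ^ (m + 1) * r j < ‖q‖ * 1 := by
        have : ‖q‖ ^ m ≤ 1 := pow_le_one₀ hq0'.le hq1.le
        have h3 := hr1 j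
        have h4 := hq0'.trans (hr0 j)
        rw [pow_succ]
        have : ‖q‖ ^ m * ‖q‖ ≤ ‖q‖ := by nlinarith
        nlinarith
      have := hr0 i
      linarith
    refine ⟨fun i => by rw [← norm_pos_iff, hnorm]; exact hq0'.trans (hr0 i), fun i j hij m h => ?_⟩
    have h' := congrArg norm h
    rw [norm_mul, norm_zpow, hnorm, hnorm] at h'
    rcases lt_trichotomy m 0 with hm | rfl | hm
    · obtain ⟨k, rfl⟩ : ∃ k : ℕ, m = -((k : ℤ) + 1) := ⟨(-m - 1).toNat, by omega⟩
      apply key j i k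
      rw [h', ← mul_assoc, zpow_neg]
      norm_cast
      rw [mul_inv_cancel₀ (pow_ne_zero _ hq0'.ne'), one_mul]
    · rw [zpow_zero, one_mul] at h'
      rcases lt_or_gt_of_ne hij with h1 | h1
      · exact (hinj i j h1).ne h'
      · exact (hinj j i h1).ne' h'
    · obtain ⟨k, rfl⟩ : ∃ k : ℕ, m = (k : ℤ) + 1 := ⟨(m - 1).toNat, by omega⟩
      apply key i j k
      rw [h']
      norm_cast

/-- A Laurent polynomial vanishing at all generic points is zero. -/
theorem LaurentPoly.eq_zero_of_generic {n : ℕ} {q : ℂ} (hq0 : q ≠ 0) (hq1 : ‖q‖ < 1)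
    {f : LaurentPoly n} (h : ∀ x, GenericPt q x → f.evalAt x = 0) : f = 0 := by
  -- Multiplication by (x_1 ⋯ x_n)^N makes all exponents nonnegative and so leads to an ordinary
  -- polynomial.
  obtain ⟨N, hN⟩ : ∃ N : ℕ, ∀ μ ∈ f.coeff.support, ∀ i, 0 ≤ μ i + N := by
    refine ⟨∑ μ ∈ f.coeff.support, ∑ i, (μ i).natAbs, fun μ hμ i => ?_⟩
    have h1 : (μ i).natAbs ≤ ∑ i, (μ i).natAbs :=
      Finset.single_le_sum (f := fun i => (μ i).natAbs) (fun _ _ => Nat.zero_le _) (Finset.mem_univ i)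
    have h2 : ∑ i, (μ i).natAbs ≤ ∑ μ ∈ f.coeff.support, ∑ i, (μ i).natAbs :=
      Finset.single_le_sum (f := fun μ : Fin n → ℤ => ∑ i, (μ i).natAbs)
        (fun _ _ => Nat.zero_le _) hμ
    omega
  set e : (Fin n → ℤ) → Fin n →₀ ℕ := fun μ =>
    Finsupp.equivFunOnFinite.symm fun i => (μ i + N).toNat with he
  set P : MvPolynomial (Fin n) ℂ := ∑ μ ∈ f.coeff.support, MvPolynomial.monomial (e μ) (f.coeff μ)
    with hP
  have einj : ∀ μ ∈ f.coeff.support, ∀ ν ∈ f.coeff.support, e μ = e ν → μ = ν := by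
    intro μ hμ ν hν h
    ext i
    have h1 := DFunLike.congr_fun h i
    have h2 := hN μ hμ i
    have h3 := hN ν hν i
    simp only [he, Finsupp.equivFunOnFinite_symm_apply_apply] at h1
    omega
  have hP0 : P = 0 := by
    obtain ⟨s, hs, hgen⟩ := exists_infinite_generic (n := n) hq0 hq1
    refine MvPolynomial.funext_set s hs fun x hx => ?_
    have hx' := hgen x hx
    rw [map_zero, hP, map_sum]
    have : ∀ μ ∈ f.coeff.support, MvPolynomial.eval x (MvPolynomial.monomial (e μ) (f.coeff μ)) =
        (f.coeff μ * monomialAt μ x) * monomialAt (fun _ => (N : ℤ)) x := by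
      intro μ hμ
      rw [MvPolynomial.eval_monomial, mul_assoc, ← monomialAt_add hx'.1, Finsupp.prod_fintype _ _
        fun i => pow_zero _, monomialAt]
      congr 1
      refine Finset.prod_congr rfl fun i _ => ?_
      rw [he, Finsupp.equivFunOnFinite_symm_apply_apply, ← zpow_natCast,
        Int.toNat_of_nonneg (hN μ hμ i)]
      rfl
    rw [Finset.sum_congr rfl this, ← Finset.sum_mul]
    have h0 := h x hx'
    rw [LaurentPoly.evalAt, Finsupp.sum] at h0
    rw [h0, zero_mul]
  ext μ
  by_contra hμ
  have hμ' : μ ∈ f.coeff.support := Finsupp.mem_support_iff.2 (by simpa using hμ)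
  have hc := congrArg (MvPolynomial.coeff (e μ)) hP0
  rw [hP, MvPolynomial.coeff_sum, Finset.sum_eq_single μ] at hc
  · rw [MvPolynomial.coeff_monomial, if_pos rfl] at hc
    exact hμ (by simpa using hc)
  · intro ν hν hne
    rw [MvPolynomial.coeff_monomial, if_neg fun h => hne (einj ν hν μ hμ' h)]
  · intro h
    exact absurd hμ' h

theorem series_eq_of_generic {n : ℕ} {q : ℂ} (hq0 : q ≠ 0) (hq1 : ‖q‖ < 1)
    {F G : PowerSeries (LaurentPoly n)}
    (h : ∀ x, GenericPt q x → evalSeriesAt F x = evalSeriesAt G x) : F = G := by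
  ext1 k
  rw [← sub_eq_zero]
  refine LaurentPoly.eq_zero_of_generic hq0 hq1 fun x hx => ?_
  have := congrArg (coeff k) (h x hx)
  rw [evalSeriesAt, evalSeriesAt, coeff_mk, coeff_mk] at this
  rw [← evalHom_apply hx.1, map_sub, evalHom_apply, evalHom_apply, this, sub_self]

/-! ### Shifts and permutations -/

/-- The operator `∏_{i ∈ I} T_{q,x_i}` on Laurent polynomials. -/
noncomputable def shiftHom {n : ℕ} (q : ℂ) (hq : q ≠ 0) (I : Finset (Fin n)) :
    LaurentPoly n →ₐ[ℂ] LaurentPoly n :=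
  AddMonoidAlgebra.lift ℂ (LaurentPoly n) (Fin n → ℤ)
    { toFun := fun μ => AddMonoidAlgebra.single μ.toAdd (q ^ ∑ i ∈ I, μ.toAdd i)
      map_one' := by simp [AddMonoidAlgebra.one_def]
      map_mul' := fun μ ν => by
        rw [AddMonoidAlgebra.single_mul_single, ← zpow_add₀ hq, ← Finset.sum_add_distrib]
        rfl }

theorem shiftHom_single {n : ℕ} {q : ℂ} (hq : q ≠ 0) (I : Finset (Fin n)) (μ : Fin n → ℤ) (c : ℂ) :
    shiftHom q hq I (AddMonoidAlgebra.single μ c) =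
      AddMonoidAlgebra.single μ (q ^ (∑ i ∈ I, μ i) * c) := by
  rw [shiftHom, AddMonoidAlgebra.lift_single, MonoidHom.coe_mk, OneHom.coe_mk, toAdd_ofAdd,
    AddMonoidAlgebra.smul_single, smul_eq_mul, mul_comm]

theorem coeff_shiftHom {n : ℕ} {q : ℂ} (hq : q ≠ 0) (I : Finset (Fin n)) (f : LaurentPoly n)
    (μ : Fin n → ℤ) : (shiftHom q hq I f).coeff μ = q ^ (∑ i ∈ I, μ i) * f.coeff μ := by
  classical
  induction f using AddMonoidAlgebra.induction_linear with
  | zero => simp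
  | add f g hf hg =>
    rw [map_add, AddMonoidAlgebra.coeff_add, AddMonoidAlgebra.coeff_add, Finsupp.add_apply,
      Finsupp.add_apply, hf, hg, mul_add]
  | single ν c =>
    rw [shiftHom_single, AddMonoidAlgebra.coeff_single, AddMonoidAlgebra.coeff_single,
      Finsupp.single_apply, Finsupp.single_apply]
    split_ifs with h
    · rw [h]
    · simp

theorem monomialAt_qShift {n : ℕ} (q : ℂ) (I : Finset (Fin n)) (μ : Fin n → ℤ) (x : Fin n → ℂ)
    (hq : q ≠ 0) : monomialAt μ (qShift q I x) = q ^ (∑ i ∈ I, μ i) * monomialAt μ x := by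
  rw [monomialAt, monomialAt]
  have : ∀ i, qShift q I x i ^ μ i = (if i ∈ I then q ^ μ i else 1) * x i ^ μ i := by
    intro i
    rw [qShift]
    split_ifs
    · rw [mul_zpow]
    · rw [one_mul]
  rw [Finset.prod_congr rfl fun i _ => this i, Finset.prod_mul_distrib, Finset.prod_ite_mem,
    Finset.univ_inter]
  congr 1
  clear this
  induction I using Finset.induction_on with
  | empty => simp
  | insert i I hi ih => rw [Finset.prod_insert hi, Finset.sum_insert hi, zpow_add₀ hq, ih]

theorem qShift_ne_zero {n : ℕ} {q : ℂ} (hq : q ≠ 0) {x : Fin n → ℂ} (hx : ∀ i, x i ≠ 0)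
    (I : Finset (Fin n)) (i : Fin n) : qShift q I x i ≠ 0 := by
  rw [qShift]
  split_ifs
  · exact mul_ne_zero hq (hx i)
  · exact hx i

theorem evalHom_shiftHom {n : ℕ} {q : ℂ} (hq : q ≠ 0) (I : Finset (Fin n)) (f : LaurentPoly n)
    {x : Fin n → ℂ} (hx : ∀ i, x i ≠ 0) :
    evalHom x hx (shiftHom q hq I f) = evalHom (qShift q I x) (qShift_ne_zero hq hx I) f := by
  induction f using AddMonoidAlgebra.induction_linear with
  | zero => simp
  | add f g hf hg => simp only [map_add, hf, hg]
  | single ν c =>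
    rw [shiftHom_single, evalHom_single, evalHom_single, monomialAt_qShift _ _ _ _ hq]
    ring

/-- The shift operator on power series. -/
noncomputable def shiftSeries {n : ℕ} (q : ℂ) (hq : q ≠ 0) (I : Finset (Fin n)) :
    PowerSeries (LaurentPoly n) →+* PowerSeries (LaurentPoly n) :=
  PowerSeries.map (shiftHom q hq I : LaurentPoly n →+* LaurentPoly n)

theorem coeff_shiftSeries {n : ℕ} {q : ℂ} (hq : q ≠ 0) (I : Finset (Fin n))
    (ψ : PowerSeries (LaurentPoly n)) (k : ℕ) :
    coeff k (shiftSeries q hq I ψ) = shiftHom q hq I (coeff k ψ) := by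
  rw [shiftSeries, coeff_map]
  rfl

theorem evalSeriesHom_shiftSeries {n : ℕ} {q : ℂ} (hq : q ≠ 0) (I : Finset (Fin n))
    (ψ : PowerSeries (LaurentPoly n)) {x : Fin n → ℂ} (hx : ∀ i, x i ≠ 0) :
    evalSeriesHom x hx (shiftSeries q hq I ψ) = evalSeriesAt ψ (qShift q I x) := by
  rw [← evalSeriesHom_apply (qShift_ne_zero hq hx I)]
  ext k
  rw [coeff_evalSeriesHom, coeff_evalSeriesHom, coeff_shiftSeries, evalHom_shiftHom]

/-- Permutation of the variables. -/
noncomputable def permute {n : ℕ} (σ : Equiv.Perm (Fin n)) (f : LaurentPoly n) : LaurentPoly n :=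
  AddMonoidAlgebra.mapDomain (fun μ => μ ∘ σ.symm) f

theorem coeff_permute {n : ℕ} (σ : Equiv.Perm (Fin n)) (f : LaurentPoly n) (μ : Fin n → ℤ) :
    (permute σ f).coeff μ = f.coeff (μ ∘ σ) := by
  rw [permute, AddMonoidAlgebra.coeff_mapDomain]
  have : μ = (fun μ : Fin n → ℤ => μ ∘ σ.symm) (μ ∘ σ) := by
    ext i
    simp
  conv_lhs => rw [this]
  refine Finsupp.mapDomain_apply (fun μ ν h => ?_) _ _
  ext i
  have := congrFun h (σ i)
  simpa using this

theorem evalAt_permute {n : ℕ} (σ : Equiv.Perm (Fin n)) (f : LaurentPoly n) (x : Fin n → ℂ) :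
    (permute σ f).evalAt x = f.evalAt (x ∘ σ) := by
  rw [LaurentPoly.evalAt, permute, AddMonoidAlgebra.coeff_mapDomain,
    Finsupp.sum_mapDomain_index (by simp) (by intros; ring), LaurentPoly.evalAt]
  refine Finsupp.sum_congr fun μ _ => ?_
  congr 1
  rw [monomialAt, monomialAt]
  exact (Equiv.prod_comp σ _).symm.trans (Finset.prod_congr rfl fun i _ => by simp)

theorem LaurentPoly.isSymm_iff_permute {n : ℕ} (f : LaurentPoly n) :
    f.IsSymm ↔ ∀ σ, permute σ f = f := by
  constructor
  · intro h σ
    ext μ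
    rw [coeff_permute]
    exact h σ μ
  · intro h σ μ
    rw [LaurentPoly.coef, ← coeff_permute, h, LaurentPoly.coef]

theorem LaurentPoly.IsSymm.evalAt_comp {n : ℕ} {f : LaurentPoly n} (hf : f.IsSymm)
    (σ : Equiv.Perm (Fin n)) (x : Fin n → ℂ) : f.evalAt (x ∘ σ) = f.evalAt x := by
  rw [← evalAt_permute, f.isSymm_iff_permute.1 hf]

theorem GenericPt.comp {n : ℕ} {q : ℂ} {x : Fin n → ℂ} (hx : GenericPt q x)
    (σ : Equiv.Perm (Fin n)) : GenericPt q (x ∘ σ) :=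
  ⟨fun _ => hx.1 _, fun _ _ hij m => hx.2 _ _ (fun h => hij (σ.injective h)) m⟩

theorem LaurentPoly.isSymm_of_generic {n : ℕ} {q : ℂ} (hq0 : q ≠ 0) (hq1 : ‖q‖ < 1)
    {f : LaurentPoly n}
    (h : ∀ (σ : Equiv.Perm (Fin n)) (x), GenericPt q x → f.evalAt (x ∘ σ) = f.evalAt x) :
    f.IsSymm := by
  rw [f.isSymm_iff_permute]
  intro σ
  rw [← sub_eq_zero]
  refine LaurentPoly.eq_zero_of_generic hq0 hq1 fun x hx => ?_
  rw [← evalHom_apply hx.1, map_sub, evalHom_apply, evalHom_apply, evalAt_permute, h σ x hx, sub_self]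

/-! ### Divisibility by the Vandermonde product -/

/-- The pairs `a < b`. -/
def ltPairs (n : ℕ) : Finset (Fin n × Fin n) := Finset.univ.filter fun ab => ab.1 < ab.2

/-- The exponent of `x_b/x_a`. -/
def rootExp {n : ℕ} (ab : Fin n × Fin n) : Fin n → ℤ := Pi.single ab.2 1 - Pi.single ab.1 1

/-- `1 - x_b/x_a`. -/
noncomputable def oneSubRoot {n : ℕ} (ab : Fin n × Fin n) : LaurentPoly n :=
  1 - AddMonoidAlgebra.single (rootExp ab) 1

theorem monomialAt_smul_rootExp {n : ℕ} {ab : Fin n × Fin n} {x : Fin n → ℂ}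
    (hx : ∀ i, x i ≠ 0) (m : ℤ) : monomialAt (m • rootExp ab) x = (x ab.2 / x ab.1) ^ m := by
  have h1 : ∀ c : Fin n, ∏ i, x i ^ (m * (Pi.single c 1 : Fin n → ℤ) i) = x c ^ m := by
    intro c
    rw [Finset.prod_eq_single c]
    · simp
    · intro i _ hi
      simp [Pi.single_eq_of_ne hi]
    · simp
  have h2 : m • rootExp ab = (m • Pi.single ab.2 1 : Fin n → ℤ) + (-m) • (Pi.single ab.1 1) := by
    rw [rootExp, smul_sub, neg_smul, sub_eq_add_neg]
  rw [h2, monomialAt_add hx, div_zpow, div_eq_mul_inv, ← zpow_neg]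
  simp only [monomialAt, Pi.smul_apply, smul_eq_mul]
  rw [h1 ab.2]
  congr 1
  rw [Finset.prod_eq_single ab.1]
  · simp
  · intro i _ hi
    simp [Pi.single_eq_of_ne hi]
  · simp

theorem monomialAt_rootExp {n : ℕ} {ab : Fin n × Fin n} {x : Fin n → ℂ} (hx : ∀ i, x i ≠ 0) :
    monomialAt (rootExp ab) x = x ab.2 / x ab.1 := by
  have := monomialAt_smul_rootExp (ab := ab) hx 1
  rwa [one_smul, zpow_one] at this

theorem evalHom_oneSubRoot {n : ℕ} {ab : Fin n × Fin n} {x : Fin n → ℂ} (hx : ∀ i, x i ≠ 0) :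
    evalHom x hx (oneSubRoot ab) = 1 - x ab.2 / x ab.1 := by
  rw [oneSubRoot, map_sub, map_one, evalHom_single, one_mul, monomialAt_rootExp hx]

/-- The exponent map of the substitution `x_a ↦ x_b`. -/
def mergeExp {n : ℕ} (ab : Fin n × Fin n) : (Fin n → ℤ) →+ (Fin n → ℤ) where
  toFun μ := μ + μ ab.1 • rootExp ab
  map_zero' := by simp
  map_add' μ ν := by
    rw [Pi.add_apply, add_smul]
    abel

/-- The substitution `x_a ↦ x_b`. -/
noncomputable def mergeHom {n : ℕ} (ab : Fin n × Fin n) : LaurentPoly n →+* LaurentPoly n :=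
  AddMonoidAlgebra.mapDomainRingHom ℂ (mergeExp ab)

theorem mergeHom_single {n : ℕ} (ab : Fin n × Fin n) (μ : Fin n → ℤ) (c : ℂ) :
    mergeHom ab (AddMonoidAlgebra.single μ c) = AddMonoidAlgebra.single (μ + μ ab.1 • rootExp ab) c :=
  AddMonoidAlgebra.mapDomain_single

/-- On a monomial the difference is x^μ (1 - (x_b/x_a)^{μ_a}), and 1 - y divides 1 - y^m for every
integer m once y is invertible. -/
theorem oneSubRoot_dvd_sub_mergeHom {n : ℕ} (ab : Fin n × Fin n) (f : LaurentPoly n) :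
    oneSubRoot ab ∣ f - mergeHom ab f := by
  induction f using AddMonoidAlgebra.induction_linear with
  | zero => simp
  | add f g hf hg =>
    rw [map_add, add_sub_add_comm]
    exact dvd_add hf hg
  | single μ c =>
    rw [mergeHom_single]
    have key : ∀ m : ℤ, oneSubRoot ab ∣ 1 - AddMonoidAlgebra.single (m • rootExp ab) (1 : ℂ) := by
      have nat : ∀ m : ℕ, oneSubRoot ab ∣
          1 - AddMonoidAlgebra.single ((m : ℤ) • rootExp ab) (1 : ℂ) := by
        intro m
        have h := one_sub_dvd_one_sub_pow (AddMonoidAlgebra.single (rootExp ab) (1 : ℂ)) m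
        rwa [AddMonoidAlgebra.single_pow, one_pow, ← natCast_zsmul] at h
      intro m
      rcases le_or_gt 0 m with hm | hm
      · obtain ⟨m, rfl⟩ := Int.eq_ofNat_of_zero_le hm
        exact nat m
      · obtain ⟨k, rfl⟩ : ∃ k : ℕ, m = -(k : ℤ) := ⟨(-m).toNat, by omega⟩
        have h := (nat k).mul_left (-AddMonoidAlgebra.single (-(k : ℤ) • rootExp ab) (1 : ℂ))
        have e : -AddMonoidAlgebra.single (-(k : ℤ) • rootExp ab) (1 : ℂ) *
            (1 - AddMonoidAlgebra.single ((k : ℤ) • rootExp ab) (1 : ℂ)) =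
            1 - AddMonoidAlgebra.single (-(k : ℤ) • rootExp ab) (1 : ℂ) := by
          rw [mul_sub, mul_one, neg_mul, AddMonoidAlgebra.single_mul_single, neg_smul,
            neg_add_cancel, one_mul, AddMonoidAlgebra.one_def]
          abel
        rwa [e] at h
    have h := (key (μ ab.1)).mul_left (AddMonoidAlgebra.single μ c)
    rwa [mul_sub, mul_one, AddMonoidAlgebra.single_mul_single, mul_one] at h

theorem evalHom_mergeHom {n : ℕ} (ab : Fin n × Fin n) (f : LaurentPoly n) {x : Fin n → ℂ}
    (hx : ∀ i, x i ≠ 0) (hx' : ∀ i, Function.update x ab.1 (x ab.2) i ≠ 0) :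
    evalHom x hx (mergeHom ab f) = evalHom (Function.update x ab.1 (x ab.2)) hx' f := by
  induction f using AddMonoidAlgebra.induction_linear with
  | zero => simp
  | add f g hf hg => simp only [map_add, hf, hg]
  | single ν c =>
    rw [mergeHom_single, evalHom_single, evalHom_single, monomialAt_add hx,
      monomialAt_smul_rootExp hx]
    congr 1
    rw [monomialAt, monomialAt, ← Finset.mul_prod_erase _ _ (Finset.mem_univ ab.1),
      ← Finset.mul_prod_erase _ _ (Finset.mem_univ ab.1), Function.update_self,
      mul_right_comm, ← mul_zpow, mul_div_cancel₀ _ (hx ab.1)]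
    congr 1
    refine Finset.prod_congr rfl fun i hi => ?_
    rw [Function.update_of_ne (Finset.mem_erase.1 hi).1]

/-- Identifying x_a with x_b makes no other pair of variables coincide, as the point x_i = i + 1
shows. This plays the part of coprimality of the factors 1 - x_b/x_a. -/
theorem mergeHom_oneSubRoot_ne_zero {n : ℕ} {ab cd : Fin n × Fin n} (hab : ab ∈ ltPairs n)
    (hcd : cd ∈ ltPairs n) (hne : cd ≠ ab) : mergeHom ab (oneSubRoot cd) ≠ 0 := by
  intro h
  set x : Fin n → ℂ := fun i => (i : ℂ) + 1 with hxdef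
  have hx : ∀ i, x i ≠ 0 := fun i => Nat.cast_add_one_ne_zero _
  have hx' : ∀ i, Function.update x ab.1 (x ab.2) i ≠ 0 := by
    intro i
    rw [Function.update_apply]
    split_ifs
    exacts [hx _, hx _]
  have h2 := congrArg (evalHom x hx) h
  rw [map_zero, evalHom_mergeHom ab _ hx hx', evalHom_oneSubRoot, sub_eq_zero, eq_comm,
    div_eq_one_iff_eq (hx' _)] at h2
  rw [ltPairs, Finset.mem_filter] at hab hcd
  have e : ∀ i, Function.update x ab.1 (x ab.2) i =
      (((if i = ab.1 then (ab.2 : ℕ) else (i : ℕ)) : ℕ) : ℂ) + 1 := by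
    intro i
    rw [Function.update_apply]
    split_ifs <;> rfl
  rw [e, e, add_left_inj, Nat.cast_inj] at h2
  obtain ⟨a, b⟩ := ab
  obtain ⟨c, d⟩ := cd
  simp only [Fin.ext_iff, Prod.mk.injEq, ne_eq, Fin.lt_def, Finset.mem_univ, true_and] at *
  split_ifs at h2 <;> omega

/-- A Laurent polynomial vanishing on all the diagonals is divisible by the product of the
factors `1 - x_b/x_a`. -/
theorem prod_oneSubRoot_dvd {n : ℕ} {q : ℂ} (hq0 : q ≠ 0) (hq1 : ‖q‖ < 1) {f : LaurentPoly n}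
    (hf : ∀ ab ∈ ltPairs n, ∀ (x : Fin n → ℂ) (hx : ∀ i, x i ≠ 0), x ab.1 = x ab.2 →
      evalHom x hx f = 0) : ∏ ab ∈ ltPairs n, oneSubRoot ab ∣ f := by
  have merge0 : ∀ ab ∈ ltPairs n, mergeHom ab f = 0 := by
    intro ab hab
    refine LaurentPoly.eq_zero_of_generic hq0 hq1 fun x hx => ?_
    have hx' : ∀ i, Function.update x ab.1 (x ab.2) i ≠ 0 := by
      intro i
      rw [Function.update_apply]
      split_ifs
      exacts [hx.1 _, hx.1 _]
    rw [← evalHom_apply hx.1, evalHom_mergeHom ab f hx.1 hx']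
    refine hf ab hab _ hx' ?_
    rw [Function.update_self, Function.update_apply]
    split_ifs <;> rfl
  suffices ∀ s ⊆ ltPairs n, ∏ ab ∈ s, oneSubRoot ab ∣ f from this _ le_rfl
  intro s
  induction s using Finset.induction_on with
  | empty => intro _; simp
  | insert ab s hab ih =>
    intro hs
    obtain ⟨g, hg⟩ := ih ((Finset.subset_insert _ _).trans hs)
    have habp := hs (Finset.mem_insert_self _ _)
    have h0 := merge0 ab habp
    rw [hg, map_mul, map_prod] at h0
    -- The factors already split off survive the merging, so in a domain it is the cofactor g that
    -- must vanish.
    have hg0 : mergeHom ab g = 0 := by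
      refine (mul_eq_zero.1 h0).resolve_left (Finset.prod_ne_zero_iff.2 fun cd hcd => ?_)
      exact mergeHom_oneSubRoot_ne_zero habp (hs (Finset.mem_insert_of_mem hcd))
        fun h => hab (h ▸ hcd)
    have h1 := oneSubRoot_dvd_sub_mergeHom ab g
    rw [hg0, sub_zero] at h1
    rw [Finset.prod_insert hab, hg, mul_comm]
    exact mul_dvd_mul dvd_rfl h1

/-! ### The elliptic operators on power series of Laurent polynomials -/

/-- The embedding of scalars. -/
noncomputable def scalarSeries (n : ℕ) : PowerSeries ℂ →+* PowerSeries (LaurentPoly n) :=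
  PowerSeries.map (algebraMap ℂ (LaurentPoly n))

theorem evalSeriesHom_scalarSeries {n : ℕ} {x : Fin n → ℂ} (hx : ∀ i, x i ≠ 0)
    (c : PowerSeries ℂ) : evalSeriesHom x hx (scalarSeries n c) = c := by
  ext k
  rw [coeff_evalSeriesHom, scalarSeries, coeff_map, AlgHom.commutes]
  rfl

theorem coeff_algebraMap_mul {n : ℕ} (c : ℂ) (f : LaurentPoly n) (μ : Fin n → ℤ) :
    (algebraMap ℂ (LaurentPoly n) c * f).coeff μ = c * f.coeff μ := by
  rw [← Algebra.smul_def]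
  rfl

theorem coeff_scalarSeries_C_mul {n : ℕ} (c : ℂ) (F : PowerSeries (LaurentPoly n)) (k : ℕ)
    (μ : Fin n → ℤ) :
    (coeff k (scalarSeries n (C c) * F)).coeff μ = c * (coeff k F).coeff μ := by
  rw [scalarSeries, map_C, coeff_C_mul, coeff_algebraMap_mul]

/-- The theta function of `c x_b/x_a`. -/
noncomputable def thetaMono {n : ℕ} (c : ℂ) (ab : Fin n × Fin n) : PowerSeries (LaurentPoly n) :=
  thetaSeries fun m => AddMonoidAlgebra.single (m • rootExp ab) ((-c) ^ m)

theorem evalSeriesHom_thetaMono {n : ℕ} {x : Fin n → ℂ} (hx : ∀ i, x i ≠ 0) (c : ℂ)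
    (ab : Fin n × Fin n) :
    evalSeriesHom x hx (thetaMono c ab) = thetaHat (c * (x ab.2 / x ab.1)) := by
  rw [evalSeriesHom, thetaMono, map_thetaSeries, thetaHat]
  congr 1
  ext m
  rw [RingHom.coe_coe, evalHom_single, monomialAt_smul_rootExp hx, ← mul_zpow, neg_mul]

/-- The common denominator `∏_{a < b} θ(x_b/x_a)`. -/
noncomputable def thetaDenom (n : ℕ) : PowerSeries (LaurentPoly n) :=
  ∏ ab ∈ ltPairs n, thetaMono 1 ab

/-- The factor for the pair `a < b` in the numerator of the coefficient of `∏_{i ∈ I} T_{q,x_i}`. -/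
noncomputable def numFactor {n : ℕ} (t : ℂ) (I : Finset (Fin n)) (ab : Fin n × Fin n) :
    PowerSeries (LaurentPoly n) :=
  if ab.1 ∈ I ∧ ab.2 ∉ I then scalarSeries n (C t) * thetaMono t⁻¹ ab
  else if ab.1 ∉ I ∧ ab.2 ∈ I then thetaMono t ab else thetaMono 1 ab

/-- The numerator of the coefficient of `∏_{i ∈ I} T_{q,x_i}`. -/
noncomputable def thetaNum {n : ℕ} (t : ℂ) (I : Finset (Fin n)) : PowerSeries (LaurentPoly n) :=
  ∏ ab ∈ ltPairs n, numFactor t I ab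

theorem prod_prod_compl_eq_prod_ltPairs {n : ℕ} {A : Type*} [CommMonoid A] (I : Finset (Fin n))
    (g : Fin n → Fin n → A) :
    ∏ i ∈ I, ∏ j ∈ Iᶜ, g i j = ∏ ab ∈ ltPairs n,
      if ab.1 ∈ I ∧ ab.2 ∉ I then g ab.1 ab.2
      else if ab.1 ∉ I ∧ ab.2 ∈ I then g ab.2 ab.1 else 1 := by
  have h1 : ∏ i ∈ I, ∏ j ∈ Iᶜ, g i j = ∏ ab : Fin n × Fin n,
      if ab.1 ∈ I ∧ ab.2 ∉ I then g ab.1 ab.2 else 1 := by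
    rw [← Finset.prod_product', ← Finset.prod_filter]
    refine Finset.prod_congr ?_ fun _ _ => rfl
    ext ab
    simp
  have h2 : ∏ ab : Fin n × Fin n, (if ab.1 ∈ I ∧ ab.2 ∉ I then g ab.1 ab.2 else 1) =
      (∏ ab ∈ ltPairs n, if ab.1 ∈ I ∧ ab.2 ∉ I then g ab.1 ab.2 else 1) *
      ∏ ab ∈ ltPairs n, if ab.2 ∈ I ∧ ab.1 ∉ I then g ab.2 ab.1 else 1 := by
    have h3 : ∏ ab ∈ ltPairs n, (if ab.2 ∈ I ∧ ab.1 ∉ I then g ab.2 ab.1 else 1) =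
        ∏ ab ∈ Finset.univ.filter (fun ab : Fin n × Fin n => ab.2 < ab.1),
          if ab.1 ∈ I ∧ ab.2 ∉ I then g ab.1 ab.2 else 1 := by
      refine Finset.prod_nbij' Prod.swap Prod.swap ?_ ?_ ?_ ?_ ?_ <;> simp [ltPairs]
    rw [h3, ltPairs, ← Finset.prod_union]
    · symm
      refine Finset.prod_subset (Finset.subset_univ _) fun ab _ hab => ?_
      rw [Finset.mem_union, Finset.mem_filter, Finset.mem_filter, not_or] at hab
      have : ab.1 = ab.2 := le_antisymm (not_lt.1 fun h => hab.2 ⟨Finset.mem_univ _, h⟩)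
        (not_lt.1 fun h => hab.1 ⟨Finset.mem_univ _, h⟩)
      rw [this, if_neg fun h => h.2 h.1]
    · rw [Finset.disjoint_filter]
      exact fun _ _ h => not_lt.2 h.le
  rw [h1, h2, ← Finset.prod_mul_distrib]
  refine Finset.prod_congr rfl fun ab _ => ?_
  by_cases ha : ab.1 ∈ I <;> by_cases hb : ab.2 ∈ I <;> simp [ha, hb]

/-- Ratios at x_a/x_b with a < b are rewritten in x_b/x_a. One denominator then serves both
directions, and all factors have their support in the cone used below. -/
theorem thetaRatio_inv {t z : ℂ} (ht : t ≠ 0) (hz : z ≠ 0) :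
    thetaRatio t z⁻¹ = C t * thetaHat (t⁻¹ * z) * (thetaHat z)⁻¹ := by
  have h1 : t * z⁻¹ = (t⁻¹ * z)⁻¹ := by rw [mul_inv, inv_inv]
  have h2 : (C (-z⁻¹) * thetaHat z)⁻¹ = C (-z) * (thetaHat z)⁻¹ := by
    rw [PowerSeries.mul_inv_rev, PowerSeries.C_inv, mul_comm, inv_neg, inv_inv]
  rw [thetaRatio, h1, thetaHat_inv (mul_ne_zero (inv_ne_zero ht) hz), thetaHat_inv hz, h2]
  have h3 : (C (-(t⁻¹ * z)⁻¹) * C (-z) : PowerSeries ℂ) = C t := by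
    apply C_mul_C_eq
    field_simp
  linear_combination (thetaHat (t⁻¹ * z) * (thetaHat z)⁻¹) * h3

/-- Clearing denominators. -/
theorem evalSeriesHom_thetaDenom_mul_shiftCoeff {n : ℕ} {t : ℂ} (ht : t ≠ 0) (I : Finset (Fin n))
    {x : Fin n → ℂ} (hx : ∀ i, x i ≠ 0) (hinj : Function.Injective x) :
    evalSeriesHom x hx (thetaDenom n) * shiftCoeff t I x = evalSeriesHom x hx (thetaNum t I) := by
  rw [shiftCoeff, prod_prod_compl_eq_prod_ltPairs, thetaDenom, thetaNum, map_prod, map_prod,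
    ← Finset.prod_mul_distrib]
  refine Finset.prod_congr rfl fun ab hab => ?_
  have hne : x ab.2 / x ab.1 ≠ 1 := by
    rw [ne_eq, div_eq_one_iff_eq (hx _)]
    intro h
    exact ((Finset.mem_filter.1 hab).2).ne (hinj h).symm
  rw [numFactor, evalSeriesHom_thetaMono, one_mul]
  have hth := thetaHat_mul_inv hne
  split_ifs with h1 h2
  · rw [map_mul, evalSeriesHom_scalarSeries, evalSeriesHom_thetaMono, ← inv_div (x ab.2) (x ab.1),
      thetaRatio_inv ht (div_ne_zero (hx _) (hx _))]
    linear_combination (C t * thetaHat (t⁻¹ * (x ab.2 / x ab.1))) * hth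
  · rw [evalSeriesHom_thetaMono, thetaRatio]
    linear_combination (thetaHat (t * (x ab.2 / x ab.1))) * hth
  · rw [evalSeriesHom_thetaMono, one_mul, mul_one]

section operator

variable {n : ℕ} (q t : ℂ) (hq0 : q ≠ 0)

/-- The operator with denominators cleared. -/
noncomputable def clearedOp (r : ℕ) (ψ : PowerSeries (LaurentPoly n)) :
    PowerSeries (LaurentPoly n) :=
  ∑ I ∈ Finset.powersetCard r (Finset.univ : Finset (Fin n)),
    scalarSeries n (C (t ^ r.choose 2)) * thetaNum t I * shiftSeries q hq0 I ψ

theorem evalSeriesHom_clearedOp (ht : t ≠ 0) (r : ℕ) (ψ : PowerSeries (LaurentPoly n))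
    {x : Fin n → ℂ} (hx : ∀ i, x i ≠ 0) (hinj : Function.Injective x) :
    evalSeriesHom x hx (clearedOp q t hq0 r ψ) =
      evalSeriesHom x hx (thetaDenom n) * ellipticRuijsenaarsOp q t r (evalSeriesAt ψ) x := by
  rw [clearedOp, ellipticRuijsenaarsOp_eq q ht r _ hx, map_sum, Finset.mul_sum, Finset.mul_sum]
  refine Finset.sum_congr rfl fun I _ => ?_
  rw [map_mul, map_mul, evalSeriesHom_scalarSeries, evalSeriesHom_shiftSeries,
    ← evalSeriesHom_thetaDenom_mul_shiftCoeff ht I hx hinj]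
  ring

theorem clearedOp_add (r : ℕ) (φ ψ : PowerSeries (LaurentPoly n)) :
    clearedOp q t hq0 r (φ + ψ) = clearedOp q t hq0 r φ + clearedOp q t hq0 r ψ := by
  simp only [clearedOp, map_add, mul_add, Finset.sum_add_distrib]

theorem shiftSeries_scalarSeries (I : Finset (Fin n)) (c : PowerSeries ℂ) :
    shiftSeries q hq0 I (scalarSeries n c) = scalarSeries n c := by
  ext1 k
  rw [coeff_shiftSeries, scalarSeries, coeff_map, AlgHom.commutes]

theorem clearedOp_scalarSeries_mul (r : ℕ) (c : PowerSeries ℂ) (ψ : PowerSeries (LaurentPoly n)) :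
    clearedOp q t hq0 r (scalarSeries n c * ψ) = scalarSeries n c * clearedOp q t hq0 r ψ := by
  rw [clearedOp, clearedOp, Finset.mul_sum]
  refine Finset.sum_congr rfl fun I _ => ?_
  rw [map_mul, shiftSeries_scalarSeries]
  ring

end operator

/-! ### Divisibility by the theta denominator -/

/-- Since θ(1) = 0, every coefficient in p vanishes when x_a and x_b are merged and is divisible by
1 - x_b/x_a. The constant term equals 1 - x_b/x_a exactly, so the quotient has constant term 1 and
is a unit. -/
theorem exists_unit_thetaMono {n : ℕ} {ab : Fin n × Fin n} (hab : ab ∈ ltPairs n) :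
    ∃ U V : PowerSeries (LaurentPoly n), thetaMono 1 ab = C (oneSubRoot ab) * U ∧ U * V = 1 := by
  have hne : ab.1 ≠ ab.2 := ((Finset.mem_filter.1 hab).2).ne
  have hroot : mergeExp ab (rootExp ab) = 0 := by
    have : rootExp ab ab.1 = -1 := by simp [rootExp, hne]
    change rootExp ab + rootExp ab ab.1 • rootExp ab = 0
    rw [this]
    simp
  have hmerge : PowerSeries.map (mergeHom ab) (thetaMono 1 ab) = 0 := by
    have h0 : scalarSeries n (thetaHat 1) = 0 := by rw [thetaHat_one, map_zero]
    rw [← h0, thetaMono, map_thetaSeries, scalarSeries, thetaHat, map_thetaSeries]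
    congr 1
    ext1 m
    have := map_zsmul (mergeExp ab) m (rootExp ab)
    rw [hroot, smul_zero] at this
    change AddMonoidAlgebra.mapDomain (mergeExp ab) _ = _
    rw [AddMonoidAlgebra.mapDomain_single, this]
    rfl
  have hdvd : ∀ l, oneSubRoot ab ∣ coeff l (thetaMono 1 ab) := by
    intro l
    have h1 := oneSubRoot_dvd_sub_mergeHom ab (coeff l (thetaMono 1 ab))
    have h2 : mergeHom ab (coeff l (thetaMono 1 ab)) = 0 := by
      rw [← coeff_map, hmerge, map_zero]
    rwa [h2, sub_zero] at h1
  choose u hu using hdvd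
  have hU : thetaMono 1 ab = C (oneSubRoot ab) * PowerSeries.mk u := by
    ext1 l
    rw [coeff_C_mul, coeff_mk, hu]
  have hs0 : oneSubRoot ab ≠ 0 := by
    intro h
    have hx : ∀ i : Fin n, ((i : ℂ) + 1) ≠ 0 := fun i => Nat.cast_add_one_ne_zero _
    have h2 := congrArg (evalHom _ hx) h
    rw [map_zero, evalHom_oneSubRoot, sub_eq_zero, eq_comm, div_eq_one_iff_eq (hx _),
      add_left_inj, Nat.cast_inj] at h2
    exact hne (Fin.ext h2).symm
  have hc : constantCoeff (PowerSeries.mk u) = 1 := by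
    have h3 : coeff 0 (thetaMono 1 ab) = oneSubRoot ab := by
      rw [thetaMono, coeff_zero_thetaSeries, oneSubRoot, AddMonoidAlgebra.one_def]
      simp [sub_eq_add_neg]
    have h4 := hu 0
    rw [h3] at h4
    rw [← coeff_zero_eq_constantCoeff_apply, coeff_mk]
    exact (mul_left_cancel₀ hs0 (by rw [mul_one]; exact h4)).symm
  refine ⟨_, PowerSeries.invOfUnit (PowerSeries.mk u) 1, hU, ?_⟩
  exact PowerSeries.mul_invOfUnit _ _ (by rw [hc]; rfl)

theorem exists_unit_thetaDenom (n : ℕ) :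
    ∃ U V : PowerSeries (LaurentPoly n),
      thetaDenom n = C (∏ ab ∈ ltPairs n, oneSubRoot ab) * U ∧ U * V = 1 := by
  have key : ∀ s ⊆ ltPairs n, ∃ U V : PowerSeries (LaurentPoly n),
      ∏ ab ∈ s, thetaMono 1 ab = C (∏ ab ∈ s, oneSubRoot ab) * U ∧ U * V = 1 := by
    intro s
    induction s using Finset.induction_on with
    | empty => exact fun _ => ⟨1, 1, by simp, by simp⟩
    | insert ab s hab ih =>
      intro hs
      obtain ⟨U, V, hU, hV⟩ := ih ((Finset.subset_insert _ _).trans hs)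
      obtain ⟨U', V', hU', hV'⟩ := exists_unit_thetaMono (hs (Finset.mem_insert_self _ _))
      refine ⟨U' * U, V' * V, ?_, by linear_combination hV' * (U * V) + hV⟩
      rw [Finset.prod_insert hab, Finset.prod_insert hab, hU, hU', map_mul]
      ring
  exact key _ le_rfl

/-- `∏_{a<b} (x_a - x_b)` is alternating. -/
theorem prod_ltPairs_sub_comp {n : ℕ} (x : Fin n → ℂ) (σ : Equiv.Perm (Fin n)) :
    ∏ ab ∈ ltPairs n, (x (σ ab.1) - x (σ ab.2)) =
      Equiv.Perm.sign σ * ∏ ab ∈ ltPairs n, (x ab.1 - x ab.2) := by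
  have h : ∀ y : Fin n → ℂ, ∏ ab ∈ ltPairs n, (y ab.1 - y ab.2) =
      (∏ ab ∈ ltPairs n, (-1)) * (Matrix.vandermonde y).det := by
    intro y
    rw [Matrix.det_vandermonde, Finset.prod_sigma', show (∏ x ∈ Finset.univ.sigma
      fun i : Fin n => Finset.Ioi i, (y x.snd - y x.fst)) = ∏ ab ∈ ltPairs n, (y ab.2 - y ab.1) from ?_,
      ← Finset.prod_mul_distrib]
    · exact Finset.prod_congr rfl fun _ _ => by ring
    · refine Finset.prod_nbij' (fun p => (p.1, p.2)) (fun p => ⟨p.1, p.2⟩) ?_ ?_ ?_ ?_ ?_ <;>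
        simp [ltPairs]
  have h2 : (Matrix.vandermonde (x ∘ σ)).det = Equiv.Perm.sign σ * (Matrix.vandermonde x).det := by
    rw [← Matrix.det_permute]
    rfl
  have h3 := h (x ∘ σ)
  simp only [Function.comp_apply] at h3
  rw [h3, h2, h x]
  ring

theorem prod_ltPairs_one_sub {n : ℕ} {x : Fin n → ℂ} (hx : ∀ i, x i ≠ 0) :
    (∏ ab ∈ ltPairs n, x ab.1) * ∏ ab ∈ ltPairs n, (1 - x ab.2 / x ab.1) =
      ∏ ab ∈ ltPairs n, (x ab.1 - x ab.2) := by
  rw [← Finset.prod_mul_distrib]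
  refine Finset.prod_congr rfl fun ab _ => ?_
  rw [mul_sub, mul_one, mul_div_cancel₀ _ (hx _)]

/-- A Laurent polynomial which is the product of `∏_{a<b}(1 - x_b/x_a)` and a symmetric function is
divisible by the former. -/
theorem prod_oneSubRoot_dvd_of_symm {n : ℕ} {q : ℂ} (hq0 : q ≠ 0) (hq1 : ‖q‖ < 1)
    {f : LaurentPoly n} (g : (Fin n → ℂ) → ℂ)
    (hg : ∀ (σ : Equiv.Perm (Fin n)) (x), GenericPt q x → g (x ∘ σ) = g x)
    (hf : ∀ x (hx : GenericPt q x), evalHom x hx.1 f =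
      (∏ ab ∈ ltPairs n, (1 - x ab.2 / x ab.1)) * g x) :
    ∏ ab ∈ ltPairs n, oneSubRoot ab ∣ f := by
  refine prod_oneSubRoot_dvd hq0 hq1 fun ab hab x hx hxab => ?_
  -- Multiplying by M turns ∏(1 - x_b/x_a) into the alternating product ∏(x_a - x_b). The
  -- transposition of a and b then negates M f but fixes the points with x_a = x_b, so M f, and with
  -- it f, vanishes there.
  set M : LaurentPoly n := ∏ cd ∈ ltPairs n, AddMonoidAlgebra.single (Pi.single cd.1 1) 1 with hM
  have hMx : ∀ (y : Fin n → ℂ) (hy : ∀ i, y i ≠ 0),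
      evalHom y hy M = ∏ cd ∈ ltPairs n, y cd.1 := by
    intro y hy
    rw [hM, map_prod]
    refine Finset.prod_congr rfl fun cd _ => ?_
    rw [evalHom_single, one_mul, monomialAt, Finset.prod_eq_single cd.1]
    · simp
    · intro i _ hi
      simp [Pi.single_eq_of_ne hi]
    · simp
  set σ := Equiv.swap ab.1 ab.2 with hσ
  have hab' : ab.1 ≠ ab.2 := ((Finset.mem_filter.1 hab).2).ne
  have hanti : permute σ (M * f) + M * f = 0 := by
    refine LaurentPoly.eq_zero_of_generic hq0 hq1 fun y hy => ?_
    have hval : ∀ z (hz : GenericPt q z), evalHom z hz.1 (M * f) =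
        (∏ cd ∈ ltPairs n, (z cd.1 - z cd.2)) * g z := by
      intro z hz
      rw [map_mul, hMx, hf z hz, ← mul_assoc, prod_ltPairs_one_sub hz.1]
    rw [← evalHom_apply hy.1, map_add, evalHom_apply, evalAt_permute, ← evalHom_apply (hy.comp σ).1,
      hval _ (hy.comp σ), hval _ hy, hg σ y hy]
    have := prod_ltPairs_sub_comp y σ
    rw [hσ, Equiv.Perm.sign_swap hab'] at this
    simp only [Function.comp_apply]
    rw [this]
    push_cast
    ring
  have h0 := congrArg (evalHom x hx) hanti
  rw [map_zero, map_add, evalHom_apply, evalAt_permute] at h0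
  have hcomp : x ∘ σ = x := by
    ext i
    rw [Function.comp_apply, hσ, Equiv.swap_apply_def]
    split_ifs with h1 h2
    · rw [h1, hxab]
    · rw [h2, hxab]
    · rfl
  rw [hcomp, ← evalHom_apply hx, ← two_mul, mul_eq_zero, map_mul, mul_eq_zero, hMx] at h0
  exact (h0.resolve_left two_ne_zero).resolve_left (Finset.prod_ne_zero_iff.2 fun _ _ => hx _)

/-! ### The elliptic operator on symmetric series -/

theorem qShift_comp {n : ℕ} (q : ℂ) (I : Finset (Fin n)) (x : Fin n → ℂ) (σ : Equiv.Perm (Fin n)) :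
    qShift q I (x ∘ σ) = qShift q (I.map σ.toEmbedding) x ∘ σ := by
  ext i
  simp [qShift]

theorem sum_prod_comp {n : ℕ} (q : ℂ) (r : ℕ) (F : ℂ → ℂ → PowerSeries ℂ)
    (f : (Fin n → ℂ) → PowerSeries ℂ)
    (hf : ∀ (σ : Equiv.Perm (Fin n)) (x : Fin n → ℂ), f (x ∘ σ) = f x)
    (σ : Equiv.Perm (Fin n)) (x : Fin n → ℂ) :
    ∑ I ∈ Finset.powersetCard r (Finset.univ : Finset (Fin n)),
        (∏ i ∈ I, ∏ j ∈ Iᶜ, F (x (σ i)) (x (σ j))) * f (qShift q I (x ∘ σ)) =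
      ∑ I ∈ Finset.powersetCard r (Finset.univ : Finset (Fin n)),
        (∏ i ∈ I, ∏ j ∈ Iᶜ, F (x i) (x j)) * f (qShift q I x) := by
  refine Finset.sum_nbij' (fun I => I.map σ.toEmbedding) (fun I => I.map σ.symm.toEmbedding)
    ?_ ?_ ?_ ?_ ?_
  · intro I hI
    rw [Finset.mem_powersetCard] at hI ⊢
    exact ⟨Finset.subset_univ _, by rw [Finset.card_map]; exact hI.2⟩
  · intro I hI
    rw [Finset.mem_powersetCard] at hI ⊢
    exact ⟨Finset.subset_univ _, by rw [Finset.card_map]; exact hI.2⟩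
  · intro I _
    ext i
    simp
  · intro I _
    ext i
    simp
  · intro I _
    have hc : (I.map σ.toEmbedding)ᶜ = Iᶜ.map σ.toEmbedding := by
      ext i
      simp
    rw [qShift_comp, hf, hc, Finset.prod_map]
    simp only [Finset.prod_map]
    rfl

theorem ellipticRuijsenaarsOp_comp {n : ℕ} (q t : ℂ) (r : ℕ) (f : (Fin n → ℂ) → PowerSeries ℂ)
    (hf : ∀ (σ : Equiv.Perm (Fin n)) (x : Fin n → ℂ), f (x ∘ σ) = f x)
    (σ : Equiv.Perm (Fin n)) (x : Fin n → ℂ) :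
    ellipticRuijsenaarsOp q t r f (x ∘ σ) = ellipticRuijsenaarsOp q t r f x := by
  have := sum_prod_comp q r (fun u v => formalTheta (t * u / v) * (formalTheta (u / v))⁻¹) f hf σ x
  rw [ellipticRuijsenaarsOp, ellipticRuijsenaarsOp, ← this]
  rfl

/-- All coefficients are symmetric. -/
def SymmSeries {n : ℕ} (ψ : PowerSeries (LaurentPoly n)) : Prop := ∀ k, (coeff k ψ).IsSymm

theorem SymmSeries.evalSeriesAt_comp {n : ℕ} {ψ : PowerSeries (LaurentPoly n)} (hψ : SymmSeries ψ)
    (σ : Equiv.Perm (Fin n)) (x : Fin n → ℂ) : evalSeriesAt ψ (x ∘ σ) = evalSeriesAt ψ x := by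
  ext k
  rw [evalSeriesAt, evalSeriesAt, coeff_mk, coeff_mk, (hψ k).evalAt_comp]

theorem SymmSeries.add {n : ℕ} {φ ψ : PowerSeries (LaurentPoly n)} (hφ : SymmSeries φ)
    (hψ : SymmSeries ψ) : SymmSeries (φ + ψ) := by
  intro k σ μ
  have h1 := hφ k σ μ
  have h2 := hψ k σ μ
  simp only [LaurentPoly.coef] at h1 h2 ⊢
  rw [map_add, AddMonoidAlgebra.coeff_add, Finsupp.add_apply, Finsupp.add_apply, h1, h2]

theorem coeff_coeff_scalarSeries_mul {n : ℕ} (c : PowerSeries ℂ) (ψ : PowerSeries (LaurentPoly n))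
    (k : ℕ) (μ : Fin n → ℤ) : (coeff k (scalarSeries n c * ψ)).coeff μ =
      ∑ ij ∈ Finset.HasAntidiagonal.antidiagonal k, coeff ij.1 c * (coeff ij.2 ψ).coeff μ := by
  rw [coeff_mul, AddMonoidAlgebra.coeff_sum, Finsupp.finsetSum_apply]
  refine Finset.sum_congr rfl fun ij _ => ?_
  rw [scalarSeries, coeff_map, coeff_algebraMap_mul]

theorem SymmSeries.scalar_mul {n : ℕ} {ψ : PowerSeries (LaurentPoly n)} (c : PowerSeries ℂ)
    (hψ : SymmSeries ψ) : SymmSeries (scalarSeries n c * ψ) := by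
  intro k σ μ
  rw [LaurentPoly.coef, LaurentPoly.coef, coeff_coeff_scalarSeries_mul,
    coeff_coeff_scalarSeries_mul]
  exact Finset.sum_congr rfl fun ij _ => by
    have := hψ ij.2 σ μ
    rw [LaurentPoly.coef, LaurentPoly.coef] at this
    rw [this]

theorem SymmSeries.sub {n : ℕ} {φ ψ : PowerSeries (LaurentPoly n)} (hφ : SymmSeries φ)
    (hψ : SymmSeries ψ) : SymmSeries (φ - ψ) := by
  have h := hφ.add (hψ.scalar_mul (-1))
  rwa [map_neg, map_one, neg_one_mul, ← sub_eq_add_neg] at h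

section

variable {n : ℕ} {q t : ℂ} (hq0 : q ≠ 0)

/-- The theta denominator is the product of the 1 - x_b/x_a times a unit. After removing the unit,
each coefficient in p is, at generic points, this product times the value of the operator, which is
symmetric in x. -/
theorem thetaDenom_dvd_clearedOp (hq1 : ‖q‖ < 1) (ht : t ≠ 0) (r : ℕ)
    {ψ : PowerSeries (LaurentPoly n)} (hψ : SymmSeries ψ) :
    thetaDenom n ∣ clearedOp q t hq0 r ψ := by
  obtain ⟨U, V, hU, hV⟩ := exists_unit_thetaDenom n
  have hdvd : ∀ l, ∏ ab ∈ ltPairs n, oneSubRoot ab ∣ coeff l (V * clearedOp q t hq0 r ψ) := by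
    intro l
    refine prod_oneSubRoot_dvd_of_symm hq0 hq1
      (fun x => coeff l (ellipticRuijsenaarsOp q t r (evalSeriesAt ψ) x)) ?_ ?_
    · intro σ x _
      rw [ellipticRuijsenaarsOp_comp _ _ _ _ hψ.evalSeriesAt_comp]
    · intro x hx
      rw [← coeff_evalSeriesHom, (evalSeriesHom x hx.1).map_mul,
        evalSeriesHom_clearedOp q t hq0 ht r ψ hx.1 hx.injective, hU,
        (evalSeriesHom x hx.1).map_mul]
      have h1 : evalSeriesHom x hx.1 U * evalSeriesHom x hx.1 V = 1 := by
        rw [← map_mul, hV, map_one]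
      have h2 : evalSeriesHom x hx.1 (C (∏ ab ∈ ltPairs n, oneSubRoot ab)) =
          C (∏ ab ∈ ltPairs n, (1 - x ab.2 / x ab.1)) := by
        rw [evalSeriesHom, map_C]
        congr 1
        rw [RingHom.coe_coe, map_prod]
        exact Finset.prod_congr rfl fun _ _ => evalHom_oneSubRoot _
      rw [← coeff_C_mul, h2]
      congr 1
      linear_combination (C (∏ ab ∈ ltPairs n, (1 - x ab.2 / x ab.1)) *
        ellipticRuijsenaarsOp q t r (evalSeriesAt ψ) x) * h1
  choose w hw using hdvd
  refine ⟨PowerSeries.mk w, ?_⟩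
  have h3 : V * clearedOp q t hq0 r ψ =
      C (∏ ab ∈ ltPairs n, oneSubRoot ab) * PowerSeries.mk w := by
    ext1 l
    rw [coeff_C_mul, coeff_mk, hw]
  rw [hU]
  linear_combination U * h3 - clearedOp q t hq0 r ψ * hV

variable (t) in
open Classical in
/-- The elliptic Ruijsenaars operator on symmetric series of Laurent polynomials. -/
noncomputable def ellipticOp (r : ℕ) (ψ : PowerSeries (LaurentPoly n)) :
    PowerSeries (LaurentPoly n) :=
  if h : thetaDenom n ∣ clearedOp q t hq0 r ψ then h.choose else 0

theorem thetaDenom_mul_ellipticOp (hq1 : ‖q‖ < 1) (ht : t ≠ 0) (r : ℕ)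
    {ψ : PowerSeries (LaurentPoly n)} (hψ : SymmSeries ψ) :
    thetaDenom n * ellipticOp t hq0 r ψ = clearedOp q t hq0 r ψ := by
  have h := thetaDenom_dvd_clearedOp hq0 hq1 ht r hψ
  rw [ellipticOp, dif_pos h]
  exact h.choose_spec.symm

theorem evalSeriesHom_thetaDenom_ne_zero {x : Fin n → ℂ} (hx : ∀ i, x i ≠ 0)
    (hinj : Function.Injective x) : evalSeriesHom x hx (thetaDenom n) ≠ 0 := by
  rw [thetaDenom, map_prod]
  refine Finset.prod_ne_zero_iff.2 fun ab hab => ?_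
  rw [evalSeriesHom_thetaMono, one_mul]
  refine thetaHat_ne_zero ?_
  rw [ne_eq, div_eq_one_iff_eq (hx _)]
  intro h
  exact ((Finset.mem_filter.1 hab).2).ne (hinj h).symm

theorem evalSeriesAt_ellipticOp (hq1 : ‖q‖ < 1) (ht : t ≠ 0) (r : ℕ)
    {ψ : PowerSeries (LaurentPoly n)} (hψ : SymmSeries ψ) {x : Fin n → ℂ} (hx : ∀ i, x i ≠ 0)
    (hinj : Function.Injective x) :
    evalSeriesAt (ellipticOp t hq0 r ψ) x = ellipticRuijsenaarsOp q t r (evalSeriesAt ψ) x := by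
  have h := congrArg (evalSeriesHom x hx) (thetaDenom_mul_ellipticOp hq0 hq1 ht r hψ)
  rw [map_mul, evalSeriesHom_clearedOp q t hq0 ht r ψ hx hinj] at h
  rw [← evalSeriesHom_apply hx]
  exact mul_left_cancel₀ (evalSeriesHom_thetaDenom_ne_zero hx hinj) h

theorem SymmSeries.ellipticOp (hq1 : ‖q‖ < 1) (ht : t ≠ 0) (r : ℕ)
    {ψ : PowerSeries (LaurentPoly n)} (hψ : SymmSeries ψ) : SymmSeries (ellipticOp t hq0 r ψ) := by
  intro k
  refine LaurentPoly.isSymm_of_generic hq0 hq1 fun σ x hx => ?_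
  have h1 := evalSeriesAt_ellipticOp hq0 hq1 ht r hψ (hx.comp σ).1 (hx.comp σ).injective
  have h2 := evalSeriesAt_ellipticOp hq0 hq1 ht r hψ hx.1 hx.injective
  rw [ellipticRuijsenaarsOp_comp _ _ _ _ hψ.evalSeriesAt_comp, ← h2] at h1
  simpa [evalSeriesAt] using congrArg (coeff k) h1

/-- The bridge between the pointwise eigenvalue equations of the theorem and algebra in power series
of Laurent polynomials. -/
theorem ellipticOp_eq_iff (hq1 : ‖q‖ < 1) (ht : t ≠ 0) (r : ℕ)
    {ψ G : PowerSeries (LaurentPoly n)} (hψ : SymmSeries ψ) :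
    ellipticOp t hq0 r ψ = G ↔ ∀ x : Fin n → ℂ, (∀ i, x i ≠ 0) → Function.Injective x →
      ellipticRuijsenaarsOp q t r (evalSeriesAt ψ) x = evalSeriesAt G x := by
  constructor
  · rintro rfl x hx hinj
    exact (evalSeriesAt_ellipticOp hq0 hq1 ht r hψ hx hinj).symm
  · intro h
    refine series_eq_of_generic hq0 hq1 fun x hx => ?_
    rw [evalSeriesAt_ellipticOp hq0 hq1 ht r hψ hx.1 hx.injective, h x hx.1 hx.injective]

theorem thetaDenom_ne_zero : thetaDenom n ≠ 0 := by
  intro h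
  have hx : ∀ i : Fin n, ((i : ℂ) + 1) ≠ 0 := fun i => Nat.cast_add_one_ne_zero _
  refine evalSeriesHom_thetaDenom_ne_zero hx ?_ (by rw [h, map_zero])
  intro i j hij
  simpa [Fin.ext_iff] using hij

theorem ellipticOp_add (hq1 : ‖q‖ < 1) (ht : t ≠ 0) (r : ℕ)
    {φ ψ : PowerSeries (LaurentPoly n)} (hφ : SymmSeries φ) (hψ : SymmSeries ψ) :
    ellipticOp t hq0 r (φ + ψ) = ellipticOp t hq0 r φ + ellipticOp t hq0 r ψ := by
  refine mul_left_cancel₀ thetaDenom_ne_zero ?_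
  rw [thetaDenom_mul_ellipticOp hq0 hq1 ht r (hφ.add hψ), mul_add,
    thetaDenom_mul_ellipticOp hq0 hq1 ht r hφ, thetaDenom_mul_ellipticOp hq0 hq1 ht r hψ,
    clearedOp_add]

theorem ellipticOp_scalarSeries_mul (hq1 : ‖q‖ < 1) (ht : t ≠ 0) (r : ℕ) (c : PowerSeries ℂ)
    {ψ : PowerSeries (LaurentPoly n)} (hψ : SymmSeries ψ) :
    ellipticOp t hq0 r (scalarSeries n c * ψ) = scalarSeries n c * ellipticOp t hq0 r ψ := by
  refine mul_left_cancel₀ thetaDenom_ne_zero ?_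
  rw [thetaDenom_mul_ellipticOp hq0 hq1 ht r (hψ.scalar_mul c), mul_left_comm,
    thetaDenom_mul_ellipticOp hq0 hq1 ht r hψ, clearedOp_scalarSeries_mul]

theorem ellipticOp_sub (hq1 : ‖q‖ < 1) (ht : t ≠ 0) (r : ℕ)
    {φ ψ : PowerSeries (LaurentPoly n)} (hφ : SymmSeries φ) (hψ : SymmSeries ψ) :
    ellipticOp t hq0 r (φ - ψ) = ellipticOp t hq0 r φ - ellipticOp t hq0 r ψ := by
  have h := ellipticOp_add hq0 hq1 ht r (hφ.sub hψ) hψ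
  rw [sub_add_cancel] at h
  rw [h, add_sub_cancel_right]

theorem zpow_ne_one_of_norm_lt_one (hq1 : ‖q‖ < 1) (m : ℤ) (hm : m ≠ 0) : q ^ m ≠ 1 := by
  intro h
  have h1 := congrArg norm h
  rw [norm_zpow, norm_one] at h1
  rcases zpow_eq_one_iff_of_ne_zero₀ hm |>.1 h1 with h2 | h2
  · exact hq1.ne h2
  · linarith [norm_nonneg q, h2.1]

theorem ellipticOp_comm (hq1 : ‖q‖ < 1) (ht : t ≠ 0) (r s : ℕ)
    {ψ : PowerSeries (LaurentPoly n)} (hψ : SymmSeries ψ) :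
    ellipticOp t hq0 r (ellipticOp t hq0 s ψ) = ellipticOp t hq0 s (ellipticOp t hq0 r ψ) := by
  refine series_eq_of_generic hq0 hq1 fun x hx => ?_
  have key : ∀ r s : ℕ, evalSeriesAt (ellipticOp t hq0 r (ellipticOp t hq0 s ψ)) x =
      ellipticRuijsenaarsOp q t r (ellipticRuijsenaarsOp q t s (evalSeriesAt ψ)) x := by
    intro r s
    rw [evalSeriesAt_ellipticOp hq0 hq1 ht r (hψ.ellipticOp hq0 hq1 ht s) hx.1 hx.injective,
      ellipticRuijsenaarsOp, ellipticRuijsenaarsOp]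
    congr 1
    refine Finset.sum_congr rfl fun I _ => ?_
    have hx' := hx.qShift hq0 I
    rw [evalSeriesAt_ellipticOp hq0 hq1 ht s hψ hx'.1 hx'.injective]
  rw [key, key]
  exact ellipticRuijsenaarsOp_comm hq0 ht (fun m hm => zpow_ne_one_of_norm_lt_one hq1 m hm)
    r s _ hx

end

/-! ### The dominance cone and triangularity -/

/-- The partial sums `β_1 + … + β_i`. -/
def partialSum {n : ℕ} (i : Fin n) : (Fin n → ℤ) →+ ℤ where
  toFun β := ∑ j ∈ Finset.Iic i, β j
  map_zero' := by simp
  map_add' β γ := by simp [Finset.sum_add_distrib]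

theorem partialSum_apply {n : ℕ} (i : Fin n) (β : Fin n → ℤ) :
    partialSum i β = ∑ j ∈ Finset.Iic i, β j := rfl

theorem eq_of_partialSum_eq {n : ℕ} {β γ : Fin n → ℤ}
    (h : ∀ i, partialSum i β = partialSum i γ) : β = γ := by
  suffices ∀ i, ∀ j ≤ i, β j = γ j from funext fun i => this i i le_rfl
  intro i
  induction i using WellFoundedLT.induction with
  | ind i ih =>
    intro j hj
    rcases hj.lt_or_eq with hj | rfl
    · exact ih j hj j le_rfl
    · have h1 := h j
      rw [partialSum_apply, partialSum_apply, ← Finset.Iio_insert, Finset.sum_insert (by simp),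
        Finset.sum_insert (by simp)] at h1
      have h2 : ∑ k ∈ Finset.Iio j, β k = ∑ k ∈ Finset.Iio j, γ k :=
        Finset.sum_congr rfl fun k hk => ih k (Finset.mem_Iio.1 hk) k le_rfl
      linarith

/-- The exponents `(l, β)` of total degree `0` in `x` with partial sums of `β` at most `l`. -/
def cone (n : ℕ) : AddSubmonoid (ℤ × (Fin n → ℤ)) where
  carrier := {s | 0 ≤ s.1 ∧ ∑ j, s.2 j = 0 ∧ ∀ i, partialSum i s.2 ≤ s.1}
  zero_mem' := by simp
  add_mem' := by
    rintro a b ⟨ha, ha', ha''⟩ ⟨hb, hb', hb''⟩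
    refine ⟨add_nonneg ha hb, ?_, fun i => ?_⟩
    · rw [Prod.snd_add]
      simp only [Pi.add_apply, Finset.sum_add_distrib, ha', hb', add_zero]
    · rw [Prod.snd_add, map_add]
      exact add_le_add (ha'' i) (hb'' i)

/-- The height of an exponent. -/
def height (n : ℕ) : ℤ × (Fin n → ℤ) →+ ℤ where
  -- For n > 0 the last partial sum already contributes l on the cone. The separate summand keeps
  -- the height definite for n = 0 and gives `fst_le_height` at once.
  toFun s := s.1 + ∑ i : Fin n, (s.1 - partialSum i s.2)
  map_zero' := by simp
  map_add' s s' := by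
    simp only [Prod.fst_add, Prod.snd_add, map_add]
    rw [show ∑ i : Fin n, (s.1 + s'.1 - (partialSum i s.2 + partialSum i s'.2)) =
      ∑ i : Fin n, ((s.1 - partialSum i s.2) + (s'.1 - partialSum i s'.2)) from
      Finset.sum_congr rfl fun i _ => by ring, Finset.sum_add_distrib]
    ring

theorem height_apply {n : ℕ} (s : ℤ × (Fin n → ℤ)) :
    height n s = s.1 + ∑ i : Fin n, (s.1 - partialSum i s.2) := rfl

theorem height_nonneg {n : ℕ} {s : ℤ × (Fin n → ℤ)} (hs : s ∈ cone n) : 0 ≤ height n s :=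
  add_nonneg hs.1 (Finset.sum_nonneg fun i _ => sub_nonneg.2 (hs.2.2 i))

theorem fst_le_height {n : ℕ} {s : ℤ × (Fin n → ℤ)} (hs : s ∈ cone n) : s.1 ≤ height n s :=
  le_add_of_nonneg_right (Finset.sum_nonneg fun i _ => sub_nonneg.2 (hs.2.2 i))

theorem eq_zero_of_height {n : ℕ} {s : ℤ × (Fin n → ℤ)} (hs : s ∈ cone n) (h : height n s = 0) :
    s = 0 := by
  have h0 : ∑ i : Fin n, (s.1 - partialSum i s.2) ≥ 0 :=
    Finset.sum_nonneg fun i _ => sub_nonneg.2 (hs.2.2 i)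
  have h1 : s.1 = 0 := le_antisymm ((fst_le_height hs).trans h.le) hs.1
  have h2 : ∑ i : Fin n, (s.1 - partialSum i s.2) = 0 := by
    rw [height_apply, h1] at h
    simpa [h1] using h
  rw [Finset.sum_eq_zero_iff_of_nonneg fun i _ => sub_nonneg.2 (hs.2.2 i)] at h2
  refine Prod.ext h1 (eq_of_partialSum_eq fun i => ?_)
  have := h2 i (Finset.mem_univ i)
  rw [h1] at this
  rw [Prod.snd_zero, map_zero]
  linarith

theorem height_pos {n : ℕ} {s : ℤ × (Fin n → ℤ)} (hs : s ∈ cone n) (h : s ≠ 0) : 0 < height n s :=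
  (height_nonneg hs).lt_of_ne fun h' => h (eq_zero_of_height hs h'.symm)

/-- The series is supported in the cone. -/
def ConeSupported {n : ℕ} (F : PowerSeries (LaurentPoly n)) : Prop :=
  ∀ s, biCoeff F s ≠ 0 → s ∈ cone n

/-- In the convolution a nonzero s in the support of F looks at G at a - s, strictly above a in the
cone order, where G vanishes by assumption. -/
theorem biCoeff_cone_mul {n : ℕ} {F G : PowerSeries (LaurentPoly n)} (hF : ConeSupported F)
    {a : ℤ × (Fin n → ℤ)} (h : ∀ b, a - b ∈ cone n → b ≠ a → biCoeff G b = 0) :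
    biCoeff (F * G) a = biCoeff F 0 * biCoeff G a := by
  rw [biCoeff_mul, finsum_eq_single _ 0, sub_zero]
  intro s hs
  by_cases h0 : biCoeff F s = 0
  · rw [h0, zero_mul]
  · rw [h (a - s) (by rw [sub_sub_cancel]; exact hF s h0) (by simpa using hs), mul_zero]

theorem ConeSupported.mul {n : ℕ} {F G : PowerSeries (LaurentPoly n)} (hF : ConeSupported F)
    (hG : ConeSupported G) : ConeSupported (F * G) := by
  intro s hs
  by_contra hcone
  apply hs
  rw [biCoeff_mul, finsum_eq_zero_of_forall_eq_zero]
  intro a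
  by_contra h
  have h1 := hF a (left_ne_zero_of_mul h)
  have h2 := hG _ (right_ne_zero_of_mul h)
  exact hcone (by simpa using add_mem h1 h2)

theorem biCoeff_zero_mul {n : ℕ} {F G : PowerSeries (LaurentPoly n)} (hF : ConeSupported F)
    (hG : ConeSupported G) : biCoeff (F * G) 0 = biCoeff F 0 * biCoeff G 0 := by
  refine biCoeff_cone_mul hF fun b hb hb0 => ?_
  by_contra h
  have h1 := height_pos (hG b h) hb0
  have h2 := height_nonneg hb
  rw [zero_sub, map_neg] at h2
  linarith

theorem finite_biCoeff_ne_zero {n : ℕ} (G : PowerSeries (LaurentPoly n)) (k : ℤ) :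
    {b : ℤ × (Fin n → ℤ) | b.1 ≤ k ∧ biCoeff G b ≠ 0}.Finite := by
  have : (⋃ i ∈ (Finset.range (k.toNat + 1) : Set ℕ),
      (Prod.mk (i : ℤ)) '' ((coeff i G).coeff.support : Set (Fin n → ℤ))).Finite :=
    Set.Finite.biUnion (Finset.finite_toSet _) fun i _ => (Finset.finite_toSet _).image _
  refine this.subset fun a ha => ?_
  have h1 : 0 ≤ a.1 := by
    by_contra! h
    exact ha.2 (biCoeff_of_neg G h)
  have h2 := ha.1
  simp only [Set.mem_iUnion, Set.mem_image]
  refine ⟨a.1.toNat, ?_, a.2, ?_, ?_⟩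
  · rw [Finset.mem_coe, Finset.mem_range]
    omega
  · rw [Finset.mem_coe, Finsupp.mem_support_iff]
    have := ha.2
    rwa [biCoeff, if_pos h1] at this
  · ext
    · simp [h1]
    · rfl

/-- Division by a series with leading coefficient `1` respects the cone. -/
theorem biCoeff_of_cone_mul {n : ℕ} {F G : PowerSeries (LaurentPoly n)} (hF : ConeSupported F)
    (hF0 : biCoeff F 0 = 1) {a : ℤ × (Fin n → ℤ)}
    (h : ∀ b, a - b ∈ cone n → b ≠ a → biCoeff (F * G) b = 0) :
    (∀ b, a - b ∈ cone n → b ≠ a → biCoeff G b = 0) ∧ biCoeff G a = biCoeff (F * G) a := by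
  have key : ∀ b, a - b ∈ cone n → b ≠ a → biCoeff G b = 0 := by
    by_contra! hbad
    have hfin : {b | a - b ∈ cone n ∧ b ≠ a ∧ biCoeff G b ≠ 0}.Finite := by
      refine (finite_biCoeff_ne_zero G a.1).subset fun b hb => ⟨?_, hb.2.2⟩
      have := hb.1.1
      rw [Prod.fst_sub] at this
      linarith
    obtain ⟨b₀, hb₀⟩ := hbad
    -- Among the nonzero coefficients of G above a choose one at maximal height distance. Nothing
    -- above b survives, so F G and G agree at b, contrary to the hypothesis. Finiteness holds since
    -- the order in p is bounded by that of a.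
    obtain ⟨b, hb, hmax⟩ := Set.exists_max_image _ (fun b => height n (a - b)) hfin ⟨b₀, hb₀⟩
    have h1 : biCoeff (F * G) b = biCoeff F 0 * biCoeff G b := by
      refine biCoeff_cone_mul hF fun b' hb' hne => ?_
      by_contra h0
      have hsum : a - b' = (a - b) + (b - b') := by abel
      have hpos := height_pos hb' (sub_ne_zero.2 hne.symm)
      have hab := height_nonneg hb.1
      have hht : height n (a - b') = height n (a - b) + height n (b - b') := by rw [hsum, map_add]
      have := hmax b' ⟨by rw [hsum]; exact add_mem hb.1 hb', fun h' => ?_, h0⟩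
      · rw [hht] at this
        linarith
      · rw [h', sub_self, map_zero] at hht
        rw [h'] at hpos
        linarith
    rw [h b hb.1 hb.2.1, hF0, one_mul] at h1
    exact hb.2.2 h1.symm
  exact ⟨key, by rw [biCoeff_cone_mul hF key, hF0, one_mul]⟩

/-! ### Leading coefficients -/

theorem partialSum_rootExp {n : ℕ} (i : Fin n) (ab : Fin n × Fin n) :
    partialSum i (rootExp ab) = (if ab.2 ≤ i then 1 else 0) - if ab.1 ≤ i then 1 else 0 := by
  rw [rootExp, map_sub, partialSum_apply, partialSum_apply]
  simp [Pi.single_apply]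

theorem sum_rootExp {n : ℕ} (ab : Fin n × Fin n) : ∑ j, rootExp ab j = 0 := by
  simp [rootExp, Finset.sum_sub_distrib]

theorem biCoeff_thetaMono {n : ℕ} (c : ℂ) {ab : Fin n × Fin n} {s : ℤ × (Fin n → ℤ)}
    (hs : biCoeff (thetaMono c ab) s ≠ 0) :
    ∃ m : ℤ, s.2 = m • rootExp ab ∧ m * (m - 1) = 2 * s.1 := by
  have h1 : 0 ≤ s.1 := by
    by_contra! h
    exact hs (biCoeff_of_neg _ h)
  rw [biCoeff, if_pos h1, thetaMono, thetaSeries, coeff_mk, AddMonoidAlgebra.coeff_sum,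
    Finsupp.finsetSum_apply] at hs
  obtain ⟨m, hm, hne⟩ := Finset.exists_ne_zero_of_sum_ne_zero hs
  rw [Finset.mem_filter, Int.toNat_of_nonneg h1] at hm
  refine ⟨m, ?_, hm.2⟩
  by_contra h
  rw [AddMonoidAlgebra.coeff_single, Finsupp.single_eq_of_ne h] at hne
  exact hne rfl

/-- The term with index m has partial sums -m between a and b and 0 elsewhere, and -m ≤ m(m-1)/2 for
every integer m. -/
theorem coneSupported_thetaMono {n : ℕ} (c : ℂ) {ab : Fin n × Fin n} (hab : ab ∈ ltPairs n) :
    ConeSupported (thetaMono c ab) := by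
  intro s hs
  have h1 : 0 ≤ s.1 := by
    by_contra! h
    exact hs (biCoeff_of_neg _ h)
  obtain ⟨m, hm, hl⟩ := biCoeff_thetaMono c hs
  have hml := mem_Icc_of_triangular (m := m) (l := s.1.toNat) (by rw [Int.toNat_of_nonneg h1]; exact hl)
  rw [Int.toNat_of_nonneg h1, Finset.mem_Icc] at hml
  have hlt := (Finset.mem_filter.1 hab).2
  refine ⟨h1, ?_, fun i => ?_⟩
  · rw [hm]
    simp only [Pi.smul_apply, smul_eq_mul, ← Finset.mul_sum, sum_rootExp, mul_zero]
  · rw [hm, map_zsmul, partialSum_rootExp, smul_eq_mul]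
    by_cases h2 : ab.2 ≤ i
    · rw [if_pos h2, if_pos (hlt.le.trans h2)]
      simpa using h1
    · rw [if_neg h2]
      split_ifs
      · linarith
      · simpa using h1

theorem rootExp_ne_zero {n : ℕ} {ab : Fin n × Fin n} (hab : ab ∈ ltPairs n) : rootExp ab ≠ 0 := by
  intro h
  have := congrFun h ab.2
  rw [rootExp, Pi.sub_apply, Pi.single_eq_same,
    Pi.single_eq_of_ne ((Finset.mem_filter.1 hab).2).ne'] at this
  simp at this

theorem biCoeff_zero_thetaMono {n : ℕ} (c : ℂ) {ab : Fin n × Fin n} (hab : ab ∈ ltPairs n) :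
    biCoeff (thetaMono c ab) 0 = 1 := by
  rw [biCoeff, if_pos (by simp), Prod.fst_zero, Int.toNat_zero, thetaMono, coeff_zero_thetaSeries,
    AddMonoidAlgebra.coeff_add, Finsupp.add_apply, AddMonoidAlgebra.coeff_single,
    AddMonoidAlgebra.coeff_single, one_smul, zero_smul, Prod.snd_zero, Finsupp.single_eq_same,
    Finsupp.single_eq_of_ne (rootExp_ne_zero hab).symm]
  simp

theorem biCoeff_scalarSeries_C_mul {n : ℕ} (c : ℂ) (F : PowerSeries (LaurentPoly n))
    (s : ℤ × (Fin n → ℤ)) : biCoeff (scalarSeries n (C c) * F) s = c * biCoeff F s := by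
  rw [biCoeff, biCoeff]
  split_ifs
  · rw [coeff_scalarSeries_C_mul]
  · rw [mul_zero]

theorem ConeSupported.C_mul {n : ℕ} {F : PowerSeries (LaurentPoly n)} (hF : ConeSupported F)
    (c : ℂ) : ConeSupported (scalarSeries n (C c) * F) := by
  intro s hs
  rw [biCoeff_scalarSeries_C_mul] at hs
  exact hF s (right_ne_zero_of_mul hs)

theorem biCoeff_one {n : ℕ} (s : ℤ × (Fin n → ℤ)) :
    biCoeff (1 : PowerSeries (LaurentPoly n)) s = if s = 0 then 1 else 0 := by
  rw [biCoeff]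
  by_cases hs : s = 0
  · rw [hs, if_pos (by simp), if_pos rfl, Prod.fst_zero, Int.toNat_zero, coeff_zero_one]
    simp [AddMonoidAlgebra.one_def]
  · rw [if_neg hs]
    split_ifs with h
    · rw [coeff_one]
      split_ifs with h1
      · rw [AddMonoidAlgebra.one_def, AddMonoidAlgebra.coeff_single, Finsupp.single_eq_of_ne]
        intro h2
        exact hs (Prod.ext (by rw [Prod.fst_zero]; omega) h2)
      · rfl
    · rfl

theorem coneSupported_prod {n : ℕ} {ι : Type*} (A : Finset ι)
    (F : ι → PowerSeries (LaurentPoly n)) (hF : ∀ i ∈ A, ConeSupported (F i)) :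
    ConeSupported (∏ i ∈ A, F i) ∧ biCoeff (∏ i ∈ A, F i) 0 = ∏ i ∈ A, biCoeff (F i) 0 := by
  classical
  induction A using Finset.induction_on with
  | empty =>
    refine ⟨fun s hs => ?_, ?_⟩
    · rw [Finset.prod_empty, biCoeff_one] at hs
      rw [show s = 0 by by_contra h; simp [h] at hs]
      exact zero_mem _
    · simp [biCoeff_one]
  | insert i A hi ih =>
    have h1 := ih fun j hj => hF j (Finset.mem_insert_of_mem hj)
    have h2 := hF i (Finset.mem_insert_self _ _)
    rw [Finset.prod_insert hi, Finset.prod_insert hi]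
    exact ⟨h2.mul h1.1, by rw [biCoeff_zero_mul h2 h1.1, h1.2]⟩

theorem coneSupported_thetaDenom (n : ℕ) : ConeSupported (thetaDenom n) :=
  (coneSupported_prod _ _ fun _ hab => coneSupported_thetaMono _ hab).1

theorem biCoeff_zero_thetaDenom (n : ℕ) : biCoeff (thetaDenom n) 0 = 1 := by
  rw [thetaDenom, (coneSupported_prod _ _ fun _ hab => coneSupported_thetaMono _ hab).2]
  exact Finset.prod_eq_one fun ab hab => biCoeff_zero_thetaMono 1 hab

theorem coneSupported_numFactor {n : ℕ} (t : ℂ) (I : Finset (Fin n)) {ab : Fin n × Fin n}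
    (hab : ab ∈ ltPairs n) : ConeSupported (numFactor t I ab) := by
  rw [numFactor]
  split_ifs
  · exact (coneSupported_thetaMono _ hab).C_mul t
  · exact coneSupported_thetaMono _ hab
  · exact coneSupported_thetaMono _ hab

theorem coneSupported_thetaNum {n : ℕ} (t : ℂ) (I : Finset (Fin n)) :
    ConeSupported (thetaNum t I) :=
  (coneSupported_prod _ _ fun _ hab => coneSupported_numFactor t I hab).1

theorem biCoeff_zero_thetaNum {n : ℕ} (t : ℂ) (I : Finset (Fin n)) :
    biCoeff (thetaNum t I) 0 = ∏ ab ∈ ltPairs n, if ab.1 ∈ I ∧ ab.2 ∉ I then t else 1 := by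
  rw [thetaNum, (coneSupported_prod _ _ fun _ hab => coneSupported_numFactor t I hab).2]
  refine Finset.prod_congr rfl fun ab hab => ?_
  rw [numFactor]
  split_ifs
  · rw [biCoeff_scalarSeries_C_mul, biCoeff_zero_thetaMono _ hab, mul_one]
  · exact biCoeff_zero_thetaMono _ hab
  · exact biCoeff_zero_thetaMono _ hab

theorem card_ltPairs_filter {n : ℕ} (I : Finset (Fin n)) :
    ((ltPairs n).filter fun ab => ab.1 ∈ I ∧ ab.2 ∈ I).card = I.card.choose 2 := by
  have h1 : I.offDiag.card = ((ltPairs n).filter fun ab => ab.1 ∈ I ∧ ab.2 ∈ I).card +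
      (((ltPairs n).filter fun ab => ab.1 ∈ I ∧ ab.2 ∈ I).map
        (Equiv.prodComm (Fin n) (Fin n)).toEmbedding).card := by
    rw [← Finset.card_union_of_disjoint]
    · congr 1
      ext ab
      simp only [Finset.mem_offDiag, ltPairs, Finset.mem_union, Finset.mem_map_equiv,
        Finset.mem_filter, Finset.mem_univ, true_and, Equiv.prodComm_symm, Equiv.prodComm_apply,
        Prod.fst_swap, Prod.snd_swap]
      constructor
      · rintro ⟨h1, h2, h3⟩
        rcases lt_or_gt_of_ne h3 with h | h
        · exact Or.inl ⟨h, h1, h2⟩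
        · exact Or.inr ⟨h, h2, h1⟩
      · rintro (⟨h, h1, h2⟩ | ⟨h, h1, h2⟩)
        · exact ⟨h1, h2, h.ne⟩
        · exact ⟨h2, h1, h.ne'⟩
    · rw [Finset.disjoint_left]
      intro ab h1 h2
      simp only [Finset.mem_map_equiv, ltPairs, Finset.mem_filter, Finset.mem_univ, true_and,
        Equiv.prodComm_symm, Equiv.prodComm_apply, Prod.fst_swap, Prod.snd_swap] at h1 h2
      exact absurd h1.1 (not_lt.2 h2.1.le)
  rw [Finset.offDiag_card, Finset.card_map] at h1
  rw [Nat.choose_two_right, Nat.mul_sub_one]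
  omega

/-- The binomial coefficient counts the pairs a < b inside I and the product those with a in I and b
outside. Together each i in I is counted once for every j > i. -/
theorem leading_eq_prod {n : ℕ} (t : ℂ) (I : Finset (Fin n)) :
    t ^ I.card.choose 2 * ∏ ab ∈ ltPairs n, (if ab.1 ∈ I ∧ ab.2 ∉ I then t else 1) =
      ∏ i ∈ I, t ^ (n - 1 - (i : ℕ)) := by
  rw [← card_ltPairs_filter, ← Finset.prod_const, Finset.prod_filter, ← Finset.prod_mul_distrib]
  have h1 : ∏ i ∈ I, t ^ (n - 1 - (i : ℕ)) = ∏ i ∈ I, ∏ _j ∈ Finset.Ioi i, t := by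
    refine Finset.prod_congr rfl fun i _ => ?_
    rw [Finset.prod_const, Fin.card_Ioi]
  rw [h1, Finset.prod_sigma']
  have h2 : ∏ ab ∈ ltPairs n, ((if ab.1 ∈ I ∧ ab.2 ∈ I then t else 1) *
      if ab.1 ∈ I ∧ ab.2 ∉ I then t else 1) = ∏ ab ∈ ltPairs n, if ab.1 ∈ I then t else 1 := by
    refine Finset.prod_congr rfl fun ab _ => ?_
    by_cases ha : ab.1 ∈ I <;> by_cases hb : ab.2 ∈ I <;> simp [ha, hb]
  rw [h2, ← Finset.prod_filter]
  refine Finset.prod_nbij' (fun p => ⟨p.1, p.2⟩) (fun p => (p.1, p.2)) ?_ ?_ ?_ ?_ ?_ <;>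
    simp +contextual [ltPairs]

section

variable {n : ℕ} {q t : ℂ} (hq0 : q ≠ 0)

theorem biCoeff_shiftSeries (I : Finset (Fin n)) (ψ : PowerSeries (LaurentPoly n))
    (a : ℤ × (Fin n → ℤ)) :
    biCoeff (shiftSeries q hq0 I ψ) a = q ^ (∑ i ∈ I, a.2 i) * biCoeff ψ a := by
  rw [biCoeff, biCoeff]
  split_ifs
  · rw [coeff_shiftSeries, coeff_shiftHom]
  · rw [mul_zero]

include hq0 in
theorem macdonaldEigenvalue_eq_sum_leading (r : ℕ) (μ : Fin n → ℤ) :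
    macdonaldEigenvalue q t μ r = ∑ I ∈ Finset.powersetCard r (Finset.univ : Finset (Fin n)),
      t ^ r.choose 2 * (biCoeff (thetaNum t I) 0 * q ^ (∑ i ∈ I, μ i)) := by
  rw [macdonaldEigenvalue]
  refine Finset.sum_congr rfl fun I hI => ?_
  rw [biCoeff_zero_thetaNum, Finset.prod_mul_distrib, ← leading_eq_prod,
    (Finset.mem_powersetCard.1 hI).2, ← mul_assoc]
  congr 1
  clear hI
  induction I using Finset.induction_on with
  | empty => simp
  | insert i J hi ih => rw [Finset.prod_insert hi, Finset.sum_insert hi, zpow_add₀ hq0, ih]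

theorem biCoeff_clearedOp (r : ℕ) {ψ : PowerSeries (LaurentPoly n)} {a : ℤ × (Fin n → ℤ)}
    (h : ∀ b, a - b ∈ cone n → b ≠ a → biCoeff ψ b = 0) :
    biCoeff (clearedOp q t hq0 r ψ) a = macdonaldEigenvalue q t a.2 r * biCoeff ψ a := by
  rw [clearedOp, biCoeff_sum, macdonaldEigenvalue_eq_sum_leading hq0, Finset.sum_mul]
  refine Finset.sum_congr rfl fun I _ => ?_
  rw [mul_assoc, biCoeff_scalarSeries_C_mul, biCoeff_cone_mul (coneSupported_thetaNum t I),
    biCoeff_shiftSeries]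
  · ring
  · intro b hb hne
    rw [biCoeff_shiftSeries, h b hb hne, mul_zero]

/-- Triangularity of the elliptic operator. -/
theorem biCoeff_ellipticOp (hq1 : ‖q‖ < 1) (ht : t ≠ 0) (r : ℕ)
    {ψ : PowerSeries (LaurentPoly n)} (hψ : SymmSeries ψ) {a : ℤ × (Fin n → ℤ)}
    (h : ∀ b, a - b ∈ cone n → b ≠ a → biCoeff ψ b = 0) :
    biCoeff (ellipticOp t hq0 r ψ) a = macdonaldEigenvalue q t a.2 r * biCoeff ψ a := by
  have hD := thetaDenom_mul_ellipticOp hq0 hq1 ht r hψ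
  rw [(biCoeff_of_cone_mul (coneSupported_thetaDenom n) (biCoeff_zero_thetaDenom n) ?_).2, hD,
    biCoeff_clearedOp hq0 r h]
  intro b hb hne
  rw [hD, biCoeff_clearedOp hq0 r, h b hb hne, mul_zero]
  intro b' hb' hne'
  have hsum : a - b' = (a - b) + (b - b') := by abel
  refine h b' (by rw [hsum]; exact add_mem hb hb') fun h' => ?_
  have h1 := height_pos hb' (sub_ne_zero.2 hne'.symm)
  have h2 := height_nonneg hb
  rw [h', ← neg_sub, map_neg] at h1
  linarith

/-- The elliptic operator preserves the translates of the cone. -/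
theorem ellipticOp_supported (hq1 : ‖q‖ < 1) (ht : t ≠ 0) (r : ℕ)
    {ψ : PowerSeries (LaurentPoly n)} (hψ : SymmSeries ψ) {c : ℤ × (Fin n → ℤ)}
    (h : ∀ b, biCoeff ψ b ≠ 0 → b - c ∈ cone n) (a : ℤ × (Fin n → ℤ))
    (ha : biCoeff (ellipticOp t hq0 r ψ) a ≠ 0) : a - c ∈ cone n := by
  by_contra hac
  have key : ∀ b, a - b ∈ cone n → biCoeff ψ b = 0 := by
    intro b hb
    by_contra h0
    exact hac (by simpa using add_mem hb (h b h0))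
  rw [biCoeff_ellipticOp hq0 hq1 ht r hψ fun b hb _ => key b hb,
    key a (by rw [sub_self]; exact zero_mem _), mul_zero] at ha
  exact ha rfl

end

/-! ### Separation of the eigenvalues -/

theorem sum_neg_pow_mul_macdonaldEigenvalue {n : ℕ} (q t u : ℂ) (μ : Fin n → ℤ) :
    ∑ r ∈ Finset.range (n + 1), (-u) ^ r * macdonaldEigenvalue q t μ r =
      ∏ j : Fin n, (1 - u * (t ^ (n - 1 - (j : ℕ)) * q ^ μ j)) := by
  have h := Finset.prod_one_add (f := fun j : Fin n => -u * (t ^ (n - 1 - (j : ℕ)) * q ^ μ j))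
    Finset.univ
  simp only [neg_mul, ← sub_eq_add_neg] at h
  rw [h, Finset.sum_powerset, Finset.card_univ, Fintype.card_fin]
  refine Finset.sum_congr rfl fun r _ => ?_
  rw [macdonaldEigenvalue, Finset.mul_sum]
  refine Finset.sum_congr rfl fun I hI => ?_
  rw [← (Finset.mem_powersetCard.1 hI).2, ← Finset.prod_const, ← Finset.prod_mul_distrib]
  exact Finset.prod_congr rfl fun i _ => by ring

/-- A zero would mean t^{n-1-i} q^{λ_i} = t^{n-1-j} q^{μ_j}. For i ≠ j some power t^k with 1 ≤ k ≤ n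
- 1 would be a power of q; for i = j a nonzero power of q would be 1. -/
theorem one_sub_eigenFactor_ne_zero {n : ℕ} {q t : ℂ} (hq0 : q ≠ 0) (hq1 : ‖q‖ < 1) (ht0 : t ≠ 0)
    (ht : ∀ k : ℕ, 1 ≤ k → k ≤ n - 1 → ∀ m : ℤ, t ^ k ≠ q ^ m) {lam μ : Fin n → ℤ} {i : Fin n}
    (hi : μ i ≠ lam i) (j : Fin n) :
    1 - (t ^ (n - 1 - (i : ℕ)) * q ^ lam i)⁻¹ * (t ^ (n - 1 - (j : ℕ)) * q ^ μ j) ≠ 0 := by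
  have hA : t ^ (n - 1 - (i : ℕ)) * q ^ lam i ≠ 0 :=
    mul_ne_zero (pow_ne_zero _ ht0) (zpow_ne_zero _ hq0)
  rw [sub_ne_zero, ne_eq, eq_comm, inv_mul_eq_one₀ hA]
  intro h
  have hi2 := i.2
  have hj2 := j.2
  rcases lt_trichotomy (i : ℕ) j with hij | hij | hij
  · obtain ⟨k, hk⟩ : ∃ k, n - 1 - (i : ℕ) = (n - 1 - (j : ℕ)) + k := ⟨j - i, by omega⟩
    refine ht k (by omega) (by omega) (μ j - lam i) ?_
    rw [hk, pow_add, mul_assoc] at h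
    rw [zpow_sub₀ hq0, eq_div_iff (zpow_ne_zero _ hq0)]
    exact mul_left_cancel₀ (pow_ne_zero _ ht0) h
  · rw [← Fin.ext hij] at h
    have h2 := mul_left_cancel₀ (pow_ne_zero _ ht0) h
    refine zpow_ne_one_of_norm_lt_one hq1 (μ i - lam i) (sub_ne_zero.2 hi) ?_
    rw [zpow_sub₀ hq0, ← h2, div_self (zpow_ne_zero _ hq0)]
  · obtain ⟨k, hk⟩ : ∃ k, n - 1 - (j : ℕ) = (n - 1 - (i : ℕ)) + k := ⟨i - j, by omega⟩
    refine ht k (by omega) (by omega) (lam i - μ j) ?_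
    rw [hk, pow_add, mul_assoc] at h
    rw [zpow_sub₀ hq0, eq_div_iff (zpow_ne_zero _ hq0)]
    exact (mul_left_cancel₀ (pow_ne_zero _ ht0) h).symm

theorem macdonaldEigenvalue_zero {n : ℕ} (q t : ℂ) (μ : Fin n → ℤ) :
    macdonaldEigenvalue q t μ 0 = 1 := by
  simp [macdonaldEigenvalue]

theorem exists_macdonaldEigenvalue_ne {n : ℕ} {q t : ℂ} (hq0 : q ≠ 0) (hq1 : ‖q‖ < 1) (ht0 : t ≠ 0)
    (ht : ∀ k : ℕ, 1 ≤ k → k ≤ n - 1 → ∀ m : ℤ, t ^ k ≠ q ^ m) {lam μ : Fin n → ℤ}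
    (hne : μ ≠ lam) :
    ∃ r : Fin n, macdonaldEigenvalue q t μ (r + 1) ≠ macdonaldEigenvalue q t lam (r + 1) := by
  by_contra! h
  obtain ⟨i, hi⟩ := Function.ne_iff.1 hne
  -- At this u the generating polynomial of the eigenvalues vanishes for λ but not for μ.
  set u := (t ^ (n - 1 - (i : ℕ)) * q ^ lam i)⁻¹ with hu
  have h1 : ∏ j : Fin n, (1 - u * (t ^ (n - 1 - (j : ℕ)) * q ^ μ j)) ≠ 0 :=
    Finset.prod_ne_zero_iff.2 fun j _ => one_sub_eigenFactor_ne_zero hq0 hq1 ht0 ht hi j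
  have h2 : ∏ j : Fin n, (1 - u * (t ^ (n - 1 - (j : ℕ)) * q ^ lam j)) = 0 := by
    refine Finset.prod_eq_zero (Finset.mem_univ i) ?_
    rw [hu, inv_mul_cancel₀, sub_self]
    exact mul_ne_zero (pow_ne_zero _ ht0) (zpow_ne_zero _ hq0)
  apply h1
  rw [← h2, ← sum_neg_pow_mul_macdonaldEigenvalue, ← sum_neg_pow_mul_macdonaldEigenvalue]
  refine Finset.sum_congr rfl fun r hr => ?_
  rcases r with _ | r
  · rw [macdonaldEigenvalue_zero, macdonaldEigenvalue_zero]
  · rw [h ⟨r, by rw [Finset.mem_range] at hr; omega⟩]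

/-! ### The lexicographic order and monomial symmetric functions -/

/-- The lexicographic order is a total order refining the comparison of partial sums. Finite
supports thus have a single largest exponent, above which the cone order sees nothing at the same
power of p. -/
theorem toLex_le_of_partialSum_le {n : ℕ} {μ ν : Fin n → ℤ}
    (h : ∀ i, partialSum i μ ≤ partialSum i ν) : toLex μ ≤ toLex ν := by
  by_contra! hlt
  obtain ⟨i, hi, hi'⟩ := hlt
  have h1 := h i
  rw [partialSum_apply, partialSum_apply, ← Finset.Iio_insert, Finset.sum_insert (by simp),
    Finset.sum_insert (by simp)] at h1
  have h2 : ∑ k ∈ Finset.Iio i, ν k = ∑ k ∈ Finset.Iio i, μ k :=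
    Finset.sum_congr rfl fun k hk => hi k (Finset.mem_Iio.1 hk)
  have h3 : ν i < μ i := hi'
  linarith

theorem toLex_lt_comp_swap {n : ℕ} {μ : Fin n → ℤ} {a b : Fin n} (hab : a < b) (h : μ a < μ b) :
    toLex μ < toLex (μ ∘ Equiv.swap a b) := by
  refine ⟨a, fun j hj => ?_, ?_⟩
  · have hjb : j ≠ b := (hj.trans hab).ne
    change μ j = μ (Equiv.swap a b j)
    rw [Equiv.swap_apply_of_ne_of_ne hj.ne hjb]
  · change μ a < μ (Equiv.swap a b a)
    rwa [Equiv.swap_apply_left]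

/-- Exchanging the indices of A beyond i for the missing ones up to i can only increase the sum of a
decreasing sequence. In consequence a dominant vector has the largest partial sums in its orbit. -/
theorem sum_le_partialSum {n : ℕ} {μ : Fin n → ℤ} (hμ : Antitone μ) (i : Fin n)
    (A : Finset (Fin n)) (hA : A.card = (i : ℕ) + 1) : ∑ j ∈ A, μ j ≤ partialSum i μ := by
  rw [partialSum_apply, ← Finset.sum_inter_add_sum_sdiff A (Finset.Iic i),
    ← Finset.sum_inter_add_sum_sdiff (Finset.Iic i) A, Finset.inter_comm]
  have hcard : (A \ Finset.Iic i).card = (Finset.Iic i \ A).card := by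
    have h1 := Finset.card_sdiff_add_card_inter A (Finset.Iic i)
    have h2 := Finset.card_sdiff_add_card_inter (Finset.Iic i) A
    rw [Finset.inter_comm, Fin.card_Iic] at h2
    omega
  have h1 : ∑ j ∈ A \ Finset.Iic i, μ j ≤ (A \ Finset.Iic i).card • μ i := by
    refine Finset.sum_le_card_nsmul _ _ _ fun j hj => hμ ?_
    rw [Finset.mem_sdiff, Finset.mem_Iic, not_le] at hj
    exact hj.2.le
  have h2 : (Finset.Iic i \ A).card • μ i ≤ ∑ j ∈ Finset.Iic i \ A, μ j := by
    refine Finset.card_nsmul_le_sum _ _ _ fun j hj => hμ ?_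
    rw [Finset.mem_sdiff, Finset.mem_Iic] at hj
    exact hj.1
  rw [hcard] at h1
  linarith

theorem partialSum_comp {n : ℕ} (μ : Fin n → ℤ) (σ : Equiv.Perm (Fin n)) (i : Fin n) :
    partialSum i (μ ∘ σ) = ∑ j ∈ (Finset.Iic i).map σ.toEmbedding, μ j := by
  rw [Finset.sum_map, partialSum_apply]
  rfl

theorem partialSum_comp_le {n : ℕ} {μ : Fin n → ℤ} (hμ : Antitone μ) (σ : Equiv.Perm (Fin n))
    (i : Fin n) : partialSum i (μ ∘ σ) ≤ partialSum i μ := by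
  rw [partialSum_comp]
  exact sum_le_partialSum hμ i _ (by rw [Finset.card_map, Fin.card_Iic])

open Classical in
/-- The monomial symmetric function. -/
noncomputable def monomialSymm {n : ℕ} (μ : Fin n → ℤ) : LaurentPoly n :=
  ∑ ν ∈ Finset.univ.image fun σ : Equiv.Perm (Fin n) => μ ∘ σ, AddMonoidAlgebra.single ν 1

open Classical in
theorem coeff_monomialSymm {n : ℕ} (μ ν : Fin n → ℤ) :
    (monomialSymm μ).coeff ν = if ∃ σ : Equiv.Perm (Fin n), μ ∘ σ = ν then 1 else 0 := by
  rw [monomialSymm, AddMonoidAlgebra.coeff_sum, Finsupp.finsetSum_apply]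
  simp only [AddMonoidAlgebra.coeff_single, Finsupp.single_apply, Finset.sum_ite_eq',
    Finset.mem_image, Finset.mem_univ, true_and]

theorem monomialSymm_isSymm {n : ℕ} (μ : Fin n → ℤ) : (monomialSymm μ).IsSymm := by
  classical
  intro σ ν
  rw [LaurentPoly.coef, LaurentPoly.coef, coeff_monomialSymm, coeff_monomialSymm]
  refine if_congr ⟨fun ⟨τ, h⟩ => ⟨σ.symm.trans τ, ?_⟩, fun ⟨τ, h⟩ => ⟨σ.trans τ, ?_⟩⟩ rfl rfl
  · ext i
    have := congrFun h (σ.symm i)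
    simpa using this
  · ext i
    have := congrFun h (σ i)
    simpa using this

theorem symmSeries_C {n : ℕ} {f : LaurentPoly n} (hf : f.IsSymm) : SymmSeries (C f) := by
  intro k
  rw [coeff_C]
  split_ifs
  · exact hf
  · intro σ μ
    rfl

/-! ### Scalar multiples -/

theorem biCoeff_scalarSeries_of_ne {n : ℕ} (c : PowerSeries ℂ) {s : ℤ × (Fin n → ℤ)}
    (h : s.2 ≠ 0) : biCoeff (scalarSeries n c) s = 0 := by
  rw [biCoeff]
  split_ifs
  · rw [scalarSeries, coeff_map]
    change (AddMonoidAlgebra.single (0 : Fin n → ℤ) (coeff s.1.toNat c)).coeff s.2 = 0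
    rw [AddMonoidAlgebra.coeff_single, Finsupp.single_eq_of_ne h]
  · rfl

theorem biCoeff_scalarSeries_natCast {n : ℕ} (c : PowerSeries ℂ) (k : ℕ) :
    biCoeff (scalarSeries n c) ((k : ℤ), 0) = coeff k c := by
  rw [biCoeff_natCast, scalarSeries, coeff_map]
  change (AddMonoidAlgebra.single (0 : Fin n → ℤ) (coeff k c)).coeff 0 = _
  rw [AddMonoidAlgebra.coeff_single, Finsupp.single_eq_same]

theorem coneSupported_scalarSeries {n : ℕ} (c : PowerSeries ℂ) :
    ConeSupported (scalarSeries n c) := by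
  intro s hs
  have h1 : 0 ≤ s.1 := by
    by_contra! h
    exact hs (biCoeff_of_neg _ h)
  have h2 : s.2 = 0 := by
    by_contra h
    exact hs (biCoeff_scalarSeries_of_ne c h)
  refine ⟨h1, by simp [h2], fun i => ?_⟩
  rw [h2, map_zero]
  exact h1

theorem ConeSupported.mul_translate {n : ℕ} {F G : PowerSeries (LaurentPoly n)}
    (hF : ConeSupported F) {c : ℤ × (Fin n → ℤ)} (hG : ∀ b, biCoeff G b ≠ 0 → b - c ∈ cone n)
    (a : ℤ × (Fin n → ℤ)) (ha : biCoeff (F * G) a ≠ 0) : a - c ∈ cone n := by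
  by_contra hcone
  apply ha
  rw [biCoeff_mul, finsum_eq_zero_of_forall_eq_zero]
  intro s
  by_contra h
  have h1 := hF s (left_ne_zero_of_mul h)
  have h2 := hG _ (right_ne_zero_of_mul h)
  have h3 := add_mem h1 h2
  rw [show s + (a - s - c) = a - c by abel] at h3
  exact hcone h3

theorem coeff_scalarSeries_mul_of_dvd {n : ℕ} {K : ℕ} {F : PowerSeries (LaurentPoly n)}
    (hF : X ^ K ∣ F) (c : PowerSeries ℂ) (μ : Fin n → ℤ) :
    (coeff K (scalarSeries n c * F)).coeff μ = coeff 0 c * (coeff K F).coeff μ := by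
  rw [X_pow_dvd_iff] at hF
  rw [coeff_coeff_scalarSeries_mul, Finset.sum_eq_single (0, K)]
  · intro ij hij hne
    rw [Finset.HasAntidiagonal.mem_antidiagonal] at hij
    rw [hF ij.2]
    · simp
    · rcases Nat.eq_zero_or_pos ij.1 with h | h
      · exact absurd (Prod.ext h (by simp only; omega)) hne
      · omega
  · intro h
    exact absurd (Finset.HasAntidiagonal.mem_antidiagonal.2 (zero_add K)) h

theorem coeff_scalarSeries_X_pow_mul {n : ℕ} (K : ℕ) (c : ℂ) (F : PowerSeries (LaurentPoly n))
    (μ : Fin n → ℤ) :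
    (coeff K (scalarSeries n (C c * X ^ K) * F)).coeff μ = c * (coeff 0 F).coeff μ := by
  have : scalarSeries n (C c * X ^ K) * F = X ^ K * (scalarSeries n (C c) * F) := by
    rw [map_mul, scalarSeries, map_pow, map_X]
    ring
  rw [this, coeff_X_pow_mul', if_pos le_rfl, Nat.sub_self, coeff_scalarSeries_C_mul]

theorem X_pow_dvd_scalarSeries {n : ℕ} {K : ℕ} {c : PowerSeries ℂ} (h : X ^ K ∣ c) :
    X ^ K ∣ scalarSeries n c := by
  obtain ⟨d, rfl⟩ := h
  rw [map_mul, scalarSeries, map_pow, map_X]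
  exact dvd_mul_right _ _

/-- The operators are linear over ℂ⟦p⟧, so a power of p passes through; this is their continuity for
the p-adic topology. -/
theorem X_pow_dvd_ellipticOp {n : ℕ} {q t : ℂ} (hq0 : q ≠ 0) (hq1 : ‖q‖ < 1) (ht : t ≠ 0) (r K : ℕ)
    {χ : PowerSeries (LaurentPoly n)} (hχ : SymmSeries χ) (h : X ^ K ∣ χ) :
    X ^ K ∣ ellipticOp t hq0 r χ := by
  obtain ⟨φ, rfl⟩ := h
  have hφ : SymmSeries φ := fun k => by
    have := hχ (K + k)
    rwa [coeff_X_pow_mul', if_pos (Nat.le_add_right _ _), Nat.add_sub_cancel_left] at this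
  have h1 : (X ^ K : PowerSeries (LaurentPoly n)) = scalarSeries n (X ^ K) := by
    rw [scalarSeries, map_pow, map_X]
  rw [h1, ellipticOp_scalarSeries_mul hq0 hq1 ht r _ hφ]
  exact dvd_mul_right _ _

theorem exists_X_pow_dvd_sub {A : Type*} [CommRing A] (g : ℕ → PowerSeries A)
    (hg : ∀ K, X ^ K ∣ g (K + 1) - g K) : ∃ G : PowerSeries A, ∀ K, X ^ K ∣ G - g K := by
  have hle : ∀ K d, X ^ K ∣ g (K + d) - g K := by
    intro K d
    induction d with
    | zero => simp
    | succ d ih =>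
      have h1 := (pow_dvd_pow X (Nat.le_add_right K d)).trans (hg (K + d))
      have h2 := dvd_add h1 ih
      rwa [sub_add_sub_cancel] at h2
  refine ⟨PowerSeries.mk fun k => coeff k (g (k + 1)), fun K => ?_⟩
  rw [X_pow_dvd_iff]
  intro k hk
  obtain ⟨d, rfl⟩ := Nat.exists_eq_add_of_le (Nat.succ_le_of_lt hk)
  have := X_pow_dvd_iff.1 (hle (k + 1) d) k (Nat.lt_succ_self k)
  rw [map_sub, sub_eq_zero] at this
  rw [map_sub, coeff_mk, sub_eq_zero, this]

/-! ### Construction of the formal eigenfunction -/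

section

variable {n : ℕ} {q t : ℂ} (hq0 : q ≠ 0)

variable (t) in
/-- The defect of an approximate eigenfunction. -/
noncomputable def defect (ψ : PowerSeries (LaurentPoly n)) (ε : Fin n → PowerSeries ℂ)
    (r : Fin n) : PowerSeries (LaurentPoly n) :=
  ellipticOp t hq0 (r + 1) ψ - scalarSeries n (ε r) * ψ

variable (t) in
/-- Normalized joint eigenfunctions modulo `p^K`, supported in the cone over `lam`. -/
structure ApproxEigen (lam : Fin n → ℤ) (K : ℕ) (ψ : PowerSeries (LaurentPoly n))
    (ε : Fin n → PowerSeries ℂ) : Prop where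
  symm : SymmSeries ψ
  supported : ∀ b, biCoeff ψ b ≠ 0 → b - (0, lam) ∈ cone n
  normalized : ∀ k, (coeff k ψ).coeff lam = if k = 0 then 1 else 0
  eigenvalue : ∀ r, coeff 0 (ε r) = macdonaldEigenvalue q t lam (r + 1)
  dvd : ∀ r, X ^ K ∣ defect t hq0 ψ ε r

variable {lam : Fin n → ℤ} {K : ℕ} {ψ : PowerSeries (LaurentPoly n)} {ε : Fin n → PowerSeries ℂ}

theorem SymmSeries.defect (hq1 : ‖q‖ < 1) (ht0 : t ≠ 0) (hψ : SymmSeries ψ) (r : Fin n) :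
    SymmSeries (defect t hq0 ψ ε r) :=
  (hψ.ellipticOp hq0 hq1 ht0 _).sub (hψ.scalar_mul _)

theorem defect_supported (hq1 : ‖q‖ < 1) (ht0 : t ≠ 0) (hψ : SymmSeries ψ)
    {c : ℤ × (Fin n → ℤ)} (h : ∀ b, biCoeff ψ b ≠ 0 → b - c ∈ cone n) (r : Fin n)
    (a : ℤ × (Fin n → ℤ)) (ha : biCoeff (defect t hq0 ψ ε r) a ≠ 0) : a - c ∈ cone n := by
  by_contra hac
  apply ha
  rw [defect, biCoeff_sub, sub_eq_zero]
  have h1 : biCoeff (ellipticOp t hq0 (r + 1) ψ) a = 0 := by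
    by_contra h'
    exact hac (ellipticOp_supported hq0 hq1 ht0 _ hψ h a h')
  have h2 : biCoeff (scalarSeries n (ε r) * ψ) a = 0 := by
    by_contra h'
    exact hac ((coneSupported_scalarSeries (ε r)).mul_translate h a h')
  rw [h1, h2]

/-- The compatibility of the defects, from the commutativity of the operators. -/
theorem defect_compat (hq1 : ‖q‖ < 1) (ht0 : t ≠ 0) (hψ : SymmSeries ψ) (r s : Fin n) :
    defect t hq0 (defect t hq0 ψ ε r) ε s = defect t hq0 (defect t hq0 ψ ε s) ε r := by
  have key : ∀ r s : Fin n, defect t hq0 (defect t hq0 ψ ε r) ε s =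
      ellipticOp t hq0 (s + 1) (ellipticOp t hq0 (r + 1) ψ) -
        scalarSeries n (ε r) * ellipticOp t hq0 (s + 1) ψ -
        scalarSeries n (ε s) * (ellipticOp t hq0 (r + 1) ψ - scalarSeries n (ε r) * ψ) := by
    intro r s
    rw [defect, defect, ellipticOp_sub hq0 hq1 ht0 _ (hψ.ellipticOp hq0 hq1 ht0 _)
      (hψ.scalar_mul _), ellipticOp_scalarSeries_mul hq0 hq1 ht0 _ _ hψ]
  rw [key, key, ellipticOp_comm hq0 hq1 ht0 _ _ hψ]
  ring

theorem toLex_lt_of_sub_mem_cone {k : ℤ} {μ ν : Fin n → ℤ} (h : ((k, μ) : ℤ × (Fin n → ℤ)) - (k, ν) ∈ cone n)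
    (hne : ν ≠ μ) : toLex μ < toLex ν := by
  refine lt_of_le_of_ne (toLex_le_of_partialSum_le fun i => ?_) fun h' => hne (toLex.injective h').symm
  have := h.2.2 i
  rw [Prod.snd_sub, Prod.fst_sub, map_sub] at this
  simp only [sub_self] at this
  linarith

/-- The top coefficients of an operator on a series divisible by `p^K`. -/
theorem coeff_ellipticOp_top (hq1 : ‖q‖ < 1) (ht0 : t ≠ 0) (hψ : SymmSeries ψ) (hK : X ^ K ∣ ψ)
    (r : ℕ) {μ : Fin n → ℤ} (hμ : ∀ ν, toLex μ < toLex ν → (coeff K ψ).coeff ν = 0) :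
    (coeff K (ellipticOp t hq0 r ψ)).coeff μ =
      macdonaldEigenvalue q t μ r * (coeff K ψ).coeff μ := by
  rw [← biCoeff_natCast, ← biCoeff_natCast, biCoeff_ellipticOp hq0 hq1 ht0 r hψ]
  rintro ⟨k, ν⟩ hb hne
  have h1 : k ≤ K := by
    have := hb.1
    rw [Prod.fst_sub] at this
    simp only at this
    linarith
  rcases lt_or_ge k 0 with hk | hk
  · exact biCoeff_of_neg _ hk
  · lift k to ℕ using hk
    rw [biCoeff_natCast]
    rcases (Nat.cast_le.1 h1).lt_or_eq with hlt | rfl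
    · rw [X_pow_dvd_iff.1 hK k hlt]
      rfl
    · exact hμ ν (toLex_lt_of_sub_mem_cone hb fun h => hne (by rw [h]))

theorem coeff_defect_top (hq1 : ‖q‖ < 1) (ht0 : t ≠ 0) (hψ : SymmSeries ψ) (hK : X ^ K ∣ ψ)
    (r : Fin n) {μ : Fin n → ℤ} (hμ : ∀ ν, toLex μ < toLex ν → (coeff K ψ).coeff ν = 0) :
    (coeff K (defect t hq0 ψ ε r)).coeff μ =
      (macdonaldEigenvalue q t μ (r + 1) - coeff 0 (ε r)) * (coeff K ψ).coeff μ := by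
  rw [defect, map_sub, AddMonoidAlgebra.coeff_sub, Finsupp.sub_apply,
    coeff_ellipticOp_top hq0 hq1 ht0 hψ hK _ hμ, coeff_scalarSeries_mul_of_dvd hK, sub_mul]

theorem defect_add_left (hq1 : ‖q‖ < 1) (ht0 : t ≠ 0) (hψ : SymmSeries ψ) (c : PowerSeries ℂ)
    {φ : PowerSeries (LaurentPoly n)} (hφ : SymmSeries φ) (r : Fin n) :
    defect t hq0 (ψ + scalarSeries n c * φ) ε r =
      defect t hq0 ψ ε r + scalarSeries n c * defect t hq0 φ ε r := by
  rw [defect, defect, defect, ellipticOp_add hq0 hq1 ht0 _ hψ (hφ.scalar_mul c),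
    ellipticOp_scalarSeries_mul hq0 hq1 ht0 _ _ hφ]
  ring

theorem coeff_monomialSymm_of_le {μ ν : Fin n → ℤ} (hμ : Antitone μ) (h : toLex μ ≤ toLex ν) :
    (monomialSymm μ).coeff ν = if ν = μ then 1 else 0 := by
  classical
  rw [coeff_monomialSymm]
  refine if_congr ⟨?_, fun h => ⟨1, by rw [h]; rfl⟩⟩ rfl rfl
  rintro ⟨σ, rfl⟩
  have := toLex_le_of_partialSum_le fun i => partialSum_comp_le hμ σ i
  exact toLex.injective (le_antisymm this h)

theorem coeff_monomialSymm_antitone {μ ν : Fin n → ℤ} (hμ : Antitone μ) (hν : Antitone ν)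
    (hne : ν ≠ μ) : (monomialSymm μ).coeff ν = 0 := by
  classical
  rw [coeff_monomialSymm, if_neg]
  rintro ⟨σ, h⟩
  refine hne (eq_of_partialSum_eq fun i => le_antisymm ?_ ?_)
  · rw [← h]
    exact partialSum_comp_le hμ σ i
  · have h2 : μ = ν ∘ σ.symm := by
      rw [← h]
      ext i
      simp
    rw [h2]
    exact partialSum_comp_le hν σ.symm i

/-- Elimination of the top coefficient of the defect. -/
theorem ApproxEigen.eliminate (hq1 : ‖q‖ < 1) (ht0 : t ≠ 0)
    (ht : ∀ k : ℕ, 1 ≤ k → k ≤ n - 1 → ∀ m : ℤ, t ^ k ≠ q ^ m) (hlam : Antitone lam)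
    (h : ApproxEigen t hq0 lam K ψ ε) {μ : Fin n → ℤ} (hμ : Antitone μ)
    (hcone : (((K : ℤ), μ) : ℤ × (Fin n → ℤ)) - (0, lam) ∈ cone n)
    (htop : ∀ r ν, toLex μ < toLex ν → (coeff K (defect t hq0 ψ ε r)).coeff ν = 0) :
    ∃ ψ' ε', ApproxEigen t hq0 lam K ψ' ε' ∧ X ^ K ∣ ψ' - ψ ∧ (∀ r, X ^ K ∣ ε' r - ε r) ∧
      ∀ r ν, toLex μ ≤ toLex ν → (coeff K (defect t hq0 ψ' ε' r)).coeff ν = 0 := by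
  have hpow : ∀ c : ℂ, X ^ K ∣ scalarSeries n (C c * X ^ K) :=
    fun c => X_pow_dvd_scalarSeries (dvd_mul_left _ _)
  -- At μ = λ the normalization leaves no freedom in ψ, and the eigenvalue differences vanish. The
  -- defects are then absorbed by correcting each eigenvalue at order p^K.
  by_cases hne : μ = lam
  · subst hne
    set c : Fin n → ℂ := fun r => (coeff K (defect t hq0 ψ ε r)).coeff μ with hc
    have hdef : ∀ r, defect t hq0 ψ (fun r => ε r + C (c r) * X ^ K) r =
        defect t hq0 ψ ε r - scalarSeries n (C (c r) * X ^ K) * ψ := by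
      intro r
      rw [defect, defect, map_add]
      ring
    have habove : ∀ ν, ν ≠ μ → toLex μ ≤ toLex ν → (coeff 0 ψ).coeff ν = 0 := by
      intro ν hν hle
      by_contra h0
      rw [← biCoeff_natCast] at h0
      have h1 := h.supported _ h0
      exact absurd hle (not_le.2 (toLex_lt_of_sub_mem_cone (k := 0) (by simpa using h1) hν.symm))
    refine ⟨ψ, fun r => ε r + C (c r) * X ^ K, ⟨h.symm, h.supported, h.normalized, ?_, ?_⟩,
      by simp, ?_, ?_⟩
    · intro r
      rw [map_add, h.eigenvalue, add_eq_left]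
      -- At K = 0 the correction would alter the leading eigenvalue, but triangularity shows that it
      -- is zero.
      rcases Nat.eq_zero_or_pos K with rfl | hK
      · rw [pow_zero, mul_one, coeff_zero_C, hc]
        simp only
        rw [coeff_defect_top hq0 hq1 ht0 h.symm (by simp), h.eigenvalue, sub_self, zero_mul]
        exact fun ν hν => habove ν (fun h => hν.ne (by rw [h])) hν.le
      · rw [coeff_C_mul, coeff_X_pow, if_neg hK.ne, mul_zero]
    · intro r
      rw [hdef]
      exact dvd_sub (h.dvd r) ((hpow _).mul_right _)
    · intro r
      rw [add_sub_cancel_left]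
      exact dvd_mul_left _ _
    · intro r ν hν
      rw [hdef, map_sub, AddMonoidAlgebra.coeff_sub, Finsupp.sub_apply,
        coeff_scalarSeries_X_pow_mul]
      by_cases hνμ : ν = μ
      · rw [hνμ, h.normalized, if_pos rfl, mul_one, sub_self]
      · rw [habove ν hνμ hν, mul_zero, sub_zero]
        exact htop r ν (lt_of_le_of_ne hν fun h => hνμ (toLex.injective h).symm)
  · obtain ⟨s, hs⟩ := exists_macdonaldEigenvalue_ne hq0 hq1 ht0 ht hne
    have hs' := sub_ne_zero.2 hs
    set R : Fin n → ℂ := fun r => (coeff K (defect t hq0 ψ ε r)).coeff μ with hR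
    set E : Fin n → ℂ := fun r =>
      macdonaldEigenvalue q t μ (r + 1) - macdonaldEigenvalue q t lam (r + 1) with hE
    -- The coefficient at μ of the two iterated defects, equal by commutativity. It lets the
    -- multiple c, determined by the single index s with E s ≠ 0, remove the top defect for every r.
    have hcomp : ∀ r, E s * R r = E r * R s := by
      intro r
      have h1 := congrArg (fun F => (coeff K F).coeff μ)
        (defect_compat (ε := ε) hq0 hq1 ht0 h.symm r s)
      rwa [coeff_defect_top hq0 hq1 ht0 (h.symm.defect hq0 hq1 ht0 r) (h.dvd r) s (htop r),
        coeff_defect_top hq0 hq1 ht0 (h.symm.defect hq0 hq1 ht0 s) (h.dvd s) r (htop s),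
        h.eigenvalue, h.eigenvalue] at h1
    set c : ℂ := -R s / E s with hc
    have hm := symmSeries_C (monomialSymm_isSymm μ)
    have hdef := fun r => defect_add_left (ε := ε) hq0 hq1 ht0 h.symm (C c * X ^ K) hm r
    refine ⟨ψ + scalarSeries n (C c * X ^ K) * C (monomialSymm μ), ε,
      ⟨h.symm.add (hm.scalar_mul _), ?_, ?_, h.eigenvalue, ?_⟩, ?_, by simp, ?_⟩
    · intro b hb
      by_contra hbad
      apply hb
      have h1 : biCoeff ψ b = 0 := by
        by_contra h'
        exact hbad (h.supported b h')
      have h2 : scalarSeries n (C c * X ^ K) * C (monomialSymm μ) =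
          X ^ K * (scalarSeries n (C c) * C (monomialSymm μ)) := by
        rw [map_mul, scalarSeries, map_pow, map_X]
        ring
      rw [biCoeff_add, h1, zero_add]
      obtain ⟨k, ν⟩ := b
      rcases lt_or_ge k 0 with hk | hk
      · exact biCoeff_of_neg _ hk
      · lift k to ℕ using hk
        rw [biCoeff_natCast, h2, coeff_X_pow_mul']
        split_ifs with hKk
        · rw [coeff_scalarSeries_C_mul, coeff_C]
          split_ifs with hk0
          · classical
            rw [coeff_monomialSymm, if_neg, mul_zero]
            rintro ⟨σ, rfl⟩
            apply hbad
            have hkK : k = K := by omega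
            subst hkK
            refine ⟨hcone.1, ?_, fun i => ?_⟩
            · have := hcone.2.1
              simp only [Prod.snd_sub, Pi.sub_apply, Finset.sum_sub_distrib] at this ⊢
              rw [← this]
              congr 1
              exact Equiv.sum_comp σ μ
            · refine le_trans ?_ (hcone.2.2 i)
              rw [Prod.snd_sub, Prod.snd_sub, map_sub, map_sub]
              exact sub_le_sub_right (partialSum_comp_le hμ σ i) _
          · exact mul_zero c
        · rfl
    · intro k
      rw [map_add, AddMonoidAlgebra.coeff_add, Finsupp.add_apply, h.normalized, add_eq_left,
        coeff_coeff_scalarSeries_mul]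
      refine Finset.sum_eq_zero fun ij _ => ?_
      rw [coeff_C]
      split_ifs
      · rw [coeff_monomialSymm_antitone hμ hlam (Ne.symm hne), mul_zero]
      · exact mul_zero _
    · intro r
      rw [hdef]
      exact dvd_add (h.dvd r) ((hpow _).mul_right _)
    · rw [add_sub_cancel_left]
      exact (hpow _).mul_right _
    · intro r ν hν
      have h0 : ∀ ν, toLex μ ≤ toLex ν → (coeff 0 (C (monomialSymm μ))).coeff ν =
          if ν = μ then 1 else 0 := by
        intro ν hν
        rw [coeff_zero_C, coeff_monomialSymm_of_le hμ hν]
      rw [hdef, map_add, AddMonoidAlgebra.coeff_add, Finsupp.add_apply,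
        coeff_scalarSeries_X_pow_mul, coeff_defect_top hq0 hq1 ht0 hm (by simp), h0 ν hν,
        h.eigenvalue]
      · split_ifs with hνμ
        · rw [hνμ, mul_one]
          change R r + c * E r = 0
          rw [hc]
          have : E s ≠ 0 := hs'
          field_simp
          linear_combination hcomp r
        · rw [htop r ν (lt_of_le_of_ne hν fun h => hνμ (toLex.injective h).symm)]
          ring
      · intro ν' hν'
        rw [h0 ν' (hν.trans hν'.le), if_neg]
        rintro rfl
        exact absurd hν (not_le.2 hν')

/-- Any entry can be permuted into first place, where the first partial sum bounds it by λ_1 + K. As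
the total degree is fixed, upper bounds for the others give a lower bound. Hence finitely many
exponents occur at each order. -/
theorem bounds_of_symm_cone (hn : 0 < n) {lam ν : Fin n → ℤ} {K : ℕ}
    (hν : ∀ σ : Equiv.Perm (Fin n), (((K : ℤ), ν ∘ σ) : ℤ × (Fin n → ℤ)) - (0, lam) ∈ cone n)
    (j : Fin n) : lam ⟨0, hn⟩ + K - n * (lam ⟨0, hn⟩ + K) + ∑ j, lam j ≤ ν j ∧
      ν j ≤ lam ⟨0, hn⟩ + K := by
  set i₀ : Fin n := ⟨0, hn⟩
  set M : ℤ := lam i₀ + K with hM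
  have hIic : Finset.Iic i₀ = {i₀} := by
    ext j
    rw [Finset.mem_Iic, Finset.mem_singleton, Fin.le_def, Fin.ext_iff]
    exact Nat.le_zero
  have hup : ∀ j, ν j ≤ M := by
    intro j
    have := (hν (Equiv.swap i₀ j)).2.2 i₀
    rw [Prod.snd_sub, map_sub, partialSum_apply, partialSum_apply, hIic, Finset.sum_singleton,
      Finset.sum_singleton] at this
    simp only [Function.comp_apply, Equiv.swap_apply_left, Prod.fst_sub, sub_zero] at this
    linarith
  refine ⟨?_, hup j⟩
  have h1 : M - ν j ≤ ∑ j, (M - ν j) :=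
    Finset.single_le_sum (f := fun j => M - ν j) (fun j _ => sub_nonneg.2 (hup j))
      (Finset.mem_univ j)
  have h2 := (hν 1).2.1
  simp only [Prod.snd_sub, Pi.sub_apply, Finset.sum_sub_distrib] at h2
  have h3 : ∑ i, (ν ∘ (1 : Equiv.Perm (Fin n))) i = ∑ i, ν i := rfl
  rw [Finset.sum_sub_distrib, Finset.sum_const, Finset.card_univ, Fintype.card_fin,
    nsmul_eq_mul] at h1
  linarith

theorem finite_symm_cone (lam : Fin n → ℤ) (K : ℕ) :
    {ν : Fin n → ℤ | ∀ σ : Equiv.Perm (Fin n),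
      (((K : ℤ), ν ∘ σ) : ℤ × (Fin n → ℤ)) - (0, lam) ∈ cone n}.Finite := by
  rcases Nat.eq_zero_or_pos n with rfl | hn
  · exact Set.toFinite _
  refine (Set.finite_Icc (fun _ => lam ⟨0, hn⟩ + K - n * (lam ⟨0, hn⟩ + K) + ∑ j, lam j :
    Fin n → ℤ) fun _ => lam ⟨0, hn⟩ + K).subset fun ν hν => ?_
  exact ⟨fun j => (bounds_of_symm_cone hn hν j).1, fun j => (bounds_of_symm_cone hn hν j).2⟩

theorem ApproxEigen.exists_succ (hq1 : ‖q‖ < 1) (ht0 : t ≠ 0)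
    (ht : ∀ k : ℕ, 1 ≤ k → k ≤ n - 1 → ∀ m : ℤ, t ^ k ≠ q ^ m) (hlam : Antitone lam)
    (h : ApproxEigen t hq0 lam K ψ ε) :
    ∃ ψ' ε', ApproxEigen t hq0 lam (K + 1) ψ' ε' ∧ X ^ K ∣ ψ' - ψ ∧ ∀ r, X ^ K ∣ ε' r - ε r := by
  classical
  set F := (finite_symm_cone lam K).toFinset with hF
  -- The position in the lexicographic order within the finite set of possible exponents. Each
  -- elimination lowers the largest rank occurring in the defects.
  set rank : (Fin n → ℤ) → ℕ := fun μ => (F.filter fun ν => toLex ν ≤ toLex μ).card with hrank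
  have hmono : ∀ μ ∈ F, ∀ ν ∈ F, toLex μ < toLex ν → rank μ < rank ν := by
    intro μ _ ν hν hlt
    refine Finset.card_lt_card ⟨fun κ hκ => ?_, fun hsub => ?_⟩
    · rw [Finset.mem_filter] at hκ ⊢
      exact ⟨hκ.1, hκ.2.trans hlt.le⟩
    · have := hsub (Finset.mem_filter.2 ⟨hν, le_rfl⟩)
      exact absurd (Finset.mem_filter.1 this).2 (not_le.2 hlt)
  have hsupp : ∀ ψ ε, ApproxEigen t hq0 lam K ψ ε → ∀ r μ,
      (coeff K (defect t hq0 ψ ε r)).coeff μ ≠ 0 → μ ∈ F := by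
    intro ψ ε h r μ hμ
    rw [hF, Set.Finite.mem_toFinset]
    intro σ
    refine defect_supported (ε := ε) hq0 hq1 ht0 h.symm h.supported r _ ?_
    rw [biCoeff_natCast]
    have := h.symm.defect (ε := ε) hq0 hq1 ht0 r K σ μ
    rw [LaurentPoly.coef, LaurentPoly.coef] at this
    rwa [this]
  suffices key : ∀ m : ℕ, ∀ ψ ε, ApproxEigen t hq0 lam K ψ ε →
      (∀ r μ, (coeff K (defect t hq0 ψ ε r)).coeff μ ≠ 0 → rank μ ≤ m) →
      ∃ ψ' ε', ApproxEigen t hq0 lam (K + 1) ψ' ε' ∧ X ^ K ∣ ψ' - ψ ∧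
        ∀ r, X ^ K ∣ ε' r - ε r from
    key F.card ψ ε h fun r μ _ => Finset.card_filter_le _ _
  intro m
  induction m with
  | zero =>
    intro ψ ε h hm
    refine ⟨ψ, ε, ⟨h.symm, h.supported, h.normalized, h.eigenvalue, fun r => ?_⟩, by simp, by simp⟩
    rw [X_pow_dvd_iff]
    intro k hk
    rcases (Nat.lt_succ_iff.1 hk).lt_or_eq with hlt | rfl
    · exact X_pow_dvd_iff.1 (h.dvd r) k hlt
    · ext μ
      by_contra h0
      have h1 := hm r μ h0
      have h2 : 0 < rank μ :=
        Finset.card_pos.2 ⟨μ, Finset.mem_filter.2 ⟨hsupp ψ ε h r μ h0, le_rfl⟩⟩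
      omega
  | succ m ih =>
    intro ψ ε h hm
    by_cases hall : ∀ r μ, (coeff K (defect t hq0 ψ ε r)).coeff μ ≠ 0 → rank μ ≤ m
    · exact ih ψ ε h hall
    push Not at hall
    obtain ⟨r, μ, h0, hrk⟩ := hall
    have hrk' : rank μ = m + 1 := le_antisymm (hm r μ h0) hrk
    have hμF := hsupp ψ ε h r μ h0
    have htop : ∀ s ν, toLex μ < toLex ν → (coeff K (defect t hq0 ψ ε s)).coeff ν = 0 := by
      intro s ν hlt
      by_contra h1
      have h2 := hm s ν h1
      have h3 := hmono μ hμF ν (hsupp ψ ε h s ν h1) hlt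
      omega
    -- Otherwise a transposition would give a lexicographically larger exponent, with a nonzero
    -- coefficient since the defect is symmetric.
    have hanti : Antitone μ := by
      intro a b hab
      by_contra! hlt
      have hab' : a < b := lt_of_le_of_ne hab fun h => by rw [h] at hlt; exact lt_irrefl _ hlt
      have h1 := htop r _ (toLex_lt_comp_swap hab' hlt)
      have h2 := h.symm.defect (ε := ε) hq0 hq1 ht0 r K (Equiv.swap a b) μ
      rw [LaurentPoly.coef, LaurentPoly.coef, h1] at h2
      exact h0 h2.symm
    have hcone : (((K : ℤ), μ) : ℤ × (Fin n → ℤ)) - (0, lam) ∈ cone n := by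
      have h1 : μ ∈ {ν : Fin n → ℤ | _} := (Set.Finite.mem_toFinset _).1 hμF
      exact h1 1
    obtain ⟨ψ₁, ε₁, h1, hd1, he1, htop1⟩ := h.eliminate hq0 hq1 ht0 ht hlam hanti hcone htop
    obtain ⟨ψ₂, ε₂, h2, hd2, he2⟩ := ih ψ₁ ε₁ h1 fun s ν hν => by
      have hlt : toLex ν < toLex μ := by
        by_contra hle
        exact hν (htop1 s ν (not_lt.1 hle))
      have := hmono ν (hsupp ψ₁ ε₁ h1 s ν hν) μ hμF hlt
      omega
    refine ⟨ψ₂, ε₂, h2, ?_, fun r => ?_⟩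
    · have := dvd_add hd2 hd1
      rwa [sub_add_sub_cancel] at this
    · have := dvd_add (he2 r) (he1 r)
      rwa [sub_add_sub_cancel] at this

end

/-! ### Existence and uniqueness of the formal eigenfunction -/

theorem constantCoeff_formalTheta (z : ℂ) : constantCoeff (formalTheta z) = 1 - z := by
  rw [← coeff_zero_eq_constantCoeff_apply, formalTheta, coeff_mk]
  simp

theorem coeff_zero_ellipticRuijsenaarsOp {n : ℕ} (q t : ℂ) (r : ℕ)
    (f : (Fin n → ℂ) → PowerSeries ℂ) (x : Fin n → ℂ) :
    coeff 0 (ellipticRuijsenaarsOp q t r f x) = macdonaldOp q t r (fun y => coeff 0 (f y)) x := by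
  rw [coeff_zero_eq_constantCoeff_apply, ellipticRuijsenaarsOp, macdonaldOp, map_mul,
    constantCoeff_C, map_sum]
  congr 1
  refine Finset.sum_congr rfl fun I _ => ?_
  rw [map_mul, map_prod, coeff_zero_eq_constantCoeff_apply]
  congr 1
  refine Finset.prod_congr rfl fun i _ => ?_
  rw [map_prod]
  refine Finset.prod_congr rfl fun j _ => ?_
  rw [map_mul, constantCoeff_inv, constantCoeff_formalTheta, constantCoeff_formalTheta]
  rfl

theorem coeff_zero_evalSeriesAt {n : ℕ} (ψ : PowerSeries (LaurentPoly n)) (x : Fin n → ℂ) :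
    coeff 0 (evalSeriesAt ψ x) = (coeff 0 ψ).evalAt x := by
  rw [evalSeriesAt, coeff_mk]

theorem evalSeriesAt_scalarSeries_mul {n : ℕ} (c : PowerSeries ℂ) (ψ : PowerSeries (LaurentPoly n))
    {x : Fin n → ℂ} (hx : ∀ i, x i ≠ 0) :
    evalSeriesAt (scalarSeries n c * ψ) x = c * evalSeriesAt ψ x := by
  rw [← evalSeriesHom_apply hx, map_mul, evalSeriesHom_scalarSeries, evalSeriesHom_apply]

theorem coeff_scalarSeries_mul_of_dvd_left {n : ℕ} {K : ℕ} {c : PowerSeries ℂ} (hc : X ^ K ∣ c)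
    (F : PowerSeries (LaurentPoly n)) (μ : Fin n → ℤ) :
    (coeff K (scalarSeries n c * F)).coeff μ = coeff K c * (coeff 0 F).coeff μ := by
  rw [X_pow_dvd_iff] at hc
  rw [coeff_coeff_scalarSeries_mul, Finset.sum_eq_single (K, 0)]
  · intro ij hij hne
    rw [Finset.HasAntidiagonal.mem_antidiagonal] at hij
    rw [hc ij.1, zero_mul]
    rcases Nat.eq_zero_or_pos ij.2 with h | h
    · exact absurd (Prod.ext (by simp only; omega) h) hne
    · omega
  · intro h
    exact absurd (Finset.HasAntidiagonal.mem_antidiagonal.2 (add_zero K)) h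

section

variable {n : ℕ} {q t : ℂ} (hq0 : q ≠ 0) {lam : Fin n → ℤ}

theorem approxEigen_zero (hlam : Antitone lam) :
    ApproxEigen t hq0 lam 0 (C (monomialSymm lam))
      fun r => C (macdonaldEigenvalue q t lam (r + 1)) := by
  classical
  refine ⟨symmSeries_C (monomialSymm_isSymm lam), ?_, fun k => ?_, fun r => coeff_zero_C _,
    fun r => by simp⟩
  · rintro ⟨k, ν⟩ hb
    rcases lt_or_ge k 0 with hk | hk
    · exact absurd (biCoeff_of_neg _ hk) hb
    · lift k to ℕ using hk
      rw [biCoeff_natCast, coeff_C] at hb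
      split_ifs at hb with hk0
      · rw [coeff_monomialSymm] at hb
        split_ifs at hb with hσ
        · obtain ⟨σ, rfl⟩ := hσ
          subst hk0
          refine ⟨by simp, ?_, fun i => ?_⟩
          · simp only [Prod.snd_sub, Pi.sub_apply, Finset.sum_sub_distrib, sub_eq_zero]
            exact Equiv.sum_comp σ lam
          · rw [Prod.snd_sub, map_sub]
            simpa using partialSum_comp_le hlam σ i
        · exact absurd rfl hb
      · exact absurd rfl hb
  · rw [coeff_C]
    split_ifs
    · rw [coeff_monomialSymm_of_le hlam le_rfl, if_pos rfl]
    · rfl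

/-- The step from K to K + 1 changes only orders at least K, so the approximations from
`ApproxEigen.exists_succ` converge p-adically, and the limit inherits each approximate equation. -/
theorem exists_formal_eigenfunction (hq1 : ‖q‖ < 1) (ht0 : t ≠ 0)
    (ht : ∀ k : ℕ, 1 ≤ k → k ≤ n - 1 → ∀ m : ℤ, t ^ k ≠ q ^ m) (hlam : Antitone lam) :
    ∃ (ψ : PowerSeries (LaurentPoly n)) (ε : Fin n → PowerSeries ℂ),
      ∀ K, ApproxEigen t hq0 lam K ψ ε := by
  choose ψ' ε' hstep hψ' hε' using fun (K : ℕ)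
    (p : {p : PowerSeries (LaurentPoly n) × (Fin n → PowerSeries ℂ) //
      ApproxEigen t hq0 lam K p.1 p.2}) => p.2.exists_succ hq0 hq1 ht0 ht hlam
  let g : (K : ℕ) → {p : PowerSeries (LaurentPoly n) × (Fin n → PowerSeries ℂ) //
      ApproxEigen t hq0 lam K p.1 p.2} := fun K => Nat.rec ⟨(_, _), approxEigen_zero hq0 hlam⟩
    (fun K p => ⟨(ψ' K p, ε' K p), hstep K p⟩) K
  obtain ⟨ψ, hψ⟩ := exists_X_pow_dvd_sub (fun K => (g K).1.1) fun K => hψ' K (g K)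
  choose ε hε using fun r => exists_X_pow_dvd_sub (fun K => (g K).1.2 r) fun K => hε' K (g K) r
  have hcoeff : ∀ k, coeff k ψ = coeff k (g (k + 1)).1.1 := fun k => by
    have := X_pow_dvd_iff.1 (hψ (k + 1)) k (Nat.lt_succ_self k)
    rwa [map_sub, sub_eq_zero] at this
  have hsymm : SymmSeries ψ := fun k => by
    rw [hcoeff]
    exact (g (k + 1)).2.symm k
  refine ⟨ψ, ε, fun K => ⟨hsymm, ?_, fun k => ?_, fun r => ?_, fun r => ?_⟩⟩
  · rintro ⟨k, ν⟩ hb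
    rcases lt_or_ge k 0 with hk | hk
    · exact absurd (biCoeff_of_neg _ hk) hb
    · lift k to ℕ using hk
      rw [biCoeff_natCast, hcoeff, ← biCoeff_natCast] at hb
      exact (g (k + 1)).2.supported _ hb
  · rw [hcoeff]
    exact (g (k + 1)).2.normalized k
  · have := X_pow_dvd_iff.1 (hε r 1) 0 one_pos
    rw [map_sub, sub_eq_zero] at this
    rw [this]
    exact (g 1).2.eigenvalue r
  · have h1 := (g K).2.dvd r
    have h2 := X_pow_dvd_ellipticOp hq0 hq1 ht0 (r + 1) K (hsymm.sub (g K).2.symm) (hψ K)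
    rw [ellipticOp_sub hq0 hq1 ht0 _ hsymm (g K).2.symm] at h2
    have h3 := (X_pow_dvd_scalarSeries (n := n) (hε r K)).mul_right ψ
    have h4 := (hψ K).mul_left (scalarSeries n ((g K).1.2 r))
    rw [map_sub] at h3
    have h5 := dvd_add h1 (dvd_sub h2 (dvd_add h3 h4))
    convert h5 using 1
    rw [defect, defect]
    ring

theorem ellipticOp_eq_of_approxEigen {ψ : PowerSeries (LaurentPoly n)} {ε : Fin n → PowerSeries ℂ}
    (h : ∀ K, ApproxEigen t hq0 lam K ψ ε) (r : Fin n) :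
    ellipticOp t hq0 (r + 1) ψ = scalarSeries n (ε r) * ψ := by
  rw [← sub_eq_zero]
  ext1 k
  exact X_pow_dvd_iff.1 ((h (k + 1)).dvd r) k (Nat.lt_succ_self k)

/-- At order p^0 the elliptic equation is the Macdonald equation, and support in the cone over λ is
dominance. The initial term is thus P_λ without any separate construction. -/
theorem isNormalizedFormalEigenfunction_of_approxEigen (hq1 : ‖q‖ < 1) (ht0 : t ≠ 0)
    {ψ : PowerSeries (LaurentPoly n)} {ε : Fin n → PowerSeries ℂ}
    (h : ∀ K, ApproxEigen t hq0 lam K ψ ε) : IsNormalizedFormalEigenfunction q t lam ψ ε := by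
  have heig : ∀ (r : Fin n) (x : Fin n → ℂ), (∀ i, x i ≠ 0) → Function.Injective x →
      ellipticRuijsenaarsOp q t (r + 1) (evalSeriesAt ψ) x = ε r * evalSeriesAt ψ x := by
    intro r x hx hinj
    rw [(ellipticOp_eq_iff hq0 hq1 ht0 _ (h 0).symm).1 (ellipticOp_eq_of_approxEigen hq0 h r) x hx
      hinj, evalSeriesAt_scalarSeries_mul _ _ hx]
  refine ⟨(h 0).symm, ⟨(h 0).symm 0, (h 0).normalized 0, fun μ _ hμ => ?_, fun r x hx hinj => ?_⟩,
    heig, (h 0).normalized⟩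
  · rw [LaurentPoly.coef, ← biCoeff_natCast] at hμ
    have h1 := (h 0).supported _ hμ
    refine ⟨?_, fun i => ?_⟩
    · have := h1.2.1
      simp only [Prod.snd_sub, Pi.sub_apply, Finset.sum_sub_distrib] at this
      linarith
    · have := h1.2.2 i
      rw [Prod.snd_sub, map_sub] at this
      simpa [partialSum_apply] using this
  · have h1 := congrArg (coeff 0) (heig r x hx hinj)
    rw [coeff_zero_ellipticRuijsenaarsOp, coeff_zero_eq_constantCoeff_apply (ε r * _), map_mul,
      ← coeff_zero_eq_constantCoeff_apply, ← coeff_zero_eq_constantCoeff_apply, (h 0).eigenvalue r, coeff_zero_evalSeriesAt] at h1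
    simpa only [coeff_zero_evalSeriesAt] using h1

/-- The lexicographically largest exponent is dominant by symmetry, hence dominated by λ and so
lexicographically at most λ. -/
theorem IsMacdonaldPoly.coeff_eq_zero_of_lt {P : LaurentPoly n} (hP : IsMacdonaldPoly q t lam P)
    {ν : Fin n → ℤ} (hν : toLex lam < toLex ν) : P.coeff ν = 0 := by
  by_contra h0
  obtain ⟨μ, hμ, hmax⟩ := Finset.exists_max_image P.coeff.support toLex
    ⟨ν, Finsupp.mem_support_iff.2 h0⟩
  have hμ0 := Finsupp.mem_support_iff.1 hμ
  have hanti : Antitone μ := by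
    intro a b hab
    by_contra! hlt
    have hab' : a < b := lt_of_le_of_ne hab fun h => by rw [h] at hlt; exact lt_irrefl _ hlt
    refine not_lt.2 (hmax (μ ∘ Equiv.swap a b) (Finsupp.mem_support_iff.2 ?_))
      (toLex_lt_comp_swap hab' hlt)
    have := hP.symm (Equiv.swap a b) μ
    rw [LaurentPoly.coef, LaurentPoly.coef] at this
    rwa [this]
  have hle : toLex μ ≤ toLex lam :=
    toLex_le_of_partialSum_le (hP.triangular μ hanti hμ0).2
  exact absurd (hν.trans_le ((hmax ν (Finsupp.mem_support_iff.2 h0)).trans hle)) (lt_irrefl _)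

-- Induction on the order in p. The competitors are not assumed to be supported in the cone over λ,
-- so only lexicographic maxima are used; symmetry and the initial condition suffice.
include hq0 in
theorem eigenfunction_unique (hq1 : ‖q‖ < 1) (ht0 : t ≠ 0)
    (ht : ∀ k : ℕ, 1 ≤ k → k ≤ n - 1 → ∀ m : ℤ, t ^ k ≠ q ^ m)
    {ψ ψ' : PowerSeries (LaurentPoly n)} {ε ε' : Fin n → PowerSeries ℂ}
    (h : IsNormalizedFormalEigenfunction q t lam ψ ε)
    (h' : IsNormalizedFormalEigenfunction q t lam ψ' ε') : ψ' = ψ ∧ ε' = ε := by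
  have heig : ∀ {φ : PowerSeries (LaurentPoly n)} {δ : Fin n → PowerSeries ℂ},
      IsNormalizedFormalEigenfunction q t lam φ δ → ∀ r : Fin n,
      ellipticOp t hq0 (r + 1) φ = scalarSeries n (δ r) * φ := by
    intro φ δ h r
    refine (ellipticOp_eq_iff hq0 hq1 ht0 _ h.symm).2 fun x hx hinj => ?_
    rw [h.eigen r x hx hinj, evalSeriesAt_scalarSeries_mul _ _ hx]
  have hnorm : ∀ {φ : PowerSeries (LaurentPoly n)} {δ : Fin n → PowerSeries ℂ},
      IsNormalizedFormalEigenfunction q t lam φ δ → (coeff 0 φ).coeff lam = 1 := by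
    intro φ δ h
    exact h.initial.leading
  have heps : ∀ {φ : PowerSeries (LaurentPoly n)} {δ : Fin n → PowerSeries ℂ},
      IsNormalizedFormalEigenfunction q t lam φ δ → ∀ r : Fin n,
      coeff 0 (δ r) = macdonaldEigenvalue q t lam (r + 1) := by
    intro φ δ h r
    have h1 := coeff_ellipticOp_top (K := 0) hq0 hq1 ht0 h.symm (by simp) (r + 1) (μ := lam)
      fun ν hν => h.initial.coeff_eq_zero_of_lt hν
    rw [heig h r, coeff_scalarSeries_mul_of_dvd (K := 0) (by simp), hnorm h, mul_one, mul_one] at h1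
    exact h1
  have key : ∀ K, X ^ K ∣ ψ' - ψ ∧ ∀ r, X ^ K ∣ ε' r - ε r := by
    intro K
    induction K with
    | zero => simp
    | succ K ih =>
      have hd : SymmSeries (ψ' - ψ) := SymmSeries.sub h'.symm h.symm
      have hdef : ∀ r, defect t hq0 (ψ' - ψ) ε r = scalarSeries n (ε' r - ε r) * ψ' := by
        intro r
        rw [defect, ellipticOp_sub hq0 hq1 ht0 _ h'.symm h.symm, heig h', heig h, map_sub]
        ring
      have htop : ∀ (r : Fin n) (μ : Fin n → ℤ),
          (∀ ν, toLex μ < toLex ν → (coeff K (ψ' - ψ)).coeff ν = 0) →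
          (macdonaldEigenvalue q t μ (r + 1) - macdonaldEigenvalue q t lam (r + 1)) *
            (coeff K (ψ' - ψ)).coeff μ = coeff K (ε' r - ε r) * (coeff 0 ψ').coeff μ := by
        intro r μ hμ
        rw [← coeff_scalarSeries_mul_of_dvd_left (ih.2 r), ← hdef,
          coeff_defect_top hq0 hq1 ht0 hd ih.1 r hμ, heps h]
      have hlam0 : (coeff K (ψ' - ψ)).coeff lam = 0 := by
        have h1 := h.normalized K
        have h2 := h'.normalized K
        rw [LaurentPoly.coef] at h1 h2
        rw [map_sub, AddMonoidAlgebra.coeff_sub, Finsupp.sub_apply, h1, h2, sub_self]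
      have hmaxne : ∀ μ, (coeff K (ψ' - ψ)).coeff μ ≠ 0 →
          (∀ ν, toLex μ < toLex ν → (coeff K (ψ' - ψ)).coeff ν = 0) →
          (∀ r, coeff K (ε' r - ε r) * (coeff 0 ψ').coeff μ = 0) → False := by
        intro μ hμ hμtop hz
        have hne : μ ≠ lam := by
          rintro rfl
          exact hμ hlam0
        obtain ⟨r, hr⟩ := exists_macdonaldEigenvalue_ne hq0 hq1 ht0 ht hne
        have h1 := htop r μ hμtop
        rw [hz r] at h1
        exact mul_ne_zero (sub_ne_zero.2 hr) hμ h1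
      have hmaxex : ∀ ν, (coeff K (ψ' - ψ)).coeff ν ≠ 0 → ∃ μ, (coeff K (ψ' - ψ)).coeff μ ≠ 0 ∧
          (∀ κ, toLex μ < toLex κ → (coeff K (ψ' - ψ)).coeff κ = 0) ∧ toLex ν ≤ toLex μ := by
        intro ν hν
        obtain ⟨μ, hμ, hmax⟩ := Finset.exists_max_image (coeff K (ψ' - ψ)).coeff.support toLex
          ⟨ν, Finsupp.mem_support_iff.2 hν⟩
        refine ⟨μ, Finsupp.mem_support_iff.1 hμ, fun κ hκ => ?_,
          hmax ν (Finsupp.mem_support_iff.2 hν)⟩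
        by_contra h0
        exact absurd hκ (not_lt.2 (hmax κ (Finsupp.mem_support_iff.2 h0)))
      -- First the exponents above λ, where P_λ has no terms and the unknown change of the
      -- eigenvalue drops out. The coefficient at λ then shows that the eigenvalues agree, and after
      -- that every remaining exponent is excluded.
      have habove : ∀ ν, toLex lam < toLex ν → (coeff K (ψ' - ψ)).coeff ν = 0 := by
        intro ν hν
        by_contra h0
        obtain ⟨μ, hμ, hμtop, hle⟩ := hmaxex ν h0
        refine hmaxne μ hμ hμtop fun r => ?_
        rw [h'.initial.coeff_eq_zero_of_lt (hν.trans_le hle), mul_zero]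
      have he : ∀ r, coeff K (ε' r - ε r) = 0 := by
        intro r
        have h1 := htop r lam habove
        rw [hlam0, mul_zero, hnorm h', mul_one] at h1
        exact h1.symm
      have hdK : coeff K (ψ' - ψ) = 0 := by
        ext ν
        by_contra h0
        obtain ⟨μ, hμ, hμtop, -⟩ := hmaxex ν h0
        exact hmaxne μ hμ hμtop fun r => by rw [he r, zero_mul]
      refine ⟨X_pow_dvd_iff.2 fun k hk => ?_, fun r => X_pow_dvd_iff.2 fun k hk => ?_⟩
      · rcases (Nat.lt_succ_iff.1 hk).lt_or_eq with hlt | rfl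
        · exact X_pow_dvd_iff.1 ih.1 k hlt
        · exact hdK
      · rcases (Nat.lt_succ_iff.1 hk).lt_or_eq with hlt | rfl
        · exact X_pow_dvd_iff.1 (ih.2 r) k hlt
        · exact he r
  constructor
  · ext1 k
    have := X_pow_dvd_iff.1 (key (k + 1)).1 k (Nat.lt_succ_self k)
    rwa [map_sub, sub_eq_zero] at this
  · ext r k
    have := X_pow_dvd_iff.1 ((key (k + 1)).2 r) k (Nat.lt_succ_self k)
    rwa [map_sub, sub_eq_zero] at this

end

/-! ### Weighted sums over exponents -/

section

variable {n : ℕ}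

/-- The weight `y ^ height`. -/
noncomputable def weight (y : ℝ≥0) (s : ℤ × (Fin n → ℤ)) : ℝ≥0∞ := (y : ℝ≥0∞) ^ height n s

theorem weight_add {y : ℝ≥0} (hy : y ≠ 0) (s s' : ℤ × (Fin n → ℤ)) :
    weight y (s + s') = weight y s * weight y s' := by
  rw [weight, map_add, ENNReal.zpow_add (ENNReal.coe_ne_zero.2 hy) ENNReal.coe_ne_top]
  rfl

/-- The weighted sum of `f`. -/
noncomputable def weightedSum (y : ℝ≥0) (f : ℤ × (Fin n → ℤ) → ℝ≥0∞) : ℝ≥0∞ :=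
  ∑' s, f s * weight y s

/-- The weighted sum of `f` over the exponents of height at most `N`. -/
noncomputable def truncSum (y : ℝ≥0) (N : ℤ) (f : ℤ × (Fin n → ℤ) → ℝ≥0∞) : ℝ≥0∞ :=
  ∑' s, if height n s ≤ N then f s * weight y s else 0

/-- Convolution. -/
noncomputable def conv (f g : ℤ × (Fin n → ℤ) → ℝ≥0∞) (s : ℤ × (Fin n → ℤ)) : ℝ≥0∞ :=
  ∑' s', f s' * g (s - s')

theorem truncSum_le_weightedSum (y : ℝ≥0) (N : ℤ) (f : ℤ × (Fin n → ℤ) → ℝ≥0∞) :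
    truncSum y N f ≤ weightedSum y f := by
  refine ENNReal.tsum_le_tsum fun s => ?_
  split_ifs
  exacts [le_rfl, zero_le]

theorem truncSum_mono (y : ℝ≥0) (N : ℤ) {f g : ℤ × (Fin n → ℤ) → ℝ≥0∞} (h : ∀ s, f s ≤ g s) :
    truncSum y N f ≤ truncSum y N g := by
  refine ENNReal.tsum_le_tsum fun s => ?_
  split_ifs
  exacts [mul_le_mul_left (h s) _, le_rfl]

theorem truncSum_add (y : ℝ≥0) (N : ℤ) (f g : ℤ × (Fin n → ℤ) → ℝ≥0∞) :
    truncSum y N (fun s => f s + g s) = truncSum y N f + truncSum y N g := by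
  rw [truncSum, truncSum, truncSum, ← ENNReal.tsum_add]
  refine tsum_congr fun s => ?_
  split_ifs
  · rw [add_mul]
  · rw [add_zero]

theorem truncSum_const_mul (y : ℝ≥0) (N : ℤ) (c : ℝ≥0∞) (f : ℤ × (Fin n → ℤ) → ℝ≥0∞) :
    truncSum y N (fun s => c * f s) = c * truncSum y N f := by
  rw [truncSum, truncSum, ← ENNReal.tsum_mul_left]
  refine tsum_congr fun s => ?_
  split_ifs
  · rw [mul_assoc]
  · rw [mul_zero]

theorem tsum_conv (F G : ℤ × (Fin n → ℤ) → ℝ≥0∞) :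
    ∑' s, ∑' s', F s' * G (s - s') = (∑' s, F s) * ∑' s, G s := by
  rw [ENNReal.tsum_comm, ← ENNReal.tsum_mul_right]
  refine tsum_congr fun s' => ?_
  rw [ENNReal.tsum_mul_left]
  congr 1
  exact (Equiv.subRight s').tsum_eq G

/-- Heights add. If one factor uses at least M₁, the other has at most N - M₁ left; this gain is
what feeds the induction on the height. -/
theorem truncSum_conv {y : ℝ≥0} (hy : y ≠ 0) (N M₁ M₂ : ℤ) {f g : ℤ × (Fin n → ℤ) → ℝ≥0∞}
    (hf : ∀ s, f s ≠ 0 → M₁ ≤ height n s) (hg : ∀ s, g s ≠ 0 → M₂ ≤ height n s) :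
    truncSum y N (conv f g) ≤ truncSum y (N - M₂) f * truncSum y (N - M₁) g := by
  rw [truncSum, truncSum, truncSum, ← tsum_conv]
  refine ENNReal.tsum_le_tsum fun s => ?_
  split_ifs with hs
  · rw [conv, ← ENNReal.tsum_mul_right]
    refine ENNReal.tsum_le_tsum fun s' => ?_
    by_cases hf0 : f s' = 0
    · rw [hf0, zero_mul, zero_mul]
      exact zero_le
    by_cases hg0 : g (s - s') = 0
    · rw [hg0, mul_zero, zero_mul]
      exact zero_le
    have h1 := hf _ hf0
    have h2 := hg _ hg0
    have hw := weight_add hy s' (s - s')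
    rw [map_sub] at h2 ⊢
    rw [add_sub_cancel] at hw
    rw [if_pos (by linarith), if_pos (by linarith), hw]
    exact le_of_eq (by ring)
  · exact zero_le

theorem weightedSum_conv {y : ℝ≥0} (hy : y ≠ 0) (f g : ℤ × (Fin n → ℤ) → ℝ≥0∞) :
    weightedSum y (conv f g) = weightedSum y f * weightedSum y g := by
  rw [weightedSum, weightedSum, weightedSum, ← tsum_conv]
  refine tsum_congr fun s => ?_
  rw [conv, ← ENNReal.tsum_mul_right]
  refine tsum_congr fun s' => ?_
  have hw := weight_add hy s' (s - s')
  rw [add_sub_cancel] at hw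
  rw [hw]
  ring

/-- The unit for convolution. -/
noncomputable def deltaZero (s : ℤ × (Fin n → ℤ)) : ℝ≥0∞ := if s = 0 then 1 else 0

theorem weight_zero (y : ℝ≥0) : weight y (0 : ℤ × (Fin n → ℤ)) = 1 := by
  rw [weight, map_zero, zpow_zero]

theorem truncSum_deltaZero_le (y : ℝ≥0) (N : ℤ) :
    truncSum y N (deltaZero (n := n)) ≤ 1 := by
  refine (truncSum_le_weightedSum y N _).trans (le_of_eq ?_)
  rw [weightedSum, tsum_eq_single 0]
  · simp [deltaZero, weight_zero]
  · intro s hs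
    simp [deltaZero, hs]

/-- A solution of a quadratic convolution inequality is bounded by small data. -/
theorem truncSum_le_of_conv_le {y : ℝ≥0} (hy : y ≠ 0) {C x : ℝ≥0} (hC : 1 ≤ C) (hx : 4 * C * x = 1)
    {b g : ℤ × (Fin n → ℤ) → ℝ≥0∞} (hb1 : ∀ s, b s ≠ 0 → 1 ≤ height n s)
    (hg1 : ∀ s, g s ≠ 0 → 1 ≤ height n s) (hb : 8 * C * weightedSum y b ≤ x)
    (h : ∀ s, g s ≤ C * (conv b (fun s => deltaZero s + g s) s +
      conv g (fun s => g s + conv b (fun s => deltaZero s + g s) s) s)) (N : ℕ) :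
    truncSum y N g ≤ x := by
  have h0 : ∀ s, deltaZero s + g s ≠ 0 → 0 ≤ height n s := by
    intro s hs
    by_cases hs0 : s = 0
    · rw [hs0, map_zero]
    · rw [deltaZero, if_neg hs0, zero_add] at hs
      linarith [hg1 s hs]
  have hbc1 : ∀ s, conv b (fun s => deltaZero s + g s) s ≠ 0 → 1 ≤ height n s := by
    intro s hs
    rw [conv, ne_eq, ENNReal.tsum_eq_zero, not_forall] at hs
    obtain ⟨s', hs'⟩ := hs
    have h1 := hb1 _ (left_ne_zero_of_mul hs')
    have h2 := h0 _ (right_ne_zero_of_mul hs')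
    rw [map_sub] at h2
    linarith
  have hgc1 : ∀ s, g s + conv b (fun s => deltaZero s + g s) s ≠ 0 → 1 ≤ height n s := by
    intro s hs
    by_cases hgs : g s = 0
    · rw [hgs, zero_add] at hs
      exact hbc1 s hs
    · exact hg1 s hgs
  -- Both b and g start at height 1, so the right side of `h` up to height N + 1 involves g only up
  -- to height N.
  induction N with
  | zero =>
    rw [truncSum, ENNReal.tsum_eq_zero.2]
    · exact zero_le
    intro s
    split_ifs with hs
    · by_cases hgs : g s = 0
      · rw [hgs, zero_mul]
      · have := hg1 s hgs
        push_cast at hs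
        linarith
    · rfl
  | succ N ih =>
    obtain ⟨η, hη⟩ : ∃ η : ℝ≥0, weightedSum y b = η := by
      refine ⟨(weightedSum y b).toNNReal, (ENNReal.coe_toNNReal fun htop => ?_).symm⟩
      rw [htop, ENNReal.mul_top] at hb
      · exact absurd hb (by simp)
      · have : (C : ℝ≥0∞) ≠ 0 := by
          rw [ENNReal.coe_ne_zero]
          exact (zero_lt_one.trans_le hC).ne'
        simp [this]
    have hbN : ∀ M, truncSum y M b ≤ η := fun M => hη ▸ truncSum_le_weightedSum y M b
    have hT1 : truncSum y N (fun s => deltaZero s + g s) ≤ 1 + x := by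
      rw [truncSum_add]
      exact add_le_add (truncSum_deltaZero_le y _) ih
    have hT2 : ∀ M : ℤ, M - 1 = N → truncSum y M (conv b fun s => deltaZero s + g s) ≤
        η * (1 + x) := by
      intro M hM
      refine (truncSum_conv hy M 1 0 hb1 h0).trans ?_
      rw [hM]
      exact mul_le_mul' (hbN _) hT1
    have hT2' : truncSum y N (conv b fun s => deltaZero s + g s) ≤ η * (1 + x) := by
      refine le_trans ?_ (hT2 (N + 1) (by ring))
      refine ENNReal.tsum_le_tsum fun s => ?_
      split_ifs with h1 h2
      · exact le_rfl
      · exact absurd (by linarith) h2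
      · exact zero_le
      · exact le_rfl
    have hT3 : truncSum y N (fun s => g s + conv b (fun s => deltaZero s + g s) s) ≤
        x + η * (1 + x) := by
      rw [truncSum_add]
      exact add_le_add ih hT2'
    have hT4 : truncSum y ((N + 1 : ℕ) : ℤ) (conv g fun s => g s +
        conv b (fun s => deltaZero s + g s) s) ≤ x * (x + η * (1 + x)) := by
      refine (truncSum_conv hy _ 1 1 hg1 hgc1).trans ?_
      rw [show (((N + 1 : ℕ) : ℤ) - 1) = N by push_cast; ring]
      exact mul_le_mul' ih hT3
    refine (truncSum_mono y _ h).trans ?_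
    rw [truncSum_const_mul, truncSum_add]
    refine (mul_le_mul_right (add_le_add (hT2 _ (by push_cast; ring)) hT4) _).trans ?_
    rw [hη] at hb
    norm_cast at hb ⊢
    rw [← NNReal.coe_le_coe] at hb hC ⊢
    rw [← NNReal.coe_inj] at hx
    push_cast at hb hx hC ⊢
    have hx0 := x.2
    have hη0 := η.2
    -- What remains is C(η(1 + x) + x(x + η(1 + x))) ≤ x. By Cη ≤ x/8, x ≤ 1 and Cx = 1/4, the four
    -- terms with η contribute at most x/2 and C x² is x/4.
    have hxs : (x : ℝ) ≤ 1 := by nlinarith [x.coe_nonneg]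
    have e1 : (C : ℝ) * η ≤ x / 8 := by linarith
    have e2 : (C : ℝ) * η * x ≤ x / 8 := by
      have := mul_le_mul e1 hxs x.coe_nonneg (by positivity)
      linarith
    have e3 : (C : ℝ) * η * x * x ≤ x / 8 := by
      have := mul_le_mul e2 hxs x.coe_nonneg (by positivity)
      linarith
    have e4 : (C : ℝ) * x * x = x / 4 := by
      have : (C : ℝ) * x = 1 / 4 := by linarith
      rw [this]
      ring
    nlinarith

end

/-! ### Weighted norms of the theta series -/

section

variable {n : ℕ}

/-- The absolute values of the coefficients. -/
noncomputable def coeffNorm (F : PowerSeries (LaurentPoly n)) (s : ℤ × (Fin n → ℤ)) : ℝ≥0∞ :=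
  ‖biCoeff F s‖ₑ

theorem coeffNorm_mul_le (F G : PowerSeries (LaurentPoly n)) (c : ℤ × (Fin n → ℤ)) :
    coeffNorm (F * G) c ≤ conv (coeffNorm F) (coeffNorm G) c := by
  rw [coeffNorm, biCoeff_mul, finsum_eq_sum _ (support_biCoeff_mul_finite F G c)]
  refine (enorm_sum_le _ _).trans ?_
  simp only [enorm_mul]
  exact ENNReal.sum_le_tsum _

theorem weight_le_weight {y y' : ℝ≥0} (h : y' ≤ y) {s : ℤ × (Fin n → ℤ)} (hs : 0 ≤ height n s) :
    weight y' s ≤ weight y s := by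
  rw [weight, weight]
  lift height n s to ℕ using hs with k
  rw [zpow_natCast, zpow_natCast]
  exact pow_le_pow_left₀ zero_le (ENNReal.coe_le_coe.2 h) k

theorem weight_mul {y y' : ℝ≥0} {s : ℤ × (Fin n → ℤ)} (hs : 0 ≤ height n s) :
    weight (y * y') s = weight y s * weight y' s := by
  rw [weight, weight, weight]
  lift height n s to ℕ using hs with k
  rw [zpow_natCast, zpow_natCast, zpow_natCast, ENNReal.coe_mul, mul_pow]

theorem coeffNorm_ne_zero {F : PowerSeries (LaurentPoly n)} {s : ℤ × (Fin n → ℤ)} :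
    coeffNorm F s ≠ 0 ↔ biCoeff F s ≠ 0 := enorm_ne_zero

theorem ConeSupported.weightedSum_mono {F : PowerSeries (LaurentPoly n)} (hF : ConeSupported F)
    {y y' : ℝ≥0} (h : y' ≤ y) : weightedSum y' (coeffNorm F) ≤ weightedSum y (coeffNorm F) := by
  refine ENNReal.tsum_le_tsum fun s => ?_
  by_cases hs : coeffNorm F s = 0
  · rw [hs, zero_mul, zero_mul]
  · exact mul_le_mul_right (weight_le_weight h (height_nonneg (hF s (coeffNorm_ne_zero.1 hs)))) _

/-- The coefficients are summable with some geometric weight in the height. -/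
def FiniteNorm (F : PowerSeries (LaurentPoly n)) : Prop :=
  ∃ y : ℝ≥0, 0 < y ∧ weightedSum y (coeffNorm F) ≠ ⊤

/-- Heights are nonnegative on the cone, so a smaller weight only decreases the sums and both
factors can share the smaller one. -/
theorem FiniteNorm.mul {F G : PowerSeries (LaurentPoly n)} (hF : FiniteNorm F) (hG : FiniteNorm G)
    (hF' : ConeSupported F) (hG' : ConeSupported G) : FiniteNorm (F * G) := by
  obtain ⟨y, hy, hFy⟩ := hF
  obtain ⟨z, hz, hGz⟩ := hG
  refine ⟨min y z, lt_min hy hz, ne_top_of_le_ne_top (ENNReal.mul_ne_top hFy hGz) ?_⟩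
  calc weightedSum (min y z) (coeffNorm (F * G))
      ≤ weightedSum (min y z) (conv (coeffNorm F) (coeffNorm G)) :=
        ENNReal.tsum_le_tsum fun s => mul_le_mul_left (coeffNorm_mul_le F G s) _
    _ = weightedSum (min y z) (coeffNorm F) * weightedSum (min y z) (coeffNorm G) :=
        weightedSum_conv (lt_min hy hz).ne' _ _
    _ ≤ _ := mul_le_mul' (hF'.weightedSum_mono (min_le_left _ _))
        (hG'.weightedSum_mono (min_le_right _ _))

theorem FiniteNorm.C_mul {F : PowerSeries (LaurentPoly n)} (hF : FiniteNorm F) (c : ℂ) :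
    FiniteNorm (scalarSeries n (C c) * F) := by
  obtain ⟨y, hy, hFy⟩ := hF
  refine ⟨y, hy, ?_⟩
  have : weightedSum y (coeffNorm (scalarSeries n (C c) * F)) =
      ‖c‖ₑ * weightedSum y (coeffNorm F) := by
    rw [weightedSum, weightedSum, ← ENNReal.tsum_mul_left]
    refine tsum_congr fun s => ?_
    rw [coeffNorm, biCoeff_scalarSeries_C_mul, enorm_mul, mul_assoc]
    rfl
  rw [this]
  exact ENNReal.mul_ne_top enorm_ne_top hFy

theorem finiteNorm_one : FiniteNorm (1 : PowerSeries (LaurentPoly n)) := by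
  refine ⟨1, one_pos, ?_⟩
  rw [weightedSum, tsum_eq_single 0]
  · rw [coeffNorm, biCoeff_one, if_pos rfl, weight_zero]
    simp
  · intro s hs
    rw [coeffNorm, biCoeff_one, if_neg hs]
    simp

theorem finiteNorm_prod {ι : Type*} (A : Finset ι) (F : ι → PowerSeries (LaurentPoly n))
    (hF : ∀ i ∈ A, ConeSupported (F i)) (hF' : ∀ i ∈ A, FiniteNorm (F i)) :
    FiniteNorm (∏ i ∈ A, F i) := by
  classical
  induction A using Finset.induction_on with
  | empty =>
    rw [Finset.prod_empty]
    exact finiteNorm_one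
  | insert i A hi ih =>
    rw [Finset.prod_insert hi]
    have h1 := fun j hj => hF j (Finset.mem_insert_of_mem hj)
    exact (hF' i (Finset.mem_insert_self _ _)).mul
      (ih h1 fun j hj => hF' j (Finset.mem_insert_of_mem hj)) (hF i (Finset.mem_insert_self _ _))
      (coneSupported_prod A F h1).1

/-- With l = m(m-1)/2, the first summand l of the height and the summand l + m at index a already
give 2l + m = m². -/
theorem natAbs_le_height {ab : Fin n × Fin n} (hab : ab ∈ ltPairs n) (m : ℤ) :
    (m.natAbs : ℤ) ≤ height n ((triExp m : ℤ), m • rootExp ab) := by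
  have hlt := (Finset.mem_filter.1 hab).2
  have h2 := two_mul_triExp m
  have hml := mem_Icc_of_triangular (m := m) (l := triExp m) h2.symm
  rw [Finset.mem_Icc] at hml
  have hterm : ∀ i : Fin n, (0 : ℤ) ≤ (triExp m : ℤ) - partialSum i (m • rootExp ab) := by
    intro i
    rw [map_zsmul, partialSum_rootExp, smul_eq_mul]
    split_ifs with hb ha ha
    · simp
    · exact absurd (hlt.le.trans hb) ha
    · linarith
    · simp
  have h3 : (triExp m : ℤ) - partialSum ab.1 (m • rootExp ab) ≤
      ∑ i : Fin n, ((triExp m : ℤ) - partialSum i (m • rootExp ab)) :=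
    Finset.single_le_sum (f := fun i => (triExp m : ℤ) - partialSum i (m • rootExp ab))
      (fun i _ => hterm i) (Finset.mem_univ _)
  rw [map_zsmul, partialSum_rootExp, smul_eq_mul, if_neg (not_le.2 hlt), if_pos le_rfl] at h3
  have h4 : (m.natAbs : ℤ) ≤ m * m := by
    rw [← Int.natAbs_mul_self (a := m)]
    exact_mod_cast Nat.le_mul_self _
  rw [height_apply]
  simp only
  nlinarith

theorem biCoeff_thetaMono_eq (c : ℂ) {ab : Fin n × Fin n} (hab : ab ∈ ltPairs n) (m : ℤ) :
    biCoeff (thetaMono c ab) ((triExp m : ℤ), m • rootExp ab) = (-c) ^ m := by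
  have hroot : ∀ m' : ℤ, m' • rootExp ab = m • rootExp ab → m' = m := by
    intro m' h
    have := congrFun h ab.2
    rw [Pi.smul_apply, Pi.smul_apply, rootExp, Pi.sub_apply, Pi.single_eq_same,
      Pi.single_eq_of_ne ((Finset.mem_filter.1 hab).2).ne'] at this
    simpa using this
  rw [biCoeff_natCast, thetaMono, thetaSeries, coeff_mk, AddMonoidAlgebra.coeff_sum,
    Finsupp.finsetSum_apply, Finset.sum_eq_single m]
  · rw [AddMonoidAlgebra.coeff_single, Finsupp.single_eq_same]
  · intro m' _ hne
    rw [AddMonoidAlgebra.coeff_single, Finsupp.single_eq_of_ne]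
    exact fun h => hne (hroot m' h.symm)
  · intro h
    exact absurd (Finset.mem_filter.2 ⟨mem_Icc_of_triangular (two_mul_triExp m).symm,
      (two_mul_triExp m).symm⟩) h

theorem summable_half_pow_natAbs : Summable fun m : ℤ => (1 / 2 : ℝ≥0) ^ m.natAbs := by
  rw [← NNReal.summable_coe]
  have h : Summable fun k : ℕ => (1 / 2 : ℝ) ^ k := summable_geometric_two
  refine Summable.of_nat_of_neg ?_ ?_
  · simpa using h
  · simpa using h

theorem finiteNorm_thetaMono (c : ℂ) {ab : Fin n × Fin n} (hab : ab ∈ ltPairs n) :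
    FiniteNorm (thetaMono c ab) := by
  set D : ℝ≥0 := max 1 (max ‖c‖₊ ‖c‖₊⁻¹) with hD
  have hD1 : 1 ≤ D := le_max_left _ _
  have hD0 : D ≠ 0 := (zero_lt_one.trans_le hD1).ne'
  -- The coefficient is at most D^|m| and the height at least |m|, so this weight makes the terms at
  -- most 2^{-|m|}.
  set y : ℝ≥0 := (2 * D)⁻¹ with hy
  have hDy : D * y = 1 / 2 := by
    rw [hy]
    field_simp
  have hy1 : y ≤ 1 := by
    refine le_trans (le_mul_of_one_le_left zero_le hD1) ?_
    rw [hDy]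
    exact half_le_self zero_le
  refine ⟨y, by positivity, ?_⟩
  have hcm : ∀ m : ℤ, ‖(-c) ^ m‖₊ ≤ D ^ m.natAbs := by
    intro m
    rw [nnnorm_zpow, nnnorm_neg]
    rcases Int.natAbs_eq m with h | h
    · conv_lhs => rw [h]
      rw [zpow_natCast]
      exact pow_le_pow_left₀ zero_le ((le_max_left _ _).trans (le_max_right _ _)) _
    · conv_lhs => rw [h]
      rw [zpow_neg, zpow_natCast, ← inv_pow]
      exact pow_le_pow_left₀ zero_le ((le_max_right _ _).trans (le_max_right _ _)) _
  have hterm : ∀ m : ℤ, ‖(-c) ^ m‖ₑ * weight y ((triExp m : ℤ), m • rootExp ab) ≤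
      (((1 / 2 : ℝ≥0) ^ m.natAbs : ℝ≥0) : ℝ≥0∞) := by
    intro m
    have h := natAbs_le_height hab m
    rw [weight]
    have h0 : 0 ≤ height n ((triExp m : ℤ), m • rootExp ab) := (Int.natCast_nonneg _).trans h
    lift height n ((triExp m : ℤ), m • rootExp ab) to ℕ using h0 with k
    rw [zpow_natCast, enorm_eq_nnnorm]
    norm_cast
    rw [← hDy, mul_pow]
    exact mul_le_mul' (hcm m) (pow_le_pow_of_le_one zero_le hy1 (Nat.cast_le.1 h))
  refine ne_top_of_le_ne_top (ENNReal.tsum_coe_ne_top_iff_summable.2 summable_half_pow_natAbs) ?_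
  refine le_trans ?_ (ENNReal.tsum_le_tsum hterm)
  have hpt : ∀ s : ℤ × (Fin n → ℤ), coeffNorm (thetaMono c ab) s * weight y s ≤
      ∑' m : ℤ, if s = ((triExp m : ℤ), m • rootExp ab) then
        ‖(-c) ^ m‖ₑ * weight y ((triExp m : ℤ), m • rootExp ab) else 0 := by
    intro s
    by_cases hs : biCoeff (thetaMono c ab) s = 0
    · rw [coeffNorm, hs, enorm_zero, zero_mul]
      exact zero_le
    · obtain ⟨m, hm1, hm2⟩ := biCoeff_thetaMono c hs
      have hs' : s = ((triExp m : ℤ), m • rootExp ab) := by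
        refine Prod.ext ?_ hm1
        have := two_mul_triExp m
        simp only
        linarith
      refine le_trans ?_ (ENNReal.le_tsum m)
      rw [if_pos hs', hs', coeffNorm, biCoeff_thetaMono_eq c hab]
  refine (ENNReal.tsum_le_tsum hpt).trans ?_
  rw [ENNReal.tsum_comm]
  refine ENNReal.tsum_le_tsum fun m => ?_
  rw [tsum_ite_eq]

theorem finiteNorm_thetaDenom : FiniteNorm (thetaDenom n) :=
  finiteNorm_prod _ _ (fun _ hab => coneSupported_thetaMono _ hab)
    fun _ hab => finiteNorm_thetaMono 1 hab

theorem finiteNorm_thetaNum (t : ℂ) (I : Finset (Fin n)) :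
    FiniteNorm (thetaNum t I) := by
  refine finiteNorm_prod _ _ (fun _ hab => coneSupported_numFactor t I hab) fun ab hab => ?_
  rw [numFactor]
  split_ifs
  · exact (finiteNorm_thetaMono _ hab).C_mul t
  · exact finiteNorm_thetaMono t hab
  · exact finiteNorm_thetaMono 1 hab

/-- The series without its leading coefficient. -/
noncomputable def tail (F : PowerSeries (LaurentPoly n)) : PowerSeries (LaurentPoly n) :=
  F - scalarSeries n (C (biCoeff F 0))

theorem biCoeff_tail (F : PowerSeries (LaurentPoly n)) (s : ℤ × (Fin n → ℤ)) :
    biCoeff (tail F) s = if s = 0 then 0 else biCoeff F s := by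
  have := biCoeff_scalarSeries_C_mul (biCoeff F 0) (1 : PowerSeries (LaurentPoly n)) s
  rw [mul_one, biCoeff_one] at this
  rw [tail, biCoeff_sub, this]
  split_ifs with h
  · rw [h, mul_one, sub_self]
  · rw [mul_zero, sub_zero]

theorem ConeSupported.one_le_height_tail {F : PowerSeries (LaurentPoly n)} (hF : ConeSupported F)
    {s : ℤ × (Fin n → ℤ)} (hs : coeffNorm (tail F) s ≠ 0) : 1 ≤ height n s := by
  rw [coeffNorm_ne_zero, biCoeff_tail] at hs
  split_ifs at hs with h
  · exact absurd rfl hs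
  · exact height_pos (hF s hs) h

/-- Tails are small for small weights. -/
theorem FiniteNorm.tail_small {F : PowerSeries (LaurentPoly n)} (hF : FiniteNorm F)
    (hF' : ConeSupported F) {η : ℝ≥0} (hη : 0 < η) :
    ∃ y₁ : ℝ≥0, 0 < y₁ ∧ ∀ y ≤ y₁, weightedSum y (coeffNorm (tail F)) ≤ η := by
  obtain ⟨z, hz, hFz⟩ := hF
  have hle : weightedSum z (coeffNorm (tail F)) ≤ weightedSum z (coeffNorm F) := by
    refine ENNReal.tsum_le_tsum fun s => mul_le_mul_left ?_ _
    rw [coeffNorm, biCoeff_tail]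
    split_ifs
    · rw [enorm_zero]
      exact zero_le
    · exact le_rfl
  lift weightedSum z (coeffNorm F) to ℝ≥0 using hFz with W
  -- Tails have height at least 1, so shrinking the weight by ρ ≤ 1 gains at least one factor ρ. The
  -- added 1 keeps the denominator positive.
  set ρ : ℝ≥0 := min 1 (η / (W + 1)) with hρ
  have hρ1 : ρ ≤ 1 := min_le_left _ _
  have hρ0 : 0 < ρ := lt_min one_pos (by positivity)
  refine ⟨ρ * z, mul_pos hρ0 hz, fun y hy => ?_⟩
  have hpt : ∀ s, coeffNorm (tail F) s * weight y s ≤ ρ * (coeffNorm (tail F) s * weight z s) := by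
    intro s
    by_cases hs : coeffNorm (tail F) s = 0
    · rw [hs, zero_mul]
      exact zero_le
    have h1 := hF'.one_le_height_tail hs
    rw [mul_left_comm]
    refine mul_le_mul_right ?_ _
    refine (weight_le_weight hy (by linarith)).trans ?_
    rw [weight_mul (by linarith)]
    refine mul_le_mul_left ?_ _
    rw [weight]
    have h0 : 0 ≤ height n s := by linarith
    lift height n s to ℕ using h0 with k
    rw [zpow_natCast]
    have hk : k ≠ 0 := by
      rintro rfl
      norm_num at h1
    exact_mod_cast pow_le_of_le_one zero_le hρ1 hk
  refine (ENNReal.tsum_le_tsum hpt).trans ?_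
  rw [ENNReal.tsum_mul_left]
  refine (mul_le_mul_right hle _).trans ?_
  norm_cast
  calc ρ * W ≤ η / (W + 1) * (W + 1) := mul_le_mul' (min_le_right _ _) (le_add_of_nonneg_right zero_le)
    _ = η := by field_simp

end

/-! ### The recursion for the coefficients -/

section

variable {n : ℕ}

theorem biCoeff_mul_C_single (F : PowerSeries (LaurentPoly n)) (c : Fin n → ℤ)
    (s : ℤ × (Fin n → ℤ)) :
    biCoeff (F * C (AddMonoidAlgebra.single c 1)) ((0, c) + s) = biCoeff F s := by
  rw [biCoeff, biCoeff, Prod.fst_add, Prod.snd_add, zero_add]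
  split_ifs
  · rw [coeff_mul_C, AddMonoidAlgebra.coeff_mul_single_eq_coeff_mul s.2, mul_one]
    intro m _
    rw [add_comm]
    exact add_right_inj c
  · rfl

variable {q t : ℂ} (hq0 : q ≠ 0) (lam : Fin n → ℤ) (ψ : PowerSeries (LaurentPoly n))
  (ε : Fin n → PowerSeries ℂ)

variable (q t) in
/-- The eigenvalue without its constant term. -/
noncomputable def eigenTail (r : Fin n) : PowerSeries ℂ :=
  ε r - C (macdonaldEigenvalue q t lam (r + 1))

/-- The product `Θ ψ` without its leading term. -/
noncomputable def thetaMulTail : PowerSeries (LaurentPoly n) :=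
  thetaDenom n * ψ - C (AddMonoidAlgebra.single lam 1)

variable (t) in
/-- The lower order terms in the eigenvalue equation. -/
noncomputable def lowerTerms (r : Fin n) : PowerSeries (LaurentPoly n) :=
  scalarSeries n (C (macdonaldEigenvalue q t lam (r + 1))) * (tail (thetaDenom n) * ψ) +
    scalarSeries n (eigenTail q t lam ε r) * thetaMulTail lam ψ -
    ∑ I ∈ Finset.powersetCard (r + 1) (Finset.univ : Finset (Fin n)),
      scalarSeries n (C (t ^ ((r : ℕ) + 1).choose 2)) *
        (tail (thetaNum t I) * shiftSeries q hq0 I ψ)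

variable {lam ψ ε}

/-- In the eigenvalue equation multiplied by the theta denominator, the leading coefficients of all
theta products go to the left, where they form the eigenvalue difference. The unknown eigenvalue
tail times x^λ is kept apart because it enters linearly, and only where the x-exponent is λ. -/
theorem eigen_recursion (hq1 : ‖q‖ < 1) (ht0 : t ≠ 0) (h : ∀ K, ApproxEigen t hq0 lam K ψ ε)
    (r : Fin n) (s : ℤ × (Fin n → ℤ)) :
    (macdonaldEigenvalue q t (lam + s.2) (r + 1) - macdonaldEigenvalue q t lam (r + 1)) *
        biCoeff ψ ((0, lam) + s) =
      biCoeff (lowerTerms t hq0 lam ψ ε r) ((0, lam) + s) +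
        biCoeff (scalarSeries n (eigenTail q t lam ε r)) s := by
  have hD := thetaDenom_mul_ellipticOp hq0 hq1 ht0 (r + 1) (h 0).symm
  rw [ellipticOp_eq_of_approxEigen hq0 h r] at hD
  set S₁ : PowerSeries (LaurentPoly n) :=
    ∑ I ∈ Finset.powersetCard (r + 1) (Finset.univ : Finset (Fin n)),
      scalarSeries n (C (t ^ ((r : ℕ) + 1).choose 2)) *
        (scalarSeries n (C (biCoeff (thetaNum t I) 0)) * shiftSeries q hq0 I ψ) with hS₁
  have hS : biCoeff S₁ ((0, lam) + s) =
      macdonaldEigenvalue q t (lam + s.2) (r + 1) * biCoeff ψ ((0, lam) + s) := by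
    rw [hS₁, biCoeff_sum, macdonaldEigenvalue_eq_sum_leading hq0, Finset.sum_mul]
    refine Finset.sum_congr rfl fun I _ => ?_
    rw [biCoeff_scalarSeries_C_mul, biCoeff_scalarSeries_C_mul, biCoeff_shiftSeries,
      Prod.snd_add]
    ring
  have hser : S₁ - scalarSeries n (C (macdonaldEigenvalue q t lam (r + 1))) * ψ =
      lowerTerms t hq0 lam ψ ε r +
        scalarSeries n (eigenTail q t lam ε r) * C (AddMonoidAlgebra.single lam 1) := by
    have hsum : S₁ = clearedOp q t hq0 (r + 1) ψ -
        ∑ I ∈ Finset.powersetCard (r + 1) (Finset.univ : Finset (Fin n)),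
          scalarSeries n (C (t ^ ((r : ℕ) + 1).choose 2)) *
            (tail (thetaNum t I) * shiftSeries q hq0 I ψ) := by
      rw [hS₁, clearedOp, ← Finset.sum_sub_distrib]
      refine Finset.sum_congr rfl fun I _ => ?_
      rw [tail]
      ring
    have htheta : tail (thetaDenom n) = thetaDenom n - 1 := by
      rw [tail, biCoeff_zero_thetaDenom, map_one, map_one]
    rw [hsum, ← hD, lowerTerms, htheta, thetaMulTail, eigenTail, map_sub]
    ring
  have := congrArg (fun F => biCoeff F ((0, lam) + s)) hser
  simp only [biCoeff_sub, biCoeff_add] at this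
  rw [hS, biCoeff_scalarSeries_C_mul, biCoeff_mul_C_single, ← sub_mul] at this
  exact this

/-! ### Bounds for the terms of the recursion -/

theorem conv_mono {f f' g g' : ℤ × (Fin n → ℤ) → ℝ≥0∞} (hf : ∀ s, f s ≤ f' s)
    (hg : ∀ s, g s ≤ g' s) (s : ℤ × (Fin n → ℤ)) : conv f g s ≤ conv f' g' s :=
  ENNReal.tsum_le_tsum fun s' => mul_le_mul' (hf s') (hg _)

theorem sum_conv {ι : Type*} (A : Finset ι) (f : ι → ℤ × (Fin n → ℤ) → ℝ≥0∞)
    (g : ℤ × (Fin n → ℤ) → ℝ≥0∞) (s : ℤ × (Fin n → ℤ)) :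
    ∑ i ∈ A, conv (f i) g s = conv (fun s => ∑ i ∈ A, f i s) g s := by
  simp only [conv, Finset.sum_mul]
  exact (Summable.tsum_finsetSum fun _ _ => ENNReal.summable).symm

theorem coeffNorm_mul_translate_le (F G : PowerSeries (LaurentPoly n)) (c s : ℤ × (Fin n → ℤ)) :
    coeffNorm (F * G) (c + s) ≤ conv (coeffNorm F) (fun s => coeffNorm G (c + s)) s := by
  refine (coeffNorm_mul_le F G (c + s)).trans (le_of_eq ?_)
  exact tsum_congr fun s' => by rw [add_sub_assoc]

variable (q) in
/-- A bound for all the powers `q^{∑_{i ∈ I} μ_i}`. -/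
noncomputable def qBound (μ : Fin n → ℤ) : ℝ≥0 := ∏ j, max 1 (‖q‖₊ ^ μ j)

theorem one_le_qBound (μ : Fin n → ℤ) : 1 ≤ qBound q μ :=
  Finset.one_le_prod' fun _ _ => le_max_left _ _

include hq0 in
theorem nnnorm_zpow_sum_le_qBound (I : Finset (Fin n)) (μ : Fin n → ℤ) :
    ‖q ^ (∑ i ∈ I, μ i)‖₊ ≤ qBound q μ := by
  have h1 : ‖q ^ (∑ i ∈ I, μ i)‖₊ = ∏ i ∈ I, ‖q‖₊ ^ μ i := by
    induction I using Finset.induction_on with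
    | empty => simp
    | insert i J hi ih =>
      rw [Finset.prod_insert hi, Finset.sum_insert hi, zpow_add₀ hq0, nnnorm_mul, ih, nnnorm_zpow]
  rw [h1, qBound]
  refine (Finset.prod_le_prod' fun i _ => le_max_right 1 _).trans ?_
  exact Finset.prod_le_prod_of_subset_of_one_le' (Finset.subset_univ I)
    fun _ _ _ => le_max_left _ _

/-- An entry is the difference of two successive partial sums: the later is at most l, and the
earlier is bounded below through the height. -/
theorem apply_le_height {s : ℤ × (Fin n → ℤ)} (hs : s ∈ cone n) (j : Fin n) :
    s.2 j ≤ height n s := by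
  have hsum : partialSum j s.2 = s.2 j + ∑ k ∈ Finset.Iio j, s.2 k := by
    rw [partialSum_apply, ← Finset.Iio_insert, Finset.sum_insert (by simp)]
  have hj := hs.2.2 j
  rcases Nat.eq_zero_or_pos (j : ℕ) with h0 | h0
  · have hempty : Finset.Iio j = ∅ := by
      ext k
      rw [Finset.mem_Iio, Fin.lt_def, h0]
      simp
    rw [hempty, Finset.sum_empty, add_zero] at hsum
    rw [← hsum]
    exact hj.trans (fst_le_height hs)
  · set i : Fin n := ⟨j - 1, by omega⟩ with hi
    have hIio : Finset.Iio j = Finset.Iic i := by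
      ext k
      rw [Finset.mem_Iio, Finset.mem_Iic, Fin.lt_def, Fin.le_def, hi]
      simp only
      omega
    rw [hIio, ← partialSum_apply] at hsum
    have h1 : s.1 - partialSum i s.2 ≤ ∑ i : Fin n, (s.1 - partialSum i s.2) :=
      Finset.single_le_sum (f := fun i => s.1 - partialSum i s.2)
        (fun i _ => sub_nonneg.2 (hs.2.2 i)) (Finset.mem_univ i)
    rw [height_apply]
    linarith [hs.1]

-- Evaluating the q-power at μ - s instead of μ costs at most |q|^{-n} per unit of height, a loss
-- that a smaller weight absorbs.
include hq0 in
theorem enorm_zpow_sub_le (hq1 : ‖q‖ < 1) (I : Finset (Fin n)) (μ : Fin n → ℤ)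
    {s : ℤ × (Fin n → ℤ)} (hs : s ∈ cone n) :
    ‖q ^ (∑ i ∈ I, (μ - s.2) i)‖ₑ ≤ qBound q μ * weight (‖q‖₊⁻¹ ^ n) s := by
  have hq0' : ‖q‖₊ ≠ 0 := nnnorm_ne_zero_iff.2 hq0
  have hle : ∑ i ∈ I, s.2 i ≤ n * height n s := by
    have h1 : ∑ i ∈ I, s.2 i ≤ I.card • height n s :=
      Finset.sum_le_card_nsmul _ _ _ fun i _ => apply_le_height hs i
    have h2 : I.card ≤ n := by simpa using Finset.card_le_univ I
    have h3 := height_nonneg hs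
    rw [nsmul_eq_mul] at h1
    have h4 : (I.card : ℤ) * height n s ≤ n * height n s :=
      mul_le_mul_of_nonneg_right (by exact_mod_cast h2) h3
    linarith
  have hsplit : q ^ (∑ i ∈ I, (μ - s.2) i) = q ^ (∑ i ∈ I, μ i) * q ^ (-∑ i ∈ I, s.2 i) := by
    rw [← zpow_add₀ hq0]
    congr 1
    simp only [Pi.sub_apply, Finset.sum_sub_distrib]
    ring
  have h0 := height_nonneg hs
  rw [hsplit, enorm_mul, weight]
  lift height n s to ℕ using h0 with k
  refine mul_le_mul' ?_ ?_
  · rw [enorm_eq_nnnorm]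
    exact ENNReal.coe_le_coe.2 (nnnorm_zpow_sum_le_qBound hq0 I μ)
  · rw [enorm_eq_nnnorm, zpow_natCast, nnnorm_zpow]
    norm_cast
    rw [← pow_mul, inv_pow, ← zpow_natCast, ← zpow_neg]
    have hq1' : ‖q‖₊ ≤ 1 := by
      rw [← NNReal.coe_le_coe]
      exact hq1.le
    refine zpow_le_zpow_right_of_le_one₀ (pos_iff_ne_zero.2 hq0') hq1' ?_
    push_cast
    linarith

theorem coeffNorm_tail_mul_shift_le (hq1 : ‖q‖ < 1) (I : Finset (Fin n))
    (s : ℤ × (Fin n → ℤ)) :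
    coeffNorm (tail (thetaNum t I) * shiftSeries q hq0 I ψ) ((0, lam) + s) ≤
      qBound q (lam + s.2) * conv
        (fun s => weight (‖q‖₊⁻¹ ^ n) s * coeffNorm (tail (thetaNum t I)) s)
        (fun s => coeffNorm ψ ((0, lam) + s)) s := by
  refine (coeffNorm_mul_translate_le _ _ _ _).trans ?_
  rw [conv, conv, ← ENNReal.tsum_mul_left]
  refine ENNReal.tsum_le_tsum fun s' => ?_
  by_cases h0 : coeffNorm (tail (thetaNum t I)) s' = 0
  · simp [h0]
  have hs' : s' ∈ cone n := by
    rw [← ne_eq, coeffNorm_ne_zero, biCoeff_tail] at h0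
    split_ifs at h0
    · exact absurd rfl h0
    · exact coneSupported_thetaNum t I s' h0
  have h1 := enorm_zpow_sub_le hq0 hq1 I (lam + s.2) hs'
  have h2 : coeffNorm (shiftSeries q hq0 I ψ) ((0, lam) + (s - s')) =
      ‖q ^ (∑ i ∈ I, (lam + s.2 - s'.2) i)‖ₑ * coeffNorm ψ ((0, lam) + (s - s')) := by
    rw [coeffNorm, biCoeff_shiftSeries, enorm_mul, Prod.snd_add, Prod.snd_sub, ← add_sub_assoc]
    rfl
  rw [h2]
  calc coeffNorm (tail (thetaNum t I)) s' * (‖q ^ (∑ i ∈ I, (lam + s.2 - s'.2) i)‖ₑ *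
        coeffNorm ψ ((0, lam) + (s - s')))
      ≤ coeffNorm (tail (thetaNum t I)) s' * ((qBound q (lam + s.2) * weight (‖q‖₊⁻¹ ^ n) s') *
        coeffNorm ψ ((0, lam) + (s - s'))) := by gcongr
    _ = _ := by ring

variable (q t n) in
/-- The majorant of the coefficients of the operators. -/
noncomputable def opMajorant (s : ℤ × (Fin n → ℤ)) : ℝ≥0∞ :=
  coeffNorm (tail (thetaDenom n)) s +
    ∑ I : Finset (Fin n), weight (‖q‖₊⁻¹ ^ n) s * coeffNorm (tail (thetaNum t I)) s

variable (q t lam ε) in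
/-- The majorant of the eigenvalues. -/
noncomputable def eigenMajorant (s : ℤ × (Fin n → ℤ)) : ℝ≥0∞ :=
  ∑ r : Fin n, coeffNorm (scalarSeries n (eigenTail q t lam ε r)) s

theorem one_le_height_opMajorant {s : ℤ × (Fin n → ℤ)} (hs : opMajorant n q t s ≠ 0) :
    1 ≤ height n s := by
  by_contra hlt
  apply hs
  have h1 : coeffNorm (tail (thetaDenom n)) s = 0 := by
    by_contra h
    exact hlt ((coneSupported_thetaDenom n).one_le_height_tail h)
  rw [opMajorant, h1, zero_add]
  refine Finset.sum_eq_zero fun I _ => ?_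
  have h2 : coeffNorm (tail (thetaNum t I)) s = 0 := by
    by_contra h
    exact hlt ((coneSupported_thetaNum t I).one_le_height_tail h)
  rw [h2, mul_zero]

/-- The bound for the lower order terms. -/
theorem coeffNorm_lowerTerms_le (hq1 : ‖q‖ < 1) :
    ∃ c : ℝ≥0, ∀ (r : Fin n) (s : ℤ × (Fin n → ℤ)),
      coeffNorm (lowerTerms t hq0 lam ψ ε r) ((0, lam) + s) ≤ c * (qBound q (lam + s.2) *
        (conv (opMajorant n q t) (fun s => coeffNorm ψ ((0, lam) + s)) s +
          conv (eigenMajorant q t lam ε) (fun s => coeffNorm (thetaMulTail lam ψ) ((0, lam) + s))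
            s)) := by
  refine ⟨∑ r : Fin n, (‖macdonaldEigenvalue q t lam (r + 1)‖₊ + 1 +
    ‖t ^ ((r : ℕ) + 1).choose 2‖₊), fun r s => ?_⟩
  set α : ℤ × (Fin n → ℤ) → ℝ≥0∞ := fun s => coeffNorm ψ ((0, lam) + s) with hα
  set v : ℤ × (Fin n → ℤ) → ℝ≥0∞ := fun s => coeffNorm (thetaMulTail lam ψ) ((0, lam) + s) with hv
  set T₁ := conv (opMajorant n q t) α s with hT₁
  set T₂ := conv (eigenMajorant q t lam ε) v s with hT₂
  set Q : ℝ≥0∞ := (qBound q (lam + s.2) : ℝ≥0∞) with hQ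
  have hQ1 : 1 ≤ Q := by
    rw [hQ]
    exact_mod_cast one_le_qBound (lam + s.2)
  have h1 : coeffNorm (scalarSeries n (C (macdonaldEigenvalue q t lam (r + 1))) *
      (tail (thetaDenom n) * ψ)) ((0, lam) + s) ≤
        (‖macdonaldEigenvalue q t lam (r + 1)‖₊ : ℝ≥0∞) * (Q * (T₁ + T₂)) := by
    rw [coeffNorm, biCoeff_scalarSeries_C_mul, enorm_mul, ← enorm_eq_nnnorm]
    refine mul_le_mul_right ?_ _
    calc coeffNorm (tail (thetaDenom n) * ψ) ((0, lam) + s)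
        ≤ conv (coeffNorm (tail (thetaDenom n))) α s := coeffNorm_mul_translate_le _ _ _ _
      _ ≤ T₁ := conv_mono (fun s => le_self_add) (fun s => le_rfl) s
      _ ≤ 1 * (T₁ + T₂) := by rw [one_mul]; exact le_self_add
      _ ≤ Q * (T₁ + T₂) := mul_le_mul_left hQ1 _
  have h2 : coeffNorm (scalarSeries n (eigenTail q t lam ε r) * thetaMulTail lam ψ)
      ((0, lam) + s) ≤ 1 * (Q * (T₁ + T₂)) := by
    rw [one_mul]
    calc coeffNorm (scalarSeries n (eigenTail q t lam ε r) * thetaMulTail lam ψ) ((0, lam) + s)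
        ≤ conv (coeffNorm (scalarSeries n (eigenTail q t lam ε r))) v s :=
          coeffNorm_mul_translate_le _ _ _ _
      _ ≤ T₂ := conv_mono (fun s => Finset.single_le_sum
          (f := fun r => coeffNorm (scalarSeries n (eigenTail q t lam ε r)) s)
          (fun _ _ => zero_le) (Finset.mem_univ r)) (fun s => le_rfl) s
      _ ≤ 1 * (T₁ + T₂) := by rw [one_mul]; exact le_add_self
      _ ≤ Q * (T₁ + T₂) := mul_le_mul_left hQ1 _
  have h3 : ‖biCoeff (∑ I ∈ Finset.powersetCard (r + 1) (Finset.univ : Finset (Fin n)),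
      scalarSeries n (C (t ^ ((r : ℕ) + 1).choose 2)) *
        (tail (thetaNum t I) * shiftSeries q hq0 I ψ)) ((0, lam) + s)‖ₑ ≤
      (‖t ^ ((r : ℕ) + 1).choose 2‖₊ : ℝ≥0∞) * (Q * (T₁ + T₂)) := by
    rw [biCoeff_sum]
    refine (enorm_sum_le _ _).trans ?_
    simp only [biCoeff_scalarSeries_C_mul, enorm_mul]
    rw [← Finset.mul_sum, ← enorm_eq_nnnorm]
    refine mul_le_mul_right ?_ _
    calc ∑ I ∈ Finset.powersetCard (r + 1) (Finset.univ : Finset (Fin n)),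
          ‖biCoeff (tail (thetaNum t I) * shiftSeries q hq0 I ψ) ((0, lam) + s)‖ₑ
        ≤ ∑ I ∈ Finset.powersetCard (r + 1) (Finset.univ : Finset (Fin n)),
          Q * conv (fun s => weight (‖q‖₊⁻¹ ^ n) s * coeffNorm (tail (thetaNum t I)) s) α s :=
          Finset.sum_le_sum fun I _ => coeffNorm_tail_mul_shift_le hq0 hq1 I s
      _ ≤ ∑ I : Finset (Fin n),
          Q * conv (fun s => weight (‖q‖₊⁻¹ ^ n) s * coeffNorm (tail (thetaNum t I)) s) α s :=
          Finset.sum_le_sum_of_subset (Finset.subset_univ _)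
      _ ≤ Q * T₁ := by
          rw [← Finset.mul_sum, sum_conv]
          exact mul_le_mul_right (conv_mono (fun s => le_add_self) (fun s => le_rfl) s) _
      _ ≤ Q * (T₁ + T₂) := mul_le_mul_right le_self_add _
  calc coeffNorm (lowerTerms t hq0 lam ψ ε r) ((0, lam) + s)
      ≤ (‖macdonaldEigenvalue q t lam (r + 1)‖₊ : ℝ≥0∞) * (Q * (T₁ + T₂)) + 1 * (Q * (T₁ + T₂)) +
        (‖t ^ ((r : ℕ) + 1).choose 2‖₊ : ℝ≥0∞) * (Q * (T₁ + T₂)) := by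
        rw [coeffNorm, lowerTerms, biCoeff_sub, biCoeff_add]
        exact (enorm_sub_le).trans (add_le_add ((enorm_add_le _ _).trans (add_le_add h1 h2)) h3)
    _ = ((‖macdonaldEigenvalue q t lam (r + 1)‖₊ + 1 + ‖t ^ ((r : ℕ) + 1).choose 2‖₊ : ℝ≥0) :
          ℝ≥0∞) * (Q * (T₁ + T₂)) := by
        push_cast
        ring
    _ ≤ _ := by
        refine mul_le_mul_left (ENNReal.coe_le_coe.2 ?_) _
        exact Finset.single_le_sum (f := fun r : Fin n =>
          ‖macdonaldEigenvalue q t lam (r + 1)‖₊ + 1 + ‖t ^ ((r : ℕ) + 1).choose 2‖₊)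
          (fun _ _ => zero_le) (Finset.mem_univ r)

end

/-! ### Lower bounds for eigenvalue differences and convergence -/

/-- For large positive m the term 1 dominates, for large negative m the term A q^m does. The
finitely many m in between are covered by a minimum over the nonzero values. -/
theorem exists_lower_bound_one_sub {q A : ℂ} (hq0 : q ≠ 0) (hq1 : ‖q‖ < 1) (hA : A ≠ 0) :
    ∃ c : ℝ≥0, 0 < c ∧ ∀ m : ℤ, 1 - A * q ^ m ≠ 0 →
      c * max 1 (‖q‖₊ ^ m) ≤ ‖1 - A * q ^ m‖₊ := by
  have hq : 0 < ‖q‖ := norm_pos_iff.2 hq0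
  have hA' : 0 < ‖A‖ := norm_pos_iff.2 hA
  -- Thresholds: |A q^m| is at most 1/2 for m ≥ M₁, and at least 2 for m ≤ -M₂.
  obtain ⟨M₁, hM₁⟩ := exists_pow_lt_of_lt_one (y := ‖q‖) (x := 1 / (2 * ‖A‖)) (by positivity) hq1
  obtain ⟨M₂, hM₂⟩ := exists_pow_lt_of_lt_one (y := ‖q‖) (x := ‖A‖ / 2) (by positivity) hq1
  have hfin : ∀ S : Finset ℤ, ∃ c : ℝ, 0 < c ∧ ∀ m ∈ S, 1 - A * q ^ m ≠ 0 →
      c * max 1 (‖q‖ ^ m) ≤ ‖1 - A * q ^ m‖ := by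
    intro S
    induction S using Finset.induction_on with
    | empty => exact ⟨1, one_pos, by simp⟩
    | insert k S _ ih =>
      obtain ⟨c, hc, hS⟩ := ih
      have hpos : (0 : ℝ) < max 1 (‖q‖ ^ k) := lt_max_of_lt_left one_pos
      by_cases hk : 1 - A * q ^ k = 0
      · refine ⟨c, hc, fun m hm h0 => ?_⟩
        rcases Finset.mem_insert.1 hm with rfl | hm
        · exact absurd hk h0
        · exact hS m hm h0
      · have hk' : 0 < ‖1 - A * q ^ k‖ := norm_pos_iff.2 hk
        refine ⟨min c (‖1 - A * q ^ k‖ / max 1 (‖q‖ ^ k)), by positivity, fun m hm h0 => ?_⟩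
        rcases Finset.mem_insert.1 hm with rfl | hm
        · calc min c (‖1 - A * q ^ m‖ / max 1 (‖q‖ ^ m)) * max 1 (‖q‖ ^ m)
              ≤ ‖1 - A * q ^ m‖ / max 1 (‖q‖ ^ m) * max 1 (‖q‖ ^ m) := by
                gcongr
                exact min_le_right _ _
            _ = _ := div_mul_cancel₀ _ hpos.ne'
        · refine le_trans ?_ (hS m hm h0)
          gcongr
          exact min_le_left _ _
  obtain ⟨c, hc, hS⟩ := hfin (Finset.Icc (-(M₂ : ℤ)) M₁)
  obtain ⟨c', hc'⟩ : ∃ c' : ℝ≥0, (c' : ℝ) = min c (min (1 / 2) (‖A‖ / 2)) :=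
    ⟨⟨_, by positivity⟩, rfl⟩
  refine ⟨c', ?_, fun m h0 => ?_⟩
  · rw [← NNReal.coe_pos, hc']
    positivity
  rw [← NNReal.coe_le_coe]
  push_cast
  rw [hc']
  by_cases hm : m ∈ Finset.Icc (-(M₂ : ℤ)) M₁
  · refine le_trans ?_ (hS m hm h0)
    gcongr
    exact min_le_left _ _
  rw [Finset.mem_Icc, not_and_or, not_le, not_le] at hm
  have hqm : 0 < ‖q‖ ^ m := zpow_pos hq m
  rcases hm with hm | hm
  · have h1 : 1 ≤ ‖A‖ * ‖q‖ ^ m / 2 := by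
      obtain ⟨k, rfl⟩ : ∃ k : ℕ, m = -((M₂ : ℤ) + k) := ⟨(-m - M₂).toNat, by omega⟩
      rw [zpow_neg, ← Nat.cast_add, zpow_natCast]
      have h2 : ‖q‖ ^ (M₂ + k) ≤ ‖A‖ / 2 :=
        (pow_le_pow_of_le_one hq.le hq1.le (Nat.le_add_right _ _)).trans hM₂.le
      have h3 : 0 < ‖q‖ ^ (M₂ + k) := by positivity
      rw [le_div_iff₀ two_pos, ← div_eq_mul_inv, le_div_iff₀ h3]
      linarith
    have h4 : 1 ≤ ‖q‖ ^ m := by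
      refine one_le_zpow_of_nonpos₀ hq hq1.le ?_
      omega
    rw [max_eq_right h4]
    have h5 : ‖A * q ^ m‖ - ‖(1 : ℂ)‖ ≤ ‖1 - A * q ^ m‖ := by
      rw [norm_sub_rev]
      exact norm_sub_norm_le _ _
    rw [norm_mul, norm_zpow, norm_one] at h5
    have h6 : min c (min (1 / 2) (‖A‖ / 2)) ≤ ‖A‖ / 2 := (min_le_right _ _).trans (min_le_right _ _)
    have h7 := mul_le_mul_of_nonneg_right h6 hqm.le
    linarith
  · have h1 : ‖A‖ * ‖q‖ ^ m ≤ 1 / 2 := by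
      obtain ⟨k, rfl⟩ : ∃ k : ℕ, m = ((M₁ : ℤ) + k) := ⟨(m - M₁).toNat, by omega⟩
      rw [← Nat.cast_add, zpow_natCast]
      have h2 : ‖q‖ ^ (M₁ + k) ≤ 1 / (2 * ‖A‖) :=
        (pow_le_pow_of_le_one hq.le hq1.le (Nat.le_add_right _ _)).trans hM₁.le
      rw [le_div_iff₀ (by positivity)] at h2
      linarith
    have h4 : ‖q‖ ^ m ≤ 1 := by
      refine zpow_le_one₀ hq hq1.le ?_
      omega
    rw [max_eq_left h4, mul_one]
    have h5 : ‖(1 : ℂ)‖ - ‖A * q ^ m‖ ≤ ‖1 - A * q ^ m‖ := norm_sub_norm_le _ _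
    rw [norm_mul, norm_zpow, norm_one] at h5
    have h6 : min c (min (1 / 2) (‖A‖ / 2)) ≤ 1 / 2 := (min_le_right _ _).trans (min_le_left _ _)
    linarith

section

variable {n : ℕ} {q t : ℂ} (hq0 : q ≠ 0) {lam : Fin n → ℤ} {ψ : PowerSeries (LaurentPoly n)}
  {ε : Fin n → PowerSeries ℂ}

-- The decisive estimate for convergence: the bound holds factor by factor, with one c for all μ.
-- The growth `qBound` is the same as on the right of the recursion, so after division the constants
-- no longer depend on μ.
include hq0 in
theorem exists_eigenProd_lower_bound (hq1 : ‖q‖ < 1) (ht0 : t ≠ 0)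
    (ht : ∀ k : ℕ, 1 ≤ k → k ≤ n - 1 → ∀ m : ℤ, t ^ k ≠ q ^ m) (lam : Fin n → ℤ) (i : Fin n) :
    ∃ c : ℝ≥0, 0 < c ∧ ∀ μ : Fin n → ℤ, μ i ≠ lam i → c * qBound q μ ≤
      ‖∏ j : Fin n, (1 - (t ^ (n - 1 - (i : ℕ)) * q ^ lam i)⁻¹ *
        (t ^ (n - 1 - (j : ℕ)) * q ^ μ j))‖₊ := by
  have hA : ∀ j : Fin n, (t ^ (n - 1 - (i : ℕ)) * q ^ lam i)⁻¹ * t ^ (n - 1 - (j : ℕ)) ≠ 0 :=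
    fun j => mul_ne_zero (inv_ne_zero (mul_ne_zero (pow_ne_zero _ ht0) (zpow_ne_zero _ hq0)))
      (pow_ne_zero _ ht0)
  choose c hc hbound using fun j => exists_lower_bound_one_sub hq0 hq1 (hA j)
  refine ⟨∏ j, c j, Finset.prod_pos fun j _ => hc j, fun μ hμ => ?_⟩
  rw [qBound, ← Finset.prod_mul_distrib, nnnorm_prod]
  refine Finset.prod_le_prod' fun j _ => ?_
  have h := one_sub_eigenFactor_ne_zero hq0 hq1 ht0 ht hμ j
  rw [← mul_assoc] at h ⊢
  exact hbound j (μ j) h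

variable (q t lam ψ ε) in
/-- The majorant of all the unknown coefficients. -/
noncomputable def solutionMajorant (s : ℤ × (Fin n → ℤ)) : ℝ≥0∞ :=
  (if s = 0 then 0 else coeffNorm ψ ((0, lam) + s)) + eigenMajorant q t lam ε s

theorem ApproxEigen.biCoeff_zero (h : ApproxEigen t hq0 lam 0 ψ ε) :
    biCoeff ψ ((0, lam) + 0) = 1 := by
  rw [add_zero]
  have := h.normalized 0
  rw [if_pos rfl, ← biCoeff_natCast] at this
  exact this

theorem ApproxEigen.biCoeff_resonant (h : ApproxEigen t hq0 lam 0 ψ ε) {s : ℤ × (Fin n → ℤ)}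
    (hs : s ≠ 0) (hs2 : s.2 = 0) : biCoeff ψ ((0, lam) + s) = 0 := by
  obtain ⟨k, β⟩ := s
  simp only at hs2
  subst hs2
  rw [Prod.mk_add_mk, zero_add, add_zero]
  rcases lt_or_ge k 0 with hk | hk
  · exact biCoeff_of_neg _ hk
  · lift k to ℕ using hk
    rw [biCoeff_natCast, h.normalized, if_neg]
    rintro rfl
    exact hs rfl

theorem eigenMajorant_of_ne {s : ℤ × (Fin n → ℤ)} (hs : s.2 ≠ 0) :
    eigenMajorant q t lam ε s = 0 :=
  Finset.sum_eq_zero fun r _ => by rw [coeffNorm, biCoeff_scalarSeries_of_ne _ hs, enorm_zero]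

theorem ApproxEigen.one_le_height_eigenMajorant (h : ApproxEigen t hq0 lam 0 ψ ε)
    {s : ℤ × (Fin n → ℤ)} (hs : eigenMajorant q t lam ε s ≠ 0) : 1 ≤ height n s := by
  obtain ⟨r, _, hr⟩ := Finset.exists_ne_zero_of_sum_ne_zero hs
  rw [coeffNorm_ne_zero] at hr
  refine height_pos (coneSupported_scalarSeries _ s hr) ?_
  rintro rfl
  apply hr
  have := biCoeff_scalarSeries_natCast (n := n) (eigenTail q t lam ε r) 0
  rw [Nat.cast_zero] at this
  rw [← Prod.mk_zero_zero, this, eigenTail, map_sub, h.eigenvalue, coeff_zero_C, sub_self]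

theorem ApproxEigen.one_le_height_solutionMajorant (h : ApproxEigen t hq0 lam 0 ψ ε)
    {s : ℤ × (Fin n → ℤ)} (hs : solutionMajorant q t lam ψ ε s ≠ 0) : 1 ≤ height n s := by
  by_cases he : eigenMajorant q t lam ε s = 0
  · rw [solutionMajorant, he, add_zero] at hs
    split_ifs at hs with h0
    · exact absurd rfl hs
    · have := h.supported _ (coeffNorm_ne_zero.1 hs)
      rw [add_sub_cancel_left] at this
      exact height_pos this h0
  · exact h.one_le_height_eigenMajorant hq0 he

theorem ApproxEigen.coeffNorm_le (h : ApproxEigen t hq0 lam 0 ψ ε) (s : ℤ × (Fin n → ℤ)) :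
    coeffNorm ψ ((0, lam) + s) ≤ deltaZero s + solutionMajorant q t lam ψ ε s := by
  rw [deltaZero, solutionMajorant]
  split_ifs with hs
  · rw [hs, coeffNorm, h.biCoeff_zero, enorm_one]
    exact le_self_add
  · rw [zero_add]
    exact le_self_add

/-- With Θ the theta denominator, Θψ - x^λ = (ψ - x^λ) + (Θ - 1)ψ. Both parts begin at height 1, so
the product with the eigenvalue tail is genuinely quadratic in small quantities. -/
theorem ApproxEigen.thetaMulTail_le (h : ApproxEigen t hq0 lam 0 ψ ε) (s : ℤ × (Fin n → ℤ)) :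
    coeffNorm (thetaMulTail lam ψ) ((0, lam) + s) ≤ solutionMajorant q t lam ψ ε s +
      conv (opMajorant n q t) (fun s => deltaZero s + solutionMajorant q t lam ψ ε s) s := by
  have htheta : thetaMulTail lam ψ = (ψ - 1 * C (AddMonoidAlgebra.single lam 1)) +
      tail (thetaDenom n) * ψ := by
    rw [tail, biCoeff_zero_thetaDenom, map_one, map_one, thetaMulTail]
    ring
  rw [coeffNorm, htheta, biCoeff_add]
  refine (enorm_add_le _ _).trans (add_le_add ?_ ?_)
  · rw [biCoeff_sub, biCoeff_mul_C_single, biCoeff_one, solutionMajorant]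
    split_ifs with hs
    · rw [hs, h.biCoeff_zero, sub_self, enorm_zero]
      exact zero_le
    · rw [sub_zero]
      exact le_self_add
  · refine (coeffNorm_mul_translate_le _ _ _ _).trans ?_
    exact conv_mono (fun s => le_self_add) (h.coeffNorm_le hq0) s

/-- The quadratic convolution inequality for the coefficients. -/
theorem exists_solutionMajorant_le (hq1 : ‖q‖ < 1) (ht0 : t ≠ 0)
    (ht : ∀ k : ℕ, 1 ≤ k → k ≤ n - 1 → ∀ m : ℤ, t ^ k ≠ q ^ m)
    (h : ∀ K, ApproxEigen t hq0 lam K ψ ε) :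
    ∃ C : ℝ≥0, 1 ≤ C ∧ ∀ s, solutionMajorant q t lam ψ ε s ≤ C *
      (conv (opMajorant n q t) (fun s => deltaZero s + solutionMajorant q t lam ψ ε s) s +
        conv (solutionMajorant q t lam ψ ε) (fun s => solutionMajorant q t lam ψ ε s +
          conv (opMajorant n q t) (fun s => deltaZero s + solutionMajorant q t lam ψ ε s) s) s) := by
  obtain ⟨c, hc⟩ := coeffNorm_lowerTerms_le (t := t) (lam := lam) (ψ := ψ) (ε := ε) hq0 hq1
  choose d hd hlow using exists_eigenProd_lower_bound hq0 hq1 ht0 ht lam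
  set u : Fin n → ℂ := fun i => (t ^ (n - 1 - (i : ℕ)) * q ^ lam i)⁻¹ with hu
  set C₁ : Fin n → ℝ≥0 := fun i => (d i)⁻¹ * (∑ r : Fin n, ‖u i‖₊ ^ ((r : ℕ) + 1)) * c with hC₁
  refine ⟨1 + ∑ i, C₁ i + n * (c * qBound q lam), by
    rw [add_assoc]
    exact le_self_add, fun s => ?_⟩
  set T : ℝ≥0∞ := conv (opMajorant n q t)
      (fun s => deltaZero s + solutionMajorant q t lam ψ ε s) s +
    conv (solutionMajorant q t lam ψ ε) (fun s => solutionMajorant q t lam ψ ε s +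
      conv (opMajorant n q t) (fun s => deltaZero s + solutionMajorant q t lam ψ ε s) s) s with hT
  have hY : ∀ r, coeffNorm (lowerTerms t hq0 lam ψ ε r) ((0, lam) + s) ≤
      c * (qBound q (lam + s.2) * T) := by
    intro r
    refine (hc r s).trans (mul_le_mul_right (mul_le_mul_right (add_le_add ?_ ?_) _) _)
    · exact conv_mono (fun s => le_rfl) ((h 0).coeffNorm_le hq0) s
    · exact conv_mono (fun s => le_add_self) ((h 0).thetaMulTail_le hq0) s
  -- Where the x-exponent is λ the left side of the recursion vanishes, ψ is fixed by normalization,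
  -- and the recursion determines the eigenvalue coefficients. At all other exponents the eigenvalue
  -- tail is absent and it determines ψ.
  by_cases hs2 : s.2 = 0
  · by_cases hs : s = 0
    · have : solutionMajorant q t lam ψ ε s = 0 := by
        by_contra h0
        have := (h 0).one_le_height_solutionMajorant hq0 h0
        rw [hs, map_zero] at this
        norm_num at this
      rw [this]
      exact zero_le
    · rw [solutionMajorant, if_neg hs, coeffNorm, (h 0).biCoeff_resonant hq0 hs hs2, enorm_zero,
        zero_add]
      have hr : ∀ r : Fin n, coeffNorm (scalarSeries n (eigenTail q t lam ε r)) s ≤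
          c * (qBound q lam * T) := by
        intro r
        have h1 := eigen_recursion hq0 hq1 ht0 h r s
        rw [hs2, add_zero, sub_self, zero_mul, eq_comm, ← eq_neg_iff_add_eq_zero] at h1
        have h2 := hY r
        rw [hs2, add_zero, coeffNorm, h1, enorm_neg] at h2
        exact h2
      calc eigenMajorant q t lam ε s ≤ ∑ _r : Fin n, (c * (qBound q lam * T) : ℝ≥0∞) :=
            Finset.sum_le_sum fun r _ => hr r
        _ = ((n * (c * qBound q lam) : ℝ≥0) : ℝ≥0∞) * T := by
            rw [Finset.sum_const, Finset.card_univ, Fintype.card_fin, nsmul_eq_mul]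
            push_cast
            ring
        _ ≤ _ := mul_le_mul_left (ENNReal.coe_le_coe.2 le_add_self) _
  · have hs : s ≠ 0 := by
      rintro rfl
      exact hs2 rfl
    rw [solutionMajorant, if_neg hs, eigenMajorant_of_ne hs2, add_zero]
    obtain ⟨i, hi⟩ := Function.ne_iff.1 hs2
    have hμ : (lam + s.2) i ≠ lam i := by
      rw [Pi.add_apply, ne_eq, add_eq_left]
      exact hi
    -- A single eigenvalue difference may be small or zero. Summing the recursions with weights
    -- (-u)^{r+1} replaces the differences by the product that has a uniform lower bound.
    have hprod : (∏ j : Fin n, (1 - u i * (t ^ (n - 1 - (j : ℕ)) * q ^ (lam + s.2) j))) *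
        biCoeff ψ ((0, lam) + s) = ∑ r : Fin n, (-u i) ^ ((r : ℕ) + 1) *
          biCoeff (lowerTerms t hq0 lam ψ ε r) ((0, lam) + s) := by
      have h0 : ∏ j : Fin n, (1 - u i * (t ^ (n - 1 - (j : ℕ)) * q ^ lam j)) = 0 := by
        refine Finset.prod_eq_zero (Finset.mem_univ i) ?_
        rw [hu]
        simp only
        rw [inv_mul_cancel₀, sub_self]
        exact mul_ne_zero (pow_ne_zero _ ht0) (zpow_ne_zero _ hq0)
      have h1 : ∏ j : Fin n, (1 - u i * (t ^ (n - 1 - (j : ℕ)) * q ^ (lam + s.2) j)) =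
          ∑ r : Fin n, (-u i) ^ ((r : ℕ) + 1) * (macdonaldEigenvalue q t (lam + s.2) (r + 1) -
            macdonaldEigenvalue q t lam (r + 1)) := by
        rw [← sub_zero (∏ j : Fin n, _), ← h0, ← sum_neg_pow_mul_macdonaldEigenvalue,
          ← sum_neg_pow_mul_macdonaldEigenvalue, ← Finset.sum_sub_distrib, Finset.sum_range_succ',
          macdonaldEigenvalue_zero, macdonaldEigenvalue_zero, sub_self, add_zero,
          Finset.sum_range]
        exact Finset.sum_congr rfl fun r _ => by ring
      rw [h1, Finset.sum_mul]
      refine Finset.sum_congr rfl fun r _ => ?_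
      rw [mul_assoc, eigen_recursion hq0 hq1 ht0 h r s, biCoeff_scalarSeries_of_ne _ hs2, add_zero]
    set Q : ℝ≥0 := qBound q (lam + s.2) with hQ
    have hQ0 : Q ≠ 0 := (zero_lt_one.trans_le (one_le_qBound _)).ne'
    have hdQ : (((d i * Q : ℝ≥0)) : ℝ≥0∞) * coeffNorm ψ ((0, lam) + s) ≤
        ((∑ r : Fin n, ‖u i‖₊ ^ ((r : ℕ) + 1) : ℝ≥0) : ℝ≥0∞) * (c * (Q * T)) := by
      calc (((d i * Q : ℝ≥0)) : ℝ≥0∞) * coeffNorm ψ ((0, lam) + s)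
          ≤ ‖∏ j : Fin n, (1 - u i * (t ^ (n - 1 - (j : ℕ)) * q ^ (lam + s.2) j))‖ₑ *
            coeffNorm ψ ((0, lam) + s) := by
            rw [enorm_eq_nnnorm]
            exact mul_le_mul_left (ENNReal.coe_le_coe.2 (hlow i _ hμ)) _
        _ = ‖∑ r : Fin n, (-u i) ^ ((r : ℕ) + 1) *
            biCoeff (lowerTerms t hq0 lam ψ ε r) ((0, lam) + s)‖ₑ := by
            rw [coeffNorm, ← enorm_mul, hprod]
        _ ≤ ∑ r : Fin n, ‖u i‖ₑ ^ ((r : ℕ) + 1) * (c * (Q * T)) := by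
            refine (enorm_sum_le _ _).trans (Finset.sum_le_sum fun r _ => ?_)
            rw [enorm_mul, enorm_pow, enorm_neg]
            exact mul_le_mul_right (hY r) _
        _ = _ := by
            rw [← Finset.sum_mul]
            push_cast
            rfl
    have hdQ0 : (((d i * Q : ℝ≥0)) : ℝ≥0∞) ≠ 0 :=
      ENNReal.coe_ne_zero.2 (mul_ne_zero (hd i).ne' hQ0)
    have hfinal : coeffNorm ψ ((0, lam) + s) ≤ C₁ i * T := by
      rw [← ENNReal.mul_le_mul_iff_right hdQ0 ENNReal.coe_ne_top]
      refine hdQ.trans (le_of_eq ?_)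
      rw [hC₁]
      rw [← mul_assoc (c : ℝ≥0∞), ← mul_assoc, ← mul_assoc (((d i * Q : ℝ≥0)) : ℝ≥0∞)]
      congr 1
      norm_cast
      have := (hd i).ne'
      field_simp
    refine hfinal.trans (mul_le_mul_left (ENNReal.coe_le_coe.2 ?_) _)
    refine le_trans (Finset.single_le_sum (f := C₁) (fun _ _ => zero_le) (Finset.mem_univ i)) ?_
    exact le_add_self.trans le_self_add

/-- The loss |q|^{-n · height} from the q-shifts amounts to replacing the weight y by |q|^{-n} y. -/
theorem weightedSum_opMajorant_le (y : ℝ≥0) : weightedSum y (opMajorant n q t) ≤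
    weightedSum y (coeffNorm (tail (thetaDenom n))) + ∑ I : Finset (Fin n),
      weightedSum (‖q‖₊⁻¹ ^ n * y) (coeffNorm (tail (thetaNum t I))) := by
  simp only [weightedSum]
  rw [← Summable.tsum_finsetSum fun _ _ => ENNReal.summable, ← ENNReal.tsum_add]
  refine ENNReal.tsum_le_tsum fun s => ?_
  rw [opMajorant, add_mul, Finset.sum_mul]
  refine add_le_add le_rfl (Finset.sum_le_sum fun I _ => ?_)
  by_cases h0 : coeffNorm (tail (thetaNum t I)) s = 0
  · simp [h0]
  · have := (coneSupported_thetaNum t I).one_le_height_tail h0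
    rw [weight_mul (by linarith)]
    exact le_of_eq (by ring)

include hq0 in
theorem exists_weightedSum_opMajorant_le {η : ℝ≥0} (hη : 0 < η) :
    ∃ y : ℝ≥0, 0 < y ∧ y ≤ 1 ∧ weightedSum y (opMajorant n q t) ≤ η := by
  set N : ℝ≥0 := 1 + Fintype.card (Finset (Fin n)) with hN
  have hN0 : 0 < N := by positivity
  have hη' : 0 < η / N := by positivity
  obtain ⟨y₀, hy₀, h₀⟩ := (finiteNorm_thetaDenom (n := n)).tail_small
    (coneSupported_thetaDenom n) hη'
  choose z hz hzI using fun I => (finiteNorm_thetaNum (n := n) t I).tail_small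
    (coneSupported_thetaNum t I) hη'
  set K : ℝ≥0 := ‖q‖₊⁻¹ ^ n with hK
  have hK0 : 0 < K := by
    have : 0 < ‖q‖₊ := pos_iff_ne_zero.2 (nnnorm_ne_zero_iff.2 hq0)
    positivity
  set y : ℝ≥0 := min 1 (min y₀ (Finset.univ.inf' Finset.univ_nonempty z / K)) with hy
  have hinf : 0 < (Finset.univ : Finset (Finset (Fin n))).inf' Finset.univ_nonempty z := by
    obtain ⟨I, _, hI⟩ := Finset.exists_mem_eq_inf' Finset.univ_nonempty z
    rw [hI]
    exact hz I
  refine ⟨y, by positivity, min_le_left _ _, (weightedSum_opMajorant_le y).trans ?_⟩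
  have h1 : weightedSum y (coeffNorm (tail (thetaDenom n))) ≤ (η / N : ℝ≥0) :=
    h₀ y ((min_le_right _ _).trans (min_le_left _ _))
  have h2 : ∀ I : Finset (Fin n), weightedSum (K * y) (coeffNorm (tail (thetaNum t I))) ≤
      (η / N : ℝ≥0) := by
    intro I
    refine hzI I _ ?_
    have h3 : y ≤ z I / K := by
      refine ((min_le_right _ _).trans (min_le_right _ _)).trans ?_
      gcongr
      exact Finset.inf'_le _ (Finset.mem_univ I)
    calc K * y ≤ K * (z I / K) := by gcongr
      _ = z I := by field_simp
  calc _ ≤ ((η / N : ℝ≥0) : ℝ≥0∞) + ∑ _I : Finset (Fin n), ((η / N : ℝ≥0) : ℝ≥0∞) :=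
        add_le_add h1 (Finset.sum_le_sum fun I _ => h2 I)
    _ = η := by
        rw [Finset.sum_const, Finset.card_univ, nsmul_eq_mul]
        norm_cast
        have : η / N + Fintype.card (Finset (Fin n)) * (η / N) = N * (η / N) := by
          rw [hN]
          ring
        rw [this]
        field_simp

/-- The weighted sums of the coefficients of the eigenfunction and eigenvalues are bounded. -/
theorem exists_truncSum_solutionMajorant_le (hq1 : ‖q‖ < 1) (ht0 : t ≠ 0)
    (ht : ∀ k : ℕ, 1 ≤ k → k ≤ n - 1 → ∀ m : ℤ, t ^ k ≠ q ^ m)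
    (h : ∀ K, ApproxEigen t hq0 lam K ψ ε) :
    ∃ y : ℝ≥0, 0 < y ∧ y ≤ 1 ∧ ∀ N : ℕ, truncSum y N (solutionMajorant q t lam ψ ε) ≤ 1 := by
  obtain ⟨C, hC, hrec⟩ := exists_solutionMajorant_le hq0 hq1 ht0 ht h
  have hC0 : 0 < C := zero_lt_one.trans_le hC
  -- The values of x and of η = x/(8C) are those required by `truncSum_le_of_conv_le`.
  set x : ℝ≥0 := (4 * C)⁻¹ with hx
  obtain ⟨y, hy, hy1, hsum⟩ := exists_weightedSum_opMajorant_le (t := t) (n := n) hq0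
    (η := x / (8 * C)) (by positivity)
  have hx1 : (x : ℝ≥0∞) ≤ 1 := by
    rw [← ENNReal.coe_one, ENNReal.coe_le_coe, hx]
    refine inv_le_one_of_one_le₀ ?_
    exact hC.trans (le_mul_of_one_le_left zero_le (by norm_num))
  refine ⟨y, hy, hy1, fun N => le_trans ?_ hx1⟩
  refine truncSum_le_of_conv_le hy.ne' hC (by rw [hx]; field_simp)
    (fun s => one_le_height_opMajorant) (fun s => (h 0).one_le_height_solutionMajorant hq0) ?_ hrec N
  calc 8 * (C : ℝ≥0∞) * weightedSum y (opMajorant n q t)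
      ≤ 8 * (C : ℝ≥0∞) * ((x / (8 * C) : ℝ≥0) : ℝ≥0∞) := mul_le_mul_right hsum _
    _ = x := by
        norm_cast
        field_simp

end

/-! ### Convergence -/

/-- Summation by parts for an antitone sequence. -/
theorem sum_mul_antitone_le (b ℓ : ℕ → ℝ) (k : ℝ) (N : ℕ)
    (hℓ : ∀ j, j < N → ℓ (j + 1) ≤ ℓ j)
    (hb : ∀ j, j ≤ N → ∑ i ∈ Finset.range (j + 1), b i ≤ k) :
    ∑ j ∈ Finset.range (N + 1), b j * ℓ j ≤
      (∑ j ∈ Finset.range (N + 1), b j) * ℓ N + k * (ℓ 0 - ℓ N) := by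
  induction N with
  | zero => simp
  | succ N ih =>
    have h1 := ih (fun j hj => hℓ j (by omega)) fun j hj => hb j (by omega)
    have h2 := hℓ N (Nat.lt_succ_self N)
    have h3 := hb N (Nat.le_succ N)
    rw [Finset.sum_range_succ, Finset.sum_range_succ (fun j => b j) (N + 1)]
    nlinarith [mul_nonneg (sub_nonneg.2 h3) (sub_nonneg.2 h2)]

section

variable {n : ℕ} {q t : ℂ} (hq0 : q ≠ 0) {lam : Fin n → ℤ} {ψ : PowerSeries (LaurentPoly n)}
  {ε : Fin n → PowerSeries ℂ}

/-- Summation by parts: the boundary term drops out since the total is zero, and the decrements of ℓ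
are weighted by partial sums of size at most l. -/
theorem sum_mul_antitone_le_of_mem_cone (hn : 0 < n) {s : ℤ × (Fin n → ℤ)} (hs : s ∈ cone n)
    {ℓ : Fin n → ℝ} (hℓ : Antitone ℓ) :
    ∑ j, (s.2 j : ℝ) * ℓ j ≤ s.1 * (ℓ ⟨0, hn⟩ - ℓ ⟨n - 1, by omega⟩) := by
  set b : ℕ → ℝ := fun j => if h : j < n then (s.2 ⟨j, h⟩ : ℝ) else 0 with hb
  set ℓ' : ℕ → ℝ := fun j => if h : j < n then ℓ ⟨j, h⟩ else 0 with hℓ'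
  have hsum : ∀ m : ℕ, ∀ hm : m < n,
      ∑ i ∈ Finset.range (m + 1), b i = ((partialSum ⟨m, hm⟩ s.2 : ℤ) : ℝ) := by
    intro m hm
    rw [partialSum_apply, Int.cast_sum]
    symm
    refine Finset.sum_bij (fun j _ => (j : ℕ)) ?_ ?_ ?_ ?_
    · intro j hj
      rw [Finset.mem_Iic, Fin.le_def] at hj
      rw [Finset.mem_range]
      exact Nat.lt_succ_of_le hj
    · intro i _ j _ hij
      exact Fin.ext hij
    · intro i hi
      rw [Finset.mem_range] at hi
      exact ⟨⟨i, by omega⟩, Finset.mem_Iic.2 (Fin.le_def.2 (by simp only; omega)), rfl⟩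
    · intro j _
      rw [hb]
      simp only [j.2, dif_pos]
  have h := sum_mul_antitone_le b ℓ' s.1 (n - 1) ?_ ?_
  · rw [Nat.sub_add_cancel hn] at h
    have h1 : ∑ j ∈ Finset.range n, b j * ℓ' j = ∑ j, (s.2 j : ℝ) * ℓ j := by
      rw [Finset.sum_range]
      refine Finset.sum_congr rfl fun j _ => ?_
      simp only [hb, hℓ', j.2, dif_pos]
    have h2 : ∑ j ∈ Finset.range n, b j = 0 := by
      rw [Finset.sum_range]
      have := hs.2.1
      simp only [hb, Fin.is_lt, dif_pos]
      exact_mod_cast this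
    have h3 : ℓ' 0 = ℓ ⟨0, hn⟩ := dif_pos hn
    have h4 : ℓ' (n - 1) = ℓ ⟨n - 1, by omega⟩ := dif_pos (by omega)
    rw [h1, h2, zero_mul, zero_add, h3, h4] at h
    exact h
  · intro j hj
    have hj1 : j < n := by omega
    have hj2 : j + 1 < n := by omega
    simp only [hℓ', hj1, hj2, dif_pos]
    exact hℓ (Fin.le_def.2 (Nat.le_succ j))
  · intro j hj
    rw [hsum j (by omega)]
    exact_mod_cast hs.2.2 _

theorem ApproxEigen.symm_supported (h : ApproxEigen t hq0 lam 0 ψ ε) {k : ℕ} {μ : Fin n → ℤ}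
    (hμ : (coeff k ψ).coeff μ ≠ 0) (σ : Equiv.Perm (Fin n)) :
    (((k : ℤ), μ ∘ σ) : ℤ × (Fin n → ℤ)) - (0, lam) ∈ cone n := by
  refine h.supported _ ?_
  rw [biCoeff_natCast]
  have := h.symm k σ μ
  rw [LaurentPoly.coef, LaurentPoly.coef] at this
  rwa [this]

/-- The growth of the monomials occurring in the eigenfunction. -/
theorem ApproxEigen.norm_monomialAt_le (hn : 0 < n) (h : ApproxEigen t hq0 lam 0 ψ ε)
    {x : Fin n → ℂ} (hx : ∀ i, x i ≠ 0) :
    ∃ (B : ℝ) (a b : Fin n), 0 ≤ B ∧ ∀ (k : ℕ) (μ : Fin n → ℤ), (coeff k ψ).coeff μ ≠ 0 →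
      ‖monomialAt μ x‖ ≤ B * ‖x a / x b‖ ^ k := by
  set ℓ : Fin n → ℝ := fun j => Real.log ‖x j‖ with hℓ
  -- Order the variables by decreasing modulus. As the coefficients are symmetric, the permuted
  -- exponent lies in the cone over λ too, and summation by parts applies; a and b are the indices
  -- of largest and smallest modulus.
  set σ := Tuple.sort fun j => -ℓ j with hσ
  have hanti : Antitone (ℓ ∘ σ) := by
    intro i j hij
    have := Tuple.monotone_sort (fun j => -ℓ j) hij
    simpa using this
  have hpos : ∀ i, 0 < ‖x i‖ := fun i => norm_pos_iff.2 (hx i)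
  have hexp : ∀ μ : Fin n → ℤ, ‖monomialAt μ x‖ = Real.exp (∑ j, (μ j : ℝ) * ℓ j) := by
    intro μ
    rw [monomialAt, norm_prod, Real.exp_sum]
    refine Finset.prod_congr rfl fun j _ => ?_
    rw [norm_zpow, mul_comm, ← Real.rpow_def_of_pos (hpos j), Real.rpow_intCast]
  refine ⟨Real.exp (∑ j, (lam j : ℝ) * (ℓ ∘ σ) j), σ ⟨0, hn⟩, σ ⟨n - 1, by omega⟩,
    (Real.exp_pos _).le, fun k μ hμ => ?_⟩
  have hcone := h.symm_supported hq0 hμ σ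
  have hle := sum_mul_antitone_le_of_mem_cone hn hcone hanti
  have h1 : ∑ j, (μ j : ℝ) * ℓ j = ∑ j, ((μ ∘ σ) j : ℝ) * (ℓ ∘ σ) j :=
    (Equiv.sum_comp σ fun j => (μ j : ℝ) * ℓ j).symm
  have h2 : ‖x (σ ⟨0, hn⟩) / x (σ ⟨n - 1, by omega⟩)‖ ^ k =
      Real.exp (k * ((ℓ ∘ σ) ⟨0, hn⟩ - (ℓ ∘ σ) ⟨n - 1, by omega⟩)) := by
    rw [Real.exp_nat_mul, Real.exp_sub, norm_div]
    simp only [Function.comp_apply, hℓ, Real.exp_log (hpos _)]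
  rw [hexp, h2, ← Real.exp_add, Real.exp_le_exp, h1]
  simp only [Prod.snd_sub, Prod.fst_sub, sub_zero, Pi.sub_apply, Int.cast_sub, sub_mul,
    Finset.sum_sub_distrib, Int.cast_natCast] at hle
  linarith

/-- Entries at order p^k are at least -(c₁ + n k), so each of the n summands of the height is at
most k + n(c₁ + n k) plus a constant. Thus weights in the height turn into geometric weights in k.
-/
theorem ApproxEigen.exists_height_le (h : ApproxEigen t hq0 lam 0 ψ ε) :
    ∃ c₀ : ℕ, ∀ (k : ℕ) (μ : Fin n → ℤ), (coeff k ψ).coeff μ ≠ 0 →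
      height n ((k : ℤ), μ - lam) ≤ c₀ + (1 + n + n ^ 3 : ℕ) * k := by
  rcases Nat.eq_zero_or_pos n with rfl | hn
  · refine ⟨0, fun k μ _ => ?_⟩
    simp [height_apply]
  set L : ℤ := ∑ j, |lam j| with hL
  have hL0 : 0 ≤ L := Finset.sum_nonneg fun j _ => abs_nonneg _
  set c₁ : ℤ := n * |lam ⟨0, hn⟩| + L with hc₁
  have hc₁0 : 0 ≤ c₁ := by positivity
  have hn' : (0 : ℤ) < n := by exact_mod_cast hn
  refine ⟨(n * (n * c₁ + L)).toNat, fun k μ hμ => ?_⟩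
  rw [Int.toNat_of_nonneg (by positivity)]
  have hlow : ∀ j, -(c₁ + n * k) ≤ μ j := by
    intro j
    have h1 := (bounds_of_symm_cone hn (h.symm_supported hq0 hμ) j).1
    have h2 : -L ≤ ∑ j, lam j := by
      have h3 : |∑ j, lam j| ≤ L := Finset.abs_sum_le_sum_abs _ _
      exact (abs_le.1 h3).1
    have h4 : (n - 1 : ℤ) * (lam ⟨0, hn⟩ + k) ≤ n * |lam ⟨0, hn⟩| + n * k := by
      have h5 := le_abs_self (lam ⟨0, hn⟩)
      have h6 := abs_nonneg (lam ⟨0, hn⟩)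
      have h7 : (0 : ℤ) ≤ k := Int.natCast_nonneg k
      nlinarith
    rw [hc₁]
    linarith
  have hterm : ∀ i : Fin n, (k : ℤ) - partialSum i (μ - lam) ≤ k + (n * (c₁ + n * k) + L) := by
    intro i
    rw [map_sub]
    have h1 : partialSum i lam ≤ L := by
      rw [partialSum_apply]
      exact (Finset.sum_le_sum fun j _ => le_abs_self _).trans
        (Finset.sum_le_sum_of_subset_of_nonneg (Finset.subset_univ _) fun _ _ _ => abs_nonneg _)
    have h2 : -(n * (c₁ + n * k)) ≤ partialSum i μ := by
      rw [partialSum_apply]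
      have h3 := Finset.card_nsmul_le_sum (Finset.Iic i) μ _ fun j _ => hlow j
      rw [nsmul_eq_mul, Fin.card_Iic] at h3
      refine le_trans ?_ h3
      have h4 : (((i : ℕ) + 1 : ℕ) : ℤ) ≤ n := by exact_mod_cast i.2
      have h5 : 0 ≤ c₁ + n * k := by positivity
      nlinarith
    linarith
  have hsum := Finset.sum_le_sum fun (i : Fin n) (_ : i ∈ Finset.univ) => hterm i
  rw [Finset.sum_const, Finset.card_univ, Fintype.card_fin, nsmul_eq_mul] at hsum
  rw [height_apply]
  refine (add_le_add_right hsum _).trans (le_of_eq ?_)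
  push_cast
  ring

/-- Geometric bounds for the coefficients of the eigenfunction and of the eigenvalues. -/
theorem exists_geometric_bounds (hq1 : ‖q‖ < 1) (ht0 : t ≠ 0)
    (ht : ∀ k : ℕ, 1 ≤ k → k ≤ n - 1 → ∀ m : ℤ, t ^ k ≠ q ^ m)
    (h : ∀ K, ApproxEigen t hq0 lam K ψ ε) :
    ∃ (τ B : ℝ), 0 < τ ∧ τ ≤ 1 ∧ 0 ≤ B ∧
      (∀ k : ℕ, ∑ μ ∈ (coeff k ψ).coeff.support, ‖(coeff k ψ).coeff μ‖ * τ ^ k ≤ B) ∧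
      ∀ (r : Fin n) (k : ℕ), k ≠ 0 → ‖coeff k (ε r)‖ * τ ^ k ≤ 1 := by
  obtain ⟨y, hy, hy1, hsum⟩ := exists_truncSum_solutionMajorant_le hq0 hq1 ht0 ht h
  obtain ⟨c₀, hc₀⟩ := (h 0).exists_height_le hq0
  set D : ℕ := 1 + n + n ^ 3 with hD
  -- Since y ≤ 1 and heights at order k are at most c₀ + D k, the weight y^height is at least y^{c₀}
  -- τ^k. The bound B = 2/y^{c₀} below collects the constant, the 2 coming from the leading term and
  -- the majorant.
  set τ : ℝ≥0 := y ^ D with hτ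
  have hy0 : (y : ℝ≥0∞) ≤ 1 := by exact_mod_cast hy1
  refine ⟨τ, 2 / y ^ c₀, by positivity, ?_, by positivity, fun k => ?_, fun r k hk => ?_⟩
  · exact_mod_cast pow_le_one₀ zero_le hy1
  · set S := (coeff k ψ).coeff.support with hS
    set f : (Fin n → ℤ) → ℤ × (Fin n → ℤ) := fun μ => ((k : ℤ), μ - lam) with hf
    have hinj : Function.Injective f := by
      intro μ ν hμν
      have := congrArg Prod.snd hμν
      simpa [hf] using this
    have h1 : ∑ μ ∈ S, ‖(coeff k ψ).coeff μ‖ₑ * (y : ℝ≥0∞) ^ (c₀ + D * k) ≤ 2 := by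
      calc ∑ μ ∈ S, ‖(coeff k ψ).coeff μ‖ₑ * (y : ℝ≥0∞) ^ (c₀ + D * k)
          ≤ ∑ μ ∈ S, (if height n (f μ) ≤ (c₀ + D * k : ℕ) then
              (deltaZero (f μ) + solutionMajorant q t lam ψ ε (f μ)) * weight y (f μ) else 0) := by
            refine Finset.sum_le_sum fun μ hμ => ?_
            have hμ0 := Finsupp.mem_support_iff.1 hμ
            have hht := hc₀ k μ hμ0
            rw [if_pos (by push_cast; exact hht)]
            have hfμ : ((0, lam) : ℤ × (Fin n → ℤ)) + f μ = ((k : ℤ), μ) := by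
              rw [hf]
              simp
            refine mul_le_mul' ?_ ?_
            · have := (h 0).coeffNorm_le hq0 (f μ)
              rwa [hfμ, coeffNorm, biCoeff_natCast] at this
            · have hcone : f μ ∈ cone n := by
                have := (h 0).supported ((k : ℤ), μ) (by rwa [biCoeff_natCast])
                simpa [hf] using this
              have h0 := height_nonneg hcone
              rw [weight]
              change height n (f μ) ≤ _ at hht
              lift height n (f μ) to ℕ using h0 with m
              rw [zpow_natCast]
              exact pow_le_pow_of_le_one zero_le hy0 (by exact_mod_cast hht)
        _ = ∑ s ∈ S.map ⟨f, hinj⟩, (if height n s ≤ (c₀ + D * k : ℕ) then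
              (deltaZero s + solutionMajorant q t lam ψ ε s) * weight y s else 0) := by
            rw [Finset.sum_map]
            rfl
        _ ≤ truncSum y (c₀ + D * k : ℕ) (fun s => deltaZero s + solutionMajorant q t lam ψ ε s) :=
            ENNReal.sum_le_tsum _
        _ ≤ 1 + 1 := by
            rw [truncSum_add]
            exact add_le_add (truncSum_deltaZero_le y _) (hsum _)
        _ = 2 := one_add_one_eq_two
    simp only [enorm_eq_nnnorm] at h1
    norm_cast at h1
    rw [← NNReal.coe_le_coe] at h1
    push_cast at h1
    rw [le_div_iff₀ (by positivity), Finset.sum_mul]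
    refine le_trans (le_of_eq (Finset.sum_congr rfl fun μ _ => ?_)) h1
    have hpow : (y : ℝ) ^ (c₀ + D * k) = y ^ c₀ * (y ^ D) ^ k := by rw [pow_add, pow_mul]
    rw [hτ, NNReal.coe_pow, hpow]
    ring
  · have hht : height n ((k : ℤ), (0 : Fin n → ℤ)) = ((1 + n) * k : ℕ) := by
      rw [height_apply]
      simp only [map_zero, sub_zero, Finset.sum_const, Finset.card_univ, Fintype.card_fin,
        nsmul_eq_mul]
      push_cast
      ring
    have h1 : ‖coeff k (ε r)‖ₑ * (y : ℝ≥0∞) ^ ((1 + n) * k) ≤ 1 := by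
      refine le_trans ?_ (hsum ((1 + n) * k))
      refine le_trans ?_ (ENNReal.le_tsum ((k : ℤ), (0 : Fin n → ℤ)))
      rw [if_pos hht.le, weight, hht, zpow_natCast]
      refine mul_le_mul_left ?_ _
      rw [solutionMajorant]
      refine le_trans ?_ le_add_self
      refine le_trans (le_of_eq ?_) (Finset.single_le_sum
        (f := fun r => coeffNorm (scalarSeries n (eigenTail q t lam ε r)) ((k : ℤ), 0))
        (fun _ _ => zero_le) (Finset.mem_univ r))
      rw [coeffNorm, biCoeff_scalarSeries_natCast, eigenTail, map_sub, coeff_C, if_neg hk, sub_zero]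
    rw [enorm_eq_nnnorm] at h1
    norm_cast at h1
    have h2 : ‖coeff k (ε r)‖₊ * τ ^ k ≤ 1 := by
      refine le_trans (mul_le_mul_right ?_ _) h1
      rw [hτ, ← pow_mul]
      refine pow_le_pow_of_le_one zero_le hy1 ?_
      rw [hD]
      exact Nat.mul_le_mul_right _ (Nat.le_add_right _ _)
    exact_mod_cast h2

theorem summable_eigenvalue {e : PowerSeries ℂ} {τ : ℝ} (hτ : 0 < τ)
    (he : ∀ k : ℕ, k ≠ 0 → ‖coeff k e‖ * τ ^ k ≤ 1) {p : ℂ} (hp : ‖p‖ < τ) :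
    Summable fun k : ℕ => ‖coeff k e * p ^ k‖ := by
  -- The constant term is dropped, as the geometric bound covers only k ≠ 0.
  rw [← summable_nat_add_iff 1]
  have hgeo : Summable fun k : ℕ => (‖p‖ / τ) ^ (k + 1) :=
    (summable_nat_add_iff 1).2
      (summable_geometric_of_lt_one (by positivity) ((div_lt_one hτ).2 hp))
  refine Summable.of_nonneg_of_le (fun k => norm_nonneg _) (fun k => ?_) hgeo
  have h1 := he (k + 1) (Nat.succ_ne_zero k)
  rw [norm_mul, norm_pow, div_pow, le_div_iff₀ (by positivity)]
  calc ‖coeff (k + 1) e‖ * ‖p‖ ^ (k + 1) * τ ^ (k + 1)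
      = ‖coeff (k + 1) e‖ * τ ^ (k + 1) * ‖p‖ ^ (k + 1) := by ring
    _ ≤ 1 * ‖p‖ ^ (k + 1) := by gcongr
    _ = _ := one_mul _

theorem ApproxEigen.summable (hn : 0 < n) (h : ApproxEigen t hq0 lam 0 ψ ε) {τ B : ℝ} (hτ : 0 < τ)
    (hB : ∀ k : ℕ, ∑ μ ∈ (coeff k ψ).coeff.support, ‖(coeff k ψ).coeff μ‖ * τ ^ k ≤ B)
    {p : ℂ} {x : Fin n → ℂ} (hp : ‖p‖ < τ) (hx : ∀ i, x i ≠ 0)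
    (hpx : ∀ i j : Fin n, i < j → ‖p‖ / τ < ‖x j / x i‖ ∧ ‖p‖ * ‖x j / x i‖ < τ) :
    Summable fun a : ℕ × (Fin n → ℤ) =>
      ‖(coeff a.1 ψ).coef a.2 * monomialAt a.2 x * p ^ a.1‖ := by
  obtain ⟨M, a, b, hM, hmono⟩ := h.norm_monomialAt_le hq0 hn hx
  have hpos : ∀ i, 0 < ‖x i‖ := fun i => norm_pos_iff.2 (hx i)
  -- The two inequalities assumed for i < j cover both possible orders of a and b; for a = b only
  -- |p| < τ is needed.
  have hratio : ‖p‖ * ‖x a / x b‖ < τ := by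
    rcases lt_trichotomy a b with hab | hab | hab
    · have h1 := (hpx a b hab).1
      rw [norm_div, div_lt_div_iff₀ hτ (hpos a)] at h1
      rw [norm_div, ← mul_div_assoc, div_lt_iff₀ (hpos b)]
      linarith
    · rw [hab, div_self (hx b), norm_one, mul_one]
      exact hp
    · exact (hpx b a hab).2
  have hzero : ∀ k (μ : Fin n → ℤ), μ ∉ (coeff k ψ).coeff.support →
      ‖(coeff k ψ).coef μ * monomialAt μ x * p ^ k‖ = 0 := by
    intro k μ hμ
    rw [Finsupp.notMem_support_iff] at hμ
    rw [LaurentPoly.coef, hμ, zero_mul, zero_mul, norm_zero]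
  rw [summable_prod_of_nonneg fun _ => norm_nonneg _]
  refine ⟨fun k => summable_of_ne_finset_zero (s := (coeff k ψ).coeff.support) fun μ hμ =>
    hzero k μ hμ, ?_⟩
  set ρ : ℝ := ‖p‖ * ‖x a / x b‖ / τ with hρ
  have hgeo : Summable fun k : ℕ => B * M * ρ ^ k :=
    (summable_geometric_of_lt_one (by positivity) ((div_lt_one hτ).2 hratio)).mul_left _
  refine Summable.of_nonneg_of_le (fun k => tsum_nonneg fun _ => norm_nonneg _) (fun k => ?_) hgeo
  rw [tsum_eq_sum (s := (coeff k ψ).coeff.support) fun μ hμ => hzero k μ hμ]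
  calc ∑ μ ∈ (coeff k ψ).coeff.support, ‖(coeff k ψ).coef μ * monomialAt μ x * p ^ k‖
      ≤ ∑ μ ∈ (coeff k ψ).coeff.support, ‖(coeff k ψ).coeff μ‖ * τ ^ k * (M * ρ ^ k) := by
        refine Finset.sum_le_sum fun μ hμ => ?_
        have h1 := hmono k μ (Finsupp.mem_support_iff.1 hμ)
        rw [norm_mul, norm_mul, norm_pow, LaurentPoly.coef]
        calc ‖(coeff k ψ).coeff μ‖ * ‖monomialAt μ x‖ * ‖p‖ ^ k
            ≤ ‖(coeff k ψ).coeff μ‖ * (M * ‖x a / x b‖ ^ k) * ‖p‖ ^ k := by gcongr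
          _ = _ := by
              rw [hρ, div_pow, mul_pow]
              field_simp
    _ ≤ B * (M * ρ ^ k) := by
        rw [← Finset.sum_mul]
        exact mul_le_mul_of_nonneg_right (hB k) (by positivity)
    _ = B * M * ρ ^ k := by ring

end

end

/-! ### Existence, uniqueness and convergence combined -/

theorem theorem2p3 (n : ℕ) (hn : 1 ≤ n) (q t : ℂ) (hq0 : q ≠ 0) (hq1 : ‖q‖ < 1) (ht0 : t ≠ 0)
    (ht : ∀ k : ℕ, 1 ≤ k → k ≤ n - 1 → ∀ m : ℤ, t ^ k ≠ q ^ m)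
    (lam : Fin n → ℤ) (hlam : Antitone lam) :
    ∃ (ψ : PowerSeries (LaurentPoly n)) (ε : Fin n → PowerSeries ℂ),
      IsNormalizedFormalEigenfunction q t lam ψ ε ∧
      (∀ (ψ' : PowerSeries (LaurentPoly n)) (ε' : Fin n → PowerSeries ℂ),
        IsNormalizedFormalEigenfunction q t lam ψ' ε' → ψ' = ψ ∧ ε' = ε) ∧
      ∃ τ : ℝ, 0 < τ ∧ τ ≤ 1 ∧
        (∀ (p : ℂ) (x : Fin n → ℂ), ‖p‖ < τ → (∀ i, x i ≠ 0) →
          (∀ i j : Fin n, i < j → ‖p‖ / τ < ‖x j / x i‖ ∧ ‖p‖ * ‖x j / x i‖ < τ) →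
          Summable fun a : ℕ × (Fin n → ℤ) =>
            ‖(PowerSeries.coeff a.1 ψ).coef a.2 * monomialAt a.2 x * p ^ a.1‖) ∧
        (∀ (r : Fin n) (p : ℂ), ‖p‖ < τ →
          Summable fun k : ℕ => ‖PowerSeries.coeff k (ε r) * p ^ k‖) := by
  obtain ⟨ψ, ε, h⟩ := exists_formal_eigenfunction hq0 hq1 ht0 ht hlam
  have hE := isNormalizedFormalEigenfunction_of_approxEigen hq0 hq1 ht0 h
  obtain ⟨τ, B, hτ, hτ1, hB0, hB, hε⟩ := exists_geometric_bounds hq0 hq1 ht0 ht h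
  exact ⟨ψ, ε, hE, fun ψ' ε' h' => eigenfunction_unique hq0 hq1 ht0 ht hE h', τ, hτ, hτ1,
    fun p x hp hx hpx => (h 0).summable hq0 hn hτ hB hp hx hpx,
    fun r p hp => summable_eigenvalue hτ (hε r) hp⟩
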